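/- **Setting.** Let $\alpha:\mathbb R\to[0,1)$ be Lipschitz continuous, i.e. $\alpha\in W^{1,\infty}(\mathbb R,[0,1))$, and let $T\ge 0$. Fix a smooth partition of unity $\chi^++\chi^-=1$ on $\mathbb R$, $0\le\chi^\pm\le1$, with $\operatorname{supp}\chi^+\subset(-1,\infty)$ and $\operatorname{supp}\chi^-\subset(-\infty,1)$, and put $E_2=\{f+a\chi^++b\chi^-: f\in H^1(\mathbb R),\ a,b\in\mathbb R\}$ and $E_1^0=\{f+a\chi^+: f\in L^2(\mathbb R),\ a\in\mathbb R\}$. Let $\mathcal D_0^\alpha$ be the set of triplets $(u,\mu,\nu)$ with $u\in E_2$, $\mu=\nu$ a finite positive Radon measure on $\mathbb R$, $d\mu_{\rm ac}=u_x^2\,dx$, and $\mu((-\infty,\cdot))\in E_1^0$. Write $F(x)=\mu((-\infty,x))$, $G(x)=\nu((-\infty,x))$, $G_\infty=\nu(\mathbb R)$, and $F=F_{\rm ac}+F_{\rm sing}$ for the splitting induced by $\mu=\mu_{\rm ac}+\mu_{\rm sing}$. **Lagrangian coordinates.** $L((u,\mu,\nu))=(y,U,V,H)$ with $y(\xi)=\sup\{x: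 x+\nu((-\infty,x))<\xi\}$, $U=u\circ y$, $H(\xi)=\xi-y(\xi)$, $V(\xi)=\int_{-\infty}^{\xi}\frac{d\mu}{d\nu}(y(\eta))H_\xi(\eta)\,d\eta$. **Exact evolution.** For $X_0=(y_0,U_0,V_0,H_0)$ let $\tau(\xi)=0$ if $y_{0,\xi}(\xi)=U_{0,\xi}(\xi)=0$, $\tau(\xi)=-2y_{0,\xi}(\xi)/U_{0,\xi}(\xi)$ if $U_{0,\xi}(\xi)<0$, and $\tau(\xi)=\infty$ otherwise. $S_t(X_0)=(y,U,V,H)(t)$ is the unique solution, with $y$ continuous on $[0,\infty)\times\mathbb R$, of $y_t=U$, $U_t=\frac12V-\frac14V_\infty(t)$ (in integrated form), $V(t,\xi)=\int_{-\infty}^{\xi}\bigl(1-\alpha(y(\tau(\eta),\eta))\mathbf 1_{\{t\ge\tau(\eta)>0\}}\bigr)V_{0,\xi}(\eta)\,d\eta$, $H_t=0$, with data $X_0$ at $t=0$, where $V_\infty(t)=\lim_{\xi\to\infty}V(t,\xi)$. **Metric.** With $H_\infty=\lim_{\xi\to\infty}H(\xi)$, set, where $U_\xi<0$, $g_1(X)=(1-\alpha(y))V_\xi$,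 $g_2(X)=\|\alpha'\|_\infty H_\infty U_\xi$, $g_3(X)=\|\alpha'\|_\infty UU_\xi$; and where $U_\xi\ge0$, $g_1(X)=V_\xi$, $g_2(X)=g_3(X)=0$. Then $$\begin{aligned}d(X,\hat X)={}&\|y-\hat y\|_\infty+\|U-\hat U\|_\infty+\|H_\xi-\hat H_\xi\|_1+\|\alpha'\|_\infty\|UH_\xi-\hat U\hat H_\xi\|_2+\|y_\xi-\hat y_\xi\|_2+\|U_\xi-\hat U_\xi\|_2\\&+\|g_1(X)+y_\xi-g_1(\hat X)-\hat y_\xi\|_2+\|H_\xi-\hat H_\xi\|_2+\|g_2(X)-g_2(\hat X)\|_2+\|g_3(X)-g_3(\hat X)\|_2 .\end{aligned}$$ **Projection.** For $\Delta x>0$ let $x_i=i\Delta x$ and, for $j\in\mathbb Z$, $Df_{2j}=\frac{f(x_{2j+2})-f(x_{2j})}{2\Delta x}$, $q_{2j}=\sqrt{DF_{{\rm ac},2j}-(Du_{2j})^2}$, and let $\sigma_j\in\{1,-1\}$ be arbitrary signs, which may depend on $\Delta x$. Then $P_{\Delta x}((u,\mu,\nu))=(u_{\Delta x},\mu_{\Delta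 x},\mu_{\Delta x})$ where $u_{\Delta x}$ is continuous, equals $u$ at every $x_{2j}$, and is affine with slope $Du_{2j}+\sigma_jq_{2j}$ on $(x_{2j},x_{2j+1}]$ and $Du_{2j}-\sigma_jq_{2j}$ on $(x_{2j+1},x_{2j+2}]$; and $\mu_{\Delta x}((-\infty,x))=F_{\Delta x,{\rm ac}}(x)+F_{\Delta x,{\rm sing}}(x)$, where $F_{\Delta x,{\rm ac}}$ is continuous, equals $F_{\rm ac}$ at every $x_{2j}$ and is affine on the same intervals with the squares of these slopes as slopes, and $F_{\Delta x,{\rm sing}}(x)=F_{\rm sing}(x_{2j+2})$ for $x_{2j}<x\le x_{2j+2}$. **Numerical evolution.** Let $X_{\Delta x}=L(P_{\Delta x}((u,\mu,\nu)))$ and $G_{\Delta x}=\mu_{\Delta x}((-\infty,\cdot))$. The nodes are $\xi_{3j}=x_{2j}+G_{\Delta x}(x_{2j})$, $\xi_{3j+1}=x_{2j}+G_{\Delta x}(x_{2j}+)$, $\xi_{3j+2}=x_{2j+1}+G_{\Delta x}(x_{2j+1})$. For each cell $[\xi_j,\xi_{j+1}]$ let $\zeta_{j+\frac12,\xi},U_{j+\frac12,\xi},V_{j+\frac12,\xi}$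 be the values at the midpoint of the derivatives of $y_{\Delta x}-{\rm id},U_{\Delta x},V_{\Delta x}$, and $\tau_{j+\frac12}$ the value there of the breaking function $\tau$ of $X_{\Delta x}$ (all four are $0$ if $\xi_j=\xi_{j+1}$). Let $B$ be the set of positive finite values $\tau_{j+\frac12}$ and let $\Delta t=\Delta t(\Delta x)>0$ be any number with $\|\alpha'\|_\infty G_\infty\Delta t^2\le 8\Delta x$. Times $0=\tau_0^*\le\tau_1^*\le\dots\le T$ are extracted as follows. Given $\tau_k^*$: if no element of $B$ lies in $(\tau_k^*,T)$, then $\tau_{k+1}^*=T$ (after $T$ is reached the procedure stops); otherwise, if the second smallest element of $B\cap(\tau_k^*,\infty)$ exists, is at most $\tau_k^*+\Delta t$ and is less than $T$, then $\tau_{k+1}^*=\max\bigl(B\cap(\tau_k^*,\min\{\tau_k^*+\Delta t,T\}]\bigr)$; otherwise $\tau_{k+1}^*=\min\bigl(B\cap(\tau_k^*,\infty)\bigr)$. On $[\tau_k^*,\tau_{k+1}^*]$ the $n$-th iterate, $n\ge1$, starts at $\tau_k^*$ from the values already computed there and solves in every cell $$\zeta^n_{t\xi}=U^n_\xi,\qquad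 U^n_{t\xi}=\tfrac12V^n_\xi,\qquad V^n_\xi(t)=\bigl(1-\beta^n\mathbf 1_{\{t\ge\tau_{j+\frac12}>\tau_k^*\}}\bigr)V_\xi(\tau_k^*),$$ with $\beta^1_{j+\frac12}=0$ and, for $n\ge2$, $\beta^n_{j+\frac12}=\alpha(y^{n-1}_j(\tau_{k+1}^*))$ if $\tau_{j+\frac12}\in(\tau_k^*,\tau_{k+1}^*]$ and $0$ otherwise. The node values are $y^n_j=\xi_j+\zeta^n_{-\infty}+\sum_{m<j}\zeta^n_{m+\frac12,\xi}(\xi_{m+1}-\xi_m)$, $U^n_j=U^n_{-\infty}+\sum_{m<j}U^n_{m+\frac12,\xi}(\xi_{m+1}-\xi_m)$, $V^n_j=\sum_{m<j}V^n_{m+\frac12,\xi}(\xi_{m+1}-\xi_m)$, where $\sum_{m<j}=\lim_{J\to-\infty}\sum_{J\le m<j}$; the left asymptotes start at $t=0$ from $\lim_{j\to-\infty}(y_{\Delta x}(\xi_j)-\xi_j)$ and $\lim_{j\to-\infty}U_{\Delta x}(\xi_j)$ and evolve by $\frac{d}{dt}\zeta^n_{-\infty}=U^n_{-\infty}$, $\frac{d}{dt}U^n_{-\infty}=-\frac14\sum_{m\in\mathbb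 Z}V^n_{m+\frac12,\xi}(\xi_{m+1}-\xi_m)$. The numerical solution on $(\tau_k^*,\tau_{k+1}^*]$ is the iterate with $n=M_k$, where $M_k=1$ if $B\cap(\tau_k^*,\tau_{k+1}^*]=\emptyset$, $M_k=2$ if $B\cap(\tau_k^*,\tau_{k+1}^*]=\{\tau_{k+1}^*\}$, and $M_k\in\{2,3\}$ is arbitrary otherwise. For $t\in[0,T]$, $S_{\Delta x,t}(X_{\Delta x})=(y,U,V,H)$ is obtained by linear interpolation between the nodes $\xi_j$ of the node values of $y,U,V$ at time $t$ and of the initial node values $H_{\Delta x}(\xi_j)$. **Theorem.** Let $(u,\mu,\nu)\in\mathcal D_0^\alpha$ and $X=L((u,\mu,\nu))$. Then the $\alpha$-dissipative solution $S_t(X)$, $t\ge0$, exists and is unique, and for every $t\in[0,T]$, for all admissible choices (for each $\Delta x>0$) of the signs $\sigma_j$, of $\Delta t$ and of the iteration numbers $M_k$, $$d\bigl(S_t(X),\,S_{\Delta x,t}(X_{\Delta x})\bigr)\to0\qquad\text{as }\Delta x\to0 .$$ -/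

import Mathlib

open MeasureTheory Filter Topology Set
open scoped NNReal ENNReal

noncomputable section

namespace HunterSaxton

/-! ## Function spaces -/

/-- The cutoff function of the fixed smooth partition of unity that equals `1` near `+∞`;
it vanishes on `(-∞, -1/2]` and equals `1` on `[1/2, ∞)`. -/
def chiPlus (x : ℝ) : ℝ := Real.smoothTransition (x + 1 / 2)

/-- The complementary cutoff function, which equals `1` near `-∞`. -/
def chiMinus (x : ℝ) : ℝ := 1 - chiPlus x

/-- `f` is (the continuous representative of) an element of the Sobolev space `H¹(ℝ)`:
`f` is square integrable and is a primitive of a square integrable function. -/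
def MemH1 (f : ℝ → ℝ) : Prop :=
  MemLp f 2 volume ∧
    ∃ g : ℝ → ℝ, MemLp g 2 volume ∧ ∀ a b : ℝ, f b - f a = ∫ x in a..b, g x

/-- The space `E₂ = { f + a χ⁺ + b χ⁻ : f ∈ H¹(ℝ), a, b ∈ ℝ }`. -/
def MemE2 (f : ℝ → ℝ) : Prop :=
  ∃ (fbar : ℝ → ℝ) (a b : ℝ), MemH1 fbar ∧ ∀ x, f x = fbar x + a * chiPlus x + b * chiMinus x

/-- The space `E₁⁰ = { f + a χ⁺ : f ∈ L²(ℝ), a ∈ ℝ }`. -/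
def MemE10 (f : ℝ → ℝ) : Prop :=
  ∃ (fbar : ℝ → ℝ) (a : ℝ), MemLp fbar 2 volume ∧ ∀ x, f x = fbar x + a * chiPlus x

/-- The norm `‖α'‖_∞`. -/
def supDeriv (α : ℝ → ℝ) : ℝ := (eLpNorm (deriv α) ⊤ volume).toReal

/-! ## Eulerian coordinates -/

/-- A triplet `(u, μ, ν)`. -/
structure Euler where
  u : ℝ → ℝ
  μ : Measure ℝ
  ν : Measure ℝ

/-- Absolutely continuous part of a measure with respect to Lebesgue measure. -/
def acPart (m : Measure ℝ) : Measure ℝ := volume.withDensity (m.rnDeriv volume)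

/-- Singular part of a measure with respect to Lebesgue measure. -/
def singPart (m : Measure ℝ) : Measure ℝ := m.singularPart volume

/-- The left-continuous primitive `x ↦ m((-∞, x))`. -/
def primitive (m : Measure ℝ) (x : ℝ) : ℝ := (m (Iio x)).toReal

/-- The set `𝒟^α` of Eulerian coordinates (which is the same for every `α` with values
in `[0, 1)`). -/
structure MemD (Z : Euler) : Prop where
  u_mem : MemE2 Z.u
  finite_mu : IsFiniteMeasure Z.μ
  finite_nu : IsFiniteMeasure Z.ν
  mu_le : Z.μ ≤ Z.ν
  ac_le : acPart Z.μ ≤ acPart Z.ν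
  ac_eq : acPart Z.μ = volume.withDensity (fun x => ENNReal.ofReal (deriv Z.u x ^ 2))
  mu_mem : MemE10 (primitive Z.μ)
  nu_mem : MemE10 (primitive Z.ν)
  density_pos : ∀ᵐ x ∂Z.ν, 0 < Z.μ.rnDeriv Z.ν x
  density_one : ∀ᵐ x ∂(acPart Z.ν), deriv Z.u x < 0 → (acPart Z.μ).rnDeriv (acPart Z.ν) x = 1

/-- The subset `𝒟₀^α` of the triplets in `𝒟^α` with `μ = ν`. -/
def MemD0 (Z : Euler) : Prop := MemD Z ∧ Z.μ = Z.ν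

/-! ## Lagrangian coordinates and the mapping `L` -/

/-- A quadruplet `X = (y, U, V, H)` of functions of the label `ξ`. -/
structure Lagr where
  y : ℝ → ℝ
  U : ℝ → ℝ
  V : ℝ → ℝ
  H : ℝ → ℝ

/-- `y(ξ) = sup { x : x + ν((-∞, x)) < ξ }`. -/
def lagrY (Z : Euler) (ξ : ℝ) : ℝ := sSup {x : ℝ | x + primitive Z.ν x < ξ}

/-- `H(ξ) = ξ - y(ξ)`. -/
def lagrH (Z : Euler) (ξ : ℝ) : ℝ := ξ - lagrY Z ξ

/-- The mapping `L` from Eulerian to Lagrangian coordinates. -/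
def mapL (Z : Euler) : Lagr where
  y := lagrY Z
  U := fun ξ => Z.u (lagrY Z ξ)
  V := fun ξ => ∫ η in Iic ξ, (Z.μ.rnDeriv Z.ν (lagrY Z η)).toReal * deriv (lagrH Z) η
  H := lagrH Z

/-! ## The `α`-dissipative solution in Lagrangian coordinates -/

/-- The limit at `+∞` of a function, used for `V_∞` and `H_∞`. -/
def limTop (f : ℝ → ℝ) : ℝ := limUnder atTop f

open Classical in
/-- The wave breaking function `τ : ℝ → [0, ∞]` of the initial data `X₀`. -/
def waveBreak (X₀ : Lagr) (ξ : ℝ) : ℝ≥0∞ :=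
  if deriv X₀.y ξ = 0 ∧ deriv X₀.U ξ = 0 then 0
  else if deriv X₀.U ξ < 0 then ENNReal.ofReal (-(2 * deriv X₀.y ξ) / deriv X₀.U ξ)
  else ⊤

open Classical in
/-- `X` is an `α`-dissipative solution (for times `t ≥ 0`) with initial data `X₀`. The equations
for `y` and `U` are written in integrated form, as `V` jumps in time. The continuity of `y` makes
`η ↦ y(τ(η), η)` measurable, so that the integral defining `V` is meaningful. -/
structure IsAlphaSolution (α : ℝ → ℝ) (X₀ : Lagr) (X : ℝ → Lagr) : Prop where
  init : X 0 = X₀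
  cont : ContinuousOn (fun p : ℝ × ℝ => (X p.1).y p.2) (Ici 0 ×ˢ univ)
  eq_y : ∀ t, 0 ≤ t → ∀ ξ, (X t).y ξ = X₀.y ξ + ∫ s in (0 : ℝ)..t, (X s).U ξ
  eq_U : ∀ t, 0 ≤ t → ∀ ξ, (X t).U ξ = X₀.U ξ +
    ∫ s in (0 : ℝ)..t, (1 / 2 * (X s).V ξ - 1 / 4 * limTop (X s).V)
  eq_V : ∀ t, 0 ≤ t → ∀ ξ, (X t).V ξ = ∫ η in Iic ξ,
    (1 - (if 0 < waveBreak X₀ η ∧ waveBreak X₀ η ≤ ENNReal.ofReal t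
      then α ((X (waveBreak X₀ η).toReal).y η) else 0)) * deriv X₀.V η
  eq_H : ∀ t, 0 ≤ t → (X t).H = X₀.H

open Classical in
/-- The solution operator `S_t`: the value at time `t` of the `α`-dissipative solution with
initial data `X₀`. -/
def solOp (α : ℝ → ℝ) (t : ℝ) (X₀ : Lagr) : Lagr :=
  if h : ∃ X : ℝ → Lagr, IsAlphaSolution α X₀ X then h.choose t else X₀

/-! ## The metric `d` -/

open Classical in
/-- The function `g₁(X)`; `Ω_d(X) = { U_ξ < 0 }` and `Ω_c(X) = { U_ξ ≥ 0 }`. -/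
def g1 (α : ℝ → ℝ) (X : Lagr) (ξ : ℝ) : ℝ :=
  if deriv X.U ξ < 0 then (1 - α (X.y ξ)) * deriv X.V ξ else deriv X.V ξ

open Classical in
/-- The function `g₂(X)`. -/
def g2 (α : ℝ → ℝ) (X : Lagr) (ξ : ℝ) : ℝ :=
  if deriv X.U ξ < 0 then supDeriv α * limTop X.H * deriv X.U ξ else 0

open Classical in
/-- The function `g₃(X)`. -/
def g3 (α : ℝ → ℝ) (X : Lagr) (ξ : ℝ) : ℝ :=
  if deriv X.U ξ < 0 then supDeriv α * (X.U ξ * deriv X.U ξ) else 0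

/-- The metric `d(X, Y)`, with values in `[0, ∞]` so that no infinite norm can be lost. -/
def lagrDist (α : ℝ → ℝ) (X Y : Lagr) : ℝ≥0∞ :=
  eLpNorm (fun ξ => X.y ξ - Y.y ξ) ⊤ volume
    + eLpNorm (fun ξ => X.U ξ - Y.U ξ) ⊤ volume
    + eLpNorm (fun ξ => deriv X.H ξ - deriv Y.H ξ) 1 volume
    + ENNReal.ofReal (supDeriv α) *
        eLpNorm (fun ξ => X.U ξ * deriv X.H ξ - Y.U ξ * deriv Y.H ξ) 2 volume
    + eLpNorm (fun ξ => deriv X.y ξ - deriv Y.y ξ) 2 volume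
    + eLpNorm (fun ξ => deriv X.U ξ - deriv Y.U ξ) 2 volume
    + eLpNorm (fun ξ => g1 α X ξ + deriv X.y ξ - g1 α Y ξ - deriv Y.y ξ) 2 volume
    + eLpNorm (fun ξ => deriv X.H ξ - deriv Y.H ξ) 2 volume
    + eLpNorm (fun ξ => g2 α X ξ - g2 α Y ξ) 2 volume
    + eLpNorm (fun ξ => g3 α X ξ - g3 α Y ξ) 2 volume

/-! ## The projection operator -/

section Projection

variable (h : ℝ) (σ : ℤ → ℝ) (Z : Euler)

/-- The grid point `x_i = i Δx`, with `Δx = h`. -/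
def gridPt (i : ℤ) : ℝ := i * h

/-- `F_ac = μ_ac((-∞, ·))`. -/
def primAc (x : ℝ) : ℝ := primitive (acPart Z.μ) x

/-- `F_sing = μ_sing((-∞, ·))`. -/
def primSing (x : ℝ) : ℝ := primitive (singPart Z.μ) x

/-- The difference quotient `D f_{2j} = (f(x_{2j+2}) - f(x_{2j})) / (2 Δx)`. -/
def diffQ (f : ℝ → ℝ) (j : ℤ) : ℝ :=
  (f (gridPt h (2 * j + 2)) - f (gridPt h (2 * j))) / (2 * h)

/-- `q_{2j} = √(D F_{ac,2j} - (D u_{2j})²)`. -/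
def qCoef (j : ℤ) : ℝ := Real.sqrt (diffQ h (primAc Z) j - diffQ h Z.u j ^ 2)

/-- Slope of the projected `u` on `(x_{2j}, x_{2j+1}]`; `σ j = ±1` is the chosen sign. -/
def slopeL (j : ℤ) : ℝ := diffQ h Z.u j + σ j * qCoef h Z j

/-- Slope of the projected `u` on `(x_{2j+1}, x_{2j+2}]`, with the opposite sign. -/
def slopeR (j : ℤ) : ℝ := diffQ h Z.u j - σ j * qCoef h Z j

/-- The index `j` with `x_{2j} < x ≤ x_{2j+2}`. -/
def gridIdx (x : ℝ) : ℤ := ⌈x / (2 * h)⌉ - 1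

open Classical in
/-- The projected wave profile `u_Δx`. -/
def projU (x : ℝ) : ℝ :=
  let j := gridIdx h x
  if x ≤ gridPt h (2 * j + 1) then
    Z.u (gridPt h (2 * j)) + slopeL h σ Z j * (x - gridPt h (2 * j))
  else
    Z.u (gridPt h (2 * j + 2)) + slopeR h σ Z j * (x - gridPt h (2 * j + 2))

open Classical in
/-- The absolutely continuous part `F_{Δx,ac}`. -/
def projFac (x : ℝ) : ℝ :=
  let j := gridIdx h x
  if x ≤ gridPt h (2 * j + 1) then
    primAc Z (gridPt h (2 * j)) + slopeL h σ Z j ^ 2 * (x - gridPt h (2 * j))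
  else
    1 / 2 * (primAc Z (gridPt h (2 * j + 2)) + primAc Z (gridPt h (2 * j)))
      + 2 * σ j * diffQ h Z.u j * qCoef h Z j * h
      + slopeR h σ Z j ^ 2 * (x - gridPt h (2 * j + 1))

/-- The singular part `F_{Δx,sing}`. -/
def projFsing (x : ℝ) : ℝ := primSing Z (gridPt h (2 * gridIdx h x + 2))

/-- `F_Δx = F_{Δx,ac} + F_{Δx,sing}`. -/
def projF (x : ℝ) : ℝ := projFac h σ Z x + projFsing h Z x

end Projection

open Classical in
/-- The measure `m` with `m((-∞, x)) = F(x)`, for `F` increasing and left-continuous with limit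
`0` at `-∞`. -/
def measureOf (F : ℝ → ℝ) : Measure ℝ :=
  if hF : Monotone F then hF.stieltjesFunction.measure else 0

/-- The projection operator `P_Δx` with `Δx = h` and sign choices `σ`. -/
def proj (h : ℝ) (σ : ℤ → ℝ) (Z : Euler) : Euler where
  u := projU h σ Z
  μ := measureOf (projF h σ Z)
  ν := measureOf (projF h σ Z)

/-- The Lagrangian gridpoints `ξ_{3j} = x_{2j} + G(x_{2j})`, `ξ_{3j+1} = x_{2j} + G(x_{2j}+)` and
`ξ_{3j+2} = x_{2j+1} + G(x_{2j+1})`, where `G = ν((-∞, ·))`. -/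
def lagrNodes (h : ℝ) (ν : Measure ℝ) (i : ℤ) : ℝ :=
  let j := i / 3
  if i % 3 = 0 then gridPt h (2 * j) + primitive ν (gridPt h (2 * j))
  else if i % 3 = 1 then gridPt h (2 * j) + (ν (Iic (gridPt h (2 * j)))).toReal
  else gridPt h (2 * j + 1) + primitive ν (gridPt h (2 * j + 1))

/-! ## The numerical solution operator

Throughout, `ξ : ℤ → ℝ` are the Lagrangian nodes, the cell `j` is `[ξ_j, ξ_{j+1}]` (written
`j + 1/2` in half-integer notation), and `X₀` is the (piecewise linear) initial datum. -/

section Numerics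

variable (ξ : ℤ → ℝ)

/-- Midpoint of the cell `j`. -/
def mid (j : ℤ) : ℝ := (ξ j + ξ (j + 1)) / 2

/-- Length of the cell `j`. -/
def len (j : ℤ) : ℝ := ξ (j + 1) - ξ j

open Classical in
/-- Breaking time `τ_{j+1/2}` of the cell `j`; degenerate cells get the value `0`. -/
def cellBreak (X₀ : Lagr) (j : ℤ) : ℝ≥0∞ :=
  if ξ j = ξ (j + 1) then 0 else waveBreak X₀ (mid ξ j)

/-- The set of positive finite breaking times. -/
def breakTimes (X₀ : Lagr) : Set ℝ :=
  {b : ℝ | 0 < b ∧ ∃ j : ℤ, cellBreak ξ X₀ j = ENNReal.ofReal b}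

open Classical in
/-- One step of the extraction algorithm, from the current time `s`, for a set `B` of breaking
times, minimal time step `Δt` and final time `T`:
* if the next breaking time after `s` is at least `T` (or there is none), go to `T`;
* otherwise, if the second next breaking time is at most `s + Δt` and smaller than `T`, go to the
  largest breaking time in `(s, min (s + Δt) T]`;
* otherwise go to the next breaking time. -/
def nextTime (B : Set ℝ) (T Δt s : ℝ) : ℝ :=
  if ∀ b ∈ B, s < b → T ≤ b then T
  else if ∃ b ∈ B, ∃ c ∈ B, s < b ∧ b < c ∧ c ≤ s + Δt ∧ c < T then
    sSup {b | b ∈ B ∧ s < b ∧ b ≤ min (s + Δt) T}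
  else sInf {b | b ∈ B ∧ s < b}

/-- The extracted times `τ*_0 = 0, τ*_1, τ*_2, …`; once `T` is reached, the sequence stays there. -/
def extracted (B : Set ℝ) (T Δt : ℝ) : ℕ → ℝ
  | 0 => 0
  | k + 1 => nextTime B T Δt (extracted B T Δt k)

/-- The data evolved by the scheme: the values of `ζ_ξ`, `U_ξ`, `V_ξ` in every cell, where
`ζ = y - id`, and the left asymptotes of `ζ` and `U`. (`H` does not change in time.) -/
structure NumState where
  Zx : ℤ → ℝ
  Ux : ℤ → ℝ
  Vx : ℤ → ℝ
  Zinf : ℝ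
  Uinf : ℝ

/-- The sum of `a m` over all `m < j`, as the limit of the sums over `J ≤ m < j` as `J → -∞`
(the series need not converge absolutely). -/
def sumBelow (a : ℤ → ℝ) (j : ℤ) : ℝ :=
  limUnder atBot (fun J : ℤ => ∑ m ∈ Finset.Ico J j, a m)

/-- Node value `y_j = ξ_j + ζ_j`. -/
def nodeY (st : NumState) (j : ℤ) : ℝ :=
  ξ j + (st.Zinf + sumBelow (fun m => st.Zx m * len ξ m) j)

/-- Node value `U_j`. -/
def nodeU (st : NumState) (j : ℤ) : ℝ := st.Uinf + sumBelow (fun m => st.Ux m * len ξ m) j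

/-- Node value `V_j`. -/
def nodeV (st : NumState) (j : ℤ) : ℝ := sumBelow (fun m => st.Vx m * len ξ m) j

open Classical in
/-- The initial state read off from `X₀`. -/
def initState (X₀ : Lagr) : NumState where
  Zx := fun j => if ξ j = ξ (j + 1) then 0 else deriv X₀.y (mid ξ j) - 1
  Ux := fun j => if ξ j = ξ (j + 1) then 0 else deriv X₀.U (mid ξ j)
  Vx := fun j => if ξ j = ξ (j + 1) then 0 else deriv X₀.V (mid ξ j)
  Zinf := limUnder atBot (fun j : ℤ => X₀.y (ξ j) - ξ j)
  Uinf := limUnder atBot (fun j : ℤ => X₀.U (ξ j))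

open Classical in
/-- The fraction of energy that the cell `j` has lost at time `t` when the evolution starts at
time `s`: it is `β j` if `s < τ_{j+1/2} ≤ t`, and `0` otherwise. -/
def lost (τ : ℤ → ℝ≥0∞) (β : ℤ → ℝ) (s t : ℝ) (j : ℤ) : ℝ :=
  if ENNReal.ofReal s < τ j ∧ τ j ≤ ENNReal.ofReal t then β j else 0

/-- The solution at time `t`, starting from the state `st` at time `s`, of
`ζ_{tξ} = U_ξ`, `U_{tξ} = V_ξ / 2`, `V_ξ(t) = (1 - β χ_{t ≥ τ > s}) V_ξ(s)` in every cell,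
together with the left asymptotes, which satisfy `ζ_t = U` and `U_t = - V_∞ / 4`. -/
def evolve (τ : ℤ → ℝ≥0∞) (β : ℤ → ℝ) (s t : ℝ) (st : NumState) : NumState where
  Zx := fun j => st.Zx j + st.Ux j * (t - s) + 1 / 4 * st.Vx j * (t - s) ^ 2
    - 1 / 4 * lost τ β s t j * st.Vx j * (t - (τ j).toReal) ^ 2
  Ux := fun j => st.Ux j + 1 / 2 * st.Vx j * (t - s)
    - 1 / 2 * lost τ β s t j * st.Vx j * (t - (τ j).toReal)
  Vx := fun j => (1 - lost τ β s t j) * st.Vx j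
  Zinf := st.Zinf + st.Uinf * (t - s) - 1 / 8 * (∑' m, st.Vx m * len ξ m) * (t - s) ^ 2
    + 1 / 8 * ∑' m, lost τ β s t m * st.Vx m * len ξ m * (t - (τ m).toReal) ^ 2
  Uinf := st.Uinf - 1 / 4 * (∑' m, st.Vx m * len ξ m) * (t - s)
    + 1 / 4 * ∑' m, lost τ β s t m * st.Vx m * len ξ m * (t - (τ m).toReal)

open Classical in
/-- The approximations `β^n` of the fractions of energy lost in `(s, s₁]`: `β^1 = 0`, and
`β^n_j = α(y_j^{n-1}(s₁))` for `n ≥ 2` if the cell `j` breaks in `(s, s₁]`, where `y^{n-1}` is the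
iterate obtained with `β^{n-1}`. (The index `0` is not used.) -/
def betaIter (α : ℝ → ℝ) (τ : ℤ → ℝ≥0∞) (s s₁ : ℝ) (st : NumState) : ℕ → ℤ → ℝ
  | 0 => fun _ => 0
  | 1 => fun _ => 0
  | n + 2 => fun j =>
    if ENNReal.ofReal s < τ j ∧ τ j ≤ ENNReal.ofReal s₁ then
      α (nodeY ξ (evolve ξ τ (betaIter α τ s s₁ st (n + 1)) s s₁ st) j)
    else 0

/-- The numbers of iterations: `M k` iterations are carried out on `(τ*_k, τ*_{k+1}]`, namely one
if no breaking time lies in this interval, two if its right endpoint is the only one, and two or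
three (an arbitrary choice) otherwise. -/
def IsIterationCount (B : Set ℝ) (ts : ℕ → ℝ) (M : ℕ → ℕ) : Prop :=
  ∀ k, (B ∩ Ioc (ts k) (ts (k + 1)) = ∅ → M k = 1) ∧
    (B ∩ Ioc (ts k) (ts (k + 1)) = {ts (k + 1)} → M k = 2) ∧
    ((B ∩ Ioo (ts k) (ts (k + 1))).Nonempty → M k = 2 ∨ M k = 3)

/-- The state at the extracted time `ts k`. -/
def stateAt (α : ℝ → ℝ) (X₀ : Lagr) (ts : ℕ → ℝ) (M : ℕ → ℕ) : ℕ → NumState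
  | 0 => initState ξ X₀
  | k + 1 =>
    let st := stateAt α X₀ ts M k
    let τ := cellBreak ξ X₀
    evolve ξ τ (betaIter ξ α τ (ts k) (ts (k + 1)) st (M k)) (ts k) (ts (k + 1)) st

/-- The state at time `t`, where `t ∈ (ts k, ts (k + 1)]` (or `t = 0` and `k = 0`). -/
def stateTime (α : ℝ → ℝ) (X₀ : Lagr) (ts : ℕ → ℝ) (M : ℕ → ℕ) (t : ℝ) : NumState :=
  let k := sInf {k : ℕ | t ≤ ts (k + 1)}
  let st := stateAt ξ α X₀ ts M k
  let τ := cellBreak ξ X₀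
  evolve ξ τ (betaIter ξ α τ (ts k) (ts (k + 1)) st (M k)) (ts k) t st

/-- Linear interpolation at `x` of the values `a j` at the nodes `ξ j`. -/
def interp (a : ℤ → ℝ) (x : ℝ) : ℝ :=
  let j := sSup {j : ℤ | ξ j ≤ x}
  a j + (a (j + 1) - a j) * ((x - ξ j) / (ξ (j + 1) - ξ j))

/-- The numerical solution operator `S_{Δx,t}` on `[0, T]`, for a minimal time step `Δt` and
numbers of iterations `M`, applied to a datum `X₀` that is piecewise linear with nodes `ξ`. -/
def numSolOp (α : ℝ → ℝ) (T Δt : ℝ) (M : ℕ → ℕ) (t : ℝ) (X₀ : Lagr) : Lagr :=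
  let st := stateTime ξ α X₀ (extracted (breakTimes ξ X₀) T Δt) M t
  { y := interp ξ (nodeY ξ st)
    U := interp ξ (nodeU ξ st)
    V := interp ξ (nodeV ξ st)
    H := interp ξ (fun j => X₀.H (ξ j)) }

end Numerics

end HunterSaxton

end

set_option linter.unusedSectionVars false

noncomputable section

namespace HunterSaxton

/-! ## Lipschitz functions -/

theorem ac_of_lipschitz {f : ℝ → ℝ} {K : ℝ≥0} (hf : LipschitzWith K f) (a b : ℝ) :
    AbsolutelyContinuousOnInterval f a b :=
  (hf.lipschitzOnWith (s := uIcc a b)).absolutelyContinuousOnInterval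

theorem integral_deriv_of_lipschitz {f : ℝ → ℝ} {K : ℝ≥0} (hf : LipschitzWith K f) (a b : ℝ) :
    ∫ x in a..b, deriv f x = f b - f a :=
  (ac_of_lipschitz hf a b).integral_deriv_eq_sub

theorem abs_sub_le_supDeriv {α : ℝ → ℝ} (hL : ∃ K : ℝ≥0, LipschitzWith K α) (a b : ℝ) :
    |α a - α b| ≤ supDeriv α * |a - b| := by
  obtain ⟨K, hK⟩ := hL
  have hb : ∀ x, ‖deriv α x‖ ≤ K := fun x => norm_deriv_le_of_lipschitz hK
  have hfin : eLpNorm (deriv α) ⊤ volume ≠ ⊤ := by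
    refine ne_top_of_le_ne_top (b := ENNReal.ofReal K) (by simp) ?_
    rw [eLpNorm_exponent_top]
    exact eLpNormEssSup_le_of_ae_bound (Eventually.of_forall hb)
  have hae : ∀ᵐ x, ‖deriv α x‖ ≤ supDeriv α := by
    have := ae_le_eLpNormEssSup (f := deriv α) (μ := volume)
    filter_upwards [this] with x hx
    rw [supDeriv, eLpNorm_exponent_top]
    rw [eLpNorm_exponent_top] at hfin
    have := ENNReal.toReal_mono hfin hx
    simpa using this
  have h1 := integral_deriv_of_lipschitz hK b a
  rw [← h1, ← Real.norm_eq_abs]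
  exact intervalIntegral.norm_integral_le_of_norm_le_const_ae (by
    filter_upwards [hae] with x hx _ using hx)

theorem supDeriv_nonneg (α : ℝ → ℝ) : 0 ≤ supDeriv α := ENNReal.toReal_nonneg

/-! ## The antisymmetrised primitive -/

/-- The primitive of `f` normalised so that its limits at `±∞` are `±½ ∫ f`. -/
def kern (f : ℝ → ℝ) (ξ : ℝ) : ℝ := (∫ η in Iic ξ, f η) - 1 / 2 * ∫ η, f η

theorem abs_kern_le {f : ℝ → ℝ} (hf : Integrable f) (ξ : ℝ) : |kern f ξ| ≤ 1 / 2 * ∫ η, |f η| := by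
  have h := integral_add_compl (measurableSet_Iic (a := ξ)) hf
  have h' := integral_add_compl (measurableSet_Iic (a := ξ)) hf.abs
  have h1 : |∫ η in Iic ξ, f η| ≤ ∫ η in Iic ξ, |f η| := abs_integral_le_integral_abs
  have h2 : |∫ η in (Iic ξ)ᶜ, f η| ≤ ∫ η in (Iic ξ)ᶜ, |f η| := abs_integral_le_integral_abs
  rw [kern, ← h, ← h']
  have := abs_sub (∫ η in Iic ξ, f η) (∫ η in (Iic ξ)ᶜ, f η)
  rw [show (∫ η in Iic ξ, f η) - 1 / 2 * ((∫ η in Iic ξ, f η) + ∫ η in (Iic ξ)ᶜ, f η)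
    = 1 / 2 * ((∫ η in Iic ξ, f η) - ∫ η in (Iic ξ)ᶜ, f η) by ring, abs_mul, abs_of_pos (by norm_num : (0:ℝ) < 1/2)]
  linarith

theorem kern_sub {f g : ℝ → ℝ} (hf : Integrable f) (hg : Integrable g) (ξ : ℝ) :
    kern (fun η => f η - g η) ξ = kern f ξ - kern g ξ := by
  simp only [kern]
  rw [integral_sub hf hg, integral_sub hf.integrableOn hg.integrableOn]; ring

theorem kern_const_mul (c : ℝ) (f : ℝ → ℝ) (ξ : ℝ) :
    kern (fun η => c * f η) ξ = c * kern f ξ := by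
  simp only [kern, integral_const_mul]; ring

theorem abs_kern_sub_kern_le {f g : ℝ → ℝ} (hf : Integrable f) (hg : Integrable g) (ξ : ℝ) :
    |kern f ξ - kern g ξ| ≤ 1 / 2 * ∫ η, |f η - g η| := by
  rw [← kern_sub hf hg]; exact abs_kern_le (hf.sub hg) ξ

theorem kern_sub_kern {f : ℝ → ℝ} (hf : Integrable f) (a b : ℝ) :
    kern f b - kern f a = ∫ η in a..b, f η := by
  rw [← intervalIntegral.integral_Iic_sub_Iic hf.integrableOn hf.integrableOn]; simp only [kern]; ring

theorem tendsto_setIntegral_Iic_atBot {f : ℝ → ℝ} (hf : Integrable f) :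
    Tendsto (fun ξ => ∫ η in Iic ξ, f η) atBot (𝓝 0) := by
  have h := intervalIntegral_tendsto_integral_Iic 0 (hf.integrableOn (s := Iic 0)) tendsto_id
  have h2 := h.const_sub (∫ η in Iic 0, f η)
  rw [sub_self] at h2
  refine h2.congr fun ξ => ?_
  rw [← intervalIntegral.integral_Iic_sub_Iic hf.integrableOn hf.integrableOn]; simp

theorem tendsto_setIntegral_Iic_atTop {f : ℝ → ℝ} (hf : Integrable f) :
    Tendsto (fun ξ => ∫ η in Iic ξ, f η) atTop (𝓝 (∫ η, f η)) := by
  have h := intervalIntegral_tendsto_integral_Ioi 0 (hf.integrableOn (s := Ioi 0)) tendsto_id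
  have h2 := h.const_add (∫ η in Iic 0, f η)
  rw [intervalIntegral.integral_Iic_add_Ioi hf.integrableOn hf.integrableOn] at h2
  refine h2.congr fun ξ => ?_
  rw [← intervalIntegral.integral_Iic_sub_Iic hf.integrableOn hf.integrableOn]; simp

theorem tendsto_kern_atBot {f : ℝ → ℝ} (hf : Integrable f) :
    Tendsto (kern f) atBot (𝓝 (-(1 / 2 * ∫ η, f η))) := by
  have := (tendsto_setIntegral_Iic_atBot hf).sub_const (1 / 2 * ∫ η, f η)
  rw [zero_sub] at this
  exact this

theorem ae_hasDerivAt_kern {f : ℝ → ℝ} (hf : Integrable f) :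
    ∀ᵐ ξ, HasDerivAt (kern f) (f ξ) ξ := by
  filter_upwards [LocallyIntegrable.ae_hasDerivAt_integral hf.locallyIntegrable] with ξ hξ
  have h1 := (hξ 0).add_const (kern f 0)
  refine h1.congr_of_eventuallyEq (Eventually.of_forall fun x => ?_)
  simp only
  rw [← kern_sub_kern hf]; ring

theorem limTop_eq {f : ℝ → ℝ} {l : ℝ} (h : Tendsto f atTop (𝓝 l)) : limTop f = l := h.limUnder_eq

/-! ## Lagrangian data -/

/-- The properties of the initial data in Lagrangian coordinates on which the evolution relies. -/
structure IsNice (X : Lagr) (G : ℝ) : Prop where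
  y_eq : ∀ ξ, X.y ξ = ξ - X.H ξ
  V_eq : X.V = X.H
  mono_y : Monotone X.y
  mono_H : Monotone X.H
  H_bot : Tendsto X.H atBot (𝓝 0)
  H_top : Tendsto X.H atTop (𝓝 G)
  cs : ∀ a b, (X.U b - X.U a) ^ 2 ≤ (X.y b - X.y a) * (X.H b - X.H a)
  U_bdd : ∃ C, ∀ ξ, |X.U ξ| ≤ C
  U_bot : ∃ l, Tendsto X.U atBot (𝓝 l)
  rel : ∀ᵐ η, deriv X.U η ^ 2 = deriv X.y η * deriv X.H η

namespace IsNice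

variable {X : Lagr} {G : ℝ} (hX : IsNice X G)
include hX

theorem lip_H : LipschitzWith 1 X.H := by
  refine LipschitzWith.of_le_add fun a b => ?_
  rcases le_total a b with h | h
  · have := hX.mono_H h; have := dist_nonneg (x := a) (y := b); linarith
  · have := hX.mono_y h
    rw [hX.y_eq, hX.y_eq] at this
    rw [Real.dist_eq, abs_of_nonneg (by linarith)]; linarith

theorem lip_y : LipschitzWith 1 X.y := by
  refine LipschitzWith.of_le_add fun a b => ?_
  rcases le_total a b with h | h
  · have := hX.mono_y h; have := dist_nonneg (x := a) (y := b); linarith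
  · have := hX.mono_H h
    rw [hX.y_eq, hX.y_eq]
    rw [Real.dist_eq, abs_of_nonneg (by linarith)]; linarith

theorem lip_U : LipschitzWith 1 X.U := by
  refine LipschitzWith.of_dist_le_mul fun a b => ?_
  rw [Real.dist_eq, Real.dist_eq, NNReal.coe_one, one_mul]
  refine sq_le_sq.mp ?_
  have h1 := hX.cs b a
  have h2 := hX.y_eq a
  have h3 := hX.y_eq b
  have : 0 ≤ (X.y a - X.y b) * (X.H a - X.H b) := (sq_nonneg _).trans h1
  have h4 : a - b = (X.y a - X.y b) + (X.H a - X.H b) := by linarith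
  rw [h4]
  nlinarith [sq_nonneg (X.y a - X.y b), sq_nonneg (X.H a - X.H b)]

theorem deriv_y : ∀ᵐ η, deriv X.y η = 1 - deriv X.H η := by
  filter_upwards [hX.lip_H.ae_differentiableAt] with η hη
  have : X.y = fun ξ => ξ - X.H ξ := funext hX.y_eq
  rw [this]
  exact ((hasDerivAt_id η).sub hη.hasDerivAt).deriv

theorem deriv_H_nonneg (η : ℝ) : 0 ≤ deriv X.H η := hX.mono_H.deriv_nonneg

theorem deriv_y_nonneg (η : ℝ) : 0 ≤ deriv X.y η := hX.mono_y.deriv_nonneg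

theorem deriv_H_le (η : ℝ) : deriv X.H η ≤ 1 := by
  have := norm_deriv_le_of_lipschitz hX.lip_H (x₀ := η)
  exact (le_abs_self _).trans (by simpa using this)

theorem integrableOn_deriv_H (a b : ℝ) : IntervalIntegrable (deriv X.H) volume a b :=
  (ac_of_lipschitz hX.lip_H a b).intervalIntegrable_deriv

theorem integrable_deriv_H : Integrable (deriv X.H) := by
  refine integrable_of_intervalIntegral_norm_tendsto (G - 0) (a := fun n : ℕ => -(n:ℝ))
    (b := fun n : ℕ => (n : ℝ)) (l := atTop) (fun n => (hX.integrableOn_deriv_H _ _).1)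
    (tendsto_neg_atTop_atBot.comp tendsto_natCast_atTop_atTop) tendsto_natCast_atTop_atTop ?_
  have h1 : Tendsto (fun n : ℕ => X.H n - X.H (-(n : ℝ))) atTop (𝓝 (G - 0)) :=
    (hX.H_top.comp tendsto_natCast_atTop_atTop).sub
      (hX.H_bot.comp (tendsto_neg_atTop_atBot.comp tendsto_natCast_atTop_atTop))
  refine h1.congr fun n => ?_
  rw [← integral_deriv_of_lipschitz hX.lip_H]
  refine intervalIntegral.integral_congr fun x _ => ?_
  simp [abs_of_nonneg (hX.deriv_H_nonneg x)]

theorem integral_Iic_deriv_H (ξ : ℝ) : ∫ η in Iic ξ, deriv X.H η = X.H ξ := by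
  have h := intervalIntegral_tendsto_integral_Iic ξ
    (hX.integrable_deriv_H.integrableOn (s := Iic ξ)) tendsto_id
  refine tendsto_nhds_unique h ?_
  have := hX.H_bot.const_sub (X.H ξ)
  rw [sub_zero] at this
  refine this.congr fun a => ?_
  rw [integral_deriv_of_lipschitz hX.lip_H]; rfl

theorem integral_deriv_H : ∫ η, deriv X.H η = G :=
  tendsto_nhds_unique (tendsto_setIntegral_Iic_atTop hX.integrable_deriv_H)
    (hX.H_top.congr fun ξ => (hX.integral_Iic_deriv_H ξ).symm)

theorem G_nonneg : 0 ≤ G := by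
  rw [← hX.integral_deriv_H]; exact integral_nonneg hX.deriv_H_nonneg

theorem rel' : ∀ᵐ η, deriv X.U η ^ 2 = (1 - deriv X.H η) * deriv X.H η := by
  filter_upwards [hX.rel, hX.deriv_y] with η h1 h2
  rw [h1, h2]

theorem integrable_deriv_U_sq : Integrable (fun η => deriv X.U η ^ 2) := by
  refine hX.integrable_deriv_H.mono' ((measurable_deriv _).pow_const 2).aestronglyMeasurable ?_
  filter_upwards [hX.rel'] with η h
  rw [Real.norm_of_nonneg (sq_nonneg _), h]
  nlinarith [hX.deriv_H_nonneg η, hX.deriv_H_le η]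

end IsNice

end HunterSaxton
end

noncomputable section


namespace HunterSaxton

/-! ## Breaking times and evolution with a prescribed loss of energy -/

open Classical in
/-- The breaking time, with the value `∞` where no energy is ever lost. -/
def brk (X : Lagr) (η : ℝ) : ℝ≥0∞ :=
  if deriv X.U η < 0 then ENNReal.ofReal (-(2 * deriv X.y η) / deriv X.U η) else ⊤

/-- The time elapsed at `t` since the breaking time `θ`. -/
def clock (θ : ℝ≥0∞) (t : ℝ) : ℝ := (ENNReal.ofReal t - θ).toReal

/-- The breaking time truncated at `T`. -/
def cutBrk (θ : ℝ≥0∞) (T : ℝ) : ℝ := (min θ (ENNReal.ofReal T)).toReal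

/-- The energy when the fraction `b` of the energy is lost at breaking. -/
def evoV (X : Lagr) (b : ℝ → ℝ) (t ξ : ℝ) : ℝ :=
  ∫ η in Iic ξ, (1 - (open Classical in if brk X η ≤ ENNReal.ofReal t then b η else 0)) *
    deriv X.H η

/-- The velocity when the fraction `b` of the energy is lost at breaking. -/
def evoU (X : Lagr) (b : ℝ → ℝ) (t ξ : ℝ) : ℝ :=
  X.U ξ + 1 / 2 * kern (fun η => deriv X.H η * (t - b η * clock (brk X η) t)) ξ

/-- The characteristics when the fraction `b` of the energy is lost at breaking. -/
def evoY (X : Lagr) (b : ℝ → ℝ) (t ξ : ℝ) : ℝ :=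
  X.y ξ + X.U ξ * t +
    1 / 4 * kern (fun η => deriv X.H η * (t ^ 2 - b η * clock (brk X η) t ^ 2)) ξ

/-- Measurable fractions with values in `[0, 1]`. -/
structure IsFrac (b : ℝ → ℝ) : Prop where
  meas : Measurable b
  nonneg : ∀ η, 0 ≤ b η
  le_one : ∀ η, b η ≤ 1

theorem measurable_brk (X : Lagr) : Measurable (brk X) := by
  unfold brk
  refine Measurable.ite (measurableSet_lt (measurable_deriv _) measurable_const) ?_ measurable_const
  exact (((measurable_deriv X.y).const_mul 2).neg.div (measurable_deriv X.U)).ennreal_ofReal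

theorem clock_nonneg (θ : ℝ≥0∞) (t : ℝ) : 0 ≤ clock θ t := ENNReal.toReal_nonneg

theorem clock_le {θ : ℝ≥0∞} {t : ℝ} (ht : 0 ≤ t) : clock θ t ≤ t := by
  unfold clock
  calc _ ≤ (ENNReal.ofReal t).toReal := ENNReal.toReal_mono ENNReal.ofReal_ne_top tsub_le_self
    _ = t := ENNReal.toReal_ofReal ht

theorem clock_of_le {θ : ℝ≥0∞} {t : ℝ} (ht : 0 ≤ t) (h : θ ≤ ENNReal.ofReal t) :
    clock θ t = t - θ.toReal := by
  unfold clock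
  rw [ENNReal.toReal_sub_of_le h ENNReal.ofReal_ne_top, ENNReal.toReal_ofReal ht]

theorem clock_of_ge {θ : ℝ≥0∞} {t : ℝ} (h : ENNReal.ofReal t ≤ θ) : clock θ t = 0 := by
  unfold clock; rw [tsub_eq_zero_of_le h]; rfl

theorem measurable_clock (X : Lagr) (t : ℝ) : Measurable (fun η => clock (brk X η) t) :=
  ((measurable_const.sub (measurable_brk X))).ennreal_toReal

theorem measurable_cutBrk (X : Lagr) (t : ℝ) : Measurable (fun η => cutBrk (brk X η) t) :=
  ((measurable_brk X).min measurable_const).ennreal_toReal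

theorem cutBrk_nonneg (θ : ℝ≥0∞) (t : ℝ) : 0 ≤ cutBrk θ t := ENNReal.toReal_nonneg

theorem cutBrk_le {θ : ℝ≥0∞} {t : ℝ} (ht : 0 ≤ t) : cutBrk θ t ≤ t := by
  unfold cutBrk
  calc _ ≤ (ENNReal.ofReal t).toReal := ENNReal.toReal_mono ENNReal.ofReal_ne_top (min_le_right _ _)
    _ = t := ENNReal.toReal_ofReal ht

theorem cutBrk_of_le {θ : ℝ≥0∞} {t : ℝ} (h : θ ≤ ENNReal.ofReal t) : cutBrk θ t = θ.toReal := by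
  unfold cutBrk; rw [min_eq_left h]

theorem cutBrk_of_ge {θ : ℝ≥0∞} {t : ℝ} (ht : 0 ≤ t) (h : ENNReal.ofReal t ≤ θ) :
    cutBrk θ t = t := by
  unfold cutBrk; rw [min_eq_right h, ENNReal.toReal_ofReal ht]

theorem clock_eq_max {θ : ℝ≥0∞} {t T : ℝ} (ht : 0 ≤ t) (hT : t ≤ T) :
    clock θ t = max (t - cutBrk θ T) 0 := by
  rcases le_total θ (ENNReal.ofReal t) with h | h
  · rw [clock_of_le ht h, cutBrk_of_le (h.trans (ENNReal.ofReal_le_ofReal hT)), max_eq_left]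
    have := ENNReal.toReal_mono ENNReal.ofReal_ne_top h
    rw [ENNReal.toReal_ofReal ht] at this; linarith
  · rw [clock_of_ge h, max_eq_right]
    unfold cutBrk
    have := ENNReal.toReal_mono (b := min θ (ENNReal.ofReal T))
      (ne_top_of_le_ne_top ENNReal.ofReal_ne_top (min_le_right _ _))
      (le_min h (ENNReal.ofReal_le_ofReal hT))
    rw [ENNReal.toReal_ofReal ht] at this; linarith

theorem clock_add_le {θ : ℝ≥0∞} {t : ℝ} (ht : 0 ≤ t) (h : θ ≤ ENNReal.ofReal t) :
    θ.toReal = t - clock θ t := by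
  rw [clock_of_le ht h]; ring

theorem abs_clock_sub_le {θ θ' : ℝ≥0∞} {t T : ℝ} (ht : 0 ≤ t) (hT : t ≤ T) :
    |clock θ t - clock θ' t| ≤ |cutBrk θ T - cutBrk θ' T| := by
  rw [clock_eq_max ht hT, clock_eq_max ht hT]
  refine (abs_max_sub_max_le_abs _ _ _).trans ?_
  rw [show t - cutBrk θ T - (t - cutBrk θ' T) = cutBrk θ' T - cutBrk θ T by ring, abs_sub_comm]

theorem abs_clock_time_sub_le {θ : ℝ≥0∞} {t t' : ℝ} (ht : 0 ≤ t) (ht' : 0 ≤ t') :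
    |clock θ t - clock θ t'| ≤ |t - t'| := by
  rw [clock_eq_max ht (le_max_left t t'), clock_eq_max ht' (le_max_right t t')]
  refine (abs_max_sub_max_le_abs _ _ _).trans ?_
  rw [show ∀ c, t - c - (t' - c) = t - t' by intro c; ring]

theorem sq_exp_bound {l w t : ℝ} (hl : 0 < l) (hw : 0 ≤ w) :
    w ^ 2 * Real.exp (l * (t - w)) ≤ 2 / l ^ 2 * Real.exp (l * t) := by
  have h1 : (l * w) ^ 2 / 2 ≤ Real.exp (l * w) := by
    have := Real.quadratic_le_exp_of_nonneg (x := l * w) (by positivity)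
    have h0 : 0 ≤ l * w := by positivity
    linarith
  have h2 : Real.exp (l * t) = Real.exp (l * (t - w)) * Real.exp (l * w) := by
    rw [← Real.exp_add]; ring_nf
  rw [h2, div_mul_eq_mul_div, le_div_iff₀ (by positivity)]
  have := Real.exp_pos (l * (t - w))
  nlinarith

theorem le_two_mul_of_half {ι : Type*} (f : ι → ℝ) {A : ℝ} (hA : 0 ≤ A)
    (hbdd : ∃ M, ∀ i, f i ≤ M)
    (h : ∀ M, 0 ≤ M → (∀ i, f i ≤ M) → ∀ i, f i ≤ A + M / 2) (i : ι) : f i ≤ 2 * A := by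
  obtain ⟨M, hM⟩ := hbdd
  have hB : BddAbove (range f) := ⟨M, by rintro _ ⟨j, rfl⟩; exact hM j⟩
  have : Nonempty ι := ⟨i⟩
  set S := max (⨆ j, f j) 0
  have h1 := h S (le_max_right _ _) (fun j => (le_ciSup hB j).trans (le_max_left _ _))
  have h2 : S ≤ A + S / 2 := max_le (ciSup_le h1) (by positivity)
  have h3 := (le_ciSup hB i).trans (le_max_left _ (0:ℝ))
  change f i ≤ S at h3
  linarith

namespace IsNice

variable {X : Lagr} {G : ℝ} (hX : IsNice X G)
include hX

theorem integrable_mul {f : ℝ → ℝ} {C : ℝ} (hf : Measurable f) (hC : ∀ η, |f η| ≤ C) :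
    Integrable (fun η => deriv X.H η * f η) :=
  hX.integrable_deriv_H.mul_bdd hf.aestronglyMeasurable (Eventually.of_forall hC)

theorem integral_mul_le {f : ℝ → ℝ} {C : ℝ} (hf : Measurable f) (hC : ∀ η, |f η| ≤ C) :
    ∫ η, deriv X.H η * f η ≤ G * C := by
  rw [← hX.integral_deriv_H, ← integral_mul_const]
  refine integral_mono (hX.integrable_mul hf hC) (hX.integrable_deriv_H.mul_const C) fun η => ?_
  exact mul_le_mul_of_nonneg_left ((le_abs_self _).trans (hC η)) (hX.deriv_H_nonneg η)

end IsNice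

namespace IsFrac

theorem abs_le {b : ℝ → ℝ} (hb : IsFrac b) (η : ℝ) : |b η| ≤ 1 := by
  rw [abs_of_nonneg (hb.nonneg η)]; exact hb.le_one η

theorem abs_sub_le {b b' : ℝ → ℝ} (hb : IsFrac b) (hb' : IsFrac b') (η : ℝ) :
    |b η - b' η| ≤ 1 := by
  rw [abs_sub_le_iff]
  constructor <;> linarith [hb.nonneg η, hb.le_one η, hb'.nonneg η, hb'.le_one η]

theorem meas_fac (X : Lagr) {b : ℝ → ℝ} (hb : IsFrac b) (t : ℝ) (k : ℕ) :
    Measurable (fun η => t ^ k - b η * clock (brk X η) t ^ k) :=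
  measurable_const.sub (hb.meas.mul ((measurable_clock X t).pow_const k))

theorem fac_nonneg (X : Lagr) {b : ℝ → ℝ} (hb : IsFrac b) {t : ℝ} (ht : 0 ≤ t) (k : ℕ) (η : ℝ) :
    0 ≤ t ^ k - b η * clock (brk X η) t ^ k := by
  have h1 := pow_le_pow_left₀ (clock_nonneg (brk X η) t) (clock_le ht) k
  have h2 := hb.le_one η
  have h3 := pow_nonneg (clock_nonneg (brk X η) t) k
  nlinarith

theorem fac_le (X : Lagr) {b : ℝ → ℝ} (hb : IsFrac b) (t : ℝ) (k : ℕ) (η : ℝ) :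
    t ^ k - b η * clock (brk X η) t ^ k ≤ t ^ k := by
  have := mul_nonneg (hb.nonneg η) (pow_nonneg (clock_nonneg (brk X η) t) k)
  linarith

theorem abs_fac_le (X : Lagr) {b : ℝ → ℝ} (hb : IsFrac b) {t : ℝ} (ht : 0 ≤ t) (k : ℕ) (η : ℝ) :
    |t ^ k - b η * clock (brk X η) t ^ k| ≤ t ^ k := by
  rw [abs_of_nonneg (hb.fac_nonneg X ht k η)]; exact hb.fac_le X t k η

theorem integrable_fac {X : Lagr} {G : ℝ} (hX : IsNice X G) {b : ℝ → ℝ} (hb : IsFrac b) {t : ℝ}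
    (ht : 0 ≤ t) (k : ℕ) :
    Integrable (fun η => deriv X.H η * (t ^ k - b η * clock (brk X η) t ^ k)) :=
  hX.integrable_mul (hb.meas_fac X t k) (hb.abs_fac_le X ht k)

end IsFrac

theorem abs_pow_sub_pow_le {a b T : ℝ} (ha : 0 ≤ a) (hb : 0 ≤ b) (haT : a ≤ T) (hbT : b ≤ T)
    (k : ℕ) : |a ^ k - b ^ k| ≤ k * T ^ (k - 1) * |a - b| := by
  have h := _root_.abs_pow_sub_pow_le a b k
  have hm : max |a| |b| ≤ T := by rw [abs_of_nonneg ha, abs_of_nonneg hb]; exact max_le haT hbT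
  calc _ ≤ |a - b| * k * max |a| |b| ^ (k - 1) := h
    _ ≤ |a - b| * k * T ^ (k - 1) := by gcongr
    _ = _ := by ring

/-- The data of a comparison of two evolutions up to time `T`. -/
structure Compare (X X' : Lagr) (G : ℝ) (b b' : ℝ → ℝ) (T K C ε : ℝ) : Prop where
  nice : IsNice X G
  nice' : IsNice X' G
  frac : IsFrac b
  frac' : IsFrac b'
  T_nonneg : 0 ≤ T
  K_nonneg : 0 ≤ K
  C_nonneg : 0 ≤ C
  ε_nonneg : 0 ≤ ε
  close : ∀ᵐ η, brk X' η ≤ ENNReal.ofReal T →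
    |b η - b' η| ≤ K * |evoY X b (cutBrk (brk X' η) T) η - evoY X' b' (cutBrk (brk X' η) T) η|
      + K * (C * |cutBrk (brk X η) T - cutBrk (brk X' η) T| + ε)

/-- The weighted distance of the breaking times. -/
def brkDist (X X' : Lagr) (T : ℝ) : ℝ :=
  ∫ η, deriv X.H η * |cutBrk (brk X η) T - cutBrk (brk X' η) T|

/-- The `L¹` distance of the energy densities. -/
def energyDist (X X' : Lagr) : ℝ := ∫ η, |deriv X.H η - deriv X'.H η|

namespace Compare

variable {X X' : Lagr} {G : ℝ} {b b' : ℝ → ℝ} {T K C ε : ℝ} (h : Compare X X' G b b' T K C ε)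
include h

theorem abs_cut_le (η : ℝ) : |cutBrk (brk X η) T - cutBrk (brk X' η) T| ≤ T := by
  have := h.T_nonneg
  rw [abs_sub_le_iff]
  constructor <;> linarith [cutBrk_nonneg (brk X η) T, cutBrk_nonneg (brk X' η) T,
    cutBrk_le (θ := brk X η) this, cutBrk_le (θ := brk X' η) this]

theorem measurable_cut : Measurable fun η => |cutBrk (brk X η) T - cutBrk (brk X' η) T| :=
  (measurable_norm.comp ((measurable_cutBrk X T).sub (measurable_cutBrk X' T)))

theorem integrable_cut :
    Integrable (fun η => deriv X.H η * |cutBrk (brk X η) T - cutBrk (brk X' η) T|) :=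
  h.nice.integrable_mul h.measurable_cut (C := T) fun η => by
    rw [abs_abs]; exact h.abs_cut_le η

theorem brkDist_nonneg : 0 ≤ brkDist X X' T :=
  integral_nonneg fun η => mul_nonneg (h.nice.deriv_H_nonneg η) (abs_nonneg _)

theorem integrable_energy : Integrable (fun η => |deriv X.H η - deriv X'.H η|) :=
  (h.nice.integrable_deriv_H.sub h.nice'.integrable_deriv_H).abs

theorem energyDist_nonneg : 0 ≤ energyDist X X' := integral_nonneg fun _ => abs_nonneg _

theorem pointwise {t : ℝ} (ht : 0 ≤ t) (hT : t ≤ T) (k : ℕ) (η : ℝ) :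
    |deriv X.H η * (t ^ k - b η * clock (brk X η) t ^ k) -
      deriv X'.H η * (t ^ k - b' η * clock (brk X' η) t ^ k)| ≤
    T ^ k * |deriv X.H η - deriv X'.H η| +
    k * T ^ (k - 1) * (deriv X.H η * |cutBrk (brk X η) T - cutBrk (brk X' η) T|) +
    deriv X.H η * (clock (brk X' η) t ^ k * |b η - b' η|) := by
  set v := deriv X.H η
  set v' := deriv X'.H η
  set w := clock (brk X η) t
  set w' := clock (brk X' η) t
  have hv : 0 ≤ v := h.nice.deriv_H_nonneg η
  have hw := clock_nonneg (brk X η) t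
  have hw' := clock_nonneg (brk X' η) t
  have hwT := (clock_le (θ := brk X η) ht).trans hT
  have hwT' := (clock_le (θ := brk X' η) ht).trans hT
  have e1 : v * (t ^ k - b η * w ^ k) - v' * (t ^ k - b' η * w' ^ k) =
    (v - v') * (t ^ k - b' η * w' ^ k) + (-(v * (b η * (w ^ k - w' ^ k))) -
      v * (w' ^ k * (b η - b' η))) := by ring
  have h1 : |(v - v') * (t ^ k - b' η * w' ^ k)| ≤ T ^ k * |v - v'| := by
    rw [abs_mul, mul_comm]
    gcongr
    exact (h.frac'.abs_fac_le X' ht k η).trans (pow_le_pow_left₀ ht hT k)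
  have h2 : |-(v * (b η * (w ^ k - w' ^ k)))| ≤
      k * T ^ (k - 1) * (v * |cutBrk (brk X η) T - cutBrk (brk X' η) T|) := by
    rw [abs_neg, abs_mul, abs_mul, abs_of_nonneg hv]
    have a1 := HunterSaxton.abs_pow_sub_pow_le hw hw' hwT hwT' k
    have a2 := abs_clock_sub_le (θ := brk X η) (θ' := brk X' η) ht hT
    have hT0 := h.T_nonneg
    calc v * (|b η| * |w ^ k - w' ^ k|) ≤ v * (1 * (k * T ^ (k - 1) *
          |cutBrk (brk X η) T - cutBrk (brk X' η) T|)) := by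
          gcongr
          · exact h.frac.abs_le η
          · exact a1.trans (by gcongr)
      _ = _ := by ring
  have h3 : |v * (w' ^ k * (b η - b' η))| = v * (w' ^ k * |b η - b' η|) := by
    rw [abs_mul, abs_mul, abs_of_nonneg hv, abs_of_nonneg (pow_nonneg hw' k)]
  rw [e1]
  have i1 := abs_add_le ((v - v') * (t ^ k - b' η * w' ^ k)) (-(v * (b η * (w ^ k - w' ^ k))) -
      v * (w' ^ k * (b η - b' η)))
  have i2 := abs_sub (-(v * (b η * (w ^ k - w' ^ k)))) (v * (w' ^ k * (b η - b' η)))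
  linarith

theorem measurable_loss (t : ℝ) (k : ℕ) :
    Measurable (fun η => clock (brk X' η) t ^ k * |b η - b' η|) :=
  ((measurable_clock X' t).pow_const k).mul
    (measurable_norm.comp (h.frac.meas.sub h.frac'.meas))

theorem abs_loss_le {t : ℝ} (ht : 0 ≤ t) (k : ℕ) (η : ℝ) :
    |(clock (brk X' η) t ^ k * |b η - b' η|)| ≤ t ^ k := by
  have hw' := clock_nonneg (brk X' η) t
  rw [abs_mul, abs_abs, abs_of_nonneg (pow_nonneg hw' k)]
  calc _ ≤ t ^ k * 1 := mul_le_mul (pow_le_pow_left₀ hw' (clock_le ht) k)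
        (h.frac.abs_sub_le h.frac' η) (abs_nonneg _) (pow_nonneg ht k)
    _ = _ := mul_one _

theorem integrable_loss {t : ℝ} (ht : 0 ≤ t) (k : ℕ) :
    Integrable (fun η => deriv X.H η * (clock (brk X' η) t ^ k * |b η - b' η|)) :=
  h.nice.integrable_mul (h.measurable_loss t k) (h.abs_loss_le ht k)

theorem integral_abs_fac_le {t : ℝ} (ht : 0 ≤ t) (hT : t ≤ T) (k : ℕ) :
    ∫ η, |deriv X.H η * (t ^ k - b η * clock (brk X η) t ^ k) -
      deriv X'.H η * (t ^ k - b' η * clock (brk X' η) t ^ k)| ≤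
    T ^ k * energyDist X X' + k * T ^ (k - 1) * brkDist X X' T +
    ∫ η, deriv X.H η * (clock (brk X' η) t ^ k * |b η - b' η|) := by
  have i12 : Integrable (fun η => T ^ k * |deriv X.H η - deriv X'.H η| +
      k * T ^ (k - 1) * (deriv X.H η * |cutBrk (brk X η) T - cutBrk (brk X' η) T|)) :=
    (h.integrable_energy.const_mul _).add (h.integrable_cut.const_mul _)
  rw [energyDist, brkDist, ← integral_const_mul, ← integral_const_mul,
    ← integral_add (h.integrable_energy.const_mul _) (h.integrable_cut.const_mul _),
    ← integral_add i12 (h.integrable_loss ht k)]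
  exact integral_mono ((h.frac.integrable_fac h.nice ht k).sub
    (h.frac'.integrable_fac h.nice' ht k)).abs
    (i12.add (h.integrable_loss ht k)) (h.pointwise ht hT k)

/-- A bound on the weighted difference of the characteristics controls the effect of the different
fractions. -/
theorem integral_loss_le {M l : ℝ} (hl : 0 < l) (hM : 0 ≤ M)
    (hY : ∀ t ∈ Icc 0 T, ∀ ξ, |evoY X b t ξ - evoY X' b' t ξ| ≤ Real.exp (l * t) * M)
    {t : ℝ} (ht : 0 ≤ t) (hT : t ≤ T) :
    ∫ η, deriv X.H η * (clock (brk X' η) t ^ 2 * |b η - b' η|) ≤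
      T ^ 2 * (K * (C * brkDist X X' T + ε * G)) +
        Real.exp (l * t) * (G * (K * M * (2 / l ^ 2))) := by
  have i1 : Integrable (fun η => C * (deriv X.H η *
      |cutBrk (brk X η) T - cutBrk (brk X' η) T|) + ε * deriv X.H η) :=
    (h.integrable_cut.const_mul C).add (h.nice.integrable_deriv_H.const_mul ε)
  have i2 := (i1.const_mul K).const_mul (T ^ 2)
  have i3 := (h.nice.integrable_deriv_H.mul_const (K * M * (2 / l ^ 2))).const_mul
    (Real.exp (l * t))
  have hi := i2.add i3
  have e : ∫ η, (T ^ 2 * (K * (C * (deriv X.H η *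
      |cutBrk (brk X η) T - cutBrk (brk X' η) T|) + ε * deriv X.H η)) +
      Real.exp (l * t) * (deriv X.H η * (K * M * (2 / l ^ 2)))) =
      T ^ 2 * (K * (C * brkDist X X' T + ε * G)) +
        Real.exp (l * t) * (G * (K * M * (2 / l ^ 2))) := by
    rw [integral_add i2 i3, integral_const_mul,
      integral_const_mul, integral_add (h.integrable_cut.const_mul C)
        (h.nice.integrable_deriv_H.const_mul ε), integral_const_mul, integral_const_mul,
      integral_const_mul, integral_mul_const, h.nice.integral_deriv_H, brkDist]
  rw [← e]
  refine integral_mono_ae (h.integrable_loss ht 2) hi ?_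
  filter_upwards [h.close] with η hη
  have hv : 0 ≤ deriv X.H η := h.nice.deriv_H_nonneg η
  have hK := h.K_nonneg
  have hC := h.C_nonneg
  have hε := h.ε_nonneg
  rcases le_total (brk X' η) (ENNReal.ofReal t) with hb | hb
  · have hb' := hb.trans (ENNReal.ofReal_le_ofReal hT)
    have h1 := hη hb'
    have hs : cutBrk (brk X' η) T = t - clock (brk X' η) t := by
      rw [cutBrk_of_le hb', clock_add_le ht hb]
    have h2 := hY _ ⟨cutBrk_nonneg (brk X' η) T, cutBrk_le h.T_nonneg⟩ η
    have hw := clock_nonneg (brk X' η) t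
    have hwT := (clock_le (θ := brk X' η) ht).trans hT
    have h3 := sq_exp_bound (t := t) hl hw
    rw [← hs] at h3
    set w := clock (brk X' η) t
    set D := |cutBrk (brk X η) T - cutBrk (brk X' η) T|
    have hD : 0 ≤ D := abs_nonneg _
    have hw2 : w ^ 2 ≤ T ^ 2 := pow_le_pow_left₀ hw hwT 2
    calc deriv X.H η * (w ^ 2 * |b η - b' η|)
        ≤ deriv X.H η * (w ^ 2 * (K * (Real.exp (l * cutBrk (brk X' η) T) * M) +
            K * (C * D + ε))) := by gcongr; exact h1.trans (by gcongr)
      _ = deriv X.H η * (w ^ 2 * (K * (C * D + ε))) +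
          deriv X.H η * (K * M * (w ^ 2 * Real.exp (l * cutBrk (brk X' η) T))) := by ring
      _ ≤ deriv X.H η * (T ^ 2 * (K * (C * D + ε))) +
          deriv X.H η * (K * M * (2 / l ^ 2 * Real.exp (l * t))) := by gcongr
      _ = _ := by ring
  · rw [clock_of_ge hb]
    have := h.T_nonneg
    simp only [ne_eq, OfNat.ofNat_ne_zero, not_false_eq_true, zero_pow, zero_mul, mul_zero]
    positivity

/-- The characteristics of two evolutions are close if their data are. -/
theorem abs_evoY_sub_le {dy dU : ℝ} (hy : ∀ ξ, |X.y ξ - X'.y ξ| ≤ dy)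
    (hU : ∀ ξ, |X.U ξ - X'.U ξ| ≤ dU) {t : ℝ} (ht : t ∈ Icc 0 T) (ξ : ℝ) :
    |evoY X b t ξ - evoY X' b' t ξ| ≤ Real.exp ((K * G + 1) * T) * (2 * (dy + T * dU +
      T ^ 2 * energyDist X X' + 2 * T * brkDist X X' T +
        T ^ 2 * (K * (C * brkDist X X' T + ε * G)))) := by
  set l := K * G + 1 with hl
  have hG := h.nice.G_nonneg
  have hK := h.K_nonneg
  have hC := h.C_nonneg
  have hε := h.ε_nonneg
  have hT := h.T_nonneg
  have hl0 : 1 ≤ l := by have := mul_nonneg hK hG; linarith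
  have hdy : 0 ≤ dy := (abs_nonneg _).trans (hy 0)
  have hdU : 0 ≤ dU := (abs_nonneg _).trans (hU 0)
  have hB := h.brkDist_nonneg
  have hE := h.energyDist_nonneg
  set A := dy + T * dU + T ^ 2 * energyDist X X' + 2 * T * brkDist X X' T +
        T ^ 2 * (K * (C * brkDist X X' T + ε * G)) with hA
  have hA0 : 0 ≤ A := by positivity
  have base : ∀ p : Icc 0 T × ℝ, |evoY X b p.1 p.2 - evoY X' b' p.1 p.2| ≤ dy + T * dU +
      (T ^ 2 * energyDist X X' + 2 * T * brkDist X X' T +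
        ∫ η, deriv X.H η * (clock (brk X' η) p.1 ^ 2 * |b η - b' η|)) / 2 := by
    rintro ⟨⟨s, hs⟩, x⟩
    have k1 := abs_kern_sub_kern_le (h.frac.integrable_fac h.nice hs.1 2)
      (h.frac'.integrable_fac h.nice' hs.1 2) x
    have k2 := h.integral_abs_fac_le hs.1 hs.2 2
    simp only [evoY]
    set k := kern (fun η => deriv X.H η * (s ^ 2 - b η * clock (brk X η) s ^ 2)) x
    set k' := kern (fun η => deriv X'.H η * (s ^ 2 - b' η * clock (brk X' η) s ^ 2)) x
    have e : X.y x + X.U x * s + 1 / 4 * k - (X'.y x + X'.U x * s + 1 / 4 * k') =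
      (X.y x - X'.y x) + ((X.U x - X'.U x) * s + 1 / 4 * (k - k')) := by ring
    rw [e]
    have a1 : |(X.U x - X'.U x) * s| ≤ T * dU := by
      rw [abs_mul, abs_of_nonneg hs.1, mul_comm]
      exact mul_le_mul hs.2 (hU x) (abs_nonneg _) hT
    have a2 : |1 / 4 * (k - k')| = 1 / 4 * |k - k'| := by rw [abs_mul]; norm_num
    have a3 := abs_add_le (X.y x - X'.y x) ((X.U x - X'.U x) * s + 1 / 4 * (k - k'))
    have a4 := abs_add_le ((X.U x - X'.U x) * s) (1 / 4 * (k - k'))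
    have a5 := hy x
    have a6 := abs_nonneg (k - k')
    norm_num at k2
    linarith
  have key := le_two_mul_of_half
    (fun p : Icc 0 T × ℝ => Real.exp (-(l * p.1)) * |evoY X b p.1 p.2 - evoY X' b' p.1 p.2|) hA0
    (by
      refine ⟨dy + T * dU + (T ^ 2 * energyDist X X' + 2 * T * brkDist X X' T + G * T ^ 2) / 2, ?_⟩
      intro p
      have h1 := base p
      have h2 : ∫ η, deriv X.H η * (clock (brk X' η) p.1 ^ 2 * |b η - b' η|) ≤ G * T ^ 2 :=
        h.nice.integral_mul_le (h.measurable_loss _ 2) fun η =>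
          (h.abs_loss_le p.1.2.1 2 η).trans (pow_le_pow_left₀ p.1.2.1 p.1.2.2 2)
      have h3 : Real.exp (-(l * p.1)) ≤ 1 := by
        rw [Real.exp_le_one_iff]; have := mul_nonneg (zero_le_one.trans hl0) p.1.2.1; linarith
      have h4 := mul_le_mul h3 le_rfl (abs_nonneg (evoY X b p.1 p.2 - evoY X' b' p.1 p.2)) zero_le_one
      linarith)
    (by
      intro M hM hp
      have hY : ∀ t ∈ Icc 0 T, ∀ ξ, |evoY X b t ξ - evoY X' b' t ξ| ≤ Real.exp (l * t) * M := by
        intro s hs x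
        have := hp (⟨s, hs⟩, x)
        simp only [Real.exp_neg] at this
        rwa [inv_mul_le_iff₀ (Real.exp_pos _)] at this
      rintro ⟨⟨s, hs⟩, x⟩
      have h1 := base (⟨s, hs⟩, x)
      have h2 := h.integral_loss_le (by linarith) hM hY hs.1 hs.2
      simp only at h1 ⊢
      simp only [Real.exp_neg]
      rw [inv_mul_le_iff₀ (Real.exp_pos _)]
      have h3 : 1 ≤ Real.exp (l * s) :=
        Real.one_le_exp (mul_nonneg (zero_le_one.trans hl0) hs.1)
      have h4 : G * (K * M * (2 / l ^ 2)) ≤ M := by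
        have : G * (K * M * (2 / l ^ 2)) = M * (2 * (K * G) / l ^ 2) := by ring
        rw [this]
        refine mul_le_of_le_one_right hM ?_
        rw [div_le_one (by positivity)]
        have := mul_nonneg hK hG
        nlinarith
      have h5 : A ≤ Real.exp (l * s) * A := le_mul_of_one_le_left hA0 h3
      have h6 : Real.exp (l * s) * (G * (K * M * (2 / l ^ 2))) ≤ Real.exp (l * s) * M := by gcongr
      have h7 : 0 ≤ T ^ 2 * energyDist X X' := by positivity
      have h8 : 0 ≤ 2 * T * brkDist X X' T := by positivity
      have h9 : 0 ≤ T ^ 2 * (K * (C * brkDist X X' T + ε * G)) := by positivity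
      linarith) (⟨t, ht⟩, ξ)
  simp only [Real.exp_neg] at key
  rw [inv_mul_le_iff₀ (Real.exp_pos _)] at key
  refine key.trans ?_
  gcongr
  exact ht.2

end Compare

end HunterSaxton
end

noncomputable section


namespace HunterSaxton

/-! ## Regularity of the characteristics -/

theorem kern_abs_mul_le {X : Lagr} {G : ℝ} (hX : IsNice X G) {f : ℝ → ℝ} {C : ℝ}
    (hf : Measurable f) (hC : ∀ η, |f η| ≤ C) (ξ : ℝ) :
    |kern (fun η => deriv X.H η * f η) ξ| ≤ 1 / 2 * (G * C) := by
  refine (abs_kern_le (hX.integrable_mul hf hC) ξ).trans ?_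
  have : ∀ η, |deriv X.H η * f η| = deriv X.H η * |f η| := fun η => by
    rw [abs_mul, abs_of_nonneg (hX.deriv_H_nonneg η)]
  simp_rw [this]
  have := hX.integral_mul_le (f := fun η => |f η|) (measurable_norm.comp hf) (C := C)
    (fun η => by rw [abs_abs]; exact hC η)
  linarith

theorem evoY_zero {X : Lagr} (b : ℝ → ℝ) (ξ : ℝ) : evoY X b 0 ξ = X.y ξ := by
  simp [evoY, clock, kern]

theorem evoU_zero {X : Lagr} (b : ℝ → ℝ) (ξ : ℝ) : evoU X b 0 ξ = X.U ξ := by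
  simp [evoU, clock, kern]

theorem abs_evoY_time_sub_le {X : Lagr} {G : ℝ} (hX : IsNice X G) {b : ℝ → ℝ} (hb : IsFrac b)
    {C : ℝ} (hC : ∀ ξ, |X.U ξ| ≤ C) {T t t' : ℝ} (ht : t ∈ Icc 0 T) (ht' : t' ∈ Icc 0 T) (ξ : ℝ) :
    |evoY X b t ξ - evoY X b t' ξ| ≤ (C + T * G) * |t - t'| := by
  have hG := hX.G_nonneg
  have hT : 0 ≤ T := ht.1.trans ht.2
  simp only [evoY]
  have hk := kern_sub (hb.integrable_fac hX ht.1 2) (hb.integrable_fac hX ht'.1 2) ξ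
  set k := kern (fun η => deriv X.H η * (t ^ 2 - b η * clock (brk X η) t ^ 2)) ξ
  set k' := kern (fun η => deriv X.H η * (t' ^ 2 - b η * clock (brk X η) t' ^ 2)) ξ
  have e : X.y ξ + X.U ξ * t + 1 / 4 * k - (X.y ξ + X.U ξ * t' + 1 / 4 * k') =
    X.U ξ * (t - t') + 1 / 4 * (k - k') := by ring
  rw [e, ← hk]
  have h1 : |X.U ξ * (t - t')| ≤ C * |t - t'| := by
    rw [abs_mul]; exact mul_le_mul_of_nonneg_right (hC ξ) (abs_nonneg _)
  have h2 := kern_abs_mul_le hX (f := fun η => (t ^ 2 - b η * clock (brk X η) t ^ 2) -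
    (t' ^ 2 - b η * clock (brk X η) t' ^ 2)) (C := 4 * T * |t - t'|)
    ((hb.meas_fac X t 2).sub (hb.meas_fac X t' 2)) (fun η => by
      have a1 := abs_pow_sub_pow_le ht.1 ht'.1 ht.2 ht'.2 2
      have a2 := abs_pow_sub_pow_le (clock_nonneg (brk X η) t) (clock_nonneg (brk X η) t')
        ((clock_le ht.1).trans ht.2) ((clock_le ht'.1).trans ht'.2) 2
      have a3 := abs_clock_time_sub_le (θ := brk X η) ht.1 ht'.1
      norm_num at a1 a2
      have e : (t ^ 2 - b η * clock (brk X η) t ^ 2) - (t' ^ 2 - b η * clock (brk X η) t' ^ 2) =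
        (t ^ 2 - t' ^ 2) - b η * (clock (brk X η) t ^ 2 - clock (brk X η) t' ^ 2) := by ring
      rw [e]
      refine (abs_sub _ _).trans ?_
      rw [abs_mul]
      have a4 : |b η| * |clock (brk X η) t ^ 2 - clock (brk X η) t' ^ 2| ≤
          1 * (2 * T * |t - t'|) := by
        gcongr
        · exact hb.abs_le η
        · exact a2.trans (by gcongr)
      linarith) ξ
  have e3 : (fun η => deriv X.H η * (t ^ 2 - b η * clock (brk X η) t ^ 2 -
      (t' ^ 2 - b η * clock (brk X η) t' ^ 2))) = fun η =>
      deriv X.H η * (t ^ 2 - b η * clock (brk X η) t ^ 2) -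
      deriv X.H η * (t' ^ 2 - b η * clock (brk X η) t' ^ 2) := by ext; ring
  rw [e3] at h2
  refine (abs_add_le _ _).trans ?_
  rw [abs_mul (1 / 4 : ℝ), abs_of_pos (by norm_num : (0:ℝ) < 1 / 4)]
  have : 0 ≤ G * (T * |t - t'|) := by positivity
  nlinarith

theorem abs_kern_sub_le {X : Lagr} {G : ℝ} (hX : IsNice X G) {f : ℝ → ℝ} {C : ℝ}
    (hf : Measurable f) (hC : ∀ η, |f η| ≤ C) (a c : ℝ) :
    |kern (fun η => deriv X.H η * f η) c - kern (fun η => deriv X.H η * f η) a| ≤ C * |c - a| := by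
  rw [kern_sub_kern (hX.integrable_mul hf hC)]
  rw [← Real.norm_eq_abs]
  refine intervalIntegral.norm_integral_le_of_norm_le_const fun x _ => ?_
  rw [Real.norm_eq_abs, abs_mul, abs_of_nonneg (hX.deriv_H_nonneg x)]
  have := mul_le_mul (hX.deriv_H_le x) (hC x) (abs_nonneg _) zero_le_one
  linarith

theorem abs_evoY_space_sub_le {X : Lagr} {G : ℝ} (hX : IsNice X G) {b : ℝ → ℝ} (hb : IsFrac b)
    {t : ℝ} (ht : 0 ≤ t) (a c : ℝ) :
    |evoY X b t c - evoY X b t a| ≤ (1 + t + t ^ 2) * |c - a| := by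
  simp only [evoY]
  have h1 := abs_kern_sub_le hX (hb.meas_fac X t 2) (hb.abs_fac_le X ht 2) a c
  set k := kern (fun η => deriv X.H η * (t ^ 2 - b η * clock (brk X η) t ^ 2)) c
  set k' := kern (fun η => deriv X.H η * (t ^ 2 - b η * clock (brk X η) t ^ 2)) a
  have e : X.y c + X.U c * t + 1 / 4 * k - (X.y a + X.U a * t + 1 / 4 * k') =
    (X.y c - X.y a) + ((X.U c - X.U a) * t + 1 / 4 * (k - k')) := by ring
  rw [e]
  have h2 := hX.lip_y.dist_le_mul c a
  have h3 := hX.lip_U.dist_le_mul c a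
  simp only [Real.dist_eq, NNReal.coe_one, one_mul] at h2 h3
  have a3 := abs_add_le (X.y c - X.y a) ((X.U c - X.U a) * t + 1 / 4 * (k - k'))
  have a4 := abs_add_le ((X.U c - X.U a) * t) (1 / 4 * (k - k'))
  have a5 : |(X.U c - X.U a) * t| ≤ |c - a| * t := by
    rw [abs_mul, abs_of_nonneg ht]; gcongr
  have a6 : |1 / 4 * (k - k')| = 1 / 4 * |k - k'| := by rw [abs_mul]; norm_num
  have : 0 ≤ t ^ 2 * |c - a| := by positivity
  nlinarith

theorem continuousOn_evoY {X : Lagr} {G : ℝ} (hX : IsNice X G) {b : ℝ → ℝ} (hb : IsFrac b) :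
    ContinuousOn (fun p : ℝ × ℝ => evoY X b p.1 p.2) (Ici 0 ×ˢ univ) := by
  obtain ⟨C, hC⟩ := hX.U_bdd
  have hC0 : 0 ≤ C := (abs_nonneg _).trans (hC 0)
  have hG := hX.G_nonneg
  rintro ⟨t₀, ξ₀⟩ ⟨ht₀, -⟩
  have ht₀ : 0 ≤ t₀ := ht₀
  rw [ContinuousWithinAt, tendsto_iff_dist_tendsto_zero]
  have hlim : Tendsto (fun p : ℝ × ℝ => (C + (t₀ + 1) * G) * |p.1 - t₀| +
      (1 + t₀ + t₀ ^ 2) * |p.2 - ξ₀|) (𝓝[Ici 0 ×ˢ univ] (t₀, ξ₀)) (𝓝 0) := by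
    have : Continuous (fun p : ℝ × ℝ => (C + (t₀ + 1) * G) * |p.1 - t₀| +
      (1 + t₀ + t₀ ^ 2) * |p.2 - ξ₀|) := by fun_prop
    have h := this.tendsto (t₀, ξ₀)
    simp only [sub_self, abs_zero, mul_zero, add_zero] at h
    exact h.mono_left nhdsWithin_le_nhds
  refine squeeze_zero' (Eventually.of_forall fun _ => dist_nonneg) ?_ hlim
  have hnear : ∀ᶠ p : ℝ × ℝ in 𝓝[Ici 0 ×ˢ univ] (t₀, ξ₀), p.1 < t₀ + 1 :=
    (continuous_fst.continuousAt.eventually (gt_mem_nhds (by simp))).filter_mono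
      nhdsWithin_le_nhds
  filter_upwards [hnear, self_mem_nhdsWithin] with p hp hp0
  have hp1 : 0 ≤ p.1 := hp0.1
  rw [Real.dist_eq]
  have h1 := abs_evoY_time_sub_le hX hb hC (T := t₀ + 1) ⟨hp1, hp.le⟩ ⟨ht₀, by linarith⟩ p.2
  have h2 := abs_evoY_space_sub_le hX hb ht₀ ξ₀ p.2
  calc _ ≤ |evoY X b p.1 p.2 - evoY X b t₀ p.2| + |evoY X b t₀ p.2 - evoY X b t₀ ξ₀| :=
        abs_sub_le _ _ _
    _ ≤ _ := add_le_add h1 h2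

/-! ## Existence of a consistent loss of energy -/

theorem integral_weighted_loss_le {X : Lagr} {G : ℝ} (hX : IsNice X G) {b b' : ℝ → ℝ}
    (hb : IsFrac b) (hb' : IsFrac b') {K M l : ℝ} (hK : 0 ≤ K) (hM : 0 ≤ M) (hl : 0 < l)
    {t : ℝ} (ht : 0 ≤ t)
    (h : ∀ η, brk X η ≤ ENNReal.ofReal t →
      |b η - b' η| ≤ K * (Real.exp (l * (brk X η).toReal) * M)) (ξ : ℝ) :
    |kern (fun η => deriv X.H η * (t ^ 2 - b η * clock (brk X η) t ^ 2)) ξ -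
      kern (fun η => deriv X.H η * (t ^ 2 - b' η * clock (brk X η) t ^ 2)) ξ| ≤
      Real.exp (l * t) * (G * (K * M * (2 / l ^ 2))) := by
  rw [← kern_sub (hb.integrable_fac hX ht 2) (hb'.integrable_fac hX ht 2)]
  have e : (fun η => deriv X.H η * (t ^ 2 - b η * clock (brk X η) t ^ 2) -
      deriv X.H η * (t ^ 2 - b' η * clock (brk X η) t ^ 2)) =
      fun η => deriv X.H η * ((t ^ 2 - b η * clock (brk X η) t ^ 2) -
        (t ^ 2 - b' η * clock (brk X η) t ^ 2)) := by ext; ring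
  rw [e]
  refine (kern_abs_mul_le hX (C := Real.exp (l * t) * (K * M * (2 / l ^ 2)))
    ((hb.meas_fac X t 2).sub (hb'.meas_fac X t 2)) (fun η => ?_) ξ).trans ?_
  · have e : (t ^ 2 - b η * clock (brk X η) t ^ 2) - (t ^ 2 - b' η * clock (brk X η) t ^ 2) =
      -(clock (brk X η) t ^ 2 * (b η - b' η)) := by ring
    simp only [Pi.sub_apply]
    rw [e, abs_neg, abs_mul, abs_of_nonneg (sq_nonneg _)]
    rcases le_total (brk X η) (ENNReal.ofReal t) with hη | hη
    · have h1 := h η hη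
      have h2 := sq_exp_bound (t := t) hl (clock_nonneg (brk X η) t)
      rw [← clock_add_le ht hη] at h2
      calc _ ≤ clock (brk X η) t ^ 2 * (K * (Real.exp (l * (brk X η).toReal) * M)) := by gcongr
        _ = K * M * (clock (brk X η) t ^ 2 * Real.exp (l * (brk X η).toReal)) := by ring
        _ ≤ K * M * (2 / l ^ 2 * Real.exp (l * t)) := by gcongr
        _ = _ := by ring
    · rw [clock_of_ge hη]
      simp only [ne_eq, OfNat.ofNat_ne_zero, not_false_eq_true, zero_pow, zero_mul]
      positivity
  · have hG := hX.G_nonneg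
    have : 0 ≤ Real.exp (l * t) * (G * (K * M * (2 / l ^ 2))) := by positivity
    linarith

/-- The fraction of the energy lost at breaking, for the characteristics `y + e^{lt} z`. -/
def fracOf (α : ℝ → ℝ) (X : Lagr) (l : ℝ) (z : ℝ≥0 × ℝ → ℝ) (η : ℝ) : ℝ :=
  α (X.y η + Real.exp (l * (brk X η).toReal) * z ((brk X η).toNNReal, η))

theorem isFrac_fracOf {α : ℝ → ℝ} (hα : ∀ x, α x ∈ Ico (0 : ℝ) 1) (hc : Continuous α) {X : Lagr}
    {G : ℝ} (hX : IsNice X G) (l : ℝ) {z : ℝ≥0 × ℝ → ℝ} (hz : Continuous z) :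
    IsFrac (fracOf α X l z) where
  meas := by
    have h1 : Measurable fun η => (brk X η).toReal := (measurable_brk X).ennreal_toReal
    have h2 : Measurable fun η => (brk X η).toNNReal := (measurable_brk X).ennreal_toNNReal
    have h3 := hX.lip_y.continuous.measurable
    refine hc.measurable.comp (h3.add ?_)
    exact ((h1.const_mul l).exp).mul (hz.measurable.comp (h2.prodMk measurable_id))
  nonneg η := (hα _).1
  le_one η := (hα _).2.le

theorem exists_consistent {α : ℝ → ℝ} (hα : ∀ x, α x ∈ Ico (0 : ℝ) 1)
    (hL : ∃ K : ℝ≥0, LipschitzWith K α) {X : Lagr} {G : ℝ} (hX : IsNice X G) :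
    ∃ b, IsFrac b ∧ ∀ η, b η = α (evoY X b (brk X η).toReal η) := by
  set K := supDeriv α with hKdef
  have hK : 0 ≤ K := supDeriv_nonneg α
  have hαK : ∀ a b, |α a - α b| ≤ K * |a - b| := abs_sub_le_supDeriv hL
  have hc : Continuous α := hL.choose_spec.continuous
  have hG := hX.G_nonneg
  obtain ⟨C, hC⟩ := hX.U_bdd
  have hC0 : 0 ≤ C := (abs_nonneg _).trans (hC 0)
  set l := K * G + 1 with hl
  have hKG := mul_nonneg hK hG
  have hl1 : 1 ≤ l := by linarith
  have hfr : ∀ z : BoundedContinuousFunction (ℝ≥0 × ℝ) ℝ, IsFrac (fracOf α X l z) :=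
    fun z => isFrac_fracOf hα hc hX l z.continuous
  have hcont : ∀ z : BoundedContinuousFunction (ℝ≥0 × ℝ) ℝ, Continuous (fun p : ℝ≥0 × ℝ =>
      Real.exp (-(l * p.1)) * (evoY X (fracOf α X l z) p.1 p.2 - X.y p.2)) := by
    intro z
    have h1 : Continuous (fun p : ℝ≥0 × ℝ => evoY X (fracOf α X l z) p.1 p.2) := by
      refine (continuousOn_evoY hX (hfr z)).comp_continuous
        (f := fun p : ℝ≥0 × ℝ => ((p.1 : ℝ), p.2)) (by fun_prop) fun p => ?_
      exact ⟨p.1.2, mem_univ _⟩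
    have h2 := hX.lip_y.continuous
    fun_prop
  have hbdd : ∀ (z : BoundedContinuousFunction (ℝ≥0 × ℝ) ℝ) (p : ℝ≥0 × ℝ),
      ‖Real.exp (-(l * p.1)) * (evoY X (fracOf α X l z) p.1 p.2 - X.y p.2)‖ ≤ C + 2 * G := by
    rintro z ⟨t, x⟩
    have ht : (0:ℝ) ≤ t := t.2
    rw [norm_mul, Real.norm_eq_abs, Real.norm_eq_abs, Real.abs_exp]
    have h1 := abs_evoY_time_sub_le hX (hfr z) hC (T := t) (t := t) (t' := 0) ⟨ht, le_rfl⟩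
      ⟨le_rfl, ht⟩ x
    rw [evoY_zero, sub_zero, abs_of_nonneg ht] at h1
    simp only
    rw [Real.exp_neg, inv_mul_le_iff₀ (Real.exp_pos _)]
    refine h1.trans ?_
    have h2 : Real.exp t ≤ Real.exp (l * t) := by gcongr; nlinarith
    have h3 := Real.quadratic_le_exp_of_nonneg ht
    have h4 : (t:ℝ) * C ≤ Real.exp (l * t) * C := by gcongr; nlinarith
    have h5 : (t:ℝ) ^ 2 * G ≤ (2 * Real.exp (l * t)) * G := by gcongr; nlinarith
    nlinarith
  set Φ : BoundedContinuousFunction (ℝ≥0 × ℝ) ℝ → BoundedContinuousFunction (ℝ≥0 × ℝ) ℝ :=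
    fun z => BoundedContinuousFunction.ofNormedAddCommGroup
      (fun p : ℝ≥0 × ℝ => Real.exp (-(l * p.1)) * (evoY X (fracOf α X l z) p.1 p.2 - X.y p.2))
      (hcont z) (C + 2 * G) (hbdd z) with hΦ
  have hcontr : ContractingWith (1 / 2 : ℝ≥0) Φ := by
    refine ⟨by norm_num, LipschitzWith.of_dist_le_mul fun z z' => ?_⟩
    rw [BoundedContinuousFunction.dist_le (by positivity)]
    rintro ⟨t, x⟩
    have ht : (0:ℝ) ≤ t := t.2
    have h1 := integral_weighted_loss_le hX (hfr z) (hfr z') hK (dist_nonneg (x := z) (y := z'))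
      (by linarith : 0 < l) ht (fun η _ => by
        refine (hαK _ _).trans ?_
        rw [add_sub_add_left_eq_sub, ← mul_sub, abs_mul, Real.abs_exp]
        gcongr
        rw [← Real.dist_eq]
        exact z.dist_coe_le_dist _) x
    simp only [hΦ, BoundedContinuousFunction.coe_ofNormedAddCommGroup, Real.dist_eq]
    rw [← mul_sub, abs_mul, Real.abs_exp, Real.exp_neg, inv_mul_le_iff₀ (Real.exp_pos _)]
    simp only [evoY]
    rw [show ∀ a b c d : ℝ, a + b + 1 / 4 * c - a - (a + b + 1 / 4 * d - a) = 1 / 4 * (c - d) by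
      intros; ring, abs_mul, abs_of_pos (by norm_num : (0:ℝ) < 1 / 4)]
    have h4 : G * (K * dist z z' * (2 / l ^ 2)) ≤ dist z z' := by
      have : G * (K * dist z z' * (2 / l ^ 2)) = dist z z' * (2 * (K * G) / l ^ 2) := by ring
      rw [this]
      refine mul_le_of_le_one_right dist_nonneg ?_
      rw [div_le_one (by positivity)]
      nlinarith
    have h5 : Real.exp (l * t) * (G * (K * dist z z' * (2 / l ^ 2))) ≤
      Real.exp (l * t) * dist z z' := by gcongr
    have h6 : 0 ≤ Real.exp (l * t) * dist z z' := by positivity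
    push_cast
    linarith
  set z := ContractingWith.fixedPoint Φ hcontr
  have hz : Φ z = z := hcontr.fixedPoint_isFixedPt
  refine ⟨fracOf α X l z, hfr z, fun η => ?_⟩
  have h1 : Φ z ((brk X η).toNNReal, η) = z ((brk X η).toNNReal, η) := by rw [hz]
  conv_lhs => rw [fracOf, ← h1]
  simp only [hΦ, BoundedContinuousFunction.coe_ofNormedAddCommGroup, ENNReal.coe_toNNReal_eq_toReal]
  rw [← mul_assoc, ← Real.exp_add, add_neg_cancel, Real.exp_zero]
  congr 1; ring

end HunterSaxton
end

noncomputable section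


namespace HunterSaxton

/-! ## The evolution equations in integrated form -/

theorem IsNice.ae_waveBreak {X : Lagr} {G : ℝ} (hX : IsNice X G) :
    ∀ᵐ η, 0 < brk X η ∧ ((waveBreak X η = 0 ∧ brk X η = ⊤) ∨ waveBreak X η = brk X η) := by
  filter_upwards [hX.rel] with η h
  unfold waveBreak brk
  by_cases hU : deriv X.U η < 0
  · have hy : 0 < deriv X.y η := by
      rcases (hX.deriv_y_nonneg η).lt_or_eq with h0 | h0
      · exact h0
      · rw [← h0, zero_mul] at h; nlinarith
    have hc : ¬(deriv X.y η = 0 ∧ deriv X.U η = 0) := fun h => hU.ne h.2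
    simp only [if_neg hc, if_pos hU]
    refine ⟨?_, by simp⟩
    rw [ENNReal.ofReal_pos]
    exact div_pos_of_neg_of_neg (by linarith) hU
  · simp only [hU, if_false]
    refine ⟨ENNReal.zero_lt_top, ?_⟩
    split_ifs <;> simp

theorem integral_split_cutBrk {θ : ℝ≥0∞} {t : ℝ} (ht : 0 ≤ t) {f g : ℝ → ℝ} (hg : Continuous g)
    (h0 : ∀ s, 0 ≤ s → s < cutBrk θ t → f s = 0) (h1 : ∀ s ∈ Ioo (cutBrk θ t) t, f s = g s) :
    IntervalIntegrable f volume 0 t ∧ ∫ s in (0:ℝ)..t, f s = ∫ s in (cutBrk θ t)..t, g s := by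
  have hr0 := cutBrk_nonneg θ t
  have hrt := cutBrk_le (θ := θ) ht
  have e0 : ∀ᵐ s, s ∈ uIoc 0 (cutBrk θ t) → (0:ℝ) = f s := by
    filter_upwards [compl_mem_ae_iff.mpr (measure_singleton (cutBrk θ t))] with s hs hs'
    rw [uIoc_of_le hr0] at hs'
    exact (h0 s hs'.1.le (lt_of_le_of_ne hs'.2 hs)).symm
  have e1 : ∀ᵐ s, s ∈ uIoc (cutBrk θ t) t → g s = f s := by
    filter_upwards [compl_mem_ae_iff.mpr (measure_singleton t)] with s hs hs'
    rw [uIoc_of_le hrt] at hs'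
    exact (h1 s ⟨hs'.1, lt_of_le_of_ne hs'.2 hs⟩).symm
  have i0 : IntervalIntegrable f volume 0 (cutBrk θ t) :=
    (intervalIntegrable_const (c := (0:ℝ))).congr_ae
      ((ae_restrict_iff' measurableSet_uIoc).mpr e0)
  have i1 : IntervalIntegrable f volume (cutBrk θ t) t :=
    (hg.intervalIntegrable _ _).congr_ae ((ae_restrict_iff' measurableSet_uIoc).mpr e1)
  refine ⟨i0.trans i1, ?_⟩
  rw [← intervalIntegral.integral_add_adjacent_intervals i0 i1,
    ← intervalIntegral.integral_congr_ae e0, ← intervalIntegral.integral_congr_ae e1]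
  simp

theorem lt_of_lt_cutBrk {θ : ℝ≥0∞} {t s : ℝ} (hs : 0 ≤ s) (h : s < cutBrk θ t) : ENNReal.ofReal s < θ := by
  unfold cutBrk at h
  have hfin : min θ (ENNReal.ofReal t) ≠ ⊤ :=
    ne_top_of_le_ne_top ENNReal.ofReal_ne_top (min_le_right _ _)
  by_contra hc
  rw [not_lt] at hc
  have := ENNReal.toReal_mono ENNReal.ofReal_ne_top ((min_le_left _ (ENNReal.ofReal t)).trans hc)
  rw [ENNReal.toReal_ofReal hs] at this; linarith

theorem le_ofReal_of_cutBrk_lt {θ : ℝ≥0∞} {t s : ℝ} (ht : 0 ≤ t) (h : cutBrk θ t < s)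
    (hs : s < t) : θ ≤ ENNReal.ofReal s ∧ θ.toReal = cutBrk θ t := by
  rcases le_total θ (ENNReal.ofReal t) with h' | h'
  · rw [cutBrk_of_le h'] at h ⊢
    refine ⟨?_, rfl⟩
    rw [← ENNReal.ofReal_toReal (ne_top_of_le_ne_top ENNReal.ofReal_ne_top h')]
    exact ENNReal.ofReal_le_ofReal h.le
  · rw [cutBrk_of_ge ht h'] at h; linarith

theorem clock_eq_sub_cutBrk {θ : ℝ≥0∞} {t : ℝ} (ht : 0 ≤ t) : clock θ t = t - cutBrk θ t := by
  rw [clock_eq_max ht le_rfl, max_eq_left]; linarith [cutBrk_le (θ := θ) ht]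

open Classical in
theorem integral_indicator_brk {θ : ℝ≥0∞} {t : ℝ} (ht : 0 ≤ t) (c : ℝ) :
    IntervalIntegrable (fun s => if θ ≤ ENNReal.ofReal s then c else 0) volume 0 t ∧
    ∫ s in (0:ℝ)..t, (if θ ≤ ENNReal.ofReal s then c else 0) = c * clock θ t := by
  have h := integral_split_cutBrk (θ := θ) ht
    (f := fun s => if θ ≤ ENNReal.ofReal s then c else 0) (g := fun _ => c) continuous_const
    (fun s h hs => if_neg (not_le.mpr (lt_of_lt_cutBrk h hs)))
    (fun s hs => if_pos (le_ofReal_of_cutBrk_lt ht hs.1 hs.2).1)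
  refine ⟨h.1, h.2.trans ?_⟩
  rw [intervalIntegral.integral_const, clock_eq_sub_cutBrk ht, smul_eq_mul, mul_comm]

theorem integral_clock {θ : ℝ≥0∞} {t : ℝ} (ht : 0 ≤ t) :
    IntervalIntegrable (fun s => clock θ s) volume 0 t ∧
    ∫ s in (0:ℝ)..t, clock θ s = 1 / 2 * clock θ t ^ 2 := by
  have hr0 := cutBrk_nonneg θ t
  have h := integral_split_cutBrk (θ := θ) ht
    (f := fun s => clock θ s) (g := fun s => s - cutBrk θ t) (by fun_prop)
    (fun s h hs => clock_of_ge (lt_of_lt_cutBrk h hs).le)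
    (fun s hs => by
      have := le_ofReal_of_cutBrk_lt ht hs.1 hs.2
      rw [clock_of_le (hr0.trans hs.1.le) this.1, this.2])
  refine ⟨h.1, h.2.trans ?_⟩
  rw [intervalIntegral.integral_sub (by simp) (by simp)]
  simp only [integral_id, intervalIntegral.integral_const, smul_eq_mul]
  rw [clock_eq_sub_cutBrk ht]; ring

theorem integral_kern {v : ℝ → ℝ} (hv : Integrable v) {φ : ℝ → ℝ → ℝ}
    (hφ : Measurable (Function.uncurry φ)) {C t : ℝ} (ht : 0 ≤ t)
    (hC : ∀ s ∈ Icc 0 t, ∀ η, |φ s η| ≤ C) (ξ : ℝ) :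
    ∫ s in (0:ℝ)..t, kern (fun η => v η * φ s η) ξ =
      kern (fun η => v η * ∫ s in (0:ℝ)..t, φ s η) ξ := by
  have key : ∀ μ : Measure ℝ, SFinite μ → Integrable v μ →
      Integrable (Function.uncurry fun s η => v η * φ s η)
        ((volume.restrict (uIoc 0 t)).prod μ) := by
    intro μ _ hvμ
    have h1 : Integrable (fun p : ℝ × ℝ => (1:ℝ) * v p.2)
        ((volume.restrict (uIoc 0 t)).prod μ) :=
      Integrable.mul_prod (f := fun _ : ℝ => (1:ℝ)) (g := v) (by
        rw [← IntegrableOn, ← intervalIntegrable_iff]; exact intervalIntegrable_const) hvμ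
    simp only [one_mul] at h1
    refine h1.mul_bdd (g := Function.uncurry φ) (c := C) hφ.aestronglyMeasurable ?_
    have h2 : ∀ᵐ s ∂(volume.restrict (uIoc 0 t)), ∀ᵐ η ∂μ, ‖Function.uncurry φ (s, η)‖ ≤ C := by
      refine (ae_restrict_iff' measurableSet_uIoc).mpr (Eventually.of_forall fun s hs => ?_)
      rw [uIoc_of_le ht] at hs
      exact Eventually.of_forall fun η => hC s ⟨hs.1.le, hs.2⟩ η
    exact (Measure.ae_prod_iff_ae_ae (measurableSet_le hφ.norm measurable_const)).mpr h2
  have k1 := key volume inferInstance hv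
  have k2 := key (volume.restrict (Iic ξ)) inferInstance hv.integrableOn
  simp only [kern]
  have j1 := k1.integral_prod_left
  have j2 := k2.integral_prod_left
  simp only [Function.uncurry_apply_pair] at j1 j2
  rw [intervalIntegral.integral_sub (intervalIntegrable_iff.mpr j2)
    ((intervalIntegrable_iff.mpr j1).const_mul _), intervalIntegral.integral_const_mul,
    intervalIntegral_integral_swap k1, intervalIntegral_integral_swap k2]
  simp_rw [intervalIntegral.integral_const_mul]

theorem integrable_evoV {X : Lagr} {G : ℝ} (hX : IsNice X G) {b : ℝ → ℝ} (hb : IsFrac b) (t : ℝ) :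
    Integrable (fun η => (1 - (open Classical in if brk X η ≤ ENNReal.ofReal t then b η else 0)) *
      deriv X.H η) := by
  classical
  have hm : Measurable fun η => (1 - (if brk X η ≤ ENNReal.ofReal t then b η else 0)) :=
    measurable_const.sub (Measurable.ite (measurableSet_le (measurable_brk X) measurable_const)
      hb.meas measurable_const)
  have := hX.integrable_mul (C := 1) hm (fun η => by
    have h0 := hb.nonneg η
    have h1 := hb.le_one η
    split_ifs
    · rw [abs_of_nonneg] <;> linarith
    · simp)
  refine this.congr (Eventually.of_forall fun η => ?_)
  simp only; rw [mul_comm]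

theorem half_evoV_sub {X : Lagr} {G : ℝ} (hX : IsNice X G) {b : ℝ → ℝ} (hb : IsFrac b) (t ξ : ℝ) :
    1 / 2 * evoV X b t ξ - 1 / 4 * limTop (evoV X b t) =
      1 / 2 * kern (fun η => deriv X.H η * (1 - (open Classical in
        if brk X η ≤ ENNReal.ofReal t then b η else 0))) ξ := by
  have h := tendsto_setIntegral_Iic_atTop (integrable_evoV hX hb t)
  have h2 : limTop (evoV X b t) = _ := limTop_eq h
  rw [h2, evoV, kern]
  simp_rw [mul_comm (deriv X.H _)]
  ring

theorem integral_evoU {X : Lagr} {G : ℝ} (hX : IsNice X G) {b : ℝ → ℝ} (hb : IsFrac b) {t : ℝ}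
    (ht : 0 ≤ t) (ξ : ℝ) :
    ∫ s in (0:ℝ)..t, evoU X b s ξ = evoY X b t ξ - X.y ξ := by
  have hG := hX.G_nonneg
  have hm : Measurable (Function.uncurry fun s η => s - b η * clock (brk X η) s) := by
    refine measurable_fst.sub ((hb.meas.comp measurable_snd).mul ?_)
    exact (((measurable_fst.ennreal_ofReal).sub ((measurable_brk X).comp
      measurable_snd))).ennreal_toReal
  have hbd : ∀ s ∈ Icc 0 t, ∀ η, |s - b η * clock (brk X η) s| ≤ t := fun s hs η => by
    have := hb.abs_fac_le X hs.1 1 η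
    simp only [pow_one] at this
    exact this.trans hs.2
  have h1 := integral_kern hX.integrable_deriv_H hm ht hbd ξ
  have h2 : ∀ η, ∫ s in (0:ℝ)..t, (s - b η * clock (brk X η) s) =
      1 / 2 * (t ^ 2 - b η * clock (brk X η) t ^ 2) := fun η => by
    have := integral_clock (θ := brk X η) ht
    rw [intervalIntegral.integral_sub (by simp) (this.1.const_mul _),
      intervalIntegral.integral_const_mul, this.2, integral_id]
    ring
  simp_rw [h2] at h1
  have hi : IntervalIntegrable (fun s => kern (fun η => deriv X.H η *
      (s - b η * clock (brk X η) s)) ξ) volume 0 t := by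
    refine ContinuousOn.intervalIntegrable ?_
    rw [uIcc_of_le ht]
    refine LipschitzOnWith.continuousOn (K := (2 * G).toNNReal)
      (LipschitzOnWith.of_dist_le_mul fun s hs s' hs' => ?_)
    have a1 := hb.integrable_fac hX hs.1 1
    have a2 := hb.integrable_fac hX hs'.1 1
    simp only [pow_one] at a1 a2
    rw [Real.dist_eq, Real.dist_eq, Real.coe_toNNReal _ (by positivity), ← kern_sub a1 a2]
    have e : (fun η => deriv X.H η * (s - b η * clock (brk X η) s) -
        deriv X.H η * (s' - b η * clock (brk X η) s')) = fun η => deriv X.H η *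
        ((s - b η * clock (brk X η) s) - (s' - b η * clock (brk X η) s')) := by ext; ring
    rw [e]
    have m1 := hb.meas_fac X s 1
    have m2 := hb.meas_fac X s' 1
    simp only [pow_one] at m1 m2
    have := kern_abs_mul_le hX (m1.sub m2) (C := 2 * |s - s'|) (fun η => by
      have a3 := abs_clock_time_sub_le (θ := brk X η) hs.1 hs'.1
      have e : s - b η * clock (brk X η) s - (s' - b η * clock (brk X η) s') =
        (s - s') - b η * (clock (brk X η) s - clock (brk X η) s') := by ring
      simp only [Pi.sub_apply]
      rw [e]
      refine (abs_sub _ _).trans ?_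
      rw [abs_mul]
      have := mul_le_mul (hb.abs_le η) a3 (abs_nonneg _) zero_le_one
      linarith) ξ
    refine this.trans ?_
    have : 0 ≤ G * |s - s'| := by positivity
    linarith
  simp only [evoU, evoY]
  rw [intervalIntegral.integral_add intervalIntegrable_const (hi.const_mul _),
    intervalIntegral.integral_const_mul, h1, intervalIntegral.integral_const]
  have e : (fun η => deriv X.H η * (1 / 2 * (t ^ 2 - b η * clock (brk X η) t ^ 2))) = fun η =>
      1 / 2 * (deriv X.H η * (t ^ 2 - b η * clock (brk X η) t ^ 2)) := by ext; ring
  rw [e, kern_const_mul, smul_eq_mul]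
  ring

theorem integral_evoV {X : Lagr} {G : ℝ} (hX : IsNice X G) {b : ℝ → ℝ} (hb : IsFrac b) {t : ℝ}
    (ht : 0 ≤ t) (ξ : ℝ) :
    ∫ s in (0:ℝ)..t, (1 / 2 * evoV X b s ξ - 1 / 4 * limTop (evoV X b s)) =
      evoU X b t ξ - X.U ξ := by
  classical
  simp_rw [half_evoV_sub hX hb]
  have hm : Measurable (Function.uncurry fun s η =>
      (1 - (if brk X η ≤ ENNReal.ofReal s then b η else 0))) := by
    refine measurable_const.sub (Measurable.ite ?_ (hb.meas.comp measurable_snd) measurable_const)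
    exact measurableSet_le ((measurable_brk X).comp measurable_snd) measurable_fst.ennreal_ofReal
  have hbd : ∀ s ∈ Icc 0 t, ∀ η, |(1 - (if brk X η ≤ ENNReal.ofReal s then b η else 0))| ≤ 1 := by
    intro s _ η
    have h0 := hb.nonneg η
    have h1 := hb.le_one η
    split_ifs
    · rw [abs_of_nonneg] <;> linarith
    · simp
  have h1 := integral_kern hX.integrable_deriv_H hm ht hbd ξ
  have h2 : ∀ η, ∫ s in (0:ℝ)..t, (1 - (if brk X η ≤ ENNReal.ofReal s then b η else 0)) =
      t - b η * clock (brk X η) t := fun η => by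
    have := integral_indicator_brk (θ := brk X η) ht (b η)
    rw [intervalIntegral.integral_sub (by simp) this.1, this.2, intervalIntegral.integral_const]
    simp
  simp_rw [h2] at h1
  rw [intervalIntegral.integral_const_mul]
  have e : ∫ s in (0:ℝ)..t, kern (fun η => deriv X.H η * (1 - (open Classical in
        if brk X η ≤ ENNReal.ofReal s then b η else 0))) ξ = _ := h1
  rw [e, evoU]
  ring

/-! ## Existence and uniqueness of the dissipative solution -/

/-- The fraction `b` of lost energy is consistent with the characteristics it generates. -/
def Consistent (α : ℝ → ℝ) (X : Lagr) (b : ℝ → ℝ) : Prop :=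
  IsFrac b ∧ ∀ η, b η = α (evoY X b (brk X η).toReal η)

theorem setIntegral_loss_eq {X : Lagr} {G : ℝ} (hX : IsNice X G) {b c : ℝ → ℝ}
    (hbc : ∀ η, waveBreak X η = brk X η → c η = b η) (t ξ : ℝ) :
    ∫ η in Iic ξ, (1 - (open Classical in if 0 < waveBreak X η ∧ waveBreak X η ≤ ENNReal.ofReal t
      then c η else 0)) * deriv X.V η = evoV X b t ξ := by
  rw [hX.V_eq, evoV]
  refine integral_congr_ae (ae_restrict_of_ae ?_)
  filter_upwards [hX.ae_waveBreak] with η h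
  obtain ⟨h0, ⟨h1, h2⟩ | h1⟩ := h
  · simp [h1, h2]
  · rw [hbc η h1, h1]
    simp [h0]

theorem isAlphaSolution_of_consistent {α : ℝ → ℝ} {X : Lagr} {G : ℝ} (hX : IsNice X G)
    {b : ℝ → ℝ} (hb : Consistent α X b) :
    IsAlphaSolution α X (fun t => ⟨evoY X b t, evoU X b t, evoV X b t, X.H⟩) where
  init := by
    have hV : evoV X b 0 = X.V := by
      ext ξ
      rw [hX.V_eq, ← hX.integral_Iic_deriv_H, evoV]
      refine integral_congr_ae (ae_restrict_of_ae ?_)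
      filter_upwards [hX.ae_waveBreak] with η h
      rw [if_neg (by simpa using h.1.ne')]
      simp
    have hy : evoY X b 0 = X.y := funext (evoY_zero b)
    have hU : evoU X b 0 = X.U := funext (evoU_zero b)
    rw [hV, hy, hU]
  cont := continuousOn_evoY hX hb.1
  eq_y t ht ξ := by rw [integral_evoU hX hb.1 ht]; ring
  eq_U t ht ξ := by rw [integral_evoV hX hb.1 ht]; ring
  eq_V t _ ξ := by
    refine (setIntegral_loss_eq hX (fun η h => ?_) t ξ).symm
    rw [hb.2 η, h]
  eq_H _ _ := rfl

theorem IsAlphaSolution.exists_consistent {α : ℝ → ℝ} (hα : ∀ x, α x ∈ Ico (0 : ℝ) 1)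
    (hc : Continuous α) {X : Lagr} {G : ℝ} (hX : IsNice X G) {Y : ℝ → Lagr}
    (hY : IsAlphaSolution α X Y) :
    ∃ b, Consistent α X b ∧ ∀ t, 0 ≤ t → Y t = ⟨evoY X b t, evoU X b t, evoV X b t, X.H⟩ := by
  set b : ℝ → ℝ := fun η => α ((Y (brk X η).toReal).y η) with hbdef
  have hb : IsFrac b := by
    refine ⟨hc.measurable.comp ?_, fun η => (hα _).1, fun η => (hα _).2.le⟩
    have h1 := hY.cont.domRestrict.measurable
    have h2 : Measurable fun η : ℝ => (⟨((brk X η).toReal, η), ENNReal.toReal_nonneg, mem_univ _⟩ :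
        (Ici 0 ×ˢ univ : Set (ℝ × ℝ))) :=
      ((measurable_brk X).ennreal_toReal.prodMk measurable_id).subtype_mk
    exact h1.comp h2
  have hV : ∀ t, 0 ≤ t → (Y t).V = evoV X b t := fun t ht => by
    ext ξ
    rw [hY.eq_V t ht ξ]
    refine setIntegral_loss_eq hX (fun η h => ?_) t ξ
    rw [h]
  have hU : ∀ t, 0 ≤ t → (Y t).U = evoU X b t := fun t ht => by
    ext ξ
    rw [hY.eq_U t ht ξ]
    have : ∫ s in (0:ℝ)..t, (1 / 2 * (Y s).V ξ - 1 / 4 * limTop (Y s).V) =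
        ∫ s in (0:ℝ)..t, (1 / 2 * evoV X b s ξ - 1 / 4 * limTop (evoV X b s)) := by
      refine intervalIntegral.integral_congr fun s hs => ?_
      rw [uIcc_of_le ht] at hs
      simp only [hV s hs.1]
    rw [this, integral_evoV hX hb ht]; ring
  have hy : ∀ t, 0 ≤ t → (Y t).y = evoY X b t := fun t ht => by
    ext ξ
    rw [hY.eq_y t ht ξ]
    have : ∫ s in (0:ℝ)..t, (Y s).U ξ = ∫ s in (0:ℝ)..t, evoU X b s ξ := by
      refine intervalIntegral.integral_congr fun s hs => ?_
      rw [uIcc_of_le ht] at hs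
      simp only [hU s hs.1]
    rw [this, integral_evoU hX hb ht]; ring
  refine ⟨b, ⟨hb, fun η => ?_⟩, fun t ht => ?_⟩
  · rw [← hy _ ENNReal.toReal_nonneg]
  · rw [← hy t ht, ← hU t ht, ← hV t ht, ← hY.eq_H t ht]

theorem Consistent.unique {α : ℝ → ℝ} (hL : ∃ K : ℝ≥0, LipschitzWith K α) {X : Lagr} {G : ℝ}
    (hX : IsNice X G) {b b' : ℝ → ℝ} (hb : Consistent α X b) (hb' : Consistent α X b') :
    b = b' := by
  have hαK := abs_sub_le_supDeriv hL
  have hY : ∀ t, 0 ≤ t → ∀ ξ, evoY X b t ξ = evoY X b' t ξ := by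
    intro T hT ξ
    have hcmp : Compare X X G b b' T (supDeriv α) 0 0 := by
      refine ⟨hX, hX, hb.1, hb'.1, hT, supDeriv_nonneg α, le_rfl, le_rfl,
        Eventually.of_forall fun η hη => ?_⟩
      rw [hb.2 η, hb'.2 η, cutBrk_of_le hη]
      refine (hαK _ _).trans ?_
      simp
    have := hcmp.abs_evoY_sub_le (dy := 0) (dU := 0) (by simp) (by simp) ⟨hT, le_rfl⟩ ξ
    have e1 : energyDist X X = 0 := by simp [energyDist]
    have e2 : brkDist X X T = 0 := by simp [brkDist]
    rw [e1, e2] at this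
    simp only [mul_zero, zero_mul, add_zero, abs_nonpos_iff] at this
    linarith
  ext η
  rw [hb.2 η, hb'.2 η, hY _ ENNReal.toReal_nonneg]

/-- Existence and uniqueness, with the explicit form of the solution. -/
theorem solOp_spec {α : ℝ → ℝ} (hα : ∀ x, α x ∈ Ico (0 : ℝ) 1)
    (hL : ∃ K : ℝ≥0, LipschitzWith K α) {X : Lagr} {G : ℝ} (hX : IsNice X G) :
    IsAlphaSolution α X (fun s => solOp α s X) ∧
    (∀ Y : ℝ → Lagr, IsAlphaSolution α X Y → ∀ s, 0 ≤ s → Y s = solOp α s X) ∧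
    ∃ b, Consistent α X b ∧ ∀ t, 0 ≤ t →
      solOp α t X = ⟨evoY X b t, evoU X b t, evoV X b t, X.H⟩ := by
  have hc : Continuous α := hL.choose_spec.continuous
  obtain ⟨b₀, hb₀⟩ := exists_consistent hα hL hX
  have hex : ∃ Y : ℝ → Lagr, IsAlphaSolution α X Y := ⟨_, isAlphaSolution_of_consistent hX hb₀⟩
  have hsol : (fun s => solOp α s X) = hex.choose := by
    ext s : 1
    rw [solOp, dif_pos hex]
  have h1 : IsAlphaSolution α X (fun s => solOp α s X) := by rw [hsol]; exact hex.choose_spec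
  obtain ⟨b, hb, hbs⟩ := h1.exists_consistent hα hc hX
  refine ⟨h1, fun Y hY s hs => ?_, b, hb, hbs⟩
  obtain ⟨b', hb', hbs'⟩ := hY.exists_consistent hα hc hX
  have := hb.unique hL hX hb'
  subst this
  rw [hbs' s hs, hbs s hs]

end HunterSaxton
end

noncomputable section


namespace HunterSaxton

/-! ## The primitive of a finite measure -/

section Primitive

variable (μ : Measure ℝ) [IsFiniteMeasure μ]

theorem primitive_mono : Monotone (primitive μ) := fun _ _ h =>
  ENNReal.toReal_mono (measure_ne_top _ _) (measure_mono (Iio_subset_Iio h))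

theorem primitive_nonneg (x : ℝ) : 0 ≤ primitive μ x := ENNReal.toReal_nonneg

theorem primitive_le (x : ℝ) : primitive μ x ≤ (μ univ).toReal :=
  ENNReal.toReal_mono (measure_ne_top _ _) (measure_mono (subset_univ _))

theorem exists_seq_primitive_left (x : ℝ) : ∃ u : ℕ → ℝ, (∀ n, u n < x) ∧
    Tendsto u atTop (𝓝 x) ∧ Tendsto (fun n => primitive μ (u n)) atTop (𝓝 (primitive μ x)) := by
  obtain ⟨u, h1, h2, h3⟩ := exists_seq_strictMono_tendsto x
  refine ⟨u, h2, h3, ?_⟩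
  have hU : ⋃ n, Iio (u n) = Iio x := by
    ext z
    simp only [mem_iUnion, mem_Iio]
    refine ⟨fun ⟨n, hn⟩ => hn.trans (h2 n), fun hz => (h3.eventually (lt_mem_nhds hz)).exists⟩
  have := tendsto_measure_iUnion_atTop (μ := μ) (s := fun n => Iio (u n))
    (fun m n h => Iio_subset_Iio (h1.monotone h))
  rw [hU] at this
  exact (ENNReal.tendsto_toReal (measure_ne_top _ _)).comp this

theorem exists_seq_primitive_right (x : ℝ) : ∃ u : ℕ → ℝ, (∀ n, x < u n) ∧
    Tendsto u atTop (𝓝 x) ∧ Tendsto (fun n => primitive μ (u n)) atTop (𝓝 (μ (Iic x)).toReal) := by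
  obtain ⟨u, h1, h2, h3⟩ := exists_seq_strictAnti_tendsto x
  refine ⟨u, h2, h3, ?_⟩
  have hU : ⋂ n, Iio (u n) = Iic x := by
    ext z
    simp only [mem_iInter, mem_Iio, mem_Iic]
    refine ⟨fun h => ge_of_tendsto h3 (Eventually.of_forall fun n => (h n).le),
      fun hz n => hz.trans_lt (h2 n)⟩
  have := tendsto_measure_iInter_atTop (μ := μ) (s := fun n => Iio (u n))
    (fun n => measurableSet_Iio.nullMeasurableSet) (fun m n h => Iio_subset_Iio (h1.antitone h))
    ⟨0, measure_ne_top _ _⟩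
  rw [hU] at this
  exact (ENNReal.tendsto_toReal (measure_ne_top _ _)).comp this

theorem tendsto_measure_Iic_atBot_zero :
    Tendsto (fun x => (μ (Iic x)).toReal) atBot (𝓝 0) := by
  have h := tendsto_measure_iInter_atBot (μ := μ) (s := fun x : ℝ => Iic x)
    (fun n => measurableSet_Iic.nullMeasurableSet) (fun m n h => Iic_subset_Iic.mpr h)
    ⟨0, measure_ne_top _ _⟩
  have hU : ⋂ x : ℝ, Iic x = ∅ := by
    ext z
    simp only [mem_iInter, mem_Iic, mem_empty_iff_false, iff_false, not_forall, not_le]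
    exact ⟨z - 1, by linarith⟩
  rw [hU, measure_empty] at h
  exact (ENNReal.tendsto_toReal ENNReal.zero_ne_top).comp h

theorem primitive_le_Iic (x : ℝ) : primitive μ x ≤ (μ (Iic x)).toReal :=
  ENNReal.toReal_mono (measure_ne_top _ _) (measure_mono Iio_subset_Iic_self)

theorem tendsto_primitive_atBot : Tendsto (primitive μ) atBot (𝓝 0) :=
  squeeze_zero (primitive_nonneg μ) (primitive_le_Iic μ) (tendsto_measure_Iic_atBot_zero μ)

theorem tendsto_primitive_atTop : Tendsto (primitive μ) atTop (𝓝 (μ univ).toReal) := by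
  have h := tendsto_measure_iUnion_atTop (μ := μ) (s := fun x : ℝ => Iio x)
    (fun m n h => Iio_subset_Iio h)
  rw [iUnion_Iio] at h
  exact (ENNReal.tendsto_toReal (measure_ne_top _ _)).comp h

theorem primitive_sub_primitive {a b : ℝ} (h : a ≤ b) :
    primitive μ b - primitive μ a = (μ (Ico a b)).toReal := by
  rw [primitive, primitive, ← Iio_sdiff_Iio, measure_sdiff (Iio_subset_Iio h)
    measurableSet_Iio.nullMeasurableSet (measure_ne_top _ _),
    ENNReal.toReal_sub_of_le (measure_mono (Iio_subset_Iio h)) (measure_ne_top _ _)]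

theorem measure_Ioo_toReal {a b : ℝ} (h : a < b) :
    (μ (Ioo a b)).toReal = primitive μ b - (μ (Iic a)).toReal := by
  have h' : Iic a ⊆ Iio b := fun x hx => lt_of_le_of_lt hx h
  have : Ioo a b = Iio b \ Iic a := by ext; simp
  rw [this, measure_sdiff h' measurableSet_Iic.nullMeasurableSet (measure_ne_top _ _),
    ENNReal.toReal_sub_of_le (measure_mono h') (measure_ne_top _ _), primitive]

end Primitive

/-! ## From Eulerian to Lagrangian coordinates -/

/-- The properties of Eulerian data which make the Lagrangian data well behaved. -/
structure IsGood (Z : Euler) : Prop where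
  fin : IsFiniteMeasure Z.μ
  nu_eq : Z.ν = Z.μ
  cs : ∀ a b, a < b → (Z.u b - Z.u a) ^ 2 ≤ (b - a) * (Z.μ (Ioo a b)).toReal
  deriv : ∀ᵐ x, ∃ c, HasDerivAt Z.u c x ∧ HasDerivAt (primitive Z.μ) (c ^ 2) x
  bdd : ∃ C, ∀ x, |Z.u x| ≤ C
  bot : ∃ l, Tendsto Z.u atBot (𝓝 l)

namespace IsGood

variable {Z : Euler} (hZ : IsGood Z)
include hZ

theorem le_lagrY_iff (x ξ : ℝ) : x ≤ lagrY Z ξ ↔ x + primitive Z.μ x ≤ ξ := by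
  have := hZ.fin
  rw [lagrY, hZ.nu_eq]
  set S := {x : ℝ | x + primitive Z.μ x < ξ}
  have hb : BddAbove S := ⟨ξ, fun z hz => by
    have : z + primitive Z.μ z < ξ := hz
    have := primitive_nonneg Z.μ z
    linarith⟩
  have hne : S.Nonempty := ⟨ξ - (Z.μ univ).toReal - 1, by
    have := primitive_le Z.μ (ξ - (Z.μ univ).toReal - 1)
    change ξ - (Z.μ univ).toReal - 1 + primitive Z.μ _ < ξ
    linarith⟩
  constructor
  · intro hx
    obtain ⟨u, h1, h2, h3⟩ := exists_seq_primitive_left Z.μ x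
    refine le_of_tendsto (h2.add h3) (Eventually.of_forall fun n => ?_)
    obtain ⟨z, hz, hz'⟩ := exists_lt_of_lt_csSup hne ((h1 n).trans_le hx)
    have := primitive_mono Z.μ hz'.le
    have : z + primitive Z.μ z < ξ := hz
    linarith
  · intro hx
    refine le_of_forall_lt fun z hz => ?_
    obtain ⟨w, hw1, hw2⟩ := exists_between hz
    refine hw1.trans_le (le_csSup hb ?_)
    have := primitive_mono Z.μ hw2.le
    change w + primitive Z.μ w < ξ
    linarith

theorem lagrY_lt_iff (x ξ : ℝ) : lagrY Z ξ < x ↔ ξ < x + primitive Z.μ x := by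
  rw [← not_le, hZ.le_lagrY_iff, not_le]

theorem lagrY_apply (x : ℝ) : lagrY Z (x + primitive Z.μ x) = x := by
  have := hZ.fin
  refine le_antisymm (le_of_forall_le fun z hz => ?_) ((hZ.le_lagrY_iff _ _).mpr le_rfl)
  rw [hZ.le_lagrY_iff] at hz
  by_contra h
  rw [not_le] at h
  have := primitive_mono Z.μ h.le
  linarith

theorem left_le (ξ : ℝ) : lagrY Z ξ + primitive Z.μ (lagrY Z ξ) ≤ ξ :=
  (hZ.le_lagrY_iff _ _).mp le_rfl

theorem le_right (ξ : ℝ) : ξ ≤ lagrY Z ξ + (Z.μ (Iic (lagrY Z ξ))).toReal := by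
  have := hZ.fin
  obtain ⟨u, h1, h2, h3⟩ := exists_seq_primitive_right Z.μ (lagrY Z ξ)
  exact ge_of_tendsto (h2.add h3)
    (Eventually.of_forall fun n => ((hZ.lagrY_lt_iff _ _).mp (h1 n)).le)

theorem lagrY_mono : Monotone (lagrY Z) := fun a _ h =>
  (hZ.le_lagrY_iff _ _).mpr ((hZ.left_le a).trans h)

theorem measure_Ioo_le {a b : ℝ} (h : lagrY Z a < lagrY Z b) :
    (Z.μ (Ioo (lagrY Z a) (lagrY Z b))).toReal ≤ lagrH Z b - lagrH Z a := by
  have := hZ.fin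
  rw [measure_Ioo_toReal _ h, lagrH, lagrH]
  have h1 := hZ.left_le b
  have h2 := hZ.le_right a
  linarith

theorem lagrH_mono : Monotone (lagrH Z) := fun a b h => by
  rcases (hZ.lagrY_mono h).lt_or_eq with h1 | h1
  · have := hZ.measure_Ioo_le h1
    have : 0 ≤ (Z.μ (Ioo (lagrY Z a) (lagrY Z b))).toReal := ENNReal.toReal_nonneg
    linarith
  · rw [lagrH, lagrH, h1]; linarith

theorem u_cs (a b : ℝ) : (Z.u (lagrY Z b) - Z.u (lagrY Z a)) ^ 2 ≤
    (lagrY Z b - lagrY Z a) * (lagrH Z b - lagrH Z a) := by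
  wlog h : a ≤ b generalizing a b
  · have := this b a (le_of_not_ge h)
    nlinarith
  rcases (hZ.lagrY_mono h).lt_or_eq with h1 | h1
  · exact (hZ.cs _ _ h1).trans (mul_le_mul_of_nonneg_left (hZ.measure_Ioo_le h1) (by linarith))
  · rw [h1]; simp

theorem tendsto_lagrY_atBot : Tendsto (lagrY Z) atBot atBot := by
  have := hZ.fin
  refine tendsto_atBot_mono (fun ξ => ?_) tendsto_id
  have := hZ.left_le ξ
  have := primitive_nonneg Z.μ (lagrY Z ξ)
  simp only [id]; linarith

theorem tendsto_lagrY_atTop : Tendsto (lagrY Z) atTop atTop := by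
  have := hZ.fin
  refine tendsto_atTop_mono (fun ξ => ?_) (tendsto_atTop_add_const_right atTop
    (-(Z.μ univ).toReal) tendsto_id)
  have := hZ.le_right ξ
  have : (Z.μ (Iic (lagrY Z ξ))).toReal ≤ (Z.μ univ).toReal :=
    ENNReal.toReal_mono (measure_ne_top _ _) (measure_mono (subset_univ _))
  simp only [id]; linarith

theorem lagrH_nonneg (ξ : ℝ) : 0 ≤ lagrH Z ξ := by
  have := hZ.fin
  have := hZ.left_le ξ
  have := primitive_nonneg Z.μ (lagrY Z ξ)
  rw [lagrH]; linarith

theorem tendsto_lagrH_atBot : Tendsto (lagrH Z) atBot (𝓝 0) := by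
  have := hZ.fin
  refine squeeze_zero hZ.lagrH_nonneg (fun ξ => ?_)
    ((tendsto_measure_Iic_atBot_zero Z.μ).comp hZ.tendsto_lagrY_atBot)
  have := hZ.le_right ξ
  rw [lagrH, Function.comp]; linarith

theorem tendsto_lagrH_atTop : Tendsto (lagrH Z) atTop (𝓝 (Z.μ univ).toReal) := by
  have := hZ.fin
  refine tendsto_of_tendsto_of_tendsto_of_le_of_le
    ((tendsto_primitive_atTop Z.μ).comp hZ.tendsto_lagrY_atTop)
    (tendsto_const_nhds (x := (Z.μ univ).toReal)) (fun ξ => ?_) (fun ξ => ?_)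
  · have := hZ.left_le ξ
    rw [lagrH, Function.comp]; linarith
  · have := hZ.le_right ξ
    have : (Z.μ (Iic (lagrY Z ξ))).toReal ≤ (Z.μ univ).toReal :=
      ENNReal.toReal_mono (measure_ne_top _ _) (measure_mono (subset_univ _))
    rw [lagrH]; linarith

theorem lagrH_lip : LipschitzWith 1 (lagrH Z) := by
  refine LipschitzWith.of_le_add fun a b => ?_
  rcases le_total a b with h | h
  · have := hZ.lagrH_mono h; have := dist_nonneg (x := a) (y := b); linarith
  · have := hZ.lagrY_mono h
    simp only [lagrH]
    rw [Real.dist_eq, abs_of_nonneg (by linarith)]; linarith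

theorem lagrY_lip : LipschitzWith 1 (lagrY Z) := by
  refine LipschitzWith.of_le_add fun a b => ?_
  rcases le_total a b with h | h
  · have := hZ.lagrY_mono h; have := dist_nonneg (x := a) (y := b); linarith
  · have := hZ.lagrH_mono h
    simp only [lagrH] at this
    rw [Real.dist_eq, abs_of_nonneg (by linarith)]; linarith

theorem preimage_Ico (a b : ℝ) : lagrY Z ⁻¹' Ico a b =
    Ico (a + primitive Z.μ a) (b + primitive Z.μ b) := by
  ext ξ
  simp only [mem_preimage, mem_Ico, hZ.le_lagrY_iff, hZ.lagrY_lt_iff]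

theorem lintegral_deriv_of_mono {f : ℝ → ℝ} (hf : LipschitzWith 1 f) (hm : Monotone f) {a b : ℝ}
    (h : a ≤ b) : ∫⁻ x in Ico a b, ENNReal.ofReal (_root_.deriv f x) =
      ENNReal.ofReal (f b - f a) := by
  have hi := (ac_of_lipschitz hf a b).intervalIntegrable_deriv
  rw [← integral_deriv_of_lipschitz hf, intervalIntegral.integral_of_le h,
    ofReal_integral_eq_lintegral_ofReal hi.1 (Eventually.of_forall fun x => hm.deriv_nonneg)]
  exact setLIntegral_congr Ico_ae_eq_Ioc

theorem monoE {a b : ℝ} (h : a ≤ b) : a + primitive Z.μ a ≤ b + primitive Z.μ b := by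
  have := hZ.fin
  exact add_le_add h (primitive_mono Z.μ h)

theorem map_lagrY_H : (volume.withDensity fun η => ENNReal.ofReal (_root_.deriv (lagrH Z) η)).map
    (lagrY Z) = Z.μ := by
  have := hZ.fin
  refine (Measure.ext_of_Ico _ _ fun a b hab => ?_).symm
  rw [Measure.map_apply hZ.lagrY_mono.measurable measurableSet_Ico, hZ.preimage_Ico,
    withDensity_apply _ measurableSet_Ico, hZ.lintegral_deriv_of_mono hZ.lagrH_lip hZ.lagrH_mono
      (hZ.monoE hab.le)]
  rw [lagrH, lagrH, hZ.lagrY_apply, hZ.lagrY_apply, add_sub_cancel_left, add_sub_cancel_left,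
    primitive_sub_primitive _ hab.le, ENNReal.ofReal_toReal (measure_ne_top _ _)]

theorem map_lagrY_y : (volume.withDensity fun η => ENNReal.ofReal (_root_.deriv (lagrY Z) η)).map
    (lagrY Z) = volume := by
  have := hZ.fin
  refine (Measure.ext_of_Ico _ _ fun a b hab => ?_).symm
  rw [Measure.map_apply hZ.lagrY_mono.measurable measurableSet_Ico, hZ.preimage_Ico,
    withDensity_apply _ measurableSet_Ico, hZ.lintegral_deriv_of_mono hZ.lagrY_lip hZ.lagrY_mono
      (hZ.monoE hab.le), hZ.lagrY_apply, hZ.lagrY_apply, Real.volume_Ico]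

theorem ae_of_ae_mu {p : ℝ → Prop} (h : ∀ᵐ x ∂Z.μ, p x) :
    ∀ᵐ η, _root_.deriv (lagrH Z) η ≠ 0 → p (lagrY Z η) := by
  rw [← hZ.map_lagrY_H] at h
  have h1 := ae_of_ae_map hZ.lagrY_mono.measurable.aemeasurable h
  rw [ae_withDensity_iff (measurable_deriv _).ennreal_ofReal] at h1
  filter_upwards [h1] with η h2 h3
  refine h2 ?_
  have : 0 ≤ _root_.deriv (lagrH Z) η := hZ.lagrH_mono.deriv_nonneg
  rw [Ne, ENNReal.ofReal_eq_zero, not_le]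
  exact lt_of_le_of_ne this (Ne.symm h3)

theorem ae_of_ae_volume {p : ℝ → Prop} (h : ∀ᵐ x, p x) :
    ∀ᵐ η, _root_.deriv (lagrY Z) η ≠ 0 → p (lagrY Z η) := by
  rw [← hZ.map_lagrY_y] at h
  have h1 := ae_of_ae_map hZ.lagrY_mono.measurable.aemeasurable h
  rw [ae_withDensity_iff (measurable_deriv _).ennreal_ofReal] at h1
  filter_upwards [h1] with η h2 h3
  refine h2 ?_
  have : 0 ≤ _root_.deriv (lagrY Z) η := hZ.lagrY_mono.deriv_nonneg
  rw [Ne, ENNReal.ofReal_eq_zero, not_le]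
  exact lt_of_le_of_ne this (Ne.symm h3)

theorem lagr_rel : ∀ᵐ η, _root_.deriv (fun ξ => Z.u (lagrY Z ξ)) η ^ 2 =
    _root_.deriv (lagrY Z) η * _root_.deriv (lagrH Z) η := by
  have := hZ.fin
  filter_upwards [hZ.ae_of_ae_volume hZ.deriv, hZ.lagrY_lip.ae_differentiableAt] with η h1 h2
  by_cases h0 : _root_.deriv (lagrY Z) η = 0
  · have hU : HasDerivAt (fun ξ => Z.u (lagrY Z ξ)) 0 η := by
      rw [hasDerivAt_iff_tendsto_slope]
      have h3 := h2.hasDerivAt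
      rw [h0, hasDerivAt_iff_tendsto_slope] at h3
      have h4 : Tendsto (fun ξ => Real.sqrt (|slope (lagrY Z) η ξ|)) (𝓝[≠] η) (𝓝 0) := by
        have := (Real.continuous_sqrt.comp continuous_abs).tendsto (0:ℝ)
        simp only [Function.comp, abs_zero, Real.sqrt_zero] at this
        exact this.comp h3
      refine squeeze_zero_norm (fun ξ => ?_) h4
      refine Real.le_sqrt_of_sq_le ?_
      rw [Real.norm_eq_abs, sq_abs]
      rcases eq_or_ne ξ η with rfl | hne
      · simp
      simp only [slope_def_field]
      have h5 := hZ.u_cs η ξ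
      have h6 := hZ.lagrH_lip.dist_le_mul ξ η
      simp only [Real.dist_eq, NNReal.coe_one, one_mul] at h6
      have hpos : 0 < |ξ - η| := abs_pos.mpr (sub_ne_zero.mpr hne)
      rw [div_pow, abs_div, div_le_div_iff₀ (by positivity) hpos]
      have h7 : (lagrY Z ξ - lagrY Z η) * (lagrH Z ξ - lagrH Z η) ≤
          |lagrY Z ξ - lagrY Z η| * |ξ - η| := by
        refine (le_abs_self _).trans ?_
        rw [abs_mul]; gcongr
      calc _ ≤ (|lagrY Z ξ - lagrY Z η| * |ξ - η|) * |ξ - η| := by gcongr; exact h5.trans h7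
        _ = |lagrY Z ξ - lagrY Z η| * (ξ - η) ^ 2 := by rw [← sq_abs (ξ - η)]; ring
    rw [hU.deriv, h0]; simp
  · obtain ⟨c, hc1, hc2⟩ := h1 h0
    set x := lagrY Z η with hx
    have hE : x + primitive Z.μ x = η := by
      refine le_antisymm (hZ.left_le η) ?_
      obtain ⟨u, k1, k2, -⟩ := exists_seq_primitive_right Z.μ x
      exact ge_of_tendsto (k2.add (hc2.continuousAt.tendsto.comp k2))
        (Eventually.of_forall fun n => ((hZ.lagrY_lt_iff _ _).mp (k1 n)).le)
    have hdE : HasDerivAt (fun z => z + primitive Z.μ z) (1 + c ^ 2) x := (hasDerivAt_id x).add hc2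
    have hdy : HasDerivAt (lagrY Z) (_root_.deriv (lagrY Z) η) (x + primitive Z.μ x) := by
      rw [hE]; exact h2.hasDerivAt
    have hcomp := hdy.comp x hdE
    have hid : (lagrY Z ∘ fun z => z + primitive Z.μ z) = id := funext hZ.lagrY_apply
    rw [hid] at hcomp
    have heq := hcomp.unique (hasDerivAt_id x)
    have hU : HasDerivAt (fun ξ => Z.u (lagrY Z ξ)) (c * _root_.deriv (lagrY Z) η) η :=
      HasDerivAt.comp η hc1 h2.hasDerivAt
    have hH : HasDerivAt (lagrH Z) (1 - _root_.deriv (lagrY Z) η) η :=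
      (hasDerivAt_id η).sub h2.hasDerivAt
    rw [hU.deriv, hH.deriv]
    linear_combination (_root_.deriv (lagrY Z) η) * heq

theorem mapL_V : (mapL Z).V = lagrH Z := by
  have := hZ.fin
  have hrn : ∀ᵐ x ∂Z.μ, Z.μ.rnDeriv Z.ν x = 1 := by
    rw [hZ.nu_eq]; exact Measure.rnDeriv_self Z.μ
  ext ξ
  simp only [mapL]
  have h1 : ∫ η in Iic ξ, (Z.μ.rnDeriv Z.ν (lagrY Z η)).toReal * _root_.deriv (lagrH Z) η =
      ∫ η in Iic ξ, _root_.deriv (lagrH Z) η := by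
    refine integral_congr_ae (ae_restrict_of_ae ?_)
    filter_upwards [hZ.ae_of_ae_mu hrn] with η h
    by_cases h0 : _root_.deriv (lagrH Z) η = 0
    · rw [h0, mul_zero]
    · rw [h h0]; simp
  rw [h1]
  have hi : ∀ a, ∫ x in a..ξ, _root_.deriv (lagrH Z) x = lagrH Z ξ - lagrH Z a :=
    fun a => integral_deriv_of_lipschitz hZ.lagrH_lip a ξ
  have hint : IntegrableOn (_root_.deriv (lagrH Z)) (Iic ξ) := by
    refine integrableOn_Iic_of_intervalIntegral_norm_tendsto (lagrH Z ξ - 0) ξ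
      (a := fun n : ℕ => -(n:ℝ)) (l := atTop)
      (fun n => ((ac_of_lipschitz hZ.lagrH_lip _ _).intervalIntegrable_deriv).1)
      (tendsto_neg_atTop_atBot.comp tendsto_natCast_atTop_atTop) ?_
    refine ((hZ.tendsto_lagrH_atBot.comp (tendsto_neg_atTop_atBot.comp
      tendsto_natCast_atTop_atTop)).const_sub (lagrH Z ξ)).congr fun n => ?_
    rw [Function.comp, Function.comp, ← hi]
    refine intervalIntegral.integral_congr fun x _ => ?_
    rw [Real.norm_of_nonneg hZ.lagrH_mono.deriv_nonneg]
  have h2 := intervalIntegral_tendsto_integral_Iic ξ hint tendsto_id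
  refine tendsto_nhds_unique h2 ?_
  have h3 := hZ.tendsto_lagrH_atBot.const_sub (lagrH Z ξ)
  rw [sub_zero] at h3
  exact h3.congr fun a => (hi a).symm

theorem isNice : IsNice (mapL Z) (Z.μ univ).toReal where
  y_eq ξ := by simp only [mapL, lagrH]; ring
  V_eq := hZ.mapL_V
  mono_y := hZ.lagrY_mono
  mono_H := hZ.lagrH_mono
  H_bot := hZ.tendsto_lagrH_atBot
  H_top := hZ.tendsto_lagrH_atTop
  cs a b := hZ.u_cs a b
  U_bdd := by
    obtain ⟨C, hC⟩ := hZ.bdd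
    exact ⟨C, fun ξ => hC _⟩
  U_bot := by
    obtain ⟨l, hl⟩ := hZ.bot
    exact ⟨l, hl.comp hZ.tendsto_lagrY_atBot⟩
  rel := hZ.lagr_rel

/-- The set where all the energy is concentrated has at most the mass of the singular part. -/
theorem volume_concentrated_le :
    volume {η | _root_.deriv (mapL Z).H η = 1} ≤ singPart Z.μ univ := by
  have := hZ.fin
  have hN := hZ.isNice
  set S := {η | _root_.deriv (mapL Z).H η = 1 ∧ DifferentiableAt ℝ (mapL Z).y η ∧
    _root_.deriv (mapL Z).y η = 1 - _root_.deriv (mapL Z).H η}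
  have hS : volume {η | _root_.deriv (mapL Z).H η = 1} ≤ volume S := by
    refine measure_mono_ae ?_
    filter_upwards [hN.deriv_y, hN.lip_y.ae_differentiableAt] with η h1 h2 h3
    exact ⟨h3, h2, h1⟩
  have hnull : volume (lagrY Z '' S) = 0 := by
    refine addHaar_image_eq_zero_of_det_fderivWithin_eq_zero volume
      (f' := fun η => ContinuousLinearMap.toSpanSingleton ℝ (_root_.deriv (mapL Z).y η))
      (fun η hη => (hη.2.1.hasDerivAt.hasFDerivAt).hasFDerivWithinAt) (fun η hη => ?_)
    rw [ContinuousLinearMap.det_toSpanSingleton, hη.2.2, hη.1, sub_self]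
  refine hS.trans ?_
  have hNm := measurableSet_toMeasurable volume (lagrY Z '' S)
  have hN0 : volume (toMeasurable volume (lagrY Z '' S)) = 0 := by rw [measure_toMeasurable]; exact hnull
  set N := toMeasurable volume (lagrY Z '' S)
  have hSN : S ⊆ lagrY Z ⁻¹' N := fun η hη => subset_toMeasurable _ _ ⟨η, hη, rfl⟩
  have hpre : MeasurableSet (lagrY Z ⁻¹' N) := hZ.lagrY_mono.measurable hNm
  have h1 : volume S ≤ Z.μ N := by
    conv_rhs => rw [← hZ.map_lagrY_H, Measure.map_apply hZ.lagrY_mono.measurable hNm]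
    rw [withDensity_apply _ hpre]
    calc volume S ≤ volume ({η | _root_.deriv (mapL Z).H η = 1} ∩ lagrY Z ⁻¹' N) :=
          measure_mono fun η hη => ⟨hη.1, hSN hη⟩
      _ = ∫⁻ η in ({η | _root_.deriv (mapL Z).H η = 1} ∩ lagrY Z ⁻¹' N), 1 := by simp
      _ = ∫⁻ η in ({η | _root_.deriv (mapL Z).H η = 1} ∩ lagrY Z ⁻¹' N),
            ENNReal.ofReal (_root_.deriv (lagrH Z) η) := by
          refine setLIntegral_congr_fun ?_ fun η hη => ?_
          · exact ((measurable_deriv _) (measurableSet_singleton 1)).inter hpre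
          · have : _root_.deriv (lagrH Z) η = 1 := hη.1
            simp [this]
      _ ≤ _ := lintegral_mono_set inter_subset_right
  refine h1.trans ?_
  conv_lhs => rw [Measure.haveLebesgueDecomposition_add Z.μ volume]
  rw [Measure.add_apply, (withDensity_absolutelyContinuous volume _) hN0, add_zero]
  exact measure_mono (subset_univ _)

end IsGood

end HunterSaxton
end

noncomputable section


namespace HunterSaxton

/-! ## The measure with a given left-continuous primitive -/

section MeasureOf

variable {F : ℝ → ℝ} (hF : Monotone F) (hl : ∀ x, Tendsto F (𝓝[<] x) (𝓝 (F x)))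
include hF hl

theorem leftLim_stieltjesFunction (x : ℝ) : Function.leftLim hF.stieltjesFunction x = F x := by
  refine le_antisymm ?_ ?_
  · refine le_of_tendsto (hF.stieltjesFunction.mono.tendsto_leftLim x) ?_
    filter_upwards [self_mem_nhdsWithin] with z hz
    rw [hF.stieltjesFunction_eq]
    exact hF.rightLim_le hz
  · refine le_of_tendsto (hl x) ?_
    filter_upwards [self_mem_nhdsWithin] with z hz
    refine le_trans ?_ (hF.stieltjesFunction.mono.le_leftLim hz)
    rw [hF.stieltjesFunction_eq]
    exact hF.le_rightLim le_rfl

theorem measureOf_Iio (h0 : Tendsto F atBot (𝓝 0)) (x : ℝ) :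
    measureOf F (Iio x) = ENNReal.ofReal (F x) := by
  rw [measureOf, dif_pos hF, StieltjesFunction.measure_Iio (l := 0), leftLim_stieltjesFunction hF hl,
    sub_zero]
  refine tendsto_of_tendsto_of_tendsto_of_le_of_le h0
    (h0.comp (tendsto_atBot_add_const_right atBot 1 tendsto_id)) (fun x => ?_) (fun x => ?_)
  · rw [hF.stieltjesFunction_eq]; exact hF.le_rightLim le_rfl
  · rw [hF.stieltjesFunction_eq]; exact hF.rightLim_le (by simp)

theorem measureOf_univ (h0 : Tendsto F atBot (𝓝 0)) {m : ℝ} (hm : Tendsto F atTop (𝓝 m)) :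
    measureOf F univ = ENNReal.ofReal m := by
  have h := tendsto_measure_iUnion_atTop (μ := measureOf F) (s := fun x : ℝ => Iio x)
    (fun m n h => Iio_subset_Iio h)
  rw [iUnion_Iio] at h
  refine tendsto_nhds_unique h ?_
  refine (ENNReal.tendsto_ofReal hm).congr fun x => ?_
  rw [Function.comp, measureOf_Iio hF hl h0]

theorem primitive_measureOf (h0 : Tendsto F atBot (𝓝 0)) : primitive (measureOf F) = F := by
  ext x
  rw [primitive, measureOf_Iio hF hl h0, ENNReal.toReal_ofReal]
  exact le_of_tendsto h0 ((eventually_le_atBot x).mono fun z hz => hF hz)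

end MeasureOf

theorem tendsto_primitive_left (μ : Measure ℝ) [IsFiniteMeasure μ] (x : ℝ) :
    Tendsto (primitive μ) (𝓝[<] x) (𝓝 (primitive μ x)) := by
  have h := (primitive_mono μ).tendsto_leftLim x
  obtain ⟨u, h1, h2, h3⟩ := exists_seq_primitive_left μ x
  have h4 := h.comp (tendsto_nhdsWithin_of_tendsto_nhds_of_eventually_within _ h2
    (Eventually.of_forall h1))
  rwa [tendsto_nhds_unique h4 h3] at h

theorem stieltjes_primitive (μ : Measure ℝ) [IsFiniteMeasure μ] :
    (primitive_mono μ).stieltjesFunction.measure = μ := by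
  refine (Measure.ext_of_Ico _ _ fun a b hab => ?_).symm
  rw [StieltjesFunction.measure_Ico, leftLim_stieltjesFunction (primitive_mono μ)
    (tendsto_primitive_left μ), leftLim_stieltjesFunction (primitive_mono μ)
    (tendsto_primitive_left μ), primitive_sub_primitive _ hab.le,
    ENNReal.ofReal_toReal (measure_ne_top _ _)]

/-! ## Wave profiles in `E₂` -/

/-- Square integrable primitives: `u` is a primitive of the square integrable function `g`. -/
structure HasSlope (u g : ℝ → ℝ) : Prop where
  memLp : MemLp g 2 volume
  prim : ∀ a b, u b - u a = ∫ x in a..b, g x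

namespace HasSlope

variable {u g : ℝ → ℝ} (h : HasSlope u g)
include h

theorem integrable_sq : Integrable (fun x => g x ^ 2) := h.memLp.integrable_sq

theorem locallyIntegrable : LocallyIntegrable g := h.memLp.locallyIntegrable (by norm_num)

theorem intervalIntegrable (a b : ℝ) : IntervalIntegrable g volume a b :=
  (h.locallyIntegrable.integrableOn_isCompact isCompact_uIcc).intervalIntegrable

theorem cs {a b : ℝ} (hab : a ≤ b) : (u b - u a) ^ 2 ≤ (b - a) * ∫ x in a..b, g x ^ 2 := by
  rcases hab.eq_or_lt with rfl | hlt
  · simp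
  set c := (u b - u a) / (b - a)
  have hba : b - a ≠ 0 := by linarith
  have hc : c * (b - a) = u b - u a := div_mul_cancel₀ _ hba
  have i1 : IntervalIntegrable (fun x => g x ^ 2) volume a b := h.integrable_sq.intervalIntegrable
  have i2 := h.intervalIntegrable a b
  have h1 : 0 ≤ ∫ x in a..b, (g x - c) ^ 2 :=
    intervalIntegral.integral_nonneg hab fun x _ => sq_nonneg _
  have h2 : ∫ x in a..b, (g x - c) ^ 2 =
      (∫ x in a..b, g x ^ 2) - 2 * c * (u b - u a) + c ^ 2 * (b - a) := by
    have e : (fun x => (g x - c) ^ 2) = fun x => g x ^ 2 - 2 * c * g x + c ^ 2 := by ext; ring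
    rw [e, intervalIntegral.integral_add (i1.sub (i2.const_mul _)) intervalIntegrable_const,
      intervalIntegral.integral_sub i1 (i2.const_mul _), intervalIntegral.integral_const_mul,
      ← h.prim, intervalIntegral.integral_const, smul_eq_mul]
    ring
  rw [h2, ← hc] at h1
  rw [← hc]
  have hpos : 0 < b - a := by linarith
  nlinarith

theorem ae_hasDerivAt : ∀ᵐ x, HasDerivAt u (g x) x := by
  filter_upwards [LocallyIntegrable.ae_hasDerivAt_integral h.locallyIntegrable] with x hx
  have h1 := (hx 0).add_const (u 0)
  refine h1.congr_of_eventuallyEq (Eventually.of_forall fun y => ?_)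
  have := h.prim 0 y
  simp only
  linarith

end HasSlope

/-- A square integrable function with square integrable slope is controlled by the tails of its
`H¹` norm. -/
theorem HasSlope.sq_le {f g : ℝ → ℝ} (h : HasSlope f g) (hf : MemLp f 2 volume) (x : ℝ) :
    f x ^ 2 ≤ 2 * ∫ y in Iic x, (f y ^ 2 + g y ^ 2) := by
  have i1 : Integrable (fun y => f y ^ 2) := hf.integrable_sq
  have i2 := h.integrable_sq
  have hpt : ∀ y ∈ Icc (x - 1) x, f x ^ 2 ≤ 2 * f y ^ 2 + 2 * ∫ z in (x - 1)..x, g z ^ 2 := by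
    intro y hy
    have h1 := h.cs hy.2
    have h2 : ∫ z in y..x, g z ^ 2 ≤ ∫ z in (x - 1)..x, g z ^ 2 :=
      intervalIntegral.integral_mono_interval hy.1 hy.2 le_rfl
        (Eventually.of_forall fun z => sq_nonneg _) i2.intervalIntegrable
    have h0 : 0 ≤ ∫ z in y..x, g z ^ 2 :=
      intervalIntegral.integral_nonneg hy.2 fun z _ => sq_nonneg _
    have h3 : (f x - f y) ^ 2 ≤ ∫ z in (x - 1)..x, g z ^ 2 := by
      refine h1.trans (le_trans ?_ h2)
      exact mul_le_of_le_one_left h0 (by linarith [hy.1])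
    nlinarith [sq_nonneg (f x - 2 * f y)]
  have h1 := intervalIntegral.integral_mono_on (a := x - 1) (b := x) (by linarith)
    (f := fun _ => f x ^ 2) (g := fun y => 2 * f y ^ 2 + 2 * ∫ z in (x - 1)..x, g z ^ 2)
    intervalIntegrable_const
    ((i1.intervalIntegrable.const_mul 2).add intervalIntegrable_const) hpt
  rw [intervalIntegral.integral_add (i1.intervalIntegrable.const_mul 2) intervalIntegrable_const,
    intervalIntegral.integral_const_mul, intervalIntegral.integral_const,
    intervalIntegral.integral_const] at h1
  simp only [sub_sub_cancel, one_smul] at h1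
  have h2 : (∫ y in (x - 1)..x, f y ^ 2) + ∫ y in (x - 1)..x, g y ^ 2 ≤
      ∫ y in Iic x, (f y ^ 2 + g y ^ 2) := by
    rw [← intervalIntegral.integral_add i1.intervalIntegrable i2.intervalIntegrable,
      intervalIntegral.integral_of_le (by linarith)]
    exact setIntegral_mono_set (i1.add i2).integrableOn
      (Eventually.of_forall fun y => by simp only [Pi.zero_apply]; positivity)
      (Ioc_subset_Iic_self).eventuallyLE
  linarith

theorem HasSlope.bdd_and_tendsto {f g : ℝ → ℝ} (h : HasSlope f g) (hf : MemLp f 2 volume) :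
    (∃ C, ∀ x, |f x| ≤ C) ∧ Tendsto f atBot (𝓝 0) := by
  have i : Integrable (fun y => f y ^ 2 + g y ^ 2) := hf.integrable_sq.add h.integrable_sq
  constructor
  · refine ⟨Real.sqrt (2 * ∫ y, (f y ^ 2 + g y ^ 2)), fun x => Real.le_sqrt_of_sq_le ?_⟩
    rw [sq_abs]
    refine (h.sq_le hf x).trans ?_
    have := setIntegral_le_integral (s := Iic x) i (Eventually.of_forall fun y => by
      simp only [Pi.zero_apply]; positivity)
    linarith
  · have h1 : Tendsto (fun x => Real.sqrt (2 * ∫ y in Iic x, (f y ^ 2 + g y ^ 2))) atBot (𝓝 0) := by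
      have h2 := (tendsto_setIntegral_Iic_atBot i).const_mul 2
      rw [mul_zero] at h2
      have := (Real.continuous_sqrt.tendsto 0).comp h2
      rwa [Real.sqrt_zero] at this
    refine squeeze_zero_norm (fun x => ?_) h1
    refine Real.le_sqrt_of_sq_le ?_
    rw [Real.norm_eq_abs, sq_abs]
    exact h.sq_le hf x

theorem hasSlope_chiPlus : HasSlope chiPlus (deriv chiPlus) := by
  have hcd : ContDiff ℝ 1 chiPlus := by
    unfold chiPlus
    exact (Real.smoothTransition.contDiff (n := 1)).comp (contDiff_id.add contDiff_const)
  have hc : Continuous (deriv chiPlus) := hcd.continuous_deriv le_rfl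
  constructor
  · refine hc.memLp_of_hasCompactSupport ?_
    refine HasCompactSupport.intro (isCompact_Icc (a := (-1:ℝ)) (b := 1)) fun x hx => ?_
    rw [mem_Icc, not_and_or, not_le, not_le] at hx
    rcases hx with hx | hx
    · have : chiPlus =ᶠ[𝓝 x] fun _ => 0 := by
        filter_upwards [Iio_mem_nhds hx] with z hz
        rw [mem_Iio] at hz
        exact Real.smoothTransition.zero_of_nonpos (by linarith)
      rw [this.deriv_eq]; simp
    · have : chiPlus =ᶠ[𝓝 x] fun _ => 1 := by
        filter_upwards [Ioi_mem_nhds hx] with z hz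
        rw [mem_Ioi] at hz
        exact Real.smoothTransition.one_of_one_le (by linarith)
      rw [this.deriv_eq]; simp
  · intro a b
    exact (intervalIntegral.integral_deriv_eq_sub
      (fun x _ => (hcd.differentiable one_ne_zero) x) (hc.intervalIntegrable _ _)).symm

theorem MemE2.exists_slope {u : ℝ → ℝ} (hu : MemE2 u) :
    (∃ g, HasSlope u g) ∧ (∃ C, ∀ x, |u x| ≤ C) ∧ ∃ l, Tendsto u atBot (𝓝 l) := by
  obtain ⟨f, a, b, ⟨hf, g, hg, hfg⟩, hu⟩ := hu
  have hs : HasSlope f g := ⟨hg, hfg⟩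
  obtain ⟨⟨C, hC⟩, hlim⟩ := hs.bdd_and_tendsto hf
  have hχ := hasSlope_chiPlus
  refine ⟨⟨fun x => g x + (a - b) * deriv chiPlus x, ?_, ?_⟩, ?_, ?_⟩
  · exact hg.add (hχ.memLp.const_mul (a - b))
  · intro c d
    rw [intervalIntegral.integral_add (hs.intervalIntegrable c d)
      ((hχ.intervalIntegrable c d).const_mul _), intervalIntegral.integral_const_mul, ← hfg,
      ← hχ.prim, hu, hu]
    simp only [chiMinus]; ring
  · refine ⟨C + |a| + |b|, fun x => ?_⟩
    have h0 : 0 ≤ chiPlus x := Real.smoothTransition.nonneg _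
    have h1 : chiPlus x ≤ 1 := Real.smoothTransition.le_one _
    rw [hu, chiMinus]
    have e1 : |a * chiPlus x| ≤ |a| := by
      rw [abs_mul, abs_of_nonneg h0]; exact mul_le_of_le_one_right (abs_nonneg _) h1
    have e2 : |b * (1 - chiPlus x)| ≤ |b| := by
      rw [abs_mul, abs_of_nonneg (by linarith : 0 ≤ 1 - chiPlus x)]
      exact mul_le_of_le_one_right (abs_nonneg _) (by linarith)
    have := abs_add_le (f x + a * chiPlus x) (b * (1 - chiPlus x))
    have := abs_add_le (f x) (a * chiPlus x)
    have := hC x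
    linarith
  · refine ⟨0 + b, (hlim.add_const b).congr' ?_⟩
    filter_upwards [eventually_le_atBot (-1)] with x hx
    have : chiPlus x = 0 := Real.smoothTransition.zero_of_nonpos (by linarith)
    rw [hu, chiMinus, this]; ring

/-! ## Eulerian data in `𝒟₀` -/

/-- The absolutely continuous part of the energy has density `g²`, where `g` is the slope of `u`. -/
structure HasEnergySlope (Z : Euler) (g : ℝ → ℝ) : Prop where
  fin : IsFiniteMeasure Z.μ
  slope : HasSlope Z.u g
  ac : acPart Z.μ = volume.withDensity (fun x => ENNReal.ofReal (g x ^ 2))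

theorem MemD0.exists_energySlope {Z : Euler} (hZ : MemD0 Z) : ∃ g, HasEnergySlope Z g := by
  obtain ⟨⟨g, hg⟩, -⟩ := hZ.1.u_mem.exists_slope
  refine ⟨g, hZ.1.finite_mu, hg, hZ.1.ac_eq.trans (withDensity_congr_ae ?_)⟩
  filter_upwards [hg.ae_hasDerivAt] with x hx
  rw [hx.deriv]

theorem acPart_le (μ : Measure ℝ) : acPart μ ≤ μ := Measure.withDensity_rnDeriv_le μ volume

theorem singPart_le (μ : Measure ℝ) : singPart μ ≤ μ := Measure.singularPart_le μ volume

instance (μ : Measure ℝ) [IsFiniteMeasure μ] : IsFiniteMeasure (acPart μ) :=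
  isFiniteMeasure_of_le μ (acPart_le μ)

instance (μ : Measure ℝ) [IsFiniteMeasure μ] : IsFiniteMeasure (singPart μ) :=
  isFiniteMeasure_of_le μ (singPart_le μ)

theorem primitive_eq_add (Z : Euler) [IsFiniteMeasure Z.μ] (x : ℝ) :
    primitive Z.μ x = primAc Z x + primSing Z x := by
  rw [primAc, primSing, primitive, primitive, primitive]
  conv_lhs => rw [Measure.haveLebesgueDecomposition_add Z.μ volume]
  rw [Measure.add_apply, ENNReal.toReal_add, add_comm]
  · rfl
  · exact measure_ne_top (singPart Z.μ) _
  · exact measure_ne_top (acPart Z.μ) _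

namespace HasEnergySlope

variable {Z : Euler} {g : ℝ → ℝ} (h : HasEnergySlope Z g)
include h

theorem primAc_sub {a b : ℝ} (hab : a ≤ b) :
    primAc Z b - primAc Z a = ∫ x in a..b, g x ^ 2 := by
  have := h.fin
  rw [primAc, primAc, primitive_sub_primitive _ hab, h.ac, withDensity_apply _ measurableSet_Ico,
    setLIntegral_congr Ico_ae_eq_Ioc, ← ofReal_integral_eq_lintegral_ofReal
      h.slope.integrable_sq.integrableOn (Eventually.of_forall fun x => sq_nonneg _),
    ENNReal.toReal_ofReal (integral_nonneg fun x => sq_nonneg _),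
    intervalIntegral.integral_of_le hab]

theorem cs_ac {a b : ℝ} (hab : a ≤ b) :
    (Z.u b - Z.u a) ^ 2 ≤ (b - a) * (primAc Z b - primAc Z a) := by
  rw [h.primAc_sub hab]; exact h.slope.cs hab

theorem cs {a b : ℝ} (hab : a < b) :
    (Z.u b - Z.u a) ^ 2 ≤ (b - a) * (Z.μ (Ioo a b)).toReal := by
  have := h.fin
  refine (h.cs_ac hab.le).trans (mul_le_mul_of_nonneg_left ?_ (by linarith))
  rw [primAc, primAc, primitive_sub_primitive _ hab.le]
  have h1 : acPart Z.μ (Ico a b) = acPart Z.μ (Ioo a b) := by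
    refine measure_congr ?_
    have : acPart Z.μ ≪ volume := withDensity_absolutelyContinuous _ _
    exact this.ae_le Ioo_ae_eq_Ico.symm
  rw [h1]
  exact ENNReal.toReal_mono (measure_ne_top _ _) (acPart_le Z.μ _)

theorem ae_hasDerivAt_primitive : ∀ᵐ x, HasDerivAt (primitive Z.μ) (g x ^ 2) x := by
  have := h.fin
  have h1 := (primitive_mono Z.μ).ae_hasDerivAt
  rw [stieltjes_primitive] at h1
  have h2 : Z.μ.rnDeriv volume =ᵐ[volume] fun x => ENNReal.ofReal (g x ^ 2) := by
    rw [← withDensity_eq_iff_of_sigmaFinite (Measure.measurable_rnDeriv _ _).aemeasurable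
      h.slope.integrable_sq.aemeasurable.ennreal_ofReal]
    exact h.ac
  filter_upwards [h1, h2] with x hx hx2
  rw [hx2, ENNReal.toReal_ofReal (sq_nonneg _)] at hx
  exact hx

end HasEnergySlope

theorem MemD0.isGood {Z : Euler} (hZ : MemD0 Z) : IsGood Z := by
  obtain ⟨g, hg⟩ := hZ.exists_energySlope
  obtain ⟨-, hb, hl⟩ := hZ.1.u_mem.exists_slope
  refine ⟨hg.fin, hZ.2.symm, fun a b hab => hg.cs hab, ?_, hb, hl⟩
  filter_upwards [hg.slope.ae_hasDerivAt, hg.ae_hasDerivAt_primitive] with x h1 h2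
  exact ⟨g x, h1, h2⟩

end HunterSaxton
end

noncomputable section


namespace HunterSaxton

/-! ## Piecewise affine functions on the uniform grid -/

theorem monotone_of_monotoneOn_grid {h : ℝ} (hh : 0 < h) {f : ℝ → ℝ}
    (hf : ∀ i : ℤ, MonotoneOn f (Icc (gridPt h i) (gridPt h (i + 1)))) : Monotone f := by
  have key : ∀ n : ℕ, ∀ a b, a ≤ b → b ≤ gridPt h (⌊a / h⌋ + 1 + n) → f a ≤ f b := by
    intro n
    induction n with
    | zero =>
      intro a b hab hb
      have h1 : gridPt h ⌊a / h⌋ ≤ a := by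
        rw [gridPt, ← le_div_iff₀ hh]; exact Int.floor_le _
      simp only [Nat.cast_zero, add_zero] at hb
      exact hf ⌊a / h⌋ ⟨h1, hab.trans hb⟩ ⟨h1.trans hab, hb⟩ hab
    | succ n ih =>
      intro a b hab hb
      rcases le_total b (gridPt h (⌊a / h⌋ + 1 + n)) with h1 | h1
      · exact ih a b hab h1
      · have h2 : a ≤ gridPt h (⌊a / h⌋ + 1 + n) := by
          have h3 : a / h < ⌊a / h⌋ + 1 := Int.lt_floor_add_one _
          rw [div_lt_iff₀ hh] at h3
          simp only [gridPt]
          push_cast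
          have : (0:ℝ) ≤ n * h := by positivity
          nlinarith
        refine (ih a _ h2 le_rfl).trans ?_
        have e : (⌊a / h⌋ + 1 + ((n + 1 : ℕ) : ℤ)) = (⌊a / h⌋ + 1 + n) + 1 := by push_cast; ring
        rw [e] at hb
        exact hf _ ⟨le_rfl, h1.trans hb⟩ ⟨h1, hb⟩ h1
  intro a b hab
  obtain ⟨n, hn⟩ := exists_nat_gt ((b - a) / h)
  refine key n a b hab ?_
  rw [div_lt_iff₀ hh] at hn
  have h3 : a / h < ⌊a / h⌋ + 1 := Int.lt_floor_add_one _
  rw [div_lt_iff₀ hh] at h3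
  simp only [gridPt]
  push_cast
  linarith

/-- `f` is affine with slope `c i` between the grid points `x_i` and `x_{i+1}`. -/
def GridAffine (h : ℝ) (f : ℝ → ℝ) (c : ℤ → ℝ) : Prop :=
  ∀ i : ℤ, ∀ x ∈ Icc (gridPt h i) (gridPt h (i + 1)), f x = f (gridPt h i) + c i * (x - gridPt h i)

namespace GridAffine

variable {h : ℝ} {f f' : ℝ → ℝ} {c c' : ℤ → ℝ}

theorem monotone (hh : 0 < h) (hf : GridAffine h f c) (hc : ∀ i, 0 ≤ c i) : Monotone f :=
  monotone_of_monotoneOn_grid hh fun i x hx y hy hxy => by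
    rw [hf i x hx, hf i y hy]
    have := mul_le_mul_of_nonneg_left hxy (hc i)
    linarith

theorem comb (hf : GridAffine h f c) (hf' : GridAffine h f' c') (r s t : ℝ) :
    GridAffine h (fun x => r * x + s * f x + t * f' x) (fun i => r + s * c i + t * c' i) := by
  intro i x hx
  simp only
  rw [hf i x hx, hf' i x hx]; ring

theorem lipschitz (hh : 0 < h) (hf : GridAffine h f c) {S : ℝ} (hc : ∀ i, |c i| ≤ S) :
    LipschitzWith S.toNNReal f := by
  have hS : 0 ≤ S := (abs_nonneg _).trans (hc 0)
  have h1 := (hf.comb hf S 1 0).monotone hh (fun i => by have := abs_le.mp (hc i); linarith)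
  have h2 := (hf.comb hf S (-1) 0).monotone hh (fun i => by have := abs_le.mp (hc i); linarith)
  refine LipschitzWith.of_dist_le_mul fun a b => ?_
  rw [Real.coe_toNNReal _ hS, Real.dist_eq, Real.dist_eq]
  wlog hab : b ≤ a generalizing a b
  · rw [abs_sub_comm, abs_sub_comm a]; exact this b a (le_of_not_ge hab)
  have k1 := h1 hab
  have k2 := h2 hab
  simp only at k1 k2
  rw [abs_of_nonneg (by linarith : 0 ≤ a - b), abs_le]
  constructor <;> linarith

theorem hasDerivAt (hf : GridAffine h f c) {i : ℤ} {x : ℝ}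
    (hx : x ∈ Ioo (gridPt h i) (gridPt h (i + 1))) : HasDerivAt f (c i) x := by
  have h1 : HasDerivAt (fun z => f (gridPt h i) + c i * (z - gridPt h i)) (c i) x := by
    simpa using (((hasDerivAt_id x).sub_const (gridPt h i)).const_mul (c i)).const_add
      (f (gridPt h i))
  refine h1.congr_of_eventuallyEq ?_
  filter_upwards [Ioo_mem_nhds hx.1 hx.2] with z hz
  exact hf i z ⟨hz.1.le, hz.2.le⟩

end GridAffine

theorem exists_mem_grid {h : ℝ} (hh : 0 < h) (x : ℝ) :
    ∃ i : ℤ, gridPt h i ≤ x ∧ x < gridPt h (i + 1) := by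
  refine ⟨⌊x / h⌋, ?_, ?_⟩
  · rw [gridPt, ← le_div_iff₀ hh]; exact Int.floor_le _
  · rw [gridPt, ← div_lt_iff₀ hh]; push_cast; exact Int.lt_floor_add_one _

theorem exists_mem_double_grid {h : ℝ} (hh : 0 < h) (x : ℝ) :
    ∃ j : ℤ, gridPt h (2 * j) ≤ x ∧ x < gridPt h (2 * j + 2) := by
  refine ⟨⌊x / (2 * h)⌋, ?_, ?_⟩
  · have := Int.floor_le (x / (2 * h))
    rw [le_div_iff₀ (by positivity)] at this
    rw [gridPt]; push_cast; linarith
  · have := Int.lt_floor_add_one (x / (2 * h))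
    rw [div_lt_iff₀ (by positivity)] at this
    rw [gridPt]; push_cast; linarith

theorem ae_not_grid (h : ℝ) : ∀ᵐ x : ℝ, ∀ i : ℤ, x ≠ gridPt h i := by
  rw [ae_all_iff]
  intro i
  exact compl_mem_ae_iff.mpr (measure_singleton (gridPt h i))

theorem gridPt_lt {h : ℝ} (hh : 0 < h) {i j : ℤ} (hij : i < j) : gridPt h i < gridPt h j := by
  simp only [gridPt]
  have : (i : ℝ) < j := by exact_mod_cast hij
  exact mul_lt_mul_of_pos_right this hh

theorem gridPt_le {h : ℝ} (hh : 0 < h) {i j : ℤ} (hij : i ≤ j) : gridPt h i ≤ gridPt h j := by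
  simp only [gridPt]
  have : (i : ℝ) ≤ j := by exact_mod_cast hij
  exact mul_le_mul_of_nonneg_right this hh.le

theorem gridIdx_eq {h : ℝ} (hh : 0 < h) {x : ℝ} {j : ℤ} (h1 : gridPt h (2 * j) < x)
    (h2 : x ≤ gridPt h (2 * j + 2)) : gridIdx h x = j := by
  have : ⌈x / (2 * h)⌉ = j + 1 := by
    rw [Int.ceil_eq_iff]
    simp only [gridPt] at h1 h2
    push_cast at h1 h2 ⊢
    constructor
    · rw [lt_div_iff₀ (by positivity)]; linarith
    · rw [div_le_iff₀ (by positivity)]; linarith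
  rw [gridIdx, this]; ring

/-! ## The projected data -/

/-- The slope of the projected wave profile between `x_i` and `x_{i+1}`. -/
def halfSlope (h : ℝ) (σ : ℤ → ℝ) (Z : Euler) (i : ℤ) : ℝ :=
  if i % 2 = 0 then slopeL h σ Z (i / 2) else slopeR h σ Z (i / 2)

section Proj

variable {h : ℝ} {σ : ℤ → ℝ} {Z : Euler} {g : ℝ → ℝ}

theorem halfSlope_even (j : ℤ) : halfSlope h σ Z (2 * j) = slopeL h σ Z j := by
  simp [halfSlope]

theorem halfSlope_odd (j : ℤ) : halfSlope h σ Z (2 * j + 1) = slopeR h σ Z j := by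
  have h1 : (2 * j + 1) % 2 = 1 := by omega
  have h2 : (2 * j + 1) / 2 = j := by omega
  simp [halfSlope, h1, h2]

theorem projU_left (hh : 0 < h) {j : ℤ} {x : ℝ} (h1 : gridPt h (2 * j) < x)
    (h2 : x ≤ gridPt h (2 * j + 1)) : projU h σ Z x =
      Z.u (gridPt h (2 * j)) + slopeL h σ Z j * (x - gridPt h (2 * j)) := by
  have h3 := h2.trans (gridPt_lt hh (by omega : 2 * j + 1 < 2 * j + 2)).le
  simp only [projU, gridIdx_eq hh h1 h3, if_pos h2]

theorem projU_right (hh : 0 < h) {j : ℤ} {x : ℝ} (h1 : gridPt h (2 * j + 1) < x)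
    (h2 : x ≤ gridPt h (2 * j + 2)) : projU h σ Z x =
      Z.u (gridPt h (2 * j + 2)) + slopeR h σ Z j * (x - gridPt h (2 * j + 2)) := by
  have h3 := (gridPt_lt hh (by omega : 2 * j < 2 * j + 1)).trans h1
  simp only [projU, gridIdx_eq hh h3 h2, if_neg (not_le.mpr h1)]

theorem projU_even (hh : 0 < h) (j : ℤ) : projU h σ Z (gridPt h (2 * j)) = Z.u (gridPt h (2 * j)) := by
  have e : 2 * j = 2 * (j - 1) + 2 := by ring
  rw [e, projU_right hh (gridPt_lt hh (by omega)) le_rfl, sub_self, mul_zero, add_zero]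

theorem projU_gridAffine (hh : 0 < h) : GridAffine h (projU h σ Z) (halfSlope h σ Z) := by
  intro i x hx
  rcases Int.even_or_odd' i with ⟨j, rfl | rfl⟩
  · rw [halfSlope_even, projU_even hh]
    rcases hx.1.eq_or_lt with h1 | h1
    · rw [← h1, projU_even hh]; ring
    · exact projU_left hh h1 hx.2
  · have e : 2 * j + 1 + 1 = 2 * j + 2 := by ring
    rw [e] at hx
    rw [halfSlope_odd, projU_left hh (gridPt_lt hh (by omega)) le_rfl]
    have hxx : projU h σ Z x = Z.u (gridPt h (2 * j)) +
        slopeL h σ Z j * (gridPt h (2 * j + 1) - gridPt h (2 * j)) +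
        slopeR h σ Z j * (gridPt h (2 * j + 1) - gridPt h (2 * j + 1)) →
        x = gridPt h (2 * j + 1) → projU h σ Z x = Z.u (gridPt h (2 * j)) +
        slopeL h σ Z j * (gridPt h (2 * j + 1) - gridPt h (2 * j)) +
        slopeR h σ Z j * (x - gridPt h (2 * j + 1)) := fun h1 h2 => by rw [h1, h2]
    rcases hx.1.eq_or_lt with h1 | h1
    · rw [← h1, projU_left hh (gridPt_lt hh (by omega)) le_rfl]; ring
    · rw [projU_right hh h1 hx.2]
      simp only [slopeL, slopeR, diffQ, gridPt]
      push_cast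
      field_simp
      ring

theorem projFac_left (hh : 0 < h) {j : ℤ} {x : ℝ} (h1 : gridPt h (2 * j) < x)
    (h2 : x ≤ gridPt h (2 * j + 1)) : projFac h σ Z x =
      primAc Z (gridPt h (2 * j)) + slopeL h σ Z j ^ 2 * (x - gridPt h (2 * j)) := by
  have h3 := h2.trans (gridPt_lt hh (by omega : 2 * j + 1 < 2 * j + 2)).le
  simp only [projFac, gridIdx_eq hh h1 h3, if_pos h2]

theorem projFac_right (hh : 0 < h) {j : ℤ} {x : ℝ} (h1 : gridPt h (2 * j + 1) < x)
    (h2 : x ≤ gridPt h (2 * j + 2)) : projFac h σ Z x =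
      1 / 2 * (primAc Z (gridPt h (2 * j + 2)) + primAc Z (gridPt h (2 * j)))
      + 2 * σ j * diffQ h Z.u j * qCoef h Z j * h
      + slopeR h σ Z j ^ 2 * (x - gridPt h (2 * j + 1)) := by
  have h3 := (gridPt_lt hh (by omega : 2 * j < 2 * j + 1)).trans h1
  simp only [projFac, gridIdx_eq hh h3 h2, if_neg (not_le.mpr h1)]

variable (hZ : HasEnergySlope Z g) (hσ : ∀ j, σ j = 1 ∨ σ j = -1)
include hZ hσ

theorem qCoef_sq (hh : 0 < h) (j : ℤ) : qCoef h Z j ^ 2 =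
    diffQ h (primAc Z) j - diffQ h Z.u j ^ 2 := by
  refine Real.sq_sqrt ?_
  have h1 := hZ.cs_ac (gridPt_lt hh (by omega : 2 * j < 2 * j + 2)).le
  have e : gridPt h (2 * j + 2) - gridPt h (2 * j) = 2 * h := by simp only [gridPt]; push_cast; ring
  rw [e] at h1
  simp only [diffQ]
  rw [div_pow, sub_nonneg, div_le_div_iff₀ (by positivity) (by positivity)]
  nlinarith

theorem sigma_sq (j : ℤ) : σ j ^ 2 = 1 := by rcases hσ j with h | h <;> rw [h] <;> norm_num

theorem projFac_right_eq (hh : 0 < h) {j : ℤ} : 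
    1 / 2 * (primAc Z (gridPt h (2 * j + 2)) + primAc Z (gridPt h (2 * j)))
      + 2 * σ j * diffQ h Z.u j * qCoef h Z j * h + slopeR h σ Z j ^ 2 * h =
    primAc Z (gridPt h (2 * j + 2)) ∧
    1 / 2 * (primAc Z (gridPt h (2 * j + 2)) + primAc Z (gridPt h (2 * j)))
      + 2 * σ j * diffQ h Z.u j * qCoef h Z j * h =
    primAc Z (gridPt h (2 * j)) + slopeL h σ Z j ^ 2 * h := by
  have hq := qCoef_sq hZ hσ hh j
  have hs := sigma_sq hZ hσ j
  have hD : diffQ h (primAc Z) j * (2 * h) =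
      primAc Z (gridPt h (2 * j + 2)) - primAc Z (gridPt h (2 * j)) := by
    rw [diffQ]; field_simp
  simp only [slopeR, slopeL]
  constructor
  · linear_combination h * hq + h * (qCoef h Z j) ^ 2 * hs + hD / 2
  · linear_combination - h * hq - h * (qCoef h Z j) ^ 2 * hs - hD / 2

theorem projFac_even (hh : 0 < h) (j : ℤ) :
    projFac h σ Z (gridPt h (2 * j)) = primAc Z (gridPt h (2 * j)) := by
  have e : 2 * j = 2 * (j - 1) + 2 := by ring
  rw [e, projFac_right hh (gridPt_lt hh (by omega)) le_rfl]
  have e2 : gridPt h (2 * (j - 1) + 2) - gridPt h (2 * (j - 1) + 1) = h := by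
    simp only [gridPt]; push_cast; ring
  rw [e2, (projFac_right_eq hZ hσ hh).1]

theorem projFac_gridAffine (hh : 0 < h) :
    GridAffine h (projFac h σ Z) (fun i => halfSlope h σ Z i ^ 2) := by
  intro i x hx
  simp only
  rcases Int.even_or_odd' i with ⟨j, rfl | rfl⟩
  · rw [halfSlope_even, projFac_even hZ hσ hh]
    rcases hx.1.eq_or_lt with h1 | h1
    · rw [← h1, projFac_even hZ hσ hh]; ring
    · exact projFac_left hh h1 hx.2
  · have e : 2 * j + 1 + 1 = 2 * j + 2 := by ring
    rw [e] at hx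
    rcases hx.1.eq_or_lt with h1 | h1
    · rw [← h1]; ring
    · rw [halfSlope_odd, projFac_left hh (gridPt_lt hh (by omega)) le_rfl,
        projFac_right hh h1 hx.2, (projFac_right_eq hZ hσ hh).2]
      have e2 : gridPt h (2 * j + 1) - gridPt h (2 * j) = h := by
        simp only [gridPt]; push_cast; ring
      rw [e2]

theorem projFac_mono (hh : 0 < h) : Monotone (projFac h σ Z) :=
  (projFac_gridAffine hZ hσ hh).monotone hh fun _ => sq_nonneg _

theorem primAc_bounds (x : ℝ) : 0 ≤ primAc Z x ∧ primAc Z x ≤ (Z.μ univ).toReal := by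
  have := hZ.fin
  refine ⟨ENNReal.toReal_nonneg, ENNReal.toReal_mono (measure_ne_top _ _) ?_⟩
  exact (acPart_le Z.μ _).trans (measure_mono (subset_univ _))

theorem halfSlope_sq_le (hh : 0 < h) (i : ℤ) : halfSlope h σ Z i ^ 2 ≤ (Z.μ univ).toReal / h := by
  rw [le_div_iff₀ hh]
  have h1 := projFac_gridAffine hZ hσ hh i (gridPt h (i + 1))
    ⟨(gridPt_lt hh (by omega)).le, le_rfl⟩
  have e2 : gridPt h (i + 1) - gridPt h i = h := by simp only [gridPt]; push_cast; ring
  rw [e2] at h1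
  have hm := projFac_mono hZ hσ hh
  have h2 : projFac h σ Z (gridPt h (i + 1)) ≤ projFac h σ Z (gridPt h (2 * (i + 1))) ∨
      projFac h σ Z (gridPt h (i + 1)) ≤ (Z.μ univ).toReal := by
    right
    obtain ⟨j, -, hj⟩ := exists_mem_double_grid hh (gridPt h (i + 1))
    have := hm hj.le
    rw [show 2 * j + 2 = 2 * (j + 1) by ring, projFac_even hZ hσ hh] at this
    exact this.trans (primAc_bounds hZ hσ _).2
  have h3 : 0 ≤ projFac h σ Z (gridPt h i) := by
    obtain ⟨j, hj, -⟩ := exists_mem_double_grid hh (gridPt h i)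
    have := hm hj
    rw [projFac_even hZ hσ hh] at this
    exact (primAc_bounds hZ hσ _).1.trans this
  rcases h2 with h2 | h2
  · obtain ⟨j, -, hj⟩ := exists_mem_double_grid hh (gridPt h (i + 1))
    have := hm hj.le
    rw [show 2 * j + 2 = 2 * (j + 1) by ring, projFac_even hZ hσ hh] at this
    have := (primAc_bounds hZ hσ (gridPt h (2 * (j + 1)))).2
    linarith
  · linarith

theorem projFac_continuous (hh : 0 < h) : Continuous (projFac h σ Z) :=
  ((projFac_gridAffine hZ hσ hh).lipschitz hh (S := (Z.μ univ).toReal / h) fun i => by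
    rw [abs_of_nonneg (sq_nonneg _)]; exact halfSlope_sq_le hZ hσ hh i).continuous

theorem projU_cs (hh : 0 < h) {a b : ℝ} (hab : a ≤ b) :
    (projU h σ Z b - projU h σ Z a) ^ 2 ≤ (b - a) * (projFac h σ Z b - projFac h σ Z a) := by
  have key : ∀ l : ℝ, 0 ≤ (projFac h σ Z b - projFac h σ Z a) * (l * l) +
      (-2 * (projU h σ Z b - projU h σ Z a)) * l + (b - a) := by
    intro l
    have hm := ((projU_gridAffine hh (σ := σ) (Z := Z)).comb (projFac_gridAffine hZ hσ hh)
      1 (-2 * l) (l ^ 2)).monotone hh (fun i => by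
        have := sq_nonneg (1 - l * halfSlope h σ Z i); nlinarith) hab
    simp only at hm
    linarith
  have := discrim_le_zero key
  rw [discrim] at this
  linarith

theorem projFsing_eq (hh : 0 < h) {j : ℤ} {x : ℝ} (h1 : gridPt h (2 * j) < x)
    (h2 : x ≤ gridPt h (2 * j + 2)) : projFsing h Z x = primSing Z (gridPt h (2 * j + 2)) := by
  rw [projFsing, gridIdx_eq hh h1 h2]

theorem projFsing_mono (hh : 0 < h) : Monotone (projFsing h Z) := by
  have := hZ.fin
  intro a b hab
  refine primitive_mono (singPart Z.μ) (gridPt_le hh ?_)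
  have : gridIdx h a ≤ gridIdx h b := by
    simp only [gridIdx]
    have : a / (2 * h) ≤ b / (2 * h) := by gcongr
    have := Int.ceil_le_ceil this
    omega
  omega

theorem projF_mono (hh : 0 < h) : Monotone (projF h σ Z) :=
  (projFac_mono hZ hσ hh).add (projFsing_mono hZ hσ hh)

theorem projF_even (hh : 0 < h) (j : ℤ) :
    projF h σ Z (gridPt h (2 * j)) = primitive Z.μ (gridPt h (2 * j)) := by
  have := hZ.fin
  rw [projF, projFac_even hZ hσ hh, primitive_eq_add]
  congr 1
  rw [projFsing_eq hZ hσ hh (j := j - 1) (gridPt_lt hh (by omega)) (gridPt_le hh (by omega)),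
    show 2 * (j - 1) + 2 = 2 * j by ring]

theorem exists_mem_Ioc_grid (hh : 0 < h) (x : ℝ) :
    ∃ j : ℤ, gridPt h (2 * j) < x ∧ x ≤ gridPt h (2 * j + 2) := by
  obtain ⟨j, h1, h2⟩ := exists_mem_double_grid hh x
  rcases h1.eq_or_lt with h1 | h1
  · refine ⟨j - 1, h1 ▸ gridPt_lt hh (by omega), ?_⟩
    rw [← h1]; exact gridPt_le hh (by omega)
  · exact ⟨j, h1, h2.le⟩

theorem projF_left_tendsto (hh : 0 < h) (x : ℝ) :
    Tendsto (projF h σ Z) (𝓝[<] x) (𝓝 (projF h σ Z x)) := by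
  refine ((projFac_continuous hZ hσ hh).continuousAt.tendsto.mono_left nhdsWithin_le_nhds).add ?_
  obtain ⟨j, h1, h2⟩ := exists_mem_Ioc_grid hZ hσ hh x
  refine tendsto_const_nhds.congr' ?_
  filter_upwards [Ioo_mem_nhdsLT h1] with z hz
  rw [projFsing_eq hZ hσ hh h1 h2, projFsing_eq hZ hσ hh hz.1 (hz.2.le.trans h2)]

theorem projF_bounds (hh : 0 < h) (x : ℝ) :
    primitive Z.μ (x - 2 * h) ≤ projF h σ Z x ∧ projF h σ Z x ≤ primitive Z.μ (x + 2 * h) := by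
  have := hZ.fin
  obtain ⟨j, h1, h2⟩ := exists_mem_double_grid hh x
  have hm := projF_mono hZ hσ hh
  have e : gridPt h (2 * j + 2) = gridPt h (2 * j) + 2 * h := by simp only [gridPt]; push_cast; ring
  constructor
  · refine le_trans ?_ (hm h1)
    rw [projF_even hZ hσ hh]
    exact primitive_mono _ (by linarith)
  · refine (hm h2.le).trans ?_
    rw [show 2 * j + 2 = 2 * (j + 1) by ring, projF_even hZ hσ hh]
    refine primitive_mono _ ?_
    rw [show 2 * (j + 1) = 2 * j + 2 by ring]; linarith

theorem projF_atBot (hh : 0 < h) : Tendsto (projF h σ Z) atBot (𝓝 0) := by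
  have := hZ.fin
  exact tendsto_of_tendsto_of_tendsto_of_le_of_le
    ((tendsto_primitive_atBot Z.μ).comp (tendsto_atBot_add_const_right atBot (-(2 * h)) tendsto_id))
    ((tendsto_primitive_atBot Z.μ).comp (tendsto_atBot_add_const_right atBot (2 * h) tendsto_id))
    (fun x => (projF_bounds hZ hσ hh x).1) (fun x => (projF_bounds hZ hσ hh x).2)

theorem projF_atTop (hh : 0 < h) : Tendsto (projF h σ Z) atTop (𝓝 (Z.μ univ).toReal) := by
  have := hZ.fin
  exact tendsto_of_tendsto_of_tendsto_of_le_of_le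
    ((tendsto_primitive_atTop Z.μ).comp (tendsto_atTop_add_const_right atTop (-(2 * h)) tendsto_id))
    ((tendsto_primitive_atTop Z.μ).comp (tendsto_atTop_add_const_right atTop (2 * h) tendsto_id))
    (fun x => (projF_bounds hZ hσ hh x).1) (fun x => (projF_bounds hZ hσ hh x).2)

theorem proj_univ (hh : 0 < h) : (proj h σ Z).μ univ = Z.μ univ := by
  have := hZ.fin
  change measureOf (projF h σ Z) univ = _
  rw [measureOf_univ (projF_mono hZ hσ hh) (projF_left_tendsto hZ hσ hh) (projF_atBot hZ hσ hh)
    (projF_atTop hZ hσ hh), ENNReal.ofReal_toReal (measure_ne_top _ _)]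

theorem proj_primitive (hh : 0 < h) : primitive (proj h σ Z).μ = projF h σ Z :=
  primitive_measureOf (projF_mono hZ hσ hh) (projF_left_tendsto hZ hσ hh) (projF_atBot hZ hσ hh)

theorem proj_finite (hh : 0 < h) : IsFiniteMeasure (proj h σ Z).μ := by
  have := hZ.fin
  exact ⟨by rw [proj_univ hZ hσ hh]; exact measure_lt_top _ _⟩

theorem proj_Iic_even (hh : 0 < h) (j : ℤ) : ((proj h σ Z).μ (Iic (gridPt h (2 * j)))).toReal =
    projFac h σ Z (gridPt h (2 * j)) + primSing Z (gridPt h (2 * j + 2)) := by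
  have := proj_finite hZ hσ hh
  obtain ⟨u, h1, h2, h3⟩ := exists_seq_primitive_right (proj h σ Z).μ (gridPt h (2 * j))
  rw [proj_primitive hZ hσ hh] at h3
  refine tendsto_nhds_unique h3 ?_
  refine (((projFac_continuous hZ hσ hh).continuousAt.tendsto.comp h2).add_const _).congr' ?_
  filter_upwards [h2.eventually (gt_mem_nhds (gridPt_lt hh (by omega : 2 * j < 2 * j + 2)))]
    with n hn
  rw [Function.comp, projF, projFsing_eq hZ hσ hh (h1 n) hn.le]

theorem proj_measure_Ioo_ge (hh : 0 < h) {a b : ℝ} (hab : a < b) :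
    projFac h σ Z b - projFac h σ Z a ≤ ((proj h σ Z).μ (Ioo a b)).toReal := by
  have := proj_finite hZ hσ hh
  rw [measure_Ioo_toReal _ hab, proj_primitive hZ hσ hh]
  obtain ⟨u, h1, h2, h3⟩ := exists_seq_primitive_right (proj h σ Z).μ a
  rw [proj_primitive hZ hσ hh] at h3
  have h4 := ((projFac_continuous hZ hσ hh).continuousAt.tendsto.comp h2).add_const
    (projFsing h Z b)
  have h5 := le_of_tendsto_of_tendsto h3 h4 (by
    filter_upwards [h2.eventually (gt_mem_nhds hab)] with n hn
    exact add_le_add le_rfl (projFsing_mono hZ hσ hh hn.le))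
  simp only [projF] at h5 ⊢
  linarith

theorem projU_sub_le (hh : 0 < h) {j : ℤ} {x : ℝ}
    (hx : x ∈ Icc (gridPt h (2 * j)) (gridPt h (2 * j + 2))) :
    (projU h σ Z x - Z.u (gridPt h (2 * j))) ^ 2 ≤
      2 * h * primitive Z.μ (gridPt h (2 * j + 2)) := by
  have := hZ.fin
  rw [← projU_even hh (σ := σ)]
  refine (projU_cs hZ hσ hh hx.1).trans ?_
  have e : gridPt h (2 * j + 2) = gridPt h (2 * j) + 2 * h := by simp only [gridPt]; push_cast; ring
  have hm := projFac_mono hZ hσ hh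
  have h1 := hm hx.1
  have h2 := hm hx.2
  rw [show 2 * j + 2 = 2 * (j + 1) by ring, projFac_even hZ hσ hh] at h2
  rw [projFac_even hZ hσ hh] at h1 ⊢
  have h3 := (primAc_bounds hZ hσ (gridPt h (2 * j))).1
  have h4 : primAc Z (gridPt h (2 * (j + 1))) ≤ primitive Z.μ (gridPt h (2 * j + 2)) := by
    rw [primitive_eq_add, show 2 * j + 2 = 2 * (j + 1) by ring]
    have : 0 ≤ primSing Z (gridPt h (2 * (j + 1))) := ENNReal.toReal_nonneg
    linarith
  have h5 := hx.2
  exact mul_le_mul (by linarith) (by linarith) (by linarith) (by positivity)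

theorem u_sub_le (hh : 0 < h) {j : ℤ} {x : ℝ}
    (hx : x ∈ Icc (gridPt h (2 * j)) (gridPt h (2 * j + 2))) :
    (Z.u x - Z.u (gridPt h (2 * j))) ^ 2 ≤ 2 * h * primitive Z.μ (gridPt h (2 * j + 2)) := by
  have := hZ.fin
  refine (hZ.cs_ac hx.1).trans ?_
  have e : gridPt h (2 * j + 2) = gridPt h (2 * j) + 2 * h := by simp only [gridPt]; push_cast; ring
  have hm : Monotone (primAc Z) := primitive_mono (acPart Z.μ)
  have h1 := hm hx.1
  have h2 := hm hx.2
  have h3 := (primAc_bounds hZ hσ (gridPt h (2 * j))).1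
  have h4 : primAc Z (gridPt h (2 * j + 2)) ≤ primitive Z.μ (gridPt h (2 * j + 2)) := by
    rw [primitive_eq_add]
    have : 0 ≤ primSing Z (gridPt h (2 * j + 2)) := ENNReal.toReal_nonneg
    linarith
  have h5 := hx.2
  exact mul_le_mul (by linarith) (by linarith) (by linarith) (by positivity)

theorem proj_isGood (hh : 0 < h) (hbdd : ∃ C, ∀ x, |Z.u x| ≤ C) (hbot : ∃ l, Tendsto Z.u atBot (𝓝 l)) :
    IsGood (proj h σ Z) := by
  have := hZ.fin
  have hfin := proj_finite hZ hσ hh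
  refine ⟨hfin, rfl, fun a b hab => ?_, ?_, ?_, ?_⟩
  · refine (projU_cs hZ hσ hh hab.le).trans ?_
    exact mul_le_mul_of_nonneg_left (proj_measure_Ioo_ge hZ hσ hh hab) (by linarith)
  · filter_upwards [ae_not_grid h] with x hx
    obtain ⟨i, h1, h2⟩ := exists_mem_grid hh x
    have hi : x ∈ Ioo (gridPt h i) (gridPt h (i + 1)) := ⟨lt_of_le_of_ne h1 (hx i).symm, h2⟩
    refine ⟨halfSlope h σ Z i, (projU_gridAffine hh).hasDerivAt hi, ?_⟩
    rw [proj_primitive hZ hσ hh]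
    have hd := ((projFac_gridAffine hZ hσ hh).hasDerivAt hi).add_const (projFsing h Z x)
    refine hd.congr_of_eventuallyEq ?_
    obtain ⟨j, k1, k2⟩ := exists_mem_Ioc_grid hZ hσ hh x
    have k3 := lt_of_le_of_ne k2 (hx _)
    filter_upwards [Ioo_mem_nhds k1 k3] with z hz
    rw [projF, projFsing_eq hZ hσ hh k1 k2, projFsing_eq hZ hσ hh hz.1 hz.2.le]
  · obtain ⟨C, hC⟩ := hbdd
    refine ⟨C + Real.sqrt (2 * h * (Z.μ univ).toReal), fun x => ?_⟩
    obtain ⟨j, h1, h2⟩ := exists_mem_double_grid hh x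
    have h3 := projU_sub_le hZ hσ hh ⟨h1, h2.le⟩
    have h4 : |projU h σ Z x - Z.u (gridPt h (2 * j))| ≤
        Real.sqrt (2 * h * (Z.μ univ).toReal) := by
      refine Real.le_sqrt_of_sq_le ?_
      rw [sq_abs]
      refine h3.trans (mul_le_mul_of_nonneg_left (primitive_le Z.μ _) (by positivity))
    have h5 := hC (gridPt h (2 * j))
    have h6 := abs_add_le (Z.u (gridPt h (2 * j))) (projU h σ Z x - Z.u (gridPt h (2 * j)))
    rw [add_sub_cancel] at h6
    change |projU h σ Z x| ≤ _
    linarith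
  · obtain ⟨l, hl⟩ := hbot
    refine ⟨l, ?_⟩
    choose j hj1 hj2 using exists_mem_double_grid hh
    have hlim : Tendsto (fun x => gridPt h (2 * j x)) atBot atBot :=
      tendsto_atBot_mono hj1 tendsto_id
    have h1 : Tendsto (fun x => Z.u (gridPt h (2 * j x))) atBot (𝓝 l) := hl.comp hlim
    have h2 : Tendsto (fun x => Real.sqrt (2 * h * primitive Z.μ (x + 2 * h))) atBot (𝓝 0) := by
      have h3 := ((tendsto_primitive_atBot Z.μ).comp
        (tendsto_atBot_add_const_right atBot (2 * h) tendsto_id)).const_mul (2 * h)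
      rw [mul_zero] at h3
      have := (Real.continuous_sqrt.tendsto 0).comp h3
      rwa [Real.sqrt_zero] at this
    have h3 : Tendsto (fun x => projU h σ Z x - Z.u (gridPt h (2 * j x))) atBot (𝓝 0) := by
      refine squeeze_zero_norm (fun x => ?_) h2
      refine Real.le_sqrt_of_sq_le ?_
      rw [Real.norm_eq_abs, sq_abs]
      refine (projU_sub_le hZ hσ hh ⟨hj1 x, (hj2 x).le⟩).trans ?_
      refine mul_le_mul_of_nonneg_left (primitive_mono _ ?_) (by positivity)
      have e : gridPt h (2 * j x + 2) = gridPt h (2 * j x) + 2 * h := by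
        simp only [gridPt]; push_cast; ring
      have := hj1 x
      linarith
    have h4 := h3.add h1
    simp only [sub_add_cancel, zero_add] at h4
    exact h4

end Proj

end HunterSaxton
end

noncomputable section


namespace HunterSaxton

/-! ## Functions that are affine between nodes -/

/-- A monotone sequence of nodes that exhausts the line. -/
structure IsNodes (ξ : ℤ → ℝ) : Prop where
  mono : Monotone ξ
  atBot : Tendsto ξ atBot atBot
  atTop : Tendsto ξ atTop atTop

/-- `f` is affine with slope `c j` between the nodes `ξ j` and `ξ (j + 1)`. -/
def CellAffine (ξ : ℤ → ℝ) (f : ℝ → ℝ) (c : ℤ → ℝ) : Prop :=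
  ∀ j : ℤ, ∀ x ∈ Icc (ξ j) (ξ (j + 1)), f x = f (ξ j) + c j * (x - ξ j)

theorem CellAffine.hasDerivAt {ξ : ℤ → ℝ} {f : ℝ → ℝ} {c : ℤ → ℝ} (hf : CellAffine ξ f c) {j : ℤ}
    {x : ℝ} (hx : x ∈ Ioo (ξ j) (ξ (j + 1))) : HasDerivAt f (c j) x := by
  have h1 : HasDerivAt (fun z => f (ξ j) + c j * (z - ξ j)) (c j) x := by
    simpa using (((hasDerivAt_id x).sub_const (ξ j)).const_mul (c j)).const_add (f (ξ j))
  refine h1.congr_of_eventuallyEq ?_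
  filter_upwards [Ioo_mem_nhds hx.1 hx.2] with z hz
  exact hf j z ⟨hz.1.le, hz.2.le⟩

/-! ## Lagrangian coordinates of piecewise affine data -/

namespace IsGood

variable {Z : Euler} (hZ : IsGood Z)
include hZ

theorem lagrY_eq_of_mem_jump {x ξ : ℝ} (h1 : x + primitive Z.μ x ≤ ξ)
    (h2 : ξ ≤ x + (Z.μ (Iic x)).toReal) : lagrY Z ξ = x := by
  have := hZ.fin
  refine le_antisymm (le_of_forall_gt_imp_ge_of_dense fun z hz => ?_)
    ((hZ.le_lagrY_iff x ξ).mpr h1)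
  refine ((hZ.lagrY_lt_iff z ξ).mpr (h2.trans_lt ?_)).le
  have : (Z.μ (Iic x)).toReal ≤ primitive Z.μ z :=
    ENNReal.toReal_mono (measure_ne_top _ _) (measure_mono fun w hw => lt_of_le_of_lt hw hz)
  linarith

theorem lagrY_eq_of_affine {a b A m : ℝ} (hab : a < b) (hm : 0 ≤ m)
    (hF : ∀ x ∈ Ioc a b, primitive Z.μ x = A + m * (x - a)) (hA : primitive Z.μ a ≤ A)
    {ξ : ℝ} (hξ : ξ ∈ Icc (a + A) (b + primitive Z.μ b)) :
    lagrY Z ξ = a + 1 / (1 + m) * (ξ - (a + A)) := by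
  rcases hξ.1.eq_or_lt with h | h
  · rw [← h, sub_self, mul_zero, add_zero]
    refine le_antisymm (le_of_forall_gt_imp_ge_of_dense fun z hz => ?_)
      ((hZ.le_lagrY_iff a _).mpr (by linarith))
    refine le_trans ?_ (min_le_left z b)
    have hz' : min z b ∈ Ioc a b := ⟨lt_min hz hab, min_le_right _ _⟩
    refine ((hZ.lagrY_lt_iff _ _).mpr ?_).le
    rw [hF _ hz']
    have := mul_nonneg hm (sub_pos.mpr hz'.1).le
    linarith [hz'.1]
  · set x := a + 1 / (1 + m) * (ξ - (a + A)) with hx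
    have hm' : 0 < 1 + m := by linarith
    have e : (1 + m) * (x - a) = ξ - (a + A) := by rw [hx]; field_simp; ring
    have hb := hξ.2
    rw [hF b ⟨hab, le_rfl⟩] at hb
    have h1 : a < x := by
      rw [hx]; have : 0 < 1 / (1 + m) * (ξ - (a + A)) := mul_pos (by positivity) (by linarith)
      linarith
    have h2 : x ≤ b := by
      have : (1 + m) * (x - a) ≤ (1 + m) * (b - a) := by rw [e]; linarith
      linarith [le_of_mul_le_mul_left this hm']
    have h3 : x + primitive Z.μ x = ξ := by rw [hF x ⟨h1, h2⟩]; linarith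
    conv_lhs => rw [← h3]
    exact hZ.lagrY_apply x

end IsGood

section Nodes

variable (h : ℝ) (ν : Measure ℝ)

theorem lagrNodes_zero (j : ℤ) :
    lagrNodes h ν (3 * j) = gridPt h (2 * j) + primitive ν (gridPt h (2 * j)) := by
  have h1 : (3 * j) % 3 = 0 := by omega
  have h2 : (3 * j) / 3 = j := by omega
  simp only [lagrNodes, h1, h2, if_pos]

theorem lagrNodes_one (j : ℤ) :
    lagrNodes h ν (3 * j + 1) = gridPt h (2 * j) + (ν (Iic (gridPt h (2 * j)))).toReal := by
  have h1 : (3 * j + 1) % 3 = 1 := by omega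
  have h2 : (3 * j + 1) / 3 = j := by omega
  simp [lagrNodes, h1, h2]

theorem lagrNodes_two (j : ℤ) : lagrNodes h ν (3 * j + 2) =
    gridPt h (2 * j + 1) + primitive ν (gridPt h (2 * j + 1)) := by
  have h1 : (3 * j + 2) % 3 = 2 := by omega
  have h2 : (3 * j + 2) / 3 = j := by omega
  simp [lagrNodes, h1, h2]

theorem exists_eq_three_mul (i : ℤ) : ∃ j, i = 3 * j ∨ i = 3 * j + 1 ∨ i = 3 * j + 2 :=
  ⟨i / 3, by omega⟩

theorem lagrNodes_isNodes {h : ℝ} (hh : 0 < h) [IsFiniteMeasure ν] : IsNodes (lagrNodes h ν) := by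
  have hmono : Monotone (lagrNodes h ν) := by
    refine monotone_int_of_le_succ fun i => ?_
    have key : ∀ a b : ℝ, a < b → (ν (Iic a)).toReal ≤ primitive ν b := fun a b hab =>
      ENNReal.toReal_mono (measure_ne_top _ _) (measure_mono fun w hw => lt_of_le_of_lt hw hab)
    obtain ⟨j, rfl | rfl | rfl⟩ := exists_eq_three_mul i
    · rw [lagrNodes_zero, lagrNodes_one]
      have := primitive_le_Iic ν (gridPt h (2 * j))
      linarith
    · rw [lagrNodes_one, show 3 * j + 1 + 1 = 3 * j + 2 by ring, lagrNodes_two]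
      have h1 := gridPt_lt hh (by omega : 2 * j < 2 * j + 1)
      linarith [key _ _ h1]
    · rw [lagrNodes_two, show 3 * j + 2 + 1 = 3 * (j + 1) by ring, lagrNodes_zero]
      have h1 := gridPt_lt hh (by omega : 2 * j + 1 < 2 * (j + 1))
      linarith [primitive_mono ν h1.le]
  refine ⟨hmono, tendsto_atBot_atBot_of_monotone hmono fun b => ?_,
    tendsto_atTop_atTop_of_monotone hmono fun b => ?_⟩
  · obtain ⟨j, hj, -⟩ := exists_mem_double_grid hh (b - (ν univ).toReal)
    refine ⟨3 * j, ?_⟩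
    rw [lagrNodes_zero]
    linarith [primitive_le ν (gridPt h (2 * j))]
  · obtain ⟨j, -, hj⟩ := exists_mem_double_grid hh b
    refine ⟨3 * (j + 1), ?_⟩
    rw [lagrNodes_zero, show 2 * (j + 1) = 2 * j + 2 by ring]
    linarith [primitive_nonneg ν (gridPt h (2 * j + 2))]

end Nodes

section ProjCells

variable {h : ℝ} {σ : ℤ → ℝ} {Z : Euler} {g : ℝ → ℝ}

/-- The slopes of the characteristics of the projected data in the Lagrangian cells. -/
def cellSlopeY (h : ℝ) (σ : ℤ → ℝ) (Z : Euler) (i : ℤ) : ℝ :=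
  if i % 3 = 0 then 0
  else if i % 3 = 1 then 1 / (1 + slopeL h σ Z (i / 3) ^ 2)
  else 1 / (1 + slopeR h σ Z (i / 3) ^ 2)

/-- The slopes of the Lagrangian velocity of the projected data in the Lagrangian cells. -/
def cellSlopeU (h : ℝ) (σ : ℤ → ℝ) (Z : Euler) (i : ℤ) : ℝ :=
  if i % 3 = 0 then 0
  else if i % 3 = 1 then slopeL h σ Z (i / 3) * (1 / (1 + slopeL h σ Z (i / 3) ^ 2))
  else slopeR h σ Z (i / 3) * (1 / (1 + slopeR h σ Z (i / 3) ^ 2))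

theorem cellSlopes_zero (j : ℤ) :
    cellSlopeY h σ Z (3 * j) = 0 ∧ cellSlopeU h σ Z (3 * j) = 0 := by
  have h1 : (3 * j) % 3 = 0 := by omega
  simp only [cellSlopeY, cellSlopeU, h1, if_pos, and_self]

theorem cellSlopes_one (j : ℤ) :
    cellSlopeY h σ Z (3 * j + 1) = 1 / (1 + slopeL h σ Z j ^ 2) ∧
    cellSlopeU h σ Z (3 * j + 1) = slopeL h σ Z j * (1 / (1 + slopeL h σ Z j ^ 2)) := by
  have h1 : (3 * j + 1) % 3 = 1 := by omega
  have h2 : (3 * j + 1) / 3 = j := by omega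
  simp [cellSlopeY, cellSlopeU, h1, h2]

theorem cellSlopes_two (j : ℤ) :
    cellSlopeY h σ Z (3 * j + 2) = 1 / (1 + slopeR h σ Z j ^ 2) ∧
    cellSlopeU h σ Z (3 * j + 2) = slopeR h σ Z j * (1 / (1 + slopeR h σ Z j ^ 2)) := by
  have h1 : (3 * j + 2) % 3 = 2 := by omega
  have h2 : (3 * j + 2) / 3 = j := by omega
  simp [cellSlopeY, cellSlopeU, h1, h2]

variable (hZ : HasEnergySlope Z g) (hσ : ∀ j, σ j = 1 ∨ σ j = -1) (hh : 0 < h)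
  (hgood : IsGood (proj h σ Z))
include hZ hσ hh hgood

theorem proj_cell_zero (j : ℤ) {ξ : ℝ} (hξ : ξ ∈ Icc (lagrNodes h (proj h σ Z).μ (3 * j))
    (lagrNodes h (proj h σ Z).μ (3 * j + 1))) : lagrY (proj h σ Z) ξ = gridPt h (2 * j) := by
  rw [lagrNodes_zero, lagrNodes_one] at hξ
  exact hgood.lagrY_eq_of_mem_jump hξ.1 hξ.2

theorem proj_cell_one (j : ℤ) {ξ : ℝ} (hξ : ξ ∈ Icc (lagrNodes h (proj h σ Z).μ (3 * j + 1))
    (lagrNodes h (proj h σ Z).μ (3 * j + 2))) : lagrY (proj h σ Z) ξ = gridPt h (2 * j) +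
      1 / (1 + slopeL h σ Z j ^ 2) * (ξ - lagrNodes h (proj h σ Z).μ (3 * j + 1)) := by
  have := hgood.fin
  rw [lagrNodes_one, lagrNodes_two] at *
  refine hgood.lagrY_eq_of_affine (gridPt_lt hh (by omega)) (sq_nonneg _) (fun x hx => ?_)
    (primitive_le_Iic _ _) hξ
  have h2 := hx.2.trans (gridPt_le hh (by omega : 2 * j + 1 ≤ 2 * j + 2))
  rw [proj_primitive hZ hσ hh, proj_Iic_even hZ hσ hh, projF, projFsing_eq hZ hσ hh hx.1 h2,
    projFac_gridAffine hZ hσ hh (2 * j) x ⟨hx.1.le, hx.2⟩]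
  simp only [halfSlope_even]
  ring

theorem proj_cell_two (j : ℤ) {ξ : ℝ} (hξ : ξ ∈ Icc (lagrNodes h (proj h σ Z).μ (3 * j + 2))
    (lagrNodes h (proj h σ Z).μ (3 * j + 2 + 1))) : lagrY (proj h σ Z) ξ = gridPt h (2 * j + 1) +
      1 / (1 + slopeR h σ Z j ^ 2) * (ξ - lagrNodes h (proj h σ Z).μ (3 * j + 2)) := by
  have := hgood.fin
  rw [show 3 * j + 2 + 1 = 3 * (j + 1) by ring, lagrNodes_zero] at hξ
  rw [lagrNodes_two] at *
  refine hgood.lagrY_eq_of_affine (gridPt_lt hh (by omega)) (sq_nonneg _) (fun x hx => ?_)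
    le_rfl hξ
  rw [show 2 * (j + 1) = 2 * j + 1 + 1 by ring] at hx
  have h0 := gridPt_lt hh (by omega : 2 * j < 2 * j + 1)
  have e : gridPt h (2 * j + 1 + 1) = gridPt h (2 * j + 2) := by ring_nf
  rw [proj_primitive hZ hσ hh, projF, projF, projFsing_eq hZ hσ hh (h0.trans hx.1) (e ▸ hx.2),
    projFsing_eq hZ hσ hh h0 (gridPt_le hh (by omega)),
    projFac_gridAffine hZ hσ hh (2 * j + 1) x ⟨hx.1.le, hx.2⟩]
  simp only [halfSlope_odd]
  ring

theorem proj_y_cellAffine :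
    CellAffine (lagrNodes h (proj h σ Z).μ) (mapL (proj h σ Z)).y (cellSlopeY h σ Z) := by
  have := hgood.fin
  have hn := (lagrNodes_isNodes (proj h σ Z).μ hh).mono
  intro i x hx
  have hl : lagrNodes h (proj h σ Z).μ i ∈ Icc (lagrNodes h (proj h σ Z).μ i)
    (lagrNodes h (proj h σ Z).μ (i + 1)) := ⟨le_rfl, hn (by omega)⟩
  obtain ⟨j, rfl | rfl | rfl⟩ := exists_eq_three_mul i
  · simp only [mapL]
    rw [(cellSlopes_zero j).1, proj_cell_zero hZ hσ hh hgood j hx,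
      proj_cell_zero hZ hσ hh hgood j hl]; ring
  · rw [show 3 * j + 1 + 1 = 3 * j + 2 by ring] at hx hl
    simp only [mapL]
    rw [(cellSlopes_one j).1, proj_cell_one hZ hσ hh hgood j hx,
      proj_cell_one hZ hσ hh hgood j hl]; ring
  · simp only [mapL]
    rw [(cellSlopes_two j).1, proj_cell_two hZ hσ hh hgood j hx,
      proj_cell_two hZ hσ hh hgood j hl]; ring

theorem proj_y_nodes (j : ℤ) :
    (mapL (proj h σ Z)).y (lagrNodes h (proj h σ Z).μ (3 * j)) = gridPt h (2 * j) ∧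
    (mapL (proj h σ Z)).y (lagrNodes h (proj h σ Z).μ (3 * j + 1)) = gridPt h (2 * j) ∧
    (mapL (proj h σ Z)).y (lagrNodes h (proj h σ Z).μ (3 * j + 2)) = gridPt h (2 * j + 1) := by
  have := hgood.fin
  have hn := (lagrNodes_isNodes (proj h σ Z).μ hh).mono
  refine ⟨?_, ?_, ?_⟩ <;> simp only [mapL]
  · exact proj_cell_zero hZ hσ hh hgood j ⟨le_rfl, hn (by omega)⟩
  · exact proj_cell_zero hZ hσ hh hgood j ⟨hn (by omega), le_rfl⟩
  · rw [proj_cell_two hZ hσ hh hgood j ⟨le_rfl, hn (by omega)⟩]; ring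

theorem proj_U_cellAffine :
    CellAffine (lagrNodes h (proj h σ Z).μ) (mapL (proj h σ Z)).U (cellSlopeU h σ Z) := by
  have := hgood.fin
  have hn := (lagrNodes_isNodes (proj h σ Z).μ hh).mono
  intro i x hx
  have hl : lagrNodes h (proj h σ Z).μ i ∈ Icc (lagrNodes h (proj h σ Z).μ i)
    (lagrNodes h (proj h σ Z).μ (i + 1)) := ⟨le_rfl, hn (by omega)⟩
  have hr : lagrNodes h (proj h σ Z).μ (i + 1) ∈ Icc (lagrNodes h (proj h σ Z).μ i)
    (lagrNodes h (proj h σ Z).μ (i + 1)) := ⟨hn (by omega), le_rfl⟩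
  have hy := proj_y_cellAffine hZ hσ hh hgood i x hx
  have m1 := hgood.lagrY_mono hx.1
  have m2 := hgood.lagrY_mono hx.2
  obtain ⟨j, rfl | rfl | rfl⟩ := exists_eq_three_mul i
  · change projU h σ Z (lagrY (proj h σ Z) x) = projU h σ Z (lagrY (proj h σ Z) _) + _
    rw [(cellSlopes_zero j).2, proj_cell_zero hZ hσ hh hgood j hx,
      proj_cell_zero hZ hσ hh hgood j hl]; ring
  · change projU h σ Z (lagrY (proj h σ Z) x) = projU h σ Z (lagrY (proj h σ Z) _) + _
    have e1 := (proj_y_nodes hZ hσ hh hgood j).2.1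
    have e2 := (proj_y_nodes hZ hσ hh hgood j).2.2
    rw [show 3 * j + 1 + 1 = 3 * j + 2 by ring] at m2
    simp only [mapL] at e1 e2 hy
    rw [e1] at m1 hy
    rw [e2] at m2
    rw [(cellSlopes_one j).1] at hy
    rw [e1, (cellSlopes_one j).2, projU_gridAffine hh (2 * j) _ ⟨m1, m2⟩, hy, halfSlope_even]
    ring
  · change projU h σ Z (lagrY (proj h σ Z) x) = projU h σ Z (lagrY (proj h σ Z) _) + _
    have e1 := (proj_y_nodes hZ hσ hh hgood j).2.2
    have e2 := (proj_y_nodes hZ hσ hh hgood (j + 1)).1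
    rw [show 3 * j + 2 + 1 = 3 * (j + 1) by ring] at m2
    simp only [mapL] at e1 e2 hy
    rw [e1] at m1 hy
    rw [e2, show 2 * (j + 1) = 2 * j + 1 + 1 by ring] at m2
    rw [(cellSlopes_two j).1] at hy
    rw [e1, (cellSlopes_two j).2, projU_gridAffine hh (2 * j + 1) _ ⟨m1, m2⟩, hy, halfSlope_odd]
    ring

theorem proj_cell_large (i : ℤ) (hi : cellSlopeY h σ Z i ≠ 0) :
    h ≤ len (lagrNodes h (proj h σ Z).μ) i := by
  have := hgood.fin
  have hn := (lagrNodes_isNodes (proj h σ Z).μ hh).mono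
  have hr : lagrNodes h (proj h σ Z).μ (i + 1) ∈ Icc (lagrNodes h (proj h σ Z).μ i)
    (lagrNodes h (proj h σ Z).μ (i + 1)) := ⟨hn (by omega), le_rfl⟩
  have hy := proj_y_cellAffine hZ hσ hh hgood i _ hr
  have key : ∀ a b s : ℝ, b = a + h → b = a + 1 / (1 + s ^ 2) *
      (lagrNodes h (proj h σ Z).μ (i + 1) - lagrNodes h (proj h σ Z).μ i) →
      h ≤ len (lagrNodes h (proj h σ Z).μ) i := by
    intro a b s h1 h2
    have hs : (0:ℝ) < 1 + s ^ 2 := by positivity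
    have e : h * (1 + s ^ 2) = len (lagrNodes h (proj h σ Z).μ) i := by
      rw [len]
      have : h = 1 / (1 + s ^ 2) *
        (lagrNodes h (proj h σ Z).μ (i + 1) - lagrNodes h (proj h σ Z).μ i) := by linarith
      field_simp at this; linarith
    rw [← e]
    nlinarith [sq_nonneg s]
  obtain ⟨j, rfl | rfl | rfl⟩ := exists_eq_three_mul i
  · exact absurd (cellSlopes_zero j).1 hi
  · have e1 := (proj_y_nodes hZ hσ hh hgood j).2.1
    have e2 := (proj_y_nodes hZ hσ hh hgood j).2.2
    rw [show 3 * j + 1 + 1 = 3 * j + 2 by ring] at *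
    rw [e1, e2, (cellSlopes_one j).1] at hy
    refine key _ _ _ ?_ hy
    simp only [gridPt]; push_cast; ring
  · have e1 := (proj_y_nodes hZ hσ hh hgood j).2.2
    have e2 := (proj_y_nodes hZ hσ hh hgood (j + 1)).1
    rw [show 3 * j + 2 + 1 = 3 * (j + 1) by ring] at *
    rw [e1, e2, (cellSlopes_two j).1] at hy
    refine key _ _ _ ?_ hy
    simp only [gridPt]; push_cast; ring

theorem singPart_le_volume_concentrated :
    singPart Z.μ univ ≤ volume {η | deriv (mapL (proj h σ Z)).H η = 1} := by
  have := hgood.fin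
  have hfin := hZ.fin
  set ξ := lagrNodes h (proj h σ Z).μ with hξ
  have hn := (lagrNodes_isNodes (proj h σ Z).μ hh).mono
  have hsub : ∀ j : ℤ, Ioo (ξ (3 * j)) (ξ (3 * j + 1)) ⊆
      {η | deriv (mapL (proj h σ Z)).H η = 1} := by
    intro j η hη
    have h1 := (proj_y_cellAffine hZ hσ hh hgood).hasDerivAt hη
    rw [(cellSlopes_zero j).1] at h1
    have h2 := ((hasDerivAt_id η).sub h1).deriv
    rw [sub_zero] at h2
    exact h2
  have hlen : ∀ j : ℤ, volume (Ioo (ξ (3 * j)) (ξ (3 * j + 1))) =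
      ENNReal.ofReal (primSing Z (gridPt h (2 * (j + 1))) - primSing Z (gridPt h (2 * j))) := by
    intro j
    rw [Real.volume_Ioo]
    congr 1
    rw [hξ, lagrNodes_one, lagrNodes_zero, proj_primitive hZ hσ hh, proj_Iic_even hZ hσ hh,
      projF_even hZ hσ hh, primitive_eq_add, projFac_even hZ hσ hh,
      show 2 * (j + 1) = 2 * j + 2 by ring]
    ring
  have hsm : Monotone (primSing Z) := primitive_mono (singPart Z.μ)
  have hsum : ∀ n : ℕ, ENNReal.ofReal (primSing Z (gridPt h (2 * (-(n : ℤ) + (2 * n : ℕ)))) -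
      primSing Z (gridPt h (2 * (-(n : ℤ))))) ≤
      volume {η | deriv (mapL (proj h σ Z)).H η = 1} := by
    intro n
    have h1 : ∑ k ∈ Finset.range (2 * n),
        volume (Ioo (ξ (3 * (-(n:ℤ) + k))) (ξ (3 * (-(n:ℤ) + k) + 1))) ≤
        volume {η | deriv (mapL (proj h σ Z)).H η = 1} := by
      rw [← measure_biUnion_finset]
      · exact measure_mono (iUnion₂_subset fun k _ => hsub _)
      · intro a _ b _ hab
        rw [Function.onFun, Set.disjoint_left]
        intro x hx hx'
        rcases lt_or_gt_of_ne hab with hab | hab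
        · have := hn (by omega : 3 * (-(n:ℤ) + a) + 1 ≤ 3 * (-(n:ℤ) + b))
          linarith [hx.2, hx'.1]
        · have := hn (by omega : 3 * (-(n:ℤ) + b) + 1 ≤ 3 * (-(n:ℤ) + a))
          linarith [hx.1, hx'.2]
      · exact fun _ _ => measurableSet_Ioo
    refine le_trans (le_of_eq ?_) h1
    have h2 := Finset.sum_range_sub (fun k : ℕ => primSing Z (gridPt h (2 * (-(n:ℤ) + k)))) (2 * n)
    simp only [Nat.cast_zero, add_zero] at h2
    rw [← h2, ENNReal.ofReal_sum_of_nonneg]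
    · refine Finset.sum_congr rfl fun k _ => ?_
      rw [hlen]; push_cast; ring_nf
    · intro k _
      exact sub_nonneg.mpr (hsm (gridPt_le hh (by push_cast; omega)))
  have hgrid : Tendsto (fun n : ℕ => (n : ℝ) * (2 * h)) atTop atTop :=
    tendsto_natCast_atTop_atTop.atTop_mul_const (by positivity)
  have l1 : Tendsto (fun n : ℕ => primSing Z (gridPt h (2 * (-(n : ℤ) + (2 * n : ℕ))))) atTop
      (𝓝 (singPart Z.μ univ).toReal) := by
    refine (tendsto_primitive_atTop (singPart Z.μ)).comp (hgrid.congr fun n => ?_)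
    simp only [gridPt]; push_cast; ring
  have l2 : Tendsto (fun n : ℕ => primSing Z (gridPt h (2 * (-(n : ℤ))))) atTop (𝓝 0) := by
    refine (tendsto_primitive_atBot (singPart Z.μ)).comp
      ((tendsto_neg_atTop_atBot.comp hgrid).congr fun n => ?_)
    simp only [gridPt, Function.comp]; push_cast; ring
  have l3 := ENNReal.tendsto_ofReal (l1.sub l2)
  rw [sub_zero, ENNReal.ofReal_toReal (measure_ne_top _ _)] at l3
  exact le_of_tendsto' l3 hsum

end ProjCells

end HunterSaxton
end

noncomputable section


namespace HunterSaxton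

/-! ## Tools for convergence in mean -/

theorem eLpNorm_two_eq {f : ℝ → ℝ} (hf : MemLp f 2 volume) :
    eLpNorm f 2 volume = ENNReal.ofReal (Real.sqrt (∫ x, f x ^ 2)) := by
  rw [hf.eLpNorm_eq_integral_rpow_norm (by norm_num) (by norm_num)]
  congr 1
  have e : (2 : ℝ≥0∞).toReal = 2 := by norm_num
  rw [e, Real.sqrt_eq_rpow]
  congr 1
  · refine integral_congr_ae (Eventually.of_forall fun x => ?_)
    simp
  · norm_num

theorem integral_sq_le_of_eLpNorm_le {f : ℝ → ℝ} (hf : MemLp f 2 volume) {δ : ℝ} (hδ : 0 ≤ δ)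
    (h : eLpNorm f 2 volume ≤ ENNReal.ofReal δ) : ∫ x, f x ^ 2 ≤ δ ^ 2 := by
  rw [eLpNorm_two_eq hf, ENNReal.ofReal_le_ofReal_iff hδ, Real.sqrt_le_left hδ] at h
  exact h

theorem exists_subseq_ae {f : ℕ → ℝ → ℝ} (hi : ∀ n, Integrable (f n)) (h0 : ∀ n x, 0 ≤ f n x)
    (h : Tendsto (fun n => ∫ x, f n x) atTop (𝓝 0)) :
    ∃ ns : ℕ → ℕ, StrictMono ns ∧ ∀ᵐ x, Tendsto (fun k => f (ns k) x) atTop (𝓝 0) := by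
  have h1 : Tendsto (fun n => eLpNorm (f n - fun _ => (0:ℝ)) 1 volume) atTop (𝓝 0) := by
    have h2 := ENNReal.tendsto_ofReal h
    rw [ENNReal.ofReal_zero] at h2
    refine h2.congr fun n => ?_
    rw [eLpNorm_one_eq_lintegral_enorm, ← ofReal_integral_norm_eq_lintegral_enorm]
    · congr 1
      refine integral_congr_ae (Eventually.of_forall fun x => ?_)
      simp [abs_of_nonneg (h0 n x)]
    · exact (hi n).sub (integrable_zero ℝ ℝ volume)
  have h2 := tendstoInMeasure_of_tendsto_eLpNorm one_ne_zero
    (fun n => (hi n).aestronglyMeasurable) aestronglyMeasurable_const h1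
  obtain ⟨ns, hns, h3⟩ := h2.exists_seq_tendsto_ae
  exact ⟨ns, hns, h3⟩

theorem tendsto_integral_mul_deriv {E : ℕ → ℝ → ℝ} {φ : ℝ → ℝ} {L : ℝ≥0} {C : ℝ}
    (hL : ∀ n, LipschitzWith L (E n))
    (hi : ∀ n, Integrable (fun x => deriv (E n) x ^ 2)) (hC : ∀ n, ∫ x, deriv (E n) x ^ 2 ≤ C)
    {ε : ℕ → ℝ} (hE : ∀ n x, |E n x| ≤ ε n) (hε : Tendsto ε atTop (𝓝 0)) (hφ : MemLp φ 2 volume) :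
    Tendsto (fun n => ∫ x, deriv (E n) x * φ x) atTop (𝓝 0) := by
  have hC0 : 0 ≤ C := (integral_nonneg fun _ => sq_nonneg _).trans (hC 0)
  have hm : ∀ n, MemLp (deriv (E n)) 2 volume := fun n =>
    (memLp_two_iff_integrable_sq (measurable_deriv _).aestronglyMeasurable).mpr (hi n)
  rw [Metric.tendsto_atTop]
  intro r hr
  set δ := r / (2 * (C + 1)) with hδ
  have hδ0 : 0 < δ := by positivity
  obtain ⟨ψ, hψ1, hψ2, hψ3⟩ := hφ.exist_eLpNorm_sub_le (by norm_num) (by norm_num) hδ0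
  have hψm : MemLp ψ 2 volume := hψ2.continuous.memLp_of_hasCompactSupport hψ1
  obtain ⟨D, hD⟩ := ContDiff.lipschitzWith_of_hasCompactSupport hψ1 hψ2 (by simp)
  have hsq := integral_sq_le_of_eLpNorm_le (hφ.sub hψm) hδ0.le hψ3
  have hdi : Integrable (deriv ψ) :=
    (hψ2.continuous_deriv (by simp)).integrable_of_hasCompactSupport hψ1.deriv
  have hlim : Tendsto (fun n => ε n * ∫ x, |deriv ψ x|) atTop (𝓝 0) := by
    simpa using hε.mul_const (∫ x, |deriv ψ x|)
  obtain ⟨N, hN⟩ := (Metric.tendsto_atTop.mp hlim) (r / 2) (by positivity)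
  refine ⟨N, fun n hn => ?_⟩
  rw [Real.dist_eq, sub_zero]
  have hp : Integrable (fun x => deriv (E n) x * (φ x - ψ x)) :=
    (hm n).integrable_mul (hφ.sub hψm)
  have hq : Integrable (fun x => deriv (E n) x * ψ x) := (hm n).integrable_mul hψm
  have e1 : ∫ x, deriv (E n) x * φ x =
      (∫ x, deriv (E n) x * (φ x - ψ x)) + ∫ x, deriv (E n) x * ψ x := by
    rw [← integral_add hp hq]
    refine integral_congr_ae (Eventually.of_forall fun x => ?_)
    simp only; ring
  have b1 : |∫ x, deriv (E n) x * (φ x - ψ x)| ≤ δ * C + δ / 4 := by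
    refine (abs_integral_le_integral_abs).trans ?_
    have h1 : ∫ x, |deriv (E n) x * (φ x - ψ x)| ≤
        ∫ x, (δ * deriv (E n) x ^ 2 + 1 / (4 * δ) * (φ x - ψ x) ^ 2) := by
      refine integral_mono hp.abs (((hi n).const_mul _).add
        ((hφ.sub hψm).integrable_sq.const_mul _)) fun x => ?_
      simp only
      rw [abs_mul, ← sq_abs (deriv (E n) x), ← sq_abs (φ x - ψ x)]
      have : δ * |deriv (E n) x| ^ 2 + 1 / (4 * δ) * |φ x - ψ x| ^ 2 -
        |deriv (E n) x| * |φ x - ψ x| = (2 * δ * |deriv (E n) x| - |φ x - ψ x|) ^ 2 / (4 * δ) := by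
        field_simp; ring
      have : 0 ≤ (2 * δ * |deriv (E n) x| - |φ x - ψ x|) ^ 2 / (4 * δ) := by positivity
      linarith
    refine h1.trans ?_
    have i2 : Integrable (fun x => (φ x - ψ x) ^ 2) := (hφ.sub hψm).integrable_sq
    have hsq' : ∫ x, (φ x - ψ x) ^ 2 ≤ δ ^ 2 := hsq
    rw [integral_add ((hi n).const_mul _) (i2.const_mul _),
      integral_const_mul, integral_const_mul]
    have h2 : 1 / (4 * δ) * ∫ x, (φ x - ψ x) ^ 2 ≤ 1 / (4 * δ) * δ ^ 2 :=
      mul_le_mul_of_nonneg_left hsq' (by positivity)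
    have h3 : 1 / (4 * δ) * δ ^ 2 = δ / 4 := by field_simp
    have h4 := mul_le_mul_of_nonneg_left (hC n) hδ0.le
    linarith
  have b2 : |∫ x, deriv (E n) x * ψ x| ≤ ε n * ∫ x, |deriv ψ x| := by
    have h1 := LipschitzWith.integral_lineDeriv_mul_eq (μ := volume) (hL n) hD hψ1 (1:ℝ)
    simp only [lineDeriv_neg] at h1
    have h2 : ∀ f : ℝ → ℝ, ∀ x, lineDeriv ℝ f x 1 = deriv f x := fun f x => by
      simp only [lineDeriv, smul_eq_mul, mul_one]
      have := deriv_comp_const_add f x 0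
      simpa using this
    simp only [h2] at h1
    rw [h1, ← integral_const_mul]
    refine (abs_integral_le_integral_abs).trans (integral_mono_of_nonneg
      (Eventually.of_forall fun _ => abs_nonneg _) (hdi.abs.const_mul _)
      (Eventually.of_forall fun x => ?_))
    simp only
    rw [abs_mul, abs_neg, mul_comm]
    exact mul_le_mul_of_nonneg_right (hE n x) (abs_nonneg _)
  have b3 : ε n * ∫ x, |deriv ψ x| < r / 2 := by
    have := hN n hn
    rw [Real.dist_eq, sub_zero] at this
    exact (le_abs_self _).trans_lt this
  have b4 : δ * C + δ / 4 ≤ r / 2 := by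
    have : δ * (C + 1) = r / 2 := by rw [hδ]; field_simp
    nlinarith
  rw [e1]
  have := abs_add_le (∫ x, deriv (E n) x * (φ x - ψ x)) (∫ x, deriv (E n) x * ψ x)
  linarith

/-! ## Convergence of Lagrangian data -/

/-- Lagrangian data that converge uniformly and do not concentrate less energy than the limit. -/
structure ConvData (X : Lagr) (Xs : ℕ → Lagr) (G : ℝ) (d : ℕ → ℝ) : Prop where
  nice : IsNice X G
  nices : ∀ n, IsNice (Xs n) G
  d_lim : Tendsto d atTop (𝓝 0)
  y_le : ∀ n ξ, |X.y ξ - (Xs n).y ξ| ≤ d n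
  U_le : ∀ n ξ, |X.U ξ - (Xs n).U ξ| ≤ d n
  conc : ∀ n, volume {η | deriv X.H η = 1} ≤ volume {η | deriv (Xs n).H η = 1}

namespace ConvData

variable {X : Lagr} {Xs : ℕ → Lagr} {G : ℝ} {d : ℕ → ℝ} (h : ConvData X Xs G d)
include h

theorem comp {ns : ℕ → ℕ} (hns : Tendsto ns atTop atTop) :
    ConvData X (fun k => Xs (ns k)) G (fun k => d (ns k)) :=
  ⟨h.nice, fun _ => h.nices _, h.d_lim.comp hns, fun _ => h.y_le _, fun _ => h.U_le _,
    fun _ => h.conc _⟩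

theorem memLp_H {Y : Lagr} (hY : IsNice Y G) : MemLp (deriv Y.H) 2 volume := by
  refine (memLp_two_iff_integrable_sq (measurable_deriv _).aestronglyMeasurable).mpr ?_
  refine hY.integrable_deriv_H.mono' ((measurable_deriv _).pow_const 2).aestronglyMeasurable
    (Eventually.of_forall fun η => ?_)
  rw [Real.norm_of_nonneg (sq_nonneg _)]
  nlinarith [hY.deriv_H_nonneg η, hY.deriv_H_le η]

theorem memLp_U {Y : Lagr} (hY : IsNice Y G) : MemLp (deriv Y.U) 2 volume :=
  (memLp_two_iff_integrable_sq (measurable_deriv _).aestronglyMeasurable).mpr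
    hY.integrable_deriv_U_sq

theorem integral_sq_add {Y : Lagr} (hY : IsNice Y G) :
    (∫ η, deriv Y.H η ^ 2) + ∫ η, deriv Y.U η ^ 2 = G := by
  rw [← hY.integral_deriv_H, ← integral_add (h.memLp_H hY).integrable_sq (h.memLp_U hY).integrable_sq]
  refine integral_congr_ae ?_
  filter_upwards [hY.rel'] with η hη
  rw [hη]; ring

theorem integral_sq_le {Y : Lagr} (hY : IsNice Y G) :
    ∫ η, deriv Y.H η ^ 2 ≤ G ∧ ∫ η, deriv Y.U η ^ 2 ≤ G := by
  have h1 := h.integral_sq_add hY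
  have h2 : 0 ≤ ∫ η, deriv Y.H η ^ 2 := integral_nonneg fun _ => sq_nonneg _
  have h3 : 0 ≤ ∫ η, deriv Y.U η ^ 2 := integral_nonneg fun _ => sq_nonneg _
  constructor <;> linarith

theorem integral_mul_deriv_of_le {f : ℝ → ℝ} {fs : ℕ → ℝ → ℝ} (hf : LipschitzWith 1 f)
    (hfs : ∀ n, LipschitzWith 1 (fs n)) (hm : MemLp (deriv f) 2 volume)
    (hms : ∀ n, MemLp (deriv (fs n)) 2 volume) (hC : ∫ x, deriv f x ^ 2 ≤ G)
    (hCs : ∀ n, ∫ x, deriv (fs n) x ^ 2 ≤ G) (hd : ∀ n x, |f x - fs n x| ≤ d n) :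
    Tendsto (fun n => ∫ x, deriv (fs n) x * deriv f x) atTop (𝓝 (∫ x, deriv f x ^ 2)) := by
  have hae : ∀ n, ∀ᵐ x, deriv (fs n - f) x = deriv (fs n) x - deriv f x := by
    intro n
    filter_upwards [hf.ae_differentiableAt, (hfs n).ae_differentiableAt] with x h1 h2
    exact deriv_sub h2 h1
  have hi : ∀ n, Integrable (fun x => deriv (fs n - f) x ^ 2) := by
    intro n
    refine ((hms n).sub hm).integrable_sq.congr ?_
    filter_upwards [hae n] with x hx
    rw [hx]; rfl
  have hb : ∀ n, ∫ x, deriv (fs n - f) x ^ 2 ≤ 4 * G := by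
    intro n
    have : ∫ x, deriv (fs n - f) x ^ 2 ≤ ∫ x, (2 * deriv (fs n) x ^ 2 + 2 * deriv f x ^ 2) := by
      refine integral_mono_ae (hi n) (((hms n).integrable_sq.const_mul 2).add
        (hm.integrable_sq.const_mul 2)) ?_
      filter_upwards [hae n] with x hx
      rw [hx]
      nlinarith [sq_nonneg (deriv (fs n) x + deriv f x)]
    rw [integral_add ((hms n).integrable_sq.const_mul 2) (hm.integrable_sq.const_mul 2),
      integral_const_mul, integral_const_mul] at this
    linarith [hCs n]
  have key := tendsto_integral_mul_deriv (E := fun n => fs n - f) (φ := deriv f)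
    (fun n => (hfs n).sub hf) hi hb (fun n x => by
      rw [Pi.sub_apply, abs_sub_comm]; exact hd n x) h.d_lim hm
  have := key.add_const (∫ x, deriv f x ^ 2)
  rw [zero_add] at this
  refine this.congr fun n => ?_
  rw [← integral_add (((hms n).sub hm).integrable_mul hm |>.congr ?_) hm.integrable_sq]
  · refine integral_congr_ae ?_
    filter_upwards [hae n] with x hx
    rw [hx]; ring
  · filter_upwards [hae n] with x hx
    simp only [Pi.mul_apply, Pi.sub_apply]
    rw [hx]

theorem tendsto_sq : Tendsto (fun n => (∫ η, (deriv X.H η - deriv (Xs n).H η) ^ 2) +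
    ∫ η, (deriv X.U η - deriv (Xs n).U η) ^ 2) atTop (𝓝 0) := by
  have hH := h.integral_mul_deriv_of_le h.nice.lip_H (fun n => (h.nices n).lip_H)
    (h.memLp_H h.nice) (fun n => h.memLp_H (h.nices n)) (h.integral_sq_le h.nice).1
    (fun n => (h.integral_sq_le (h.nices n)).1) (fun n x => by
      have := h.y_le n x
      rw [h.nice.y_eq, (h.nices n).y_eq, abs_sub_comm] at this
      convert this using 2; ring)
  have hU := h.integral_mul_deriv_of_le h.nice.lip_U (fun n => (h.nices n).lip_U)
    (h.memLp_U h.nice) (fun n => h.memLp_U (h.nices n)) (h.integral_sq_le h.nice).2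
    (fun n => (h.integral_sq_le (h.nices n)).2) h.U_le
  have e := h.integral_sq_add h.nice
  have lim := ((hH.add hU).const_mul 2).const_sub (2 * G)
  rw [e, sub_self] at lim
  refine lim.congr fun n => ?_
  have exp : ∀ {f k : ℝ → ℝ}, MemLp f 2 volume → MemLp k 2 volume →
      ∫ x, (f x - k x) ^ 2 = (∫ x, f x ^ 2) + (∫ x, k x ^ 2) - 2 * ∫ x, k x * f x := by
    intro f k hf hk
    have i1 : Integrable fun x => f x ^ 2 + k x ^ 2 := hf.integrable_sq.add hk.integrable_sq
    have i2 : Integrable fun x => k x * f x := hk.integrable_mul hf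
    rw [← integral_const_mul, ← integral_add hf.integrable_sq hk.integrable_sq,
      ← integral_sub i1 (i2.const_mul 2)]
    refine integral_congr_ae (Eventually.of_forall fun x => ?_)
    simp only; ring
  rw [exp (h.memLp_H h.nice) (h.memLp_H (h.nices n)), exp (h.memLp_U h.nice) (h.memLp_U (h.nices n))]
  have := h.integral_sq_add (h.nices n)
  linarith

theorem tendsto_sq_U :
    Tendsto (fun n => ∫ η, (deriv X.U η - deriv (Xs n).U η) ^ 2) atTop (𝓝 0) :=
  squeeze_zero (fun _ => integral_nonneg fun _ => sq_nonneg _)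
    (fun _ => le_add_of_nonneg_left (integral_nonneg fun _ => sq_nonneg _)) h.tendsto_sq

theorem exists_subseq_deriv : ∃ ns : ℕ → ℕ, StrictMono ns ∧ ∀ᵐ η,
    Tendsto (fun k => deriv (Xs (ns k)).H η) atTop (𝓝 (deriv X.H η)) ∧
    Tendsto (fun k => deriv (Xs (ns k)).U η) atTop (𝓝 (deriv X.U η)) := by
  have i1 := fun n => ((h.memLp_H h.nice).sub (h.memLp_H (h.nices n))).integrable_sq
  have i2 := fun n => ((h.memLp_U h.nice).sub (h.memLp_U (h.nices n))).integrable_sq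
  obtain ⟨ns, hns, hae⟩ := exists_subseq_ae
    (f := fun n η => (deriv X.H η - deriv (Xs n).H η) ^ 2 + (deriv X.U η - deriv (Xs n).U η) ^ 2)
    (fun n => (i1 n).add (i2 n)) (fun n η => by positivity)
    (h.tendsto_sq.congr fun n => (integral_add (i1 n) (i2 n)).symm)
  refine ⟨ns, hns, ?_⟩
  filter_upwards [hae] with η hη
  have key : ∀ a : ℝ, ∀ f : ℕ → ℝ, Tendsto (fun k => (a - f k) ^ 2) atTop (𝓝 0) →
      Tendsto f atTop (𝓝 a) := by
    intro a f hf
    have h1 := (Real.continuous_sqrt.tendsto 0).comp hf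
    rw [Real.sqrt_zero] at h1
    rw [tendsto_iff_dist_tendsto_zero]
    refine h1.congr fun k => ?_
    rw [Function.comp, Real.sqrt_sq_eq_abs, Real.dist_eq, abs_sub_comm]
  exact ⟨key _ _ (squeeze_zero (fun _ => sq_nonneg _)
    (fun _ => le_add_of_nonneg_right (sq_nonneg _)) hη), key _ _ (squeeze_zero
    (fun _ => sq_nonneg _) (fun _ => le_add_of_nonneg_left (sq_nonneg _)) hη)⟩

theorem energyDist_eq (n : ℕ) :
    energyDist X (Xs n) = 2 * ∫ η, max (deriv X.H η - deriv (Xs n).H η) 0 := by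
  have i1 := h.nice.integrable_deriv_H
  have i2 := (h.nices n).integrable_deriv_H
  have i3 : Integrable fun η => deriv X.H η - deriv (Xs n).H η := i1.sub i2
  have e : ∫ η, (deriv X.H η - deriv (Xs n).H η) = 0 := by
    rw [integral_sub i1 i2, h.nice.integral_deriv_H, (h.nices n).integral_deriv_H, sub_self]
  have e2 : energyDist X (Xs n) = (∫ η, |deriv X.H η - deriv (Xs n).H η|) +
      ∫ η, (deriv X.H η - deriv (Xs n).H η) := by rw [e, add_zero, energyDist]
  rw [e2, ← integral_const_mul, ← integral_add i3.abs i3]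
  refine integral_congr_ae (Eventually.of_forall fun η => ?_)
  simp only
  rcases le_total 0 (deriv X.H η - deriv (Xs n).H η) with h1 | h1
  · rw [abs_of_nonneg h1, max_eq_left h1]; ring
  · rw [abs_of_nonpos h1, max_eq_right h1]; ring

theorem tendsto_energyDist_of_ae
    (hae : ∀ᵐ η, Tendsto (fun k => deriv (Xs k).H η) atTop (𝓝 (deriv X.H η))) :
    Tendsto (fun n => energyDist X (Xs n)) atTop (𝓝 0) := by
  have key : Tendsto (fun n => ∫ η, max (deriv X.H η - deriv (Xs n).H η) 0) atTop
      (𝓝 (∫ _ : ℝ, (0:ℝ))) := by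
    refine tendsto_integral_of_dominated_convergence (deriv X.H) (fun n => ?_)
      h.nice.integrable_deriv_H (fun n => Eventually.of_forall fun η => ?_) ?_
    · exact (((measurable_deriv _).sub (measurable_deriv _)).max measurable_const).aestronglyMeasurable
    · rw [Real.norm_of_nonneg (le_max_right _ _)]
      exact max_le (by linarith [(h.nices n).deriv_H_nonneg η]) (h.nice.deriv_H_nonneg η)
    · filter_upwards [hae] with η hη
      have := (hη.const_sub (deriv X.H η)).max (tendsto_const_nhds (x := (0:ℝ)))
      simpa using this
  rw [integral_zero] at key
  have := key.const_mul 2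
  rw [mul_zero] at this
  exact this.congr fun n => (h.energyDist_eq n).symm

theorem tendsto_energyDist : Tendsto (fun n => energyDist X (Xs n)) atTop (𝓝 0) := by
  refine tendsto_of_subseq_tendsto fun ns hns => ?_
  obtain ⟨ms, hms, hae⟩ := (h.comp hns).exists_subseq_deriv
  refine ⟨ms, ((h.comp hns).comp hms.tendsto_atTop).tendsto_energyDist_of_ae ?_⟩
  filter_upwards [hae] with η hη
  exact hη.1

theorem volume_conc_lt_top {Y : Lagr} (hY : IsNice Y G) : volume {η | deriv Y.H η = 1} ≠ ⊤ := by
  have h1 := hY.integrable_deriv_H.measure_norm_ge_lt_top (ε := 1) one_pos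
  refine ne_top_of_le_ne_top h1.ne (measure_mono fun η hη => ?_)
  have : deriv Y.H η = 1 := hη
  simp [this]

theorem measurableSet_conc (Y : Lagr) : MeasurableSet {η | deriv Y.H η = 1} :=
  (measurable_deriv _) (measurableSet_singleton 1)

theorem tendsto_conc_of_ae
    (hae : ∀ᵐ η, Tendsto (fun k => deriv (Xs k).H η) atTop (𝓝 (deriv X.H η))) :
    Tendsto (fun n => volume.real ({η | deriv X.H η = 1} \ {η | deriv (Xs n).H η = 1})) atTop
      (𝓝 0) := by
  set S := {η | deriv X.H η = 1} with hS
  set R : ℕ → Set ℝ := fun n => {η | deriv (Xs n).H η = 1} with hR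
  have mS : MeasurableSet S := h.measurableSet_conc X
  have mR : ∀ n, MeasurableSet (R n) := fun n => h.measurableSet_conc (Xs n)
  have fS : volume S ≠ ⊤ := h.volume_conc_lt_top h.nice
  have fR : ∀ n, volume (R n) ≠ ⊤ := fun n => h.volume_conc_lt_top (h.nices n)
  have hle : ∀ n, volume.real (S \ R n) ≤ volume.real (R n \ S) := by
    intro n
    refine ENNReal.toReal_mono (ne_top_of_le_ne_top (fR n) (measure_mono sdiff_subset)) ?_
    have h1 := h.conc n
    change volume S ≤ volume (R n) at h1
    rw [← measure_inter_add_sdiff S (mR n), ← measure_inter_add_sdiff (R n) mS,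
      inter_comm (R n) S] at h1
    exact (ENNReal.add_le_add_iff_left
      (ne_top_of_le_ne_top fS (measure_mono inter_subset_left))).mp h1
  have key : Tendsto (fun n => ∫ η, (R n \ S).indicator (deriv X.H) η) atTop
      (𝓝 (∫ _ : ℝ, (0:ℝ))) := by
    refine tendsto_integral_of_dominated_convergence (deriv X.H) (fun n => ?_)
      h.nice.integrable_deriv_H (fun n => Eventually.of_forall fun η => ?_) ?_
    · exact ((measurable_deriv _).indicator ((mR n).diff mS)).aestronglyMeasurable
    · refine (norm_indicator_le_norm_self _ _).trans ?_
      rw [Real.norm_of_nonneg (h.nice.deriv_H_nonneg η)]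
    · filter_upwards [hae] with η hη
      refine tendsto_const_nhds.congr' ?_
      by_cases hηS : η ∈ S
      · exact Eventually.of_forall fun n => (indicator_of_notMem (fun hh => hh.2 hηS) _).symm
      · have hlt : deriv X.H η < 1 := lt_of_le_of_ne (h.nice.deriv_H_le η) hηS
        filter_upwards [hη.eventually_lt_const hlt] with n hn
        exact (indicator_of_notMem (fun hh => hn.ne hh.1) _).symm
  rw [integral_zero] at key
  have lim := (h.tendsto_energyDist_of_ae hae).add key
  rw [add_zero] at lim
  refine squeeze_zero (fun _ => measureReal_nonneg) (fun n => (hle n).trans ?_) lim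
  have i1 : Integrable (fun η => |deriv X.H η - deriv (Xs n).H η|) :=
    (h.nice.integrable_deriv_H.sub (h.nices n).integrable_deriv_H).abs
  have i2 := h.nice.integrable_deriv_H.indicator ((mR n).diff mS)
  rw [← integral_indicator_one ((mR n).diff mS), energyDist, ← integral_add i1 i2]
  refine integral_mono_of_nonneg (Eventually.of_forall fun η => ?_) (i1.add i2)
    (Eventually.of_forall fun η => ?_)
  · exact indicator_nonneg (fun _ _ => zero_le_one) η
  · by_cases hη : η ∈ R n \ S
    · simp only [indicator_of_mem hη, Pi.one_apply]
      have : deriv (Xs n).H η = 1 := hη.1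
      have := neg_abs_le (deriv X.H η - deriv (Xs n).H η)
      linarith
    · simp only [indicator_of_notMem hη, add_zero]
      exact abs_nonneg _

theorem exists_subseq_conc : ∃ ns : ℕ → ℕ, StrictMono ns ∧ ∀ᵐ η,
    Tendsto (fun k => deriv (Xs (ns k)).H η) atTop (𝓝 (deriv X.H η)) ∧
    Tendsto (fun k => deriv (Xs (ns k)).U η) atTop (𝓝 (deriv X.U η)) ∧
    (deriv X.H η = 1 → ∀ᶠ k in atTop, deriv (Xs (ns k)).H η = 1) := by
  obtain ⟨ns, hns, hae⟩ := h.exists_subseq_deriv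
  have h' := h.comp hns.tendsto_atTop
  have hc := h'.tendsto_conc_of_ae (hae.mono fun η hη => hη.1)
  have mD : ∀ k, MeasurableSet ({η | deriv X.H η = 1} \ {η | deriv (Xs (ns k)).H η = 1}) :=
    fun k => (h.measurableSet_conc X).diff (h.measurableSet_conc _)
  obtain ⟨ms, hms, hae2⟩ := exists_subseq_ae
    (f := fun k => ({η | deriv X.H η = 1} \ {η | deriv (Xs (ns k)).H η = 1}).indicator 1)
    (fun k => by
      refine (integrable_indicator_iff (mD k)).mpr (integrableOn_const ?_)
      exact ne_top_of_le_ne_top (h.volume_conc_lt_top h.nice) (measure_mono sdiff_subset))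
    (fun k η => indicator_nonneg (fun _ _ => zero_le_one) η)
    (hc.congr fun k => (integral_indicator_one (mD k)).symm)
  refine ⟨ns ∘ ms, hns.comp hms, ?_⟩
  filter_upwards [hae, hae2] with η h1 h2
  refine ⟨h1.1.comp hms.tendsto_atTop, h1.2.comp hms.tendsto_atTop, fun h3 => ?_⟩
  filter_upwards [h2.eventually_lt_const (zero_lt_one)] with k hk
  by_contra h4
  have hm : η ∈ {η | deriv X.H η = 1} \ {η | deriv (Xs (ns (ms k))).H η = 1} := ⟨h3, h4⟩
  rw [indicator_of_mem hm] at hk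
  exact lt_irrefl _ hk

end ConvData

/-! ## Convergence of the breaking times -/

theorem continuous_cutBrk_ofReal (T : ℝ) : Continuous fun a : ℝ => cutBrk (ENNReal.ofReal a) T := by
  have : (fun a : ℝ => cutBrk (ENNReal.ofReal a) T) =
      fun a : ℝ => (ENNReal.ofReal (min a T)).toReal := by
    funext a
    rw [cutBrk, ENNReal.ofReal_min]
  rw [this]
  simp only [ENNReal.toReal_ofReal']
  fun_prop

theorem brk_tendsto {X : Lagr} {Xs : ℕ → Lagr} {η : ℝ}
    (hy : deriv X.y η = 1 - deriv X.H η) (hys : ∀ k, deriv (Xs k).y η = 1 - deriv (Xs k).H η)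
    (hr : deriv X.U η ^ 2 = (1 - deriv X.H η) * deriv X.H η)
    (hrs : ∀ k, deriv (Xs k).U η ^ 2 = (1 - deriv (Xs k).H η) * deriv (Xs k).H η)
    (hH : Tendsto (fun k => deriv (Xs k).H η) atTop (𝓝 (deriv X.H η)))
    (hU : Tendsto (fun k => deriv (Xs k).U η) atTop (𝓝 (deriv X.U η)))
    (hc : deriv X.H η = 1 → ∀ᶠ k in atTop, deriv (Xs k).H η = 1) (h0 : deriv X.H η ≠ 0) (T : ℝ) :
    (∀ᶠ k in atTop, (brk (Xs k) η = ⊤ ↔ brk X η = ⊤)) ∧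
    Tendsto (fun k => cutBrk (brk (Xs k) η) T) atTop (𝓝 (cutBrk (brk X η) T)) := by
  have htop : ∀ Y : Lagr, ¬ deriv Y.U η < 0 → brk Y η = ⊤ := fun Y hY => by rw [brk, if_neg hY]
  have both : (∀ᶠ k in atTop, brk (Xs k) η = ⊤) → brk X η = ⊤ →
      (∀ᶠ k in atTop, (brk (Xs k) η = ⊤ ↔ brk X η = ⊤)) ∧
      Tendsto (fun k => cutBrk (brk (Xs k) η) T) atTop (𝓝 (cutBrk (brk X η) T)) := by
    intro h1 h2
    refine ⟨h1.mono fun k hk => by rw [hk, h2], ?_⟩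
    refine tendsto_const_nhds.congr' ?_
    filter_upwards [h1] with k hk
    rw [hk, h2]
  by_cases h1 : deriv X.H η = 1
  · refine both ?_ (htop X ?_)
    · filter_upwards [hc h1] with k hk
      refine htop _ ?_
      have := hrs k
      rw [hk, sub_self, zero_mul] at this
      rw [pow_eq_zero_iff two_ne_zero] at this
      rw [this]; exact lt_irrefl 0
    · rw [h1, sub_self, zero_mul, pow_eq_zero_iff two_ne_zero] at hr
      rw [hr]; exact lt_irrefl 0
  · have hne : deriv X.U η ≠ 0 := by
      intro h2
      rw [h2, zero_pow two_ne_zero] at hr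
      rcases mul_eq_zero.mp hr.symm with h3 | h3
      · exact h1 (by linarith)
      · exact h0 h3
    rcases lt_or_gt_of_ne hne with h2 | h2
    · have hev : ∀ᶠ k in atTop, deriv (Xs k).U η < 0 := hU.eventually_lt_const h2
      have hneg : ∀ Y : Lagr, deriv Y.U η < 0 →
          brk Y η = ENNReal.ofReal (-(2 * deriv Y.y η) / deriv Y.U η) :=
        fun Y hY => by rw [brk, if_pos hY]
      refine ⟨?_, ?_⟩
      · filter_upwards [hev] with k hk
        rw [hneg _ hk, hneg _ h2]
        simp
      · have hyl : Tendsto (fun k => deriv (Xs k).y η) atTop (𝓝 (deriv X.y η)) := by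
          rw [hy]; exact (hH.const_sub 1).congr fun k => (hys k).symm
        have hq := ((hyl.const_mul 2).neg).div hU hne
        rw [hneg _ h2]
        refine (((continuous_cutBrk_ofReal T).tendsto _).comp hq).congr' ?_
        filter_upwards [hev] with k hk
        rw [hneg _ hk]; rfl
    · refine both ?_ (htop X (not_lt.mpr h2.le))
      filter_upwards [hU.eventually_const_lt h2] with k hk
      exact htop _ (not_lt.mpr hk.le)

/-- The energy of the labels for which exactly one of two solutions breaks. -/
def mismatch (X X' : Lagr) : ℝ :=
  ∫ η, deriv X.H η * (open Classical in if (brk X' η = ⊤ ↔ brk X η = ⊤) then 0 else 1)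

theorem measurableSet_brk_iff (X X' : Lagr) :
    MeasurableSet {η | brk X' η = ⊤ ↔ brk X η = ⊤} := by
  have h1 := measurable_brk X (measurableSet_singleton ⊤)
  have h2 := measurable_brk X' (measurableSet_singleton ⊤)
  have : {η | brk X' η = ⊤ ↔ brk X η = ⊤} = (brk X' ⁻¹' {⊤} ∩ brk X ⁻¹' {⊤}) ∪
      ((brk X' ⁻¹' {⊤})ᶜ ∩ (brk X ⁻¹' {⊤})ᶜ) := by
    ext η; simp; tauto
  rw [this]
  exact (h2.inter h1).union (h2.compl.inter h1.compl)

namespace ConvData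

variable {X : Lagr} {Xs : ℕ → Lagr} {G : ℝ} {d : ℕ → ℝ} (h : ConvData X Xs G d)
include h

theorem exists_subseq_brk (T : ℝ) : ∃ ns : ℕ → ℕ, ∀ᵐ η, deriv X.H η ≠ 0 →
    (∀ᶠ k in atTop, (brk (Xs (ns k)) η = ⊤ ↔ brk X η = ⊤)) ∧
    Tendsto (fun k => cutBrk (brk (Xs (ns k)) η) T) atTop (𝓝 (cutBrk (brk X η) T)) := by
  obtain ⟨ns, -, hae⟩ := h.exists_subseq_conc
  refine ⟨ns, ?_⟩
  have a1 := ae_all_iff.mpr fun k => (h.nices (ns k)).deriv_y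
  have a2 := ae_all_iff.mpr fun k => (h.nices (ns k)).rel'
  filter_upwards [hae, a1, a2, h.nice.deriv_y, h.nice.rel'] with η h1 h2 h3 h4 h5 h6
  exact brk_tendsto h4 h2 h5 h3 h1.1 h1.2.1 h1.2.2 h6 T

theorem tendsto_brkDist {T : ℝ} (hT : 0 ≤ T) :
    Tendsto (fun n => brkDist X (Xs n) T) atTop (𝓝 0) := by
  refine tendsto_of_subseq_tendsto fun ns hns => ?_
  obtain ⟨ms, hae⟩ := (h.comp hns).exists_subseq_brk T
  refine ⟨ms, ?_⟩
  have key : Tendsto (fun k => brkDist X (Xs (ns (ms k))) T) atTop (𝓝 (∫ _ : ℝ, (0:ℝ))) := by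
    refine tendsto_integral_of_dominated_convergence (fun η => deriv X.H η * T) (fun n => ?_)
      (h.nice.integrable_deriv_H.mul_const T) (fun n => Eventually.of_forall fun η => ?_) ?_
    · exact ((measurable_deriv _).mul ((measurable_cutBrk _ _).sub
        (measurable_cutBrk _ _)).abs).aestronglyMeasurable
    · rw [Real.norm_of_nonneg (mul_nonneg (h.nice.deriv_H_nonneg η) (abs_nonneg _))]
      refine mul_le_mul_of_nonneg_left ?_ (h.nice.deriv_H_nonneg η)
      have := cutBrk_nonneg (brk X η) T
      have := cutBrk_nonneg (brk (Xs (ns (ms n))) η) T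
      have := cutBrk_le (θ := brk X η) hT
      have := cutBrk_le (θ := brk (Xs (ns (ms n))) η) hT
      rw [abs_le]; constructor <;> linarith
    · filter_upwards [hae] with η hη
      by_cases h0 : deriv X.H η = 0
      · simp only [h0, zero_mul]; exact tendsto_const_nhds
      · have h2 := (((hη h0).2.const_sub (cutBrk (brk X η) T)).abs).const_mul (deriv X.H η)
        rw [sub_self, abs_zero, mul_zero] at h2
        exact h2
  rwa [integral_zero] at key

theorem tendsto_mismatch : Tendsto (fun n => mismatch X (Xs n)) atTop (𝓝 0) := by
  refine tendsto_of_subseq_tendsto fun ns hns => ?_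
  obtain ⟨ms, hae⟩ := (h.comp hns).exists_subseq_brk 0
  refine ⟨ms, ?_⟩
  have key : Tendsto (fun k => mismatch X (Xs (ns (ms k)))) atTop (𝓝 (∫ _ : ℝ, (0:ℝ))) := by
    refine tendsto_integral_of_dominated_convergence (deriv X.H) (fun n => ?_)
      h.nice.integrable_deriv_H (fun n => Eventually.of_forall fun η => ?_) ?_
    · exact ((measurable_deriv _).mul (Measurable.ite (measurableSet_brk_iff X _)
        measurable_const measurable_const)).aestronglyMeasurable
    · have := h.nice.deriv_H_nonneg η
      split_ifs
      · simpa using this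
      · rw [mul_one, Real.norm_of_nonneg this]
    · filter_upwards [hae] with η hη
      by_cases h0 : deriv X.H η = 0
      · simp only [h0, zero_mul]; exact tendsto_const_nhds
      · refine tendsto_const_nhds.congr' ?_
        filter_upwards [(hη h0).1] with k hk
        rw [if_pos hk, mul_zero]
  rwa [integral_zero] at key

end ConvData

end HunterSaxton
end

noncomputable section


namespace HunterSaxton

/-! ## Convergence of the projected data -/

section Projected

variable {Z : Euler} (hZ : MemD0 Z) {h : ℝ} (hh : 0 < h) {σ : ℤ → ℝ}
  (hσ : ∀ j, σ j = 1 ∨ σ j = -1)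
include hZ hh hσ

theorem MemD0.proj_isGood : IsGood (proj h σ Z) := by
  obtain ⟨g, hg⟩ := hZ.exists_energySlope
  exact HunterSaxton.proj_isGood hg hσ hh hZ.isGood.bdd hZ.isGood.bot

theorem MemD0.proj_isNice : IsNice (mapL (proj h σ Z)) (Z.μ univ).toReal := by
  obtain ⟨g, hg⟩ := hZ.exists_energySlope
  have := (hZ.proj_isGood hh hσ).isNice
  rwa [proj_univ hg hσ hh] at this

theorem exists_common_cell (ξ : ℝ) : ∃ j : ℤ,
    lagrY Z ξ ∈ Icc (gridPt h (2 * j)) (gridPt h (2 * j + 2)) ∧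
    lagrY (proj h σ Z) ξ ∈ Icc (gridPt h (2 * j)) (gridPt h (2 * j + 2)) := by
  obtain ⟨g, hg⟩ := hZ.exists_energySlope
  have h1 := hZ.isGood
  have h2 := hZ.proj_isGood hh hσ
  obtain ⟨j, hj1, hj2⟩ := exists_mem_double_grid hh (lagrY Z ξ)
  refine ⟨j, ⟨hj1, hj2.le⟩, ?_, ?_⟩
  · rw [h2.le_lagrY_iff, proj_primitive hg hσ hh, projF_even hg hσ hh]
    exact (h1.le_lagrY_iff _ _).mp hj1
  · refine le_of_lt ?_
    rw [show 2 * j + 2 = 2 * (j + 1) by ring] at hj2 ⊢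
    rw [h2.lagrY_lt_iff, proj_primitive hg hσ hh, projF_even hg hσ hh]
    exact (h1.lagrY_lt_iff _ _).mp hj2

theorem abs_lagrY_sub_le (ξ : ℝ) : |lagrY Z ξ - lagrY (proj h σ Z) ξ| ≤ 2 * h := by
  obtain ⟨j, h1, h2⟩ := exists_common_cell hZ hh hσ ξ
  have e : gridPt h (2 * j + 2) = gridPt h (2 * j) + 2 * h := by simp only [gridPt]; push_cast; ring
  rw [e] at h1 h2
  rw [abs_le]
  constructor <;> linarith [h1.1, h1.2, h2.1, h2.2]

theorem abs_lagrU_sub_le (ξ : ℝ) : |Z.u (lagrY Z ξ) - projU h σ Z (lagrY (proj h σ Z) ξ)| ≤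
    2 * Real.sqrt (2 * h * (Z.μ univ).toReal) := by
  obtain ⟨g, hg⟩ := hZ.exists_energySlope
  have := hg.fin
  obtain ⟨j, h1, h2⟩ := exists_common_cell hZ hh hσ ξ
  have a1 := u_sub_le hg hσ hh h1
  have a2 := projU_sub_le hg hσ hh h2
  have hb : 2 * h * primitive Z.μ (gridPt h (2 * j + 2)) ≤ 2 * h * (Z.μ univ).toReal :=
    mul_le_mul_of_nonneg_left (primitive_le Z.μ _) (by positivity)
  have b1 := Real.abs_le_sqrt (a1.trans hb)
  have b2 := Real.abs_le_sqrt (a2.trans hb)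
  have := abs_sub_le (Z.u (lagrY Z ξ)) (Z.u (gridPt h (2 * j))) (projU h σ Z (lagrY (proj h σ Z) ξ))
  rw [abs_sub_comm (Z.u (gridPt h (2 * j)))] at this
  linarith

end Projected

theorem MemD0.convData {Z : Euler} (hZ : MemD0 Z) {hs : ℕ → ℝ} (hpos : ∀ n, 0 < hs n)
    (hlim : Tendsto hs atTop (𝓝 0)) {σ : ℕ → ℤ → ℝ} (hσ : ∀ n j, σ n j = 1 ∨ σ n j = -1) :
    ConvData (mapL Z) (fun n => mapL (proj (hs n) (σ n) Z)) (Z.μ univ).toReal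
      (fun n => 2 * hs n + 2 * Real.sqrt (2 * hs n * (Z.μ univ).toReal)) := by
  refine ⟨hZ.isGood.isNice, fun n => hZ.proj_isNice (hpos n) (hσ n), ?_, fun n ξ => ?_,
    fun n ξ => ?_, fun n => ?_⟩
  · have h1 := (hlim.const_mul 2)
    have h2 := ((Real.continuous_sqrt.tendsto _).comp (h1.mul_const (Z.μ univ).toReal)).const_mul 2
    have := h1.add h2
    simpa using this
  · refine (abs_lagrY_sub_le hZ (hpos n) (hσ n) ξ).trans ?_
    have := Real.sqrt_nonneg (2 * hs n * (Z.μ univ).toReal)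
    linarith
  · refine (abs_lagrU_sub_le hZ (hpos n) (hσ n) ξ).trans ?_
    have := hpos n
    linarith
  · obtain ⟨g, hg⟩ := hZ.exists_energySlope
    exact hZ.isGood.volume_concentrated_le.trans
      (singPart_le_volume_concentrated hg (hσ n) (hpos n) (hZ.proj_isGood (hpos n) (hσ n)))

end HunterSaxton
end

noncomputable section


namespace HunterSaxton

/-! ## Nodes and cells -/

/-- The index of the cell that contains `x`. -/
def cellIdx (ξ : ℤ → ℝ) (x : ℝ) : ℤ := sSup {j : ℤ | ξ j ≤ x}

namespace IsNodes

variable {ξ : ℤ → ℝ} (hξ : IsNodes ξ)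
include hξ

theorem exists_cell (x : ℝ) : ∃ j : ℤ, ξ j ≤ x ∧ x < ξ (j + 1) := by
  obtain ⟨a, ha⟩ := (hξ.atBot.eventually (eventually_le_atBot x)).exists
  obtain ⟨b, hb⟩ := (hξ.atTop.eventually (eventually_gt_atTop x)).exists
  obtain ⟨j, hj1, hj2⟩ := Int.exists_greatest_of_bdd (P := fun j => ξ j ≤ x)
    ⟨b, fun z hz => by
      by_contra h
      exact absurd (hb.trans_le (hξ.mono (not_le.mp h).le)) (not_lt.mpr hz)⟩ ⟨a, ha⟩
  refine ⟨j, hj1, ?_⟩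
  by_contra h
  have := hj2 (j + 1) (not_lt.mp h)
  omega

theorem cellIdx_eq {x : ℝ} {j : ℤ} (h1 : ξ j ≤ x) (h2 : x < ξ (j + 1)) : cellIdx ξ x = j := by
  refine IsGreatest.csSup_eq ⟨h1, fun k hk => ?_⟩
  by_contra h
  have := hξ.mono (show j + 1 ≤ k by omega)
  have : ξ k ≤ x := hk
  linarith

theorem cellIdx_spec (x : ℝ) : ξ (cellIdx ξ x) ≤ x ∧ x < ξ (cellIdx ξ x + 1) := by
  obtain ⟨j, h1, h2⟩ := hξ.exists_cell x
  rw [hξ.cellIdx_eq h1 h2]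
  exact ⟨h1, h2⟩

theorem measurable_cellIdx : Measurable (cellIdx ξ) := by
  refine Monotone.measurable fun a b hab => ?_
  by_contra h
  rw [not_le] at h
  have h1 := (hξ.cellIdx_spec b).2
  have h2 := (hξ.cellIdx_spec a).1
  have := hξ.mono (show cellIdx ξ b + 1 ≤ cellIdx ξ a by omega)
  linarith

theorem ae_mem_cell : ∀ᵐ x, x ∈ Ioo (ξ (cellIdx ξ x)) (ξ (cellIdx ξ x + 1)) := by
  have : ∀ᵐ x : ℝ, ∀ i : ℤ, x ≠ ξ i := by
    rw [ae_all_iff]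
    exact fun i => compl_mem_ae_iff.mpr (measure_singleton (ξ i))
  filter_upwards [this] with x hx
  exact ⟨lt_of_le_of_ne (hξ.cellIdx_spec x).1 (hx _).symm, (hξ.cellIdx_spec x).2⟩

theorem len_nonneg (j : ℤ) : 0 ≤ len ξ j := sub_nonneg.mpr (hξ.mono (by omega))

theorem hasSum_integral {f : ℝ → ℝ} (hf : Integrable f) {c : ℤ → ℝ}
    (hc : ∀ j, ∀ x ∈ Ioo (ξ j) (ξ (j + 1)), f x = c j) :
    HasSum (fun j => c j * len ξ j) (∫ x, f x) := by
  have hU : ⋃ j : ℤ, Ico (ξ j) (ξ (j + 1)) = univ := by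
    rw [eq_univ_iff_forall]
    intro x
    obtain ⟨j, hj⟩ := hξ.exists_cell x
    exact mem_iUnion.mpr ⟨j, hj⟩
  have hd : Pairwise (Function.onFun Disjoint fun j : ℤ => Ico (ξ j) (ξ (j + 1))) := by
    intro a b hab
    rw [Function.onFun, Set.disjoint_left]
    intro x hx hx'
    exact hab ((hξ.cellIdx_eq hx.1 hx.2).symm.trans (hξ.cellIdx_eq hx'.1 hx'.2))
  have h := hasSum_integral_iUnion (f := f) (μ := volume) (fun j : ℤ => measurableSet_Ico) hd
    hf.integrableOn
  rw [hU, setIntegral_univ] at h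
  refine (congrArg (fun a => HasSum a (∫ x, f x)) (funext fun j => ?_)).mp h
  rw [integral_Ico_eq_integral_Ioo, setIntegral_congr_fun measurableSet_Ioo (hc j)]
  simp only [setIntegral_const, smul_eq_mul]
  rw [measureReal_def, Real.volume_Ioo, ENNReal.toReal_ofReal
    (show 0 ≤ ξ (j + 1) - ξ j from hξ.len_nonneg j), mul_comm]
  rfl

end IsNodes

namespace CellAffine

variable {ξ : ℤ → ℝ} {f f' : ℝ → ℝ} {c c' : ℤ → ℝ}

theorem add (hf : CellAffine ξ f c) (hf' : CellAffine ξ f' c') :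
    CellAffine ξ (fun x => f x + f' x) (fun j => c j + c' j) := by
  intro j x hx
  simp only
  rw [hf j x hx, hf' j x hx]; ring

theorem const_mul (hf : CellAffine ξ f c) (r : ℝ) :
    CellAffine ξ (fun x => r * f x) (fun j => r * c j) := by
  intro j x hx
  simp only
  rw [hf j x hx]; ring

theorem congr (hf : CellAffine ξ f c) (hff : ∀ x, f' x = f x)
    (hcc : ∀ j, ξ j < ξ (j + 1) → c' j = c j) : CellAffine ξ f' c' := by
  intro j x hx
  rw [hff, hff, hf j x hx]
  rcases (hx.1.trans hx.2).eq_or_lt with h | h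
  · rw [show x = ξ j from le_antisymm (hx.2.trans h.ge) hx.1]; ring
  · rw [hcc j h]

theorem setIntegral_Iic (hf : Integrable f) (hc : ∀ j, ∀ x ∈ Ioo (ξ j) (ξ (j + 1)), f x = c j) :
    CellAffine ξ (fun x => ∫ η in Iic x, f η) c := by
  intro j x hx
  simp only
  rw [← sub_eq_iff_eq_add', intervalIntegral.integral_Iic_sub_Iic hf.integrableOn hf.integrableOn,
    intervalIntegral.integral_of_le hx.1, integral_Ioc_eq_integral_Ioo,
    setIntegral_congr_fun measurableSet_Ioo (g := fun _ => c j)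
      (fun z hz => hc j z ⟨hz.1, hz.2.trans_le hx.2⟩)]
  simp only [setIntegral_const, smul_eq_mul]
  rw [measureReal_def, Real.volume_Ioo, ENNReal.toReal_ofReal (sub_nonneg.mpr hx.1), mul_comm]

theorem kern (hf : Integrable f) (hc : ∀ j, ∀ x ∈ Ioo (ξ j) (ξ (j + 1)), f x = c j) :
    CellAffine ξ (kern f) c := by
  intro j x hx
  have := setIntegral_Iic hf hc j x hx
  simp only [HunterSaxton.kern]
  simp only at this
  rw [this]; ring

theorem sub_succ (hξ : IsNodes ξ) (hf : CellAffine ξ f c) (j : ℤ) :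
    f (ξ (j + 1)) - f (ξ j) = c j * len ξ j := by
  rw [hf j (ξ (j + 1)) ⟨hξ.mono (by omega), le_rfl⟩, len]; ring

theorem sumBelow_eq (hξ : IsNodes ξ) (hf : CellAffine ξ f c) {l : ℝ} (hl : Tendsto f atBot (𝓝 l))
    (j : ℤ) : sumBelow (fun m => c m * len ξ m) j = f (ξ j) - l := by
  refine Tendsto.limUnder_eq ?_
  have h1 : Tendsto (fun J : ℤ => f (ξ j) - f (ξ J)) atBot (𝓝 (f (ξ j) - l)) :=
    (hl.comp hξ.atBot).const_sub _
  refine h1.congr' ?_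
  filter_upwards [eventually_le_atBot j] with J hJ
  have key : ∀ n : ℕ, f (ξ (J + n)) - f (ξ J) = ∑ m ∈ Finset.Ico J (J + n), c m * len ξ m := by
    intro n
    induction n with
    | zero => simp
    | succ n ih =>
      have e : J + ((n + 1 : ℕ) : ℤ) = J + n + 1 := by push_cast; ring
      have e2 : Finset.Ico J (J + (n:ℤ) + 1) = insert (J + (n:ℤ)) (Finset.Ico J (J + (n:ℤ))) := by
        ext m; simp only [Finset.mem_Ico, Finset.mem_insert]; omega
      rw [e, e2, Finset.sum_insert (by simp), ← ih, ← hf.sub_succ hξ]; ring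
  have := key (j - J).toNat
  rwa [show J + ((j - J).toNat : ℤ) = j by omega] at this

theorem interp_eq (hξ : IsNodes ξ) (hf : CellAffine ξ f c) :
    interp ξ (fun j => f (ξ j)) = f := by
  funext x
  have hs := hξ.cellIdx_spec x
  change f (ξ (cellIdx ξ x)) + (f (ξ (cellIdx ξ x + 1)) - f (ξ (cellIdx ξ x))) *
    ((x - ξ (cellIdx ξ x)) / (ξ (cellIdx ξ x + 1) - ξ (cellIdx ξ x))) = f x
  have hpos : 0 < ξ (cellIdx ξ x + 1) - ξ (cellIdx ξ x) := by linarith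
  rw [hf.sub_succ hξ, hf _ x ⟨hs.1, hs.2.le⟩, len]
  field_simp

end CellAffine

/-! ## Piecewise affine Lagrangian data -/

/-- Lagrangian data that are affine between the nodes `ξ`. In a cell either `y` is constant, or
the length of the cell is at least `h`. -/
structure CellData (ξ : ℤ → ℝ) (X : Lagr) (G h : ℝ) (p r : ℤ → ℝ) : Prop where
  nodes : IsNodes ξ
  nice : IsNice X G
  pos : 0 < h
  aff_y : CellAffine ξ X.y p
  aff_U : CellAffine ξ X.U r
  large : ∀ j, p j ≠ 0 → h ≤ len ξ j

/-- The breaking time in a cell. -/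
def slopeBreak (p r : ℝ) : ℝ≥0∞ := open Classical in
  if r < 0 then ENNReal.ofReal (-(2 * p) / r) else ⊤

namespace CellData

variable {ξ : ℤ → ℝ} {X : Lagr} {G h : ℝ} {p r : ℤ → ℝ} (hc : CellData ξ X G h p r)
include hc

theorem aff_H : CellAffine ξ X.H (fun j => 1 - p j) := by
  intro j x hx
  have h1 := hc.aff_y j x hx
  rw [hc.nice.y_eq, hc.nice.y_eq] at h1
  simp only
  linarith

theorem derivs {j : ℤ} {x : ℝ} (hx : x ∈ Ioo (ξ j) (ξ (j + 1))) :
    deriv X.y x = p j ∧ deriv X.U x = r j ∧ deriv X.H x = 1 - p j :=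
  ⟨(hc.aff_y.hasDerivAt hx).deriv, (hc.aff_U.hasDerivAt hx).deriv, (hc.aff_H.hasDerivAt hx).deriv⟩

theorem slope_rel {j : ℤ} (hj : ξ j < ξ (j + 1)) :
    r j ^ 2 = p j * (1 - p j) ∧ 0 ≤ p j ∧ p j ≤ 1 := by
  have hm : mid ξ j ∈ Ioo (ξ j) (ξ (j + 1)) := by rw [mid]; constructor <;> linarith
  obtain ⟨h1, h2, h3⟩ := hc.derivs hm
  refine ⟨?_, h1 ▸ hc.nice.deriv_y_nonneg _, ?_⟩
  · by_contra hne
    have h0 : volume (Ioo (ξ j) (ξ (j + 1))) = 0 := by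
      refine measure_mono_null (fun x hx => ?_) hc.nice.rel
      obtain ⟨k1, k2, k3⟩ := hc.derivs hx
      intro h4
      simp only [mem_ofPred_eq] at h4
      rw [k1, k2, k3] at h4; exact hne h4
    rw [Real.volume_Ioo, ENNReal.ofReal_eq_zero] at h0
    linarith
  · have := hc.nice.deriv_H_nonneg (mid ξ j); rw [h3] at this; linarith

theorem mid_mem {j : ℤ} (hj : ξ j < ξ (j + 1)) : mid ξ j ∈ Ioo (ξ j) (ξ (j + 1)) := by
  rw [mid]; constructor <;> linarith

theorem brk_eq {j : ℤ} {x : ℝ} (hx : x ∈ Ioo (ξ j) (ξ (j + 1))) :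
    brk X x = slopeBreak (p j) (r j) := by
  obtain ⟨k1, k2, -⟩ := hc.derivs hx
  rw [brk, slopeBreak, k1, k2]

theorem p_pos {j : ℤ} (hj : ξ j < ξ (j + 1)) (hr : r j < 0) : 0 < p j := by
  obtain ⟨h1, h2, h3⟩ := hc.slope_rel hj
  refine lt_of_le_of_ne h2 fun h0 => ?_
  rw [← h0, zero_mul, pow_eq_zero_iff two_ne_zero] at h1
  exact hr.ne h1

theorem slopeBreak_pos {j : ℤ} (hj : ξ j < ξ (j + 1)) : 0 < slopeBreak (p j) (r j) := by
  rw [slopeBreak]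
  split_ifs with hr
  · exact ENNReal.ofReal_pos.mpr (div_pos_of_neg_of_neg (by linarith [hc.p_pos hj hr]) hr)
  · exact ENNReal.zero_lt_top

theorem cellBreak_degenerate {j : ℤ} (hj : ¬ ξ j < ξ (j + 1)) : cellBreak ξ X j = 0 := by
  have := hc.nodes.mono (show j ≤ j + 1 by omega)
  rw [cellBreak, if_pos (le_antisymm this (not_lt.mp hj))]

theorem cellBreak_eq {j : ℤ} (hj : ξ j < ξ (j + 1)) :
    (cellBreak ξ X j = 0 ∧ slopeBreak (p j) (r j) = ⊤) ∨
      cellBreak ξ X j = slopeBreak (p j) (r j) := by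
  obtain ⟨k1, k2, -⟩ := hc.derivs (hc.mid_mem hj)
  rw [cellBreak, if_neg hj.ne, waveBreak, k1, k2, slopeBreak]
  by_cases h0 : p j = 0 ∧ r j = 0
  · left; rw [if_pos h0, if_neg (by rw [h0.2]; exact lt_irrefl 0)]; exact ⟨rfl, rfl⟩
  · right; rw [if_neg h0]

theorem cellBreak_le_iff {j : ℤ} (hj : ξ j < ξ (j + 1)) (t : ℝ) :
    (0 < cellBreak ξ X j ∧ cellBreak ξ X j ≤ ENNReal.ofReal t) ↔
      slopeBreak (p j) (r j) ≤ ENNReal.ofReal t := by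
  rcases hc.cellBreak_eq hj with ⟨h1, h2⟩ | h1
  · rw [h1, h2]; simp
  · rw [h1]; exact ⟨fun h => h.2, fun h => ⟨hc.slopeBreak_pos hj, h⟩⟩

theorem lost_zero {β : ℤ → ℝ} {t : ℝ} {j : ℤ} (hj : ξ j < ξ (j + 1)) :
    lost (cellBreak ξ X) β 0 t j =
      open Classical in if slopeBreak (p j) (r j) ≤ ENNReal.ofReal t then β j else 0 := by
  rw [lost, ENNReal.ofReal_zero]
  simp only [hc.cellBreak_le_iff hj]

theorem lost_clock {β : ℤ → ℝ} {t : ℝ} (ht : 0 ≤ t) {j : ℤ} (hj : ξ j < ξ (j + 1)) {k : ℕ}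
    (hk : k ≠ 0) : lost (cellBreak ξ X) β 0 t j * (t - (cellBreak ξ X j).toReal) ^ k =
      β j * clock (slopeBreak (p j) (r j)) t ^ k := by
  rw [hc.lost_zero hj]
  split_ifs with h
  · have h1 := (hc.cellBreak_le_iff hj t).mpr h
    rcases hc.cellBreak_eq hj with ⟨h2, h3⟩ | h2
    · rw [h2] at h1; exact absurd h1.1 (lt_irrefl 0)
    · rw [clock_of_le ht h, h2]
  · rw [clock_of_ge (not_le.mp h).le, zero_pow hk]; ring

theorem init_eq (j : ℤ) (hj : ξ j < ξ (j + 1)) : (initState ξ X).Zx j = p j - 1 ∧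
    (initState ξ X).Ux j = r j ∧ (initState ξ X).Vx j = 1 - p j := by
  obtain ⟨k1, k2, k3⟩ := hc.derivs (hc.mid_mem hj)
  simp only [initState, if_neg hj.ne, hc.nice.V_eq]
  rw [k1, k2, k3]
  exact ⟨rfl, rfl, rfl⟩

theorem init_degenerate (j : ℤ) (hj : ¬ ξ j < ξ (j + 1)) : (initState ξ X).Vx j = 0 := by
  have := hc.nodes.mono (show j ≤ j + 1 by omega)
  simp only [initState, if_pos (le_antisymm this (not_lt.mp hj))]

theorem init_Vx_nonneg (j : ℤ) : 0 ≤ (initState ξ X).Vx j := by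
  by_cases hj : ξ j < ξ (j + 1)
  · rw [(hc.init_eq j hj).2.2]
    linarith [(hc.slope_rel hj).2.2]
  · rw [hc.init_degenerate j hj]

theorem step_frac {β : ℤ → ℝ} (h0 : ∀ j, 0 ≤ β j) (h1 : ∀ j, β j ≤ 1) :
    IsFrac (fun x => β (cellIdx ξ x)) :=
  ⟨measurable_from_top.comp hc.nodes.measurable_cellIdx, fun _ => h0 _, fun _ => h1 _⟩

theorem step_eq (β : ℤ → ℝ) {j : ℤ} {x : ℝ} (hx : x ∈ Ioo (ξ j) (ξ (j + 1))) :
    β (cellIdx ξ x) = β j := by rw [hc.nodes.cellIdx_eq hx.1.le hx.2]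

theorem fac_eq {β : ℤ → ℝ} {t : ℝ} (k : ℕ) {j : ℤ} {x : ℝ} (hx : x ∈ Ioo (ξ j) (ξ (j + 1))) :
    deriv X.H x * (t ^ k - β (cellIdx ξ x) * clock (brk X x) t ^ k) =
      (1 - p j) * (t ^ k - β j * clock (slopeBreak (p j) (r j)) t ^ k) := by
  rw [(hc.derivs hx).2.2, hc.step_eq β hx, hc.brk_eq hx]

variable {β : ℤ → ℝ} (h0 : ∀ j, 0 ≤ β j) (h1 : ∀ j, β j ≤ 1) {t : ℝ} (ht : 0 ≤ t)

include h0 h1 ht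

theorem evoY_aff : CellAffine ξ (evoY X (fun x => β (cellIdx ξ x)) t)
    (fun j => p j + t * r j +
      1 / 4 * ((1 - p j) * (t ^ 2 - β j * clock (slopeBreak (p j) (r j)) t ^ 2))) := by
  have hb := hc.step_frac h0 h1
  have := (hc.aff_y.add (hc.aff_U.const_mul t)).add
    ((CellAffine.kern (hb.integrable_fac hc.nice ht 2) (fun j x hx => hc.fac_eq 2 hx)).const_mul
      (1 / 4))
  exact this.congr (fun x => by rw [evoY]; ring) fun _ _ => rfl

theorem evoU_aff : CellAffine ξ (evoU X (fun x => β (cellIdx ξ x)) t)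
    (fun j => r j + 1 / 2 * ((1 - p j) * (t - β j * clock (slopeBreak (p j) (r j)) t))) := by
  have hb := hc.step_frac h0 h1
  have := hc.aff_U.add
    ((CellAffine.kern (hb.integrable_fac hc.nice ht 1) (fun j x hx => hc.fac_eq 1 hx)).const_mul
      (1 / 2))
  simp only [pow_one] at this
  exact this.congr (fun x => by rw [evoU]) fun _ _ => rfl

theorem evoV_aff : CellAffine ξ (evoV X (fun x => β (cellIdx ξ x)) t)
    (fun j => (1 - lost (cellBreak ξ X) β 0 t j) * (1 - p j)) := by
  have hb := hc.step_frac h0 h1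
  refine (CellAffine.setIntegral_Iic (integrable_evoV hc.nice hb t) (c := fun j =>
    (1 - (open Classical in if slopeBreak (p j) (r j) ≤ ENNReal.ofReal t then β j else 0)) *
      (1 - p j)) fun j x hx => ?_).congr
    (fun x => by rw [evoV]) fun j hj => by rw [hc.lost_zero hj]
  rw [(hc.derivs hx).2.2, hc.step_eq β hx, hc.brk_eq hx]

end CellData

end HunterSaxton
end

noncomputable section


namespace HunterSaxton

/-! ## Composition of evolution steps -/

section Steps

variable {ξ : ℤ → ℝ} {τ : ℤ → ℝ≥0∞} {β β₁ β₂ : ℤ → ℝ} {s t : ℝ}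

theorem abs_lost_mul_pow_le (h0 : ∀ j, 0 ≤ β j) (h1 : ∀ j, β j ≤ 1) (ht : 0 ≤ t) (k : ℕ) (j : ℤ) :
    |lost τ β s t j * (t - (τ j).toReal) ^ k| ≤ t ^ k := by
  rw [lost]
  split_ifs with h
  · have h2 : (τ j).toReal ≤ t := by
      have := ENNReal.toReal_mono ENNReal.ofReal_ne_top h.2
      rwa [ENNReal.toReal_ofReal ht] at this
    have h3 : 0 ≤ (τ j).toReal := ENNReal.toReal_nonneg
    rw [abs_of_nonneg (mul_nonneg (h0 j) (pow_nonneg (sub_nonneg.mpr h2) k))]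
    calc β j * (t - (τ j).toReal) ^ k ≤ 1 * t ^ k :=
          mul_le_mul (h1 j) (pow_le_pow_left₀ (sub_nonneg.mpr h2) (by linarith) k)
            (pow_nonneg (sub_nonneg.mpr h2) k) zero_le_one
      _ = t ^ k := one_mul _
  · rw [zero_mul, abs_zero]; positivity

theorem summable_mul_of_bounded {a c : ℤ → ℝ} (ha : Summable a) (h0 : ∀ j, 0 ≤ a j) {C : ℝ}
    (hc : ∀ j, |c j| ≤ C) : Summable fun j => c j * a j := by
  refine Summable.of_norm_bounded (ha.mul_left C) fun j => ?_
  rw [Real.norm_eq_abs, abs_mul, abs_of_nonneg (h0 j)]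
  exact mul_le_mul_of_nonneg_right (hc j) (h0 j)

/-- Fractions lost in `(0, s]` and in `(s, t]`, combined. -/
def joinFrac (τ : ℤ → ℝ≥0∞) (s : ℝ) (β₁ β₂ : ℤ → ℝ) (j : ℤ) : ℝ :=
  open Classical in if τ j ≤ ENNReal.ofReal s then β₁ j else β₂ j

theorem lost_join (hst : s ≤ t) (j : ℤ) :
    lost τ (joinFrac τ s β₁ β₂) 0 t j = lost τ β₁ 0 s j + lost τ β₂ s t j ∧
      lost τ β₁ 0 s j * lost τ β₂ s t j = 0 := by
  have hst' : ENNReal.ofReal s ≤ ENNReal.ofReal t := ENNReal.ofReal_le_ofReal hst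
  simp only [lost, joinFrac, ENNReal.ofReal_zero]
  by_cases h1 : τ j ≤ ENNReal.ofReal s
  · simp only [h1, h1.trans hst', not_lt.mpr h1, and_true, if_true, if_false, add_zero, mul_zero,
      and_self]
  · have h2 := not_le.mp h1
    simp only [h1, h2, (zero_le).trans_lt h2, and_false, true_and, if_false, zero_add, zero_mul,
      and_self]

theorem evolve_zero (st : NumState) : evolve ξ τ β 0 0 st = st := by
  have : ∀ j, lost τ β 0 0 j = 0 := fun j => by
    rw [lost, if_neg]
    rintro ⟨h1, h2⟩
    exact absurd (h1.trans_le h2) (lt_irrefl _)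
  simp [evolve, this]

theorem evolve_evolve {st : NumState} (hs : 0 ≤ s) (hst : s ≤ t)
    (ha0 : ∀ j, 0 ≤ st.Vx j * len ξ j) (ha : Summable fun j => st.Vx j * len ξ j)
    (h10 : ∀ j, 0 ≤ β₁ j) (h11 : ∀ j, β₁ j ≤ 1) (h20 : ∀ j, 0 ≤ β₂ j) (h21 : ∀ j, β₂ j ≤ 1) :
    evolve ξ τ β₂ s t (evolve ξ τ β₁ 0 s st) = evolve ξ τ (joinFrac τ s β₁ β₂) 0 t st := by
  have hj := lost_join (τ := τ) (β₁ := β₁) (β₂ := β₂) hst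
  have hl : lost τ (joinFrac τ s β₁ β₂) 0 t = fun j => lost τ β₁ 0 s j + lost τ β₂ s t j :=
    funext fun j => (hj j).1
  have ht := hs.trans hst
  have H0 := ha.hasSum
  have S1 : ∀ k : ℕ, Summable fun j =>
      lost τ β₁ 0 s j * (s - (τ j).toReal) ^ k * (st.Vx j * len ξ j) := fun k =>
    summable_mul_of_bounded ha ha0 (abs_lost_mul_pow_le h10 h11 hs k)
  have S2 : ∀ k : ℕ, Summable fun j =>
      lost τ β₂ s t j * (t - (τ j).toReal) ^ k * (st.Vx j * len ξ j) := fun k =>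
    summable_mul_of_bounded ha ha0 (abs_lost_mul_pow_le h20 h21 ht k)
  have P0 := (S1 0).hasSum
  have P1 := (S1 1).hasSum
  have P2 := (S1 2).hasSum
  have Q1 := (S2 1).hasSum
  have Q2 := (S2 2).hasSum
  have e1 : ∑' m, lost τ β₁ 0 s m * st.Vx m * len ξ m * (s - (τ m).toReal) ^ 2 =
      ∑' j, lost τ β₁ 0 s j * (s - (τ j).toReal) ^ 2 * (st.Vx j * len ξ j) :=
    tsum_congr fun m => by ring
  have e2 : ∑' m, lost τ β₁ 0 s m * st.Vx m * len ξ m * (s - (τ m).toReal) =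
      ∑' j, lost τ β₁ 0 s j * (s - (τ j).toReal) ^ 1 * (st.Vx j * len ξ j) :=
    tsum_congr fun m => by ring
  have e3 : ∑' m, (1 - lost τ β₁ 0 s m) * st.Vx m * len ξ m = (∑' m, st.Vx m * len ξ m) -
      ∑' j, lost τ β₁ 0 s j * (s - (τ j).toReal) ^ 0 * (st.Vx j * len ξ j) := by
    rw [← (H0.sub P0).tsum_eq]; exact tsum_congr fun m => by ring
  have e4 : ∑' m, lost τ β₂ s t m * ((1 - lost τ β₁ 0 s m) * st.Vx m) * len ξ m *
      (t - (τ m).toReal) =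
      ∑' j, lost τ β₂ s t j * (t - (τ j).toReal) ^ 1 * (st.Vx j * len ξ j) :=
    tsum_congr fun m => by
      linear_combination (- st.Vx m * len ξ m * (t - (τ m).toReal)) * (hj m).2
  have e5 : ∑' m, lost τ β₂ s t m * ((1 - lost τ β₁ 0 s m) * st.Vx m) * len ξ m *
      (t - (τ m).toReal) ^ 2 =
      ∑' j, lost τ β₂ s t j * (t - (τ j).toReal) ^ 2 * (st.Vx j * len ξ j) :=
    tsum_congr fun m => by
      linear_combination (- st.Vx m * len ξ m * (t - (τ m).toReal) ^ 2) * (hj m).2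
  have e6 : ∑' m, (lost τ β₁ 0 s m + lost τ β₂ s t m) * st.Vx m * len ξ m * (t - (τ m).toReal) =
      (∑' j, lost τ β₁ 0 s j * (s - (τ j).toReal) ^ 1 * (st.Vx j * len ξ j)) +
      (t - s) * (∑' j, lost τ β₁ 0 s j * (s - (τ j).toReal) ^ 0 * (st.Vx j * len ξ j)) +
      ∑' j, lost τ β₂ s t j * (t - (τ j).toReal) ^ 1 * (st.Vx j * len ξ j) := by
    rw [← ((P1.add (P0.mul_left (t - s))).add Q1).tsum_eq]; exact tsum_congr fun m => by ring
  have e7 : ∑' m, (lost τ β₁ 0 s m + lost τ β₂ s t m) * st.Vx m * len ξ m *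
      (t - (τ m).toReal) ^ 2 =
      (∑' j, lost τ β₁ 0 s j * (s - (τ j).toReal) ^ 2 * (st.Vx j * len ξ j)) +
      2 * (t - s) * (∑' j, lost τ β₁ 0 s j * (s - (τ j).toReal) ^ 1 * (st.Vx j * len ξ j)) +
      (t - s) ^ 2 * (∑' j, lost τ β₁ 0 s j * (s - (τ j).toReal) ^ 0 * (st.Vx j * len ξ j)) +
      ∑' j, lost τ β₂ s t j * (t - (τ j).toReal) ^ 2 * (st.Vx j * len ξ j) := by
    rw [← (((P2.add (P1.mul_left (2 * (t - s)))).add (P0.mul_left ((t - s) ^ 2))).add Q2).tsum_eq]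
    exact tsum_congr fun m => by ring
  simp only [evolve, NumState.mk.injEq]
  simp only [hl, sub_zero]
  refine ⟨funext fun j => ?_, funext fun j => ?_, funext fun j => ?_, ?_, ?_⟩
  · linear_combination (1 / 4 * st.Vx j * (t - (τ j).toReal) ^ 2) * (hj j).2
  · linear_combination (1 / 2 * st.Vx j * (t - (τ j).toReal)) * (hj j).2
  · linear_combination st.Vx j * (hj j).2
  · rw [e1, e2, e3, e5, e7]; ring
  · rw [e2, e3, e4, e6]; ring

end Steps

/-! ## The scheme in terms of the evolution with prescribed fractions -/

namespace CellData

variable {ξ : ℤ → ℝ} {X : Lagr} {G h : ℝ} {p r : ℤ → ℝ} (hc : CellData ξ X G h p r)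
include hc

theorem hasSum_Vx : HasSum (fun m => (initState ξ X).Vx m * len ξ m) G := by
  have h := hc.nodes.hasSum_integral hc.nice.integrable_deriv_H fun j x hx => (hc.derivs hx).2.2
  rw [hc.nice.integral_deriv_H] at h
  refine (congrArg (fun a => HasSum a G) (funext fun j => ?_)).mp h
  by_cases hj : ξ j < ξ (j + 1)
  · rw [(hc.init_eq j hj).2.2]
  · have := hc.nodes.mono (show j ≤ j + 1 by omega)
    rw [len, le_antisymm this (not_lt.mp hj), sub_self, mul_zero, mul_zero]

theorem energy_nonneg (m : ℤ) : 0 ≤ (initState ξ X).Vx m * len ξ m :=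
  mul_nonneg (hc.init_Vx_nonneg m) (hc.nodes.len_nonneg m)

theorem cell_congr {a b : ℤ → ℝ} (hab : ∀ j, ξ j < ξ (j + 1) → a j = b j) :
    (fun m => a m * len ξ m) = fun m => b m * len ξ m := by
  funext j
  by_cases hj : ξ j < ξ (j + 1)
  · rw [hab j hj]
  · have := hc.nodes.mono (show j ≤ j + 1 by omega)
    rw [len, le_antisymm this (not_lt.mp hj), sub_self, mul_zero, mul_zero]

theorem init_Zinf : (initState ξ X).Zinf = 0 := by
  refine Tendsto.limUnder_eq ?_
  have := (hc.nice.H_bot.comp hc.nodes.atBot).neg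
  rw [neg_zero] at this
  refine this.congr fun j => ?_
  rw [hc.nice.y_eq]; simp

theorem init_Uinf {l : ℝ} (hl : Tendsto X.U atBot (𝓝 l)) : (initState ξ X).Uinf = l :=
  (hl.comp hc.nodes.atBot).limUnder_eq

variable {β : ℤ → ℝ} (h0 : ∀ j, 0 ≤ β j) (h1 : ∀ j, β j ≤ 1) {t : ℝ} (ht : 0 ≤ t)
include h0 h1 ht

theorem tsum_lost {k : ℕ} (hk : k ≠ 0) :
    ∑' m, lost (cellBreak ξ X) β 0 t m * (initState ξ X).Vx m * len ξ m *
      (t - (cellBreak ξ X m).toReal) ^ k =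
    G * t ^ k - ∫ η, deriv X.H η * (t ^ k - β (cellIdx ξ η) * clock (brk X η) t ^ k) := by
  have hb := hc.step_frac h0 h1
  have hi := hb.integrable_fac hc.nice ht k
  have hs := hc.nodes.hasSum_integral ((hc.nice.integrable_deriv_H.mul_const (t ^ k)).sub hi)
    (c := fun j => (1 - p j) * (β j * clock (slopeBreak (p j) (r j)) t ^ k)) (fun j x hx => by
      have := hc.fac_eq (β := β) (t := t) k hx
      simp only [Pi.sub_apply]
      rw [this, (hc.derivs hx).2.2]; ring)
  have e : ∫ x, ((fun x => deriv X.H x * t ^ k) - fun η => deriv X.H η *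
      (t ^ k - β (cellIdx ξ η) * clock (brk X η) t ^ k)) x =
      G * t ^ k - ∫ η, deriv X.H η * (t ^ k - β (cellIdx ξ η) * clock (brk X η) t ^ k) := by
    simp only [Pi.sub_apply]
    rw [integral_sub (hc.nice.integrable_deriv_H.mul_const (t ^ k)) hi, integral_mul_const,
      hc.nice.integral_deriv_H]
  rw [← e, ← hs.tsum_eq, ← hc.cell_congr (a := fun m => lost (cellBreak ξ X) β 0 t m *
    (initState ξ X).Vx m * (t - (cellBreak ξ X m).toReal) ^ k) fun j hj => ?_]
  · exact tsum_congr fun m => by ring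
  · rw [← hc.lost_clock ht hj hk, (hc.init_eq j hj).2.2]; ring

theorem nodeY_evolve (j : ℤ) :
    nodeY ξ (evolve ξ (cellBreak ξ X) β 0 t (initState ξ X)) j =
      evoY X (fun x => β (cellIdx ξ x)) t (ξ j) := by
  have hb := hc.step_frac h0 h1
  obtain ⟨l, hl⟩ := hc.nice.U_bot
  have hid : CellAffine ξ (fun x => -x) (fun _ => -1) := fun j x _ => by ring
  have haff := (hc.evoY_aff h0 h1 ht).add hid
  set I := ∫ η, deriv X.H η * (t ^ 2 - β (cellIdx ξ η) * clock (brk X η) t ^ 2) with hI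
  have hlim : Tendsto (fun x => evoY X (fun x => β (cellIdx ξ x)) t x + -x) atBot
      (𝓝 (l * t - 1 / 8 * I)) := by
    have h2 := ((tendsto_kern_atBot (hb.integrable_fac hc.nice ht 2)).const_mul (1 / 4)).add
      ((hl.mul_const t).sub hc.nice.H_bot)
    have e : 1 / 4 * -(1 / 2 * I) + (l * t - 0) = l * t - 1 / 8 * I := by ring
    rw [e] at h2
    refine h2.congr fun x => ?_
    rw [evoY, hc.nice.y_eq]; ring
  have hsum := haff.sumBelow_eq hc.nodes hlim j
  have hts := hc.tsum_lost h0 h1 ht two_ne_zero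
  rw [nodeY, hc.cell_congr (a := (evolve ξ (cellBreak ξ X) β 0 t (initState ξ X)).Zx)
    (b := fun j => p j + t * r j +
      1 / 4 * ((1 - p j) * (t ^ 2 - β j * clock (slopeBreak (p j) (r j)) t ^ 2)) + -1)
    fun m hm => ?_, hsum]
  · simp only [evolve, sub_zero]
    rw [hts, hc.hasSum_Vx.tsum_eq, hc.init_Zinf, hc.init_Uinf hl]; ring
  · obtain ⟨i1, i2, i3⟩ := hc.init_eq m hm
    have := hc.lost_clock (β := β) ht hm two_ne_zero
    simp only [evolve, sub_zero]
    rw [i1, i2, i3]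
    linear_combination (-(1 / 4) * (1 - p m)) * this

theorem nodeU_evolve (j : ℤ) :
    nodeU ξ (evolve ξ (cellBreak ξ X) β 0 t (initState ξ X)) j =
      evoU X (fun x => β (cellIdx ξ x)) t (ξ j) := by
  have hb := hc.step_frac h0 h1
  obtain ⟨l, hl⟩ := hc.nice.U_bot
  have haff := hc.evoU_aff h0 h1 ht
  have hi := hb.integrable_fac hc.nice ht 1
  have hts := hc.tsum_lost h0 h1 ht one_ne_zero
  simp only [pow_one] at hi hts
  set I := ∫ η, deriv X.H η * (t - β (cellIdx ξ η) * clock (brk X η) t) with hI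
  have hlim : Tendsto (evoU X (fun x => β (cellIdx ξ x)) t) atBot (𝓝 (l + 1 / 2 * -(1 / 2 * I))) :=
    hl.add ((tendsto_kern_atBot hi).const_mul (1 / 2))
  have hsum := haff.sumBelow_eq hc.nodes hlim j
  rw [nodeU, hc.cell_congr (a := (evolve ξ (cellBreak ξ X) β 0 t (initState ξ X)).Ux)
    (b := fun j => r j + 1 / 2 * ((1 - p j) * (t - β j * clock (slopeBreak (p j) (r j)) t)))
    fun m hm => ?_, hsum]
  · simp only [evolve, sub_zero]
    rw [hts, hc.hasSum_Vx.tsum_eq, hc.init_Uinf hl]; ring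
  · obtain ⟨i1, i2, i3⟩ := hc.init_eq m hm
    have := hc.lost_clock (β := β) ht hm one_ne_zero
    simp only [pow_one] at this
    simp only [evolve, sub_zero]
    rw [i2, i3]
    linear_combination (-(1 / 2) * (1 - p m)) * this

theorem nodeV_evolve (j : ℤ) :
    nodeV ξ (evolve ξ (cellBreak ξ X) β 0 t (initState ξ X)) j =
      evoV X (fun x => β (cellIdx ξ x)) t (ξ j) := by
  have hb := hc.step_frac h0 h1
  have hsum := (hc.evoV_aff h0 h1 ht).sumBelow_eq hc.nodes
    (tendsto_setIntegral_Iic_atBot (integrable_evoV hc.nice hb t)) j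
  rw [nodeV, hc.cell_congr (a := (evolve ξ (cellBreak ξ X) β 0 t (initState ξ X)).Vx)
    (b := fun j => (1 - lost (cellBreak ξ X) β 0 t j) * (1 - p j)) fun m hm => ?_, hsum, sub_zero]
  simp only [evolve]
  rw [(hc.init_eq m hm).2.2]

theorem interp_evolve :
    interp ξ (nodeY ξ (evolve ξ (cellBreak ξ X) β 0 t (initState ξ X))) =
      evoY X (fun x => β (cellIdx ξ x)) t ∧
    interp ξ (nodeU ξ (evolve ξ (cellBreak ξ X) β 0 t (initState ξ X))) =
      evoU X (fun x => β (cellIdx ξ x)) t ∧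
    interp ξ (nodeV ξ (evolve ξ (cellBreak ξ X) β 0 t (initState ξ X))) =
      evoV X (fun x => β (cellIdx ξ x)) t := by
  refine ⟨?_, ?_, ?_⟩
  · rw [← (hc.evoY_aff h0 h1 ht).interp_eq hc.nodes]
    exact congrArg _ (funext fun j => hc.nodeY_evolve h0 h1 ht j)
  · rw [← (hc.evoU_aff h0 h1 ht).interp_eq hc.nodes]
    exact congrArg _ (funext fun j => hc.nodeU_evolve h0 h1 ht j)
  · rw [← (hc.evoV_aff h0 h1 ht).interp_eq hc.nodes]
    exact congrArg _ (funext fun j => hc.nodeV_evolve h0 h1 ht j)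

end CellData

end HunterSaxton
end

noncomputable section


namespace HunterSaxton

/-! ## The extracted times -/

section Extraction

variable {B : Set ℝ} {T Δt s : ℝ}

theorem nextTime_cases (hfin : (B ∩ Iic T).Finite) :
    nextTime B T Δt s = T ∧ (∀ b ∈ B, s < b → T ≤ b) ∨
    (nextTime B T Δt s ∈ B ∧ s < nextTime B T Δt s ∧ nextTime B T Δt s ≤ T ∧
      (nextTime B T Δt s ≤ s + Δt ∨ ∀ b ∈ B, s < b → nextTime B T Δt s ≤ b)) := by
  by_cases h1 : ∀ b ∈ B, s < b → T ≤ b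
  · left; rw [nextTime, if_pos h1]; exact ⟨rfl, h1⟩
  right
  by_cases h2 : ∃ b ∈ B, ∃ c ∈ B, s < b ∧ b < c ∧ c ≤ s + Δt ∧ c < T
  · rw [nextTime, if_neg h1, if_pos h2]
    obtain ⟨b, hb, c, -, h3, h4, h5, h6⟩ := h2
    have hf : {b | b ∈ B ∧ s < b ∧ b ≤ min (s + Δt) T}.Finite :=
      hfin.subset fun x hx => ⟨hx.1, hx.2.2.trans (min_le_right _ _)⟩
    have hm := Set.Nonempty.csSup_mem
      (s := {b | b ∈ B ∧ s < b ∧ b ≤ min (s + Δt) T})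
      ⟨b, hb, h3, le_min (h4.le.trans h5) (h4.trans h6).le⟩ hf
    exact ⟨hm.1, hm.2.1, hm.2.2.trans (min_le_right _ _), Or.inl (hm.2.2.trans (min_le_left _ _))⟩
  · rw [nextTime, if_neg h1, if_neg h2]
    push Not at h1
    obtain ⟨b, hb, h3, h4⟩ := h1
    have hf : {b | b ∈ B ∧ s < b ∧ b ≤ T}.Finite := hfin.subset fun x hx => ⟨hx.1, hx.2.2⟩
    obtain ⟨m, hm1, hm2⟩ := Set.exists_min_image _ id hf ⟨b, hb, h3, h4.le⟩
    have hl : IsLeast {b | b ∈ B ∧ s < b} m := by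
      refine ⟨⟨hm1.1, hm1.2.1⟩, fun x hx => ?_⟩
      rcases le_total x T with h | h
      · exact hm2 x ⟨hx.1, hx.2, h⟩
      · exact (hm2 b ⟨hb, h3, h4.le⟩).trans (h4.le.trans h)
    rw [hl.csInf_eq]
    exact ⟨hm1.1, hm1.2.1, hm1.2.2, Or.inr fun x hx hsx => hl.2 ⟨hx, hsx⟩⟩

theorem le_nextTime (hfin : (B ∩ Iic T).Finite) (hs : s ≤ T) : s ≤ nextTime B T Δt s := by
  rcases nextTime_cases (Δt := Δt) (s := s) hfin with h | h
  · rw [h.1]; exact hs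
  · exact h.2.1.le

theorem nextTime_le (hfin : (B ∩ Iic T).Finite) : nextTime B T Δt s ≤ T := by
  rcases nextTime_cases (Δt := Δt) (s := s) hfin with h | h
  · rw [h.1]
  · exact h.2.2.1

theorem nextTime_sub_le (hfin : (B ∩ Iic T).Finite)
    (hne : (B ∩ Ioo s (nextTime B T Δt s)).Nonempty) : nextTime B T Δt s ≤ s + Δt := by
  obtain ⟨b, hb, hsb, hbn⟩ := hne
  rcases nextTime_cases (Δt := Δt) (s := s) hfin with h | h
  · rw [h.1] at hbn
    exact absurd (h.2 b hb hsb) (not_le.mpr hbn)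
  · rcases h.2.2.2 with h' | h'
    · exact h'
    · exact absurd (h' b hb hsb) (not_le.mpr hbn)

theorem extracted_mem (hfin : (B ∩ Iic T).Finite) (hT : 0 ≤ T) (k : ℕ) :
    0 ≤ extracted B T Δt k ∧ extracted B T Δt k ≤ T := by
  induction k with
  | zero => exact ⟨le_rfl, hT⟩
  | succ k ih => exact ⟨ih.1.trans (le_nextTime hfin ih.2), nextTime_le hfin⟩

theorem extracted_le_succ (hfin : (B ∩ Iic T).Finite) (hT : 0 ≤ T) (k : ℕ) :
    extracted B T Δt k ≤ extracted B T Δt (k + 1) :=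
  le_nextTime hfin (extracted_mem hfin hT k).2

theorem exists_extracted_eq (hfin : (B ∩ Iic T).Finite) :
    ∃ k, extracted B T Δt (k + 1) = T := by
  have key : ∀ n k : ℕ, (B ∩ Ioc (extracted B T Δt k) T).ncard ≤ n →
      ∃ k, extracted B T Δt (k + 1) = T := by
    intro n
    induction n with
    | zero =>
      intro k hk
      rcases nextTime_cases (Δt := Δt) (s := extracted B T Δt k) hfin with h | h
      · exact ⟨k, h.1⟩
      · have hf : (B ∩ Ioc (extracted B T Δt k) T).Finite :=
          hfin.subset fun x hx => ⟨hx.1, hx.2.2⟩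
        rw [Nat.le_zero, Set.ncard_eq_zero hf] at hk
        have : nextTime B T Δt (extracted B T Δt k) ∈ B ∩ Ioc (extracted B T Δt k) T :=
          ⟨h.1, h.2.1, h.2.2.1⟩
        rw [hk] at this
        exact absurd this (notMem_empty _)
    | succ n ih =>
      intro k hk
      rcases nextTime_cases (Δt := Δt) (s := extracted B T Δt k) hfin with h | h
      · exact ⟨k, h.1⟩
      · refine ih (k + 1) (Nat.lt_succ_iff.mp (lt_of_lt_of_le ?_ hk))
        have hf : (B ∩ Ioc (extracted B T Δt k) T).Finite :=
          hfin.subset fun x hx => ⟨hx.1, hx.2.2⟩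
        refine Set.ncard_lt_ncard ⟨fun x hx => ⟨hx.1, h.2.1.trans hx.2.1, hx.2.2⟩, fun hh => ?_⟩ hf
        exact lt_irrefl _ (hh ⟨h.1, h.2.1, h.2.2.1⟩).2.1
  exact key _ 0 le_rfl

end Extraction

/-! ## Sensitivity of the characteristics to the fractions -/

theorem abs_evoY_sub_le_of_recent {X : Lagr} {G : ℝ} (hX : IsNice X G) {b b' : ℝ → ℝ}
    (hb : IsFrac b) (hb' : IsFrac b') {t δ : ℝ} (ht : 0 ≤ t)
    (h : ∀ᵐ η, b η = b' η ∨ clock (brk X η) t ≤ δ) (ξ : ℝ) :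
    |evoY X b t ξ - evoY X b' t ξ| ≤ 1 / 8 * (G * δ ^ 2) := by
  have e : evoY X b t ξ - evoY X b' t ξ = 1 / 4 *
      (kern (fun η => deriv X.H η * (t ^ 2 - b η * clock (brk X η) t ^ 2)) ξ -
        kern (fun η => deriv X.H η * (t ^ 2 - b' η * clock (brk X η) t ^ 2)) ξ) := by
    simp only [evoY]; ring
  rw [e, abs_mul, abs_of_pos (by norm_num : (0:ℝ) < 1 / 4)]
  have i1 := hb.integrable_fac hX ht 2
  have i2 := hb'.integrable_fac hX ht 2
  have h1 := abs_kern_sub_kern_le i1 i2 ξ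
  have h2 : ∫ η, |deriv X.H η * (t ^ 2 - b η * clock (brk X η) t ^ 2) -
      deriv X.H η * (t ^ 2 - b' η * clock (brk X η) t ^ 2)| ≤ ∫ η, deriv X.H η * δ ^ 2 := by
    refine integral_mono_ae (i1.sub i2).abs (hX.integrable_deriv_H.mul_const _) ?_
    filter_upwards [h] with η hη
    have hv := hX.deriv_H_nonneg η
    have hw := clock_nonneg (brk X η) t
    rw [show deriv X.H η * (t ^ 2 - b η * clock (brk X η) t ^ 2) -
      deriv X.H η * (t ^ 2 - b' η * clock (brk X η) t ^ 2) =
      deriv X.H η * (clock (brk X η) t ^ 2 * (b' η - b η)) by ring, abs_mul, abs_of_nonneg hv]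
    refine mul_le_mul_of_nonneg_left ?_ hv
    rcases hη with hη | hη
    · rw [hη, sub_self, mul_zero, abs_zero]; positivity
    · rw [abs_mul, abs_of_nonneg (sq_nonneg _)]
      calc _ ≤ δ ^ 2 * 1 := mul_le_mul (pow_le_pow_left₀ hw hη 2) (hb'.abs_sub_le hb η)
            (abs_nonneg _) (sq_nonneg _)
        _ = δ ^ 2 := mul_one _
  rw [integral_mul_const, hX.integral_deriv_H] at h2
  linarith

theorem evoY_congr {X : Lagr} {G : ℝ} (hX : IsNice X G) {b b' : ℝ → ℝ}
    (hb : IsFrac b) (hb' : IsFrac b') {t : ℝ} (ht : 0 ≤ t)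
    (h : ∀ᵐ η, brk X η ≤ ENNReal.ofReal t → b η = b' η) (ξ : ℝ) :
    evoY X b t ξ = evoY X b' t ξ := by
  have := abs_evoY_sub_le_of_recent hX hb hb' (δ := 0) ht (by
    filter_upwards [h] with η hη
    rcases le_total (brk X η) (ENNReal.ofReal t) with h1 | h1
    · exact Or.inl (hη h1)
    · exact Or.inr (clock_of_ge h1).le) ξ
  rw [zero_pow two_ne_zero, mul_zero, mul_zero] at this
  exact sub_eq_zero.mp (abs_nonpos_iff.mp this)

/-! ## Fractions in the scheme -/

theorem betaIter_mem {ξ : ℤ → ℝ} {α : ℝ → ℝ} (hα : ∀ x, α x ∈ Ico (0:ℝ) 1) {τ : ℤ → ℝ≥0∞}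
    {s s₁ : ℝ} {st : NumState} (n : ℕ) (j : ℤ) :
    0 ≤ betaIter ξ α τ s s₁ st n j ∧ betaIter ξ α τ s s₁ st n j ≤ 1 := by
  rcases n with _ | _ | n
  · exact ⟨le_rfl, zero_le_one⟩
  · exact ⟨le_rfl, zero_le_one⟩
  · simp only [betaIter]
    split_ifs
    · exact ⟨(hα _).1, (hα _).2.le⟩
    · exact ⟨le_rfl, zero_le_one⟩

theorem joinFrac_mem {τ : ℤ → ℝ≥0∞} {s : ℝ} {β₁ β₂ : ℤ → ℝ} (h1 : ∀ j, 0 ≤ β₁ j ∧ β₁ j ≤ 1)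
    (h2 : ∀ j, 0 ≤ β₂ j ∧ β₂ j ≤ 1) (j : ℤ) :
    0 ≤ joinFrac τ s β₁ β₂ j ∧ joinFrac τ s β₁ β₂ j ≤ 1 := by
  rw [joinFrac]; split_ifs; exacts [h1 j, h2 j]

/-- The fractions lost up to the extracted time `ts k`. -/
def stepFrac (ξ : ℤ → ℝ) (α : ℝ → ℝ) (X : Lagr) (ts : ℕ → ℝ) (M : ℕ → ℕ) : ℕ → ℤ → ℝ
  | 0 => fun _ => 0
  | k + 1 => joinFrac (cellBreak ξ X) (ts k) (stepFrac ξ α X ts M k)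
      (betaIter ξ α (cellBreak ξ X) (ts k) (ts (k + 1)) (stateAt ξ α X ts M k) (M k))

theorem stepFrac_mem {ξ : ℤ → ℝ} {α : ℝ → ℝ} (hα : ∀ x, α x ∈ Ico (0:ℝ) 1) {X : Lagr}
    {ts : ℕ → ℝ} {M : ℕ → ℕ} (k : ℕ) (j : ℤ) :
    0 ≤ stepFrac ξ α X ts M k j ∧ stepFrac ξ α X ts M k j ≤ 1 := by
  induction k generalizing j with
  | zero => exact ⟨le_rfl, zero_le_one⟩
  | succ k ih => exact joinFrac_mem ih (betaIter_mem hα _) j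

namespace CellData

variable {ξ : ℤ → ℝ} {X : Lagr} {G h : ℝ} {p r : ℤ → ℝ} (hc : CellData ξ X G h p r)
include hc

theorem finite_breakTimes (T : ℝ) : (breakTimes ξ X ∩ Iic T).Finite := by
  have hsum := hc.hasSum_Vx.summable
  have hpos : 0 < h * (4 / (4 + T ^ 2)) := mul_pos hc.pos (by positivity)
  have hev := hsum.tendsto_cofinite_zero.eventually_lt_const hpos
  have hfin : {j | ¬ (initState ξ X).Vx j * len ξ j < h * (4 / (4 + T ^ 2))}.Finite := hev
  refine (hfin.image fun j => (cellBreak ξ X j).toReal).subset ?_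
  rintro b ⟨⟨hb0, j, hj⟩, hbT⟩
  have hbT : b ≤ T := hbT
  refine ⟨j, ?_, by simp only; rw [hj, ENNReal.toReal_ofReal hb0.le]⟩
  have hdeg : ξ j < ξ (j + 1) := by
    by_contra hd
    rw [hc.cellBreak_degenerate hd] at hj
    exact absurd (ENNReal.ofReal_eq_zero.mp hj.symm) (not_le.mpr hb0)
  have hsb : slopeBreak (p j) (r j) = ENNReal.ofReal b := by
    rcases hc.cellBreak_eq hdeg with h1 | h1
    · rw [h1.1] at hj
      exact absurd (ENNReal.ofReal_eq_zero.mp hj.symm) (not_le.mpr hb0)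
    · rw [← h1, hj]
  have hr : r j < 0 := by
    by_contra hr
    rw [slopeBreak, if_neg hr] at hsb
    exact ENNReal.ofReal_ne_top hsb.symm
  have hp := hc.p_pos hdeg hr
  obtain ⟨h1, h2, h3⟩ := hc.slope_rel hdeg
  rw [slopeBreak, if_pos hr, ENNReal.ofReal_eq_ofReal_iff
    (div_nonneg_of_nonpos (by linarith) hr.le) hb0.le] at hsb
  have hmul : b * r j = -(2 * p j) := by rw [← hsb, div_mul_cancel₀ _ hr.ne]
  have hsq : b ^ 2 * (1 - p j) = 4 * p j := by
    have h4 : b ^ 2 * (p j * (1 - p j)) = 4 * p j ^ 2 := by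
      rw [← h1, ← mul_pow, hmul]; ring
    have : p j * (b ^ 2 * (1 - p j)) = p j * (4 * p j) := by linear_combination h4
    exact mul_left_cancel₀ hp.ne' this
  have hbT2 : b ^ 2 ≤ T ^ 2 := pow_le_pow_left₀ hb0.le hbT 2
  have hv : 4 / (4 + T ^ 2) ≤ 1 - p j := by
    rw [div_le_iff₀ (by positivity)]
    nlinarith
  have hlen := hc.large j hp.ne'
  change ¬ _
  rw [(hc.init_eq j hdeg).2.2, not_lt, mul_comm]
  exact mul_le_mul hv hlen hc.pos.le (by linarith)

/-- At breaking, the characteristics of a cell have met. -/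
theorem evoY_slopeBreak {β : ℤ → ℝ} (h0 : ∀ j, 0 ≤ β j) (h1 : ∀ j, β j ≤ 1) {j : ℤ}
    (hj : ξ j < ξ (j + 1)) (htop : slopeBreak (p j) (r j) ≠ ⊤) {x : ℝ}
    (hx : x ∈ Icc (ξ j) (ξ (j + 1))) :
    evoY X (fun x => β (cellIdx ξ x)) (slopeBreak (p j) (r j)).toReal x =
      evoY X (fun x => β (cellIdx ξ x)) (slopeBreak (p j) (r j)).toReal (ξ j) := by
  rw [hc.evoY_aff h0 h1 ENNReal.toReal_nonneg j x hx]
  have hr : r j < 0 := by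
    by_contra hr
    exact htop (by rw [slopeBreak, if_neg hr])
  have hp := hc.p_pos hj hr
  obtain ⟨k1, k2, k3⟩ := hc.slope_rel hj
  have e : (slopeBreak (p j) (r j)).toReal = -(2 * p j) / r j := by
    rw [slopeBreak, if_pos hr, ENNReal.toReal_ofReal (div_nonneg_of_nonpos (by linarith) hr.le)]
  have hclock : clock (slopeBreak (p j) (r j)) (slopeBreak (p j) (r j)).toReal = 0 :=
    clock_of_ge (by rw [ENNReal.ofReal_toReal htop])
  beta_reduce
  rw [hclock, e]
  have hsq : (1 - p j) * (-(2 * p j) / r j) ^ 2 = 4 * p j := by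
    rw [div_pow, k1]
    have : 1 - p j ≠ 0 := fun h4 => by
      rw [h4, mul_zero, pow_eq_zero_iff two_ne_zero] at k1
      exact hr.ne k1
    field_simp
    ring
  have hlin : -(2 * p j) / r j * r j = -(2 * p j) := div_mul_cancel₀ _ hr.ne
  linear_combination (1 / 4 * hsq + hlin) * (x - ξ j)

variable {α : ℝ → ℝ} (hα : ∀ x, α x ∈ Ico (0:ℝ) 1) {ts : ℕ → ℝ} {M : ℕ → ℕ} (hts0 : ts 0 = 0)
  (hts : ∀ k, ts k ≤ ts (k + 1))
include hα hts0 hts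

theorem ts_nonneg (k : ℕ) : 0 ≤ ts k := by
  induction k with
  | zero => rw [hts0]
  | succ k ih => exact ih.trans (hts k)

theorem stateAt_eq (k : ℕ) : stateAt ξ α X ts M k =
    evolve ξ (cellBreak ξ X) (stepFrac ξ α X ts M k) 0 (ts k) (initState ξ X) := by
  induction k with
  | zero => rw [hts0, evolve_zero]; rfl
  | succ k ih =>
    simp only [stateAt]
    conv_lhs => arg 6; rw [ih]
    rw [evolve_evolve (hc.ts_nonneg hα hts0 hts k) (hts k) hc.energy_nonneg hc.hasSum_Vx.summable
      (fun j => (stepFrac_mem hα k j).1) (fun j => (stepFrac_mem hα k j).2)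
      (fun j => (betaIter_mem hα _ j).1) (fun j => (betaIter_mem hα _ j).2)]
    rfl

theorem step_eq_evolve {k : ℕ} {t : ℝ} (ht : ts k ≤ t) {β : ℤ → ℝ} (h0 : ∀ j, 0 ≤ β j)
    (h1 : ∀ j, β j ≤ 1) :
    evolve ξ (cellBreak ξ X) β (ts k) t (stateAt ξ α X ts M k) =
      evolve ξ (cellBreak ξ X) (joinFrac (cellBreak ξ X) (ts k) (stepFrac ξ α X ts M k) β) 0 t
        (initState ξ X) := by
  rw [hc.stateAt_eq hα hts0 hts k, evolve_evolve (hc.ts_nonneg hα hts0 hts k) ht hc.energy_nonneg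
    hc.hasSum_Vx.summable (fun j => (stepFrac_mem hα k j).1) (fun j => (stepFrac_mem hα k j).2)
    h0 h1]

theorem exists_stepFrac_eq {Δt : ℝ} (hΔ : 0 ≤ Δt)
    (hgap : ∀ k, (breakTimes ξ X ∩ Ioo (ts k) (ts (k + 1))).Nonempty → ts (k + 1) ≤ ts k + Δt)
    (hM : IsIterationCount (breakTimes ξ X) ts M) {k : ℕ} {j : ℤ} (hj : ξ j < ξ (j + 1))
    (h1 : ¬ slopeBreak (p j) (r j) ≤ ENNReal.ofReal (ts k))
    (h2 : slopeBreak (p j) (r j) ≤ ENNReal.ofReal (ts (k + 1))) :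
    ∃ δ, 0 ≤ δ ∧ δ ≤ Δt ∧ ts (k + 1) - (slopeBreak (p j) (r j)).toReal ≤ δ ∧
      (∀ i, ξ i < ξ (i + 1) → slopeBreak (p i) (r i) ≤ ENNReal.ofReal (ts k) ∨
        clock (slopeBreak (p i) (r i)) (ts (k + 1)) ≤ δ) ∧
      ∃ β : ℤ → ℝ, (∀ j, 0 ≤ β j) ∧ (∀ j, β j ≤ 1) ∧ stepFrac ξ α X ts M (k + 1) j =
        α (nodeY ξ (evolve ξ (cellBreak ξ X) β (ts k) (ts (k + 1)) (stateAt ξ α X ts M k)) j) := by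
  have hs := hc.ts_nonneg hα hts0 hts
  have conv : ∀ i, ξ i < ξ (i + 1) → ¬ slopeBreak (p i) (r i) ≤ ENNReal.ofReal (ts k) →
      slopeBreak (p i) (r i) ≤ ENNReal.ofReal (ts (k + 1)) →
      cellBreak ξ X i = slopeBreak (p i) (r i) ∧
      slopeBreak (p i) (r i) = ENNReal.ofReal (slopeBreak (p i) (r i)).toReal ∧
      (slopeBreak (p i) (r i)).toReal ∈ breakTimes ξ X ∩ Ioc (ts k) (ts (k + 1)) := by
    intro i hi k1 k2
    have k3 : slopeBreak (p i) (r i) ≠ ⊤ := ne_top_of_le_ne_top ENNReal.ofReal_ne_top k2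
    have k4 : cellBreak ξ X i = slopeBreak (p i) (r i) := by
      rcases hc.cellBreak_eq hi with h | h
      · exact absurd h.2 k3
      · exact h
    have k5 := (ENNReal.ofReal_toReal k3).symm
    have k6 : ts k < (slopeBreak (p i) (r i)).toReal := by
      rw [k5, not_le] at k1
      exact (ENNReal.ofReal_lt_ofReal_iff_of_nonneg (hs k)).mp k1
    refine ⟨k4, k5, ⟨(hs k).trans_lt k6, i, k4.trans k5⟩, k6, ?_⟩
    rw [k5] at k2
    exact (ENNReal.ofReal_le_ofReal_iff (hs _)).mp k2
  obtain ⟨c1, c2, c3⟩ := conv j hj h1 h2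
  have hiter : ∀ n, M k = n + 2 → ∃ β : ℤ → ℝ, (∀ j, 0 ≤ β j) ∧ (∀ j, β j ≤ 1) ∧
      stepFrac ξ α X ts M (k + 1) j =
        α (nodeY ξ (evolve ξ (cellBreak ξ X) β (ts k) (ts (k + 1)) (stateAt ξ α X ts M k)) j) := by
    intro n hn
    refine ⟨betaIter ξ α (cellBreak ξ X) (ts k) (ts (k + 1)) (stateAt ξ α X ts M k) (n + 1),
      fun j => (betaIter_mem hα _ j).1, fun j => (betaIter_mem hα _ j).2, ?_⟩
    rw [stepFrac, joinFrac, c1, if_neg h1, hn, betaIter]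
    beta_reduce
    rw [c1, if_pos ⟨not_le.mp h1, h2⟩]
  have hbound : ∀ i, slopeBreak (p i) (r i) ≤ ENNReal.ofReal (ts k) ∨
      clock (slopeBreak (p i) (r i)) (ts (k + 1)) ≤ ts (k + 1) - ts k := by
    intro i
    by_cases k1 : slopeBreak (p i) (r i) ≤ ENNReal.ofReal (ts k)
    · exact Or.inl k1
    right
    rcases le_total (slopeBreak (p i) (r i)) (ENNReal.ofReal (ts (k + 1))) with k2 | k2
    · rw [clock_of_le (hs _) k2]
      have := ENNReal.toReal_mono (ne_top_of_le_ne_top ENNReal.ofReal_ne_top k2) (not_le.mp k1).le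
      rw [ENNReal.toReal_ofReal (hs k)] at this
      linarith
    · rw [clock_of_ge k2]; linarith [hts k]
  by_cases hne : (breakTimes ξ X ∩ Ioo (ts k) (ts (k + 1))).Nonempty
  · have hg := hgap k hne
    refine ⟨ts (k + 1) - ts k, sub_nonneg.mpr (hts k), by linarith, by linarith [c3.2.1],
      fun i _ => hbound i, ?_⟩
    rcases (hM k).2.2 hne with h | h
    · exact hiter 0 h
    · exact hiter 1 h
  · rw [not_nonempty_iff_eq_empty] at hne
    have huniq : ∀ x ∈ breakTimes ξ X ∩ Ioc (ts k) (ts (k + 1)), x = ts (k + 1) := by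
      intro x hx
      by_contra hx'
      have : x ∈ breakTimes ξ X ∩ Ioo (ts k) (ts (k + 1)) :=
        ⟨hx.1, hx.2.1, lt_of_le_of_ne hx.2.2 hx'⟩
      rw [hne] at this
      exact notMem_empty _ this
    refine ⟨0, le_rfl, hΔ, by rw [huniq _ c3]; linarith, fun i hi => ?_, hiter 0 ?_⟩
    · by_cases k1 : slopeBreak (p i) (r i) ≤ ENNReal.ofReal (ts k)
      · exact Or.inl k1
      right
      rcases le_total (slopeBreak (p i) (r i)) (ENNReal.ofReal (ts (k + 1))) with k2 | k2
      · rw [clock_of_le (hs _) k2, huniq _ (conv i hi k1 k2).2.2, sub_self]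
      · rw [clock_of_ge k2]
    · refine (hM k).2.1 (Subset.antisymm (fun x hx => huniq x hx) ?_)
      have h3 := c3
      rw [huniq _ c3] at h3
      exact singleton_subset_iff.mpr h3

theorem stepFrac_error (hL : ∃ K, LipschitzWith K α) {T Δt C : ℝ} (hΔ : 0 ≤ Δt)
    (htsT : ∀ k, ts k ≤ T) (hC : ∀ ξ, |X.U ξ| ≤ C)
    (hgap : ∀ k, (breakTimes ξ X ∩ Ioo (ts k) (ts (k + 1))).Nonempty → ts (k + 1) ≤ ts k + Δt)
    (hM : IsIterationCount (breakTimes ξ X) ts M) (k : ℕ) (j : ℤ) (hj : ξ j < ξ (j + 1))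
    (hle : slopeBreak (p j) (r j) ≤ ENNReal.ofReal (ts k)) :
    |stepFrac ξ α X ts M k j - α (evoY X (fun x => stepFrac ξ α X ts M k (cellIdx ξ x))
      (slopeBreak (p j) (r j)).toReal (ξ j))| ≤
      supDeriv α * (1 / 8 * (G * Δt ^ 2) + (C + T * G) * Δt) := by
  have hs := hc.ts_nonneg hα hts0 hts
  have hfrac : ∀ k, IsFrac (fun x => stepFrac ξ α X ts M k (cellIdx ξ x)) := fun k =>
    hc.step_frac (fun j => (stepFrac_mem hα k j).1) (fun j => (stepFrac_mem hα k j).2)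
  induction k with
  | zero =>
    rw [hts0, ENNReal.ofReal_zero] at hle
    exact absurd (hc.slopeBreak_pos hj) (not_lt.mpr hle)
  | succ k ih =>
    have hold : ∀ i, ξ i < ξ (i + 1) → slopeBreak (p i) (r i) ≤ ENNReal.ofReal (ts k) →
        ∀ β : ℤ → ℝ, joinFrac (cellBreak ξ X) (ts k) (stepFrac ξ α X ts M k) β i =
          stepFrac ξ α X ts M k i := fun i hi k1 β => by
      rw [joinFrac, if_pos ((hc.cellBreak_le_iff hi _).mpr k1).2]
    by_cases h1 : slopeBreak (p j) (r j) ≤ ENNReal.ofReal (ts k)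
    · have e1 : stepFrac ξ α X ts M (k + 1) j = stepFrac ξ α X ts M k j := hold j hj h1 _
      have htop := ne_top_of_le_ne_top ENNReal.ofReal_ne_top h1
      rw [e1, evoY_congr hc.nice (hfrac (k + 1)) (hfrac k) ENNReal.toReal_nonneg]
      · exact ih h1
      · filter_upwards [hc.nodes.ae_mem_cell] with η hη h2
        rw [hc.brk_eq hη, ENNReal.ofReal_toReal htop] at h2
        exact hold _ (hη.1.trans hη.2) (h2.trans h1) _
    · obtain ⟨δ, d0, d1, d2, d3, β, b0, b1, e⟩ :=
        hc.exists_stepFrac_eq hα hts0 hts hΔ hgap hM hj h1 hle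
      have hjm : ∀ i, 0 ≤ joinFrac (cellBreak ξ X) (ts k) (stepFrac ξ α X ts M k) β i ∧
          joinFrac (cellBreak ξ X) (ts k) (stepFrac ξ α X ts M k) β i ≤ 1 :=
        joinFrac_mem (stepFrac_mem hα k) fun j => ⟨b0 j, b1 j⟩
      have hjf := hc.step_frac (fun j => (hjm j).1) (fun j => (hjm j).2)
      rw [e, hc.step_eq_evolve hα hts0 hts (hts k) b0 b1,
        hc.nodeY_evolve (fun j => (hjm j).1) (fun j => (hjm j).2) (hs _)]
      refine (abs_sub_le_supDeriv hL _ _).trans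
        (mul_le_mul_of_nonneg_left ?_ (supDeriv_nonneg α))
      refine (_root_.abs_sub_le _ (evoY X (fun x => stepFrac ξ α X ts M (k + 1) (cellIdx ξ x))
        (ts (k + 1)) (ξ j)) _).trans ?_
      have hG := hc.nice.G_nonneg
      have hC0 : 0 ≤ C := (abs_nonneg _).trans (hC 0)
      have hT : 0 ≤ T := (hs 0).trans (htsT 0)
      have hb : (slopeBreak (p j) (r j)).toReal ≤ ts (k + 1) := by
        have := ENNReal.toReal_mono ENNReal.ofReal_ne_top hle
        rwa [ENNReal.toReal_ofReal (hs _)] at this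
      refine add_le_add ?_ ?_
      · refine (abs_evoY_sub_le_of_recent hc.nice hjf (hfrac (k + 1)) (hs _) (δ := δ) ?_ _).trans ?_
        · filter_upwards [hc.nodes.ae_mem_cell] with η hη
          rw [hc.brk_eq hη]
          refine (d3 _ (hη.1.trans hη.2)).imp (fun h => ?_) id
          rw [hold _ (hη.1.trans hη.2) h]
          exact (hold _ (hη.1.trans hη.2) h _).symm
        · gcongr
      · refine (abs_evoY_time_sub_le hc.nice (hfrac _) hC ⟨hs _, htsT _⟩
          ⟨ENNReal.toReal_nonneg, hb.trans (htsT _)⟩ _).trans ?_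
        rw [abs_of_nonneg (sub_nonneg.mpr hb)]
        exact mul_le_mul_of_nonneg_left (d2.trans d1) (by positivity)

end CellData

/-- The numerical solution is the evolution with fractions that are consistent up to an error. -/
theorem CellData.numSolOp_spec {ξ : ℤ → ℝ} {X : Lagr} {G h : ℝ} {p r : ℤ → ℝ}
    (hc : CellData ξ X G h p r) {α : ℝ → ℝ} (hα : ∀ x, α x ∈ Ico (0:ℝ) 1)
    (hL : ∃ K, LipschitzWith K α) {T Δt C t : ℝ} (hΔ : 0 ≤ Δt) (hC : ∀ ξ, |X.U ξ| ≤ C)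
    {M : ℕ → ℕ} (hM : IsIterationCount (breakTimes ξ X) (extracted (breakTimes ξ X) T Δt) M)
    (ht : t ∈ Icc 0 T) :
    ∃ b, IsFrac b ∧ numSolOp ξ α T Δt M t X = ⟨evoY X b t, evoU X b t, evoV X b t, X.H⟩ ∧
      ∀ᵐ η, brk X η ≤ ENNReal.ofReal t → |b η - α (evoY X b (brk X η).toReal η)| ≤
        supDeriv α * (1 / 8 * (G * Δt ^ 2) + (C + T * G) * Δt) := by
  have hT : 0 ≤ T := ht.1.trans ht.2
  have hfin := hc.finite_breakTimes T
  set ts := extracted (breakTimes ξ X) T Δt with hts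
  have hts0 : ts 0 = 0 := rfl
  have hmono : ∀ k, ts k ≤ ts (k + 1) := extracted_le_succ hfin hT
  have hgap : ∀ k, (breakTimes ξ X ∩ Ioo (ts k) (ts (k + 1))).Nonempty → ts (k + 1) ≤ ts k + Δt :=
    fun k hk => nextTime_sub_le hfin hk
  set S := {k : ℕ | t ≤ ts (k + 1)} with hS
  have hne : S.Nonempty := by
    obtain ⟨k, hk⟩ := exists_extracted_eq (Δt := Δt) hfin
    refine ⟨k, ?_⟩
    change t ≤ ts (k + 1)
    rw [hts, hk]; exact ht.2
  set k := sInf S with hk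
  have hk1 : t ≤ ts (k + 1) := Nat.sInf_mem hne
  have hk0 : ts k ≤ t := by
    rcases Nat.eq_zero_or_pos k with h0 | h0
    · rw [h0, hts0]; exact ht.1
    · by_contra hlt
      have : k - 1 ∈ S := by
        change t ≤ ts (k - 1 + 1)
        rw [Nat.sub_add_cancel h0]; exact (not_le.mp hlt).le
      have := Nat.sInf_le this
      omega
  have hf0 := fun j => (stepFrac_mem (ξ := ξ) (X := X) (ts := ts) (M := M) hα (k + 1) j).1
  have hf1 := fun j => (stepFrac_mem (ξ := ξ) (X := X) (ts := ts) (M := M) hα (k + 1) j).2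
  have hstate : stateTime ξ α X ts M t =
      evolve ξ (cellBreak ξ X) (stepFrac ξ α X ts M (k + 1)) 0 t (initState ξ X) :=
    hc.step_eq_evolve hα hts0 hmono hk0 (fun j => (betaIter_mem hα _ j).1)
      (fun j => (betaIter_mem hα _ j).2)
  obtain ⟨i1, i2, i3⟩ := hc.interp_evolve hf0 hf1 ht.1
  refine ⟨fun x => stepFrac ξ α X ts M (k + 1) (cellIdx ξ x), hc.step_frac hf0 hf1, ?_, ?_⟩
  · simp only [numSolOp, Lagr.mk.injEq]
    rw [← hts, hstate]
    exact ⟨i1, i2, i3, hc.aff_H.interp_eq hc.nodes⟩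
  · filter_upwards [hc.nodes.ae_mem_cell] with η hη hb
    have hj := hη.1.trans hη.2
    rw [hc.brk_eq hη] at hb ⊢
    have htop := ne_top_of_le_ne_top ENNReal.ofReal_ne_top hb
    rw [hc.evoY_slopeBreak hf0 hf1 hj htop ⟨hη.1.le, hη.2.le⟩]
    exact hc.stepFrac_error hα hts0 hmono hL hΔ (fun k => (extracted_mem hfin hT k).2) hC hgap hM
      (k + 1) _ hj (hb.trans (ENNReal.ofReal_le_ofReal hk1))

end HunterSaxton
end

noncomputable section


namespace HunterSaxton

/-! ## Fractions that are consistent up to an error -/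

/-- The fractions `b` agree, up to the error `e`, with the values of `α` on the characteristics at
the time of breaking, or at the time `t` in case there is no breaking before `t`. -/
structure AlmostConsistent (α : ℝ → ℝ) (X : Lagr) (b : ℝ → ℝ) (t e : ℝ) : Prop where
  frac : IsFrac b
  close : ∀ᵐ η, |b η - α (evoY X b (cutBrk (brk X η) t) η)| ≤ e
  later : ∀ η, ENNReal.ofReal t < brk X η → b η = α (evoY X b t η)

/-- The fractions `b`, replaced by the values of `α` for the labels that break after `t`. -/
def truncFrac (α : ℝ → ℝ) (X : Lagr) (b : ℝ → ℝ) (t η : ℝ) : ℝ := open Classical in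
  if brk X η ≤ ENNReal.ofReal t then b η else α (evoY X b t η)

theorem evo_congr {X : Lagr} {b b' : ℝ → ℝ} {s : ℝ}
    (h : ∀ η, brk X η ≤ ENNReal.ofReal s → b η = b' η) :
    evoY X b s = evoY X b' s ∧ evoU X b s = evoU X b' s ∧ evoV X b s = evoV X b' s := by
  have key : ∀ η, b η * clock (brk X η) s = b' η * clock (brk X η) s := by
    intro η
    rcases le_total (brk X η) (ENNReal.ofReal s) with h1 | h1
    · rw [h η h1]
    · rw [clock_of_ge h1, mul_zero, mul_zero]
  have key2 : ∀ η, b η * clock (brk X η) s ^ 2 = b' η * clock (brk X η) s ^ 2 := fun η => by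
    rw [pow_two, ← mul_assoc, key, mul_assoc]
  refine ⟨?_, ?_, ?_⟩
  · funext ξ; simp only [evoY, key2]
  · funext ξ; simp only [evoU, key]
  · funext ξ
    simp only [evoV]
    congr 1
    funext η
    split_ifs with h1
    · rw [h η h1]
    · rfl

theorem almostConsistent_truncFrac {α : ℝ → ℝ} (hα : ∀ x, α x ∈ Ico (0:ℝ) 1)
    (hc : Continuous α) {X : Lagr} {G : ℝ} (hX : IsNice X G) {b : ℝ → ℝ} (hb : IsFrac b)
    {t e : ℝ} (ht : 0 ≤ t) (he : 0 ≤ e)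
    (h : ∀ᵐ η, brk X η ≤ ENNReal.ofReal t → |b η - α (evoY X b (brk X η).toReal η)| ≤ e) :
    AlmostConsistent α X (truncFrac α X b t) t e ∧ evoY X b t = evoY X (truncFrac α X b t) t ∧
      evoU X b t = evoU X (truncFrac α X b t) t ∧ evoV X b t = evoV X (truncFrac α X b t) t := by
  have heq : ∀ η, brk X η ≤ ENNReal.ofReal t → b η = truncFrac α X b t η := fun η hη => by
    rw [truncFrac, if_pos hη]
  have hcont : Continuous (evoY X b t) := by
    have : LipschitzWith (1 + t + t ^ 2).toNNReal (evoY X b t) :=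
      LipschitzWith.of_dist_le_mul fun x y => by
        rw [Real.coe_toNNReal _ (by positivity), Real.dist_eq, Real.dist_eq]
        exact abs_evoY_space_sub_le hX hb ht _ _
    exact this.continuous
  refine ⟨⟨⟨?_, fun η => ?_, fun η => ?_⟩, ?_, fun η hη => ?_⟩, evo_congr heq⟩
  · exact Measurable.ite (measurableSet_le (measurable_brk X) measurable_const) hb.meas
      (hc.comp hcont).measurable
  · rw [truncFrac]; split_ifs
    exacts [hb.nonneg η, (hα _).1]
  · rw [truncFrac]; split_ifs
    exacts [hb.le_one η, (hα _).2.le]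
  · filter_upwards [h] with η hη
    rcases le_or_gt (brk X η) (ENNReal.ofReal t) with h1 | h1
    · have htop := ne_top_of_le_ne_top ENNReal.ofReal_ne_top h1
      rw [cutBrk_of_le h1, ← heq η h1, ← (evo_congr (b := b) fun ζ hζ => heq ζ ?_).1]
      · exact hη h1
      · rw [ENNReal.ofReal_toReal htop] at hζ; exact hζ.trans h1
    · rw [cutBrk_of_ge ht h1.le, ← (evo_congr (b := b) heq).1, truncFrac, if_neg (not_le.mpr h1),
        sub_self, abs_zero]
      exact he
  · rw [← (evo_congr (b := b) heq).1, truncFrac, if_neg (not_le.mpr hη)]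

section TwoData

variable {α : ℝ → ℝ} (hL : ∃ K, LipschitzWith K α) {X X' : Lagr} {G : ℝ}
  (hX : IsNice X G) (hX' : IsNice X' G) {b b' : ℝ → ℝ} {t ε C : ℝ} (ht : 0 ≤ t) (hε : 0 ≤ ε)
  (hC : ∀ ξ, |X.U ξ| ≤ C) (hb : AlmostConsistent α X b t 0)
  (hb' : AlmostConsistent α X' b' t (supDeriv α * ε))
include hL hX hX' ht hε hC hb hb'

theorem AlmostConsistent.abs_sub_le : ∀ᵐ η, |b η - b' η| ≤
    supDeriv α * |evoY X b (cutBrk (brk X' η) t) η - evoY X' b' (cutBrk (brk X' η) t) η|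
      + supDeriv α * ((C + t * G) * |cutBrk (brk X η) t - cutBrk (brk X' η) t| + ε) := by
  filter_upwards [hb.close, hb'.close] with η h1 h2
  have h3 : b η = α (evoY X b (cutBrk (brk X η) t) η) :=
    sub_eq_zero.mp (abs_nonpos_iff.mp h1)
  have h4 := abs_sub_le_supDeriv hL (evoY X b (cutBrk (brk X η) t) η)
    (evoY X' b' (cutBrk (brk X' η) t) η)
  have h5 := abs_evoY_time_sub_le hX hb.frac hC (T := t)
    ⟨cutBrk_nonneg (brk X η) t, cutBrk_le ht⟩ ⟨cutBrk_nonneg (brk X' η) t, cutBrk_le ht⟩ η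
  have h6 := _root_.abs_sub_le (evoY X b (cutBrk (brk X η) t) η)
    (evoY X b (cutBrk (brk X' η) t) η) (evoY X' b' (cutBrk (brk X' η) t) η)
  have h7 := _root_.abs_sub_le (b η) (α (evoY X' b' (cutBrk (brk X' η) t) η)) (b' η)
  rw [abs_sub_comm (α _) (b' η)] at h7
  rw [← h3] at h4
  have h8 := mul_le_mul_of_nonneg_left (h6.trans (add_le_add_left h5 _)) (supDeriv_nonneg α)
  linarith

theorem AlmostConsistent.compare : Compare X X' G b b' t (supDeriv α) (C + t * G) ε where
  nice := hX
  nice' := hX'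
  frac := hb.frac
  frac' := hb'.frac
  T_nonneg := ht
  K_nonneg := supDeriv_nonneg α
  C_nonneg := add_nonneg ((abs_nonneg _).trans (hC 0)) (mul_nonneg ht hX.G_nonneg)
  ε_nonneg := hε
  close := (AlmostConsistent.abs_sub_le hL hX hX' ht hε hC hb hb').mono fun _ h _ => h

theorem AlmostConsistent.integral_frac_le {D : ℝ}
    (hD : ∀ s ∈ Icc 0 t, ∀ ξ, |evoY X b s ξ - evoY X' b' s ξ| ≤ D) :
    ∫ η, deriv X.H η * |b η - b' η| ≤
      supDeriv α * (G * D + (C + t * G) * brkDist X X' t + ε * G) := by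
  have hcmp := AlmostConsistent.compare hL hX hX' ht hε hC hb hb'
  have hv := hX.integrable_deriv_H
  have i1 := (hcmp.integrable_cut.const_mul (C + t * G))
  have i2 : Integrable fun η => deriv X.H η * D + (C + t * G) *
      (deriv X.H η * |cutBrk (brk X η) t - cutBrk (brk X' η) t|) + ε * deriv X.H η :=
    ((hv.mul_const D).add i1).add (hv.const_mul ε)
  have i3 : Integrable fun η => deriv X.H η * D + (C + t * G) *
      (deriv X.H η * |cutBrk (brk X η) t - cutBrk (brk X' η) t|) := (hv.mul_const D).add i1
  have e : ∫ η, supDeriv α * (deriv X.H η * D + (C + t * G) *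
      (deriv X.H η * |cutBrk (brk X η) t - cutBrk (brk X' η) t|) + ε * deriv X.H η) =
      supDeriv α * (G * D + (C + t * G) * brkDist X X' t + ε * G) := by
    rw [integral_const_mul, integral_add i3 (hv.const_mul ε), integral_add (hv.mul_const D) i1,
      integral_mul_const, integral_const_mul, integral_const_mul, hX.integral_deriv_H, brkDist]
  rw [← e]
  refine integral_mono_of_nonneg (Eventually.of_forall fun η =>
    mul_nonneg (hX.deriv_H_nonneg η) (abs_nonneg _)) (i2.const_mul _) ?_
  filter_upwards [AlmostConsistent.abs_sub_le hL hX hX' ht hε hC hb hb'] with η hη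
  have h1 := hX.deriv_H_nonneg η
  have h2 := hD _ ⟨cutBrk_nonneg (brk X' η) t, cutBrk_le ht⟩ η
  have hK := supDeriv_nonneg α
  have h3 := mul_le_mul_of_nonneg_left (hη.trans (add_le_add_left
    (mul_le_mul_of_nonneg_left h2 hK) _)) h1
  refine h3.trans (le_of_eq ?_)
  ring

end TwoData

/-! ## Derivatives of the evolved quantities -/

section Derivatives

variable {X : Lagr} {G : ℝ} (hX : IsNice X G) {b : ℝ → ℝ} (hb : IsFrac b) {t : ℝ} (ht : 0 ≤ t)
include hX hb

theorem ae_deriv_evoV : ∀ᵐ η, deriv (evoV X b t) η =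
    (1 - (open Classical in if brk X η ≤ ENNReal.ofReal t then b η else 0)) * deriv X.H η := by
  filter_upwards [ae_hasDerivAt_kern (integrable_evoV hX hb t)] with η hη
  have h1 := hη.add_const (1 / 2 * ∫ η, (1 - (open Classical in
    if brk X η ≤ ENNReal.ofReal t then b η else 0)) * deriv X.H η)
  refine (h1.congr_of_eventuallyEq (Eventually.of_forall fun x => ?_)).deriv
  simp only [evoV, kern]; ring

include ht

theorem ae_deriv_evoU : ∀ᵐ η, deriv (evoU X b t) η =
    deriv X.U η + 1 / 2 * (deriv X.H η * (t - b η * clock (brk X η) t)) := by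
  have hi := hb.integrable_fac hX ht 1
  simp only [pow_one] at hi
  filter_upwards [ae_hasDerivAt_kern hi, hX.lip_U.ae_differentiableAt] with η h1 h2
  exact (h2.hasDerivAt.add (h1.const_mul (1 / 2))).deriv

theorem ae_deriv_evoY : ∀ᵐ η, deriv (evoY X b t) η = 1 - deriv X.H η + deriv X.U η * t +
    1 / 4 * (deriv X.H η * (t ^ 2 - b η * clock (brk X η) t ^ 2)) := by
  have hi := hb.integrable_fac hX ht 2
  filter_upwards [ae_hasDerivAt_kern hi, hX.lip_U.ae_differentiableAt,
    hX.lip_y.ae_differentiableAt, hX.deriv_y] with η h1 h2 h3 h4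
  rw [← h4]
  exact ((h3.hasDerivAt.add (h2.hasDerivAt.mul_const t)).add (h1.const_mul (1 / 4))).deriv

/-- The function `g₁` of the evolved quantities, for fractions that are consistent for the labels
that break after `t`. -/
theorem ae_g1_eq {α : ℝ → ℝ} {H : ℝ → ℝ}
    (hcons : ∀ᵐ η, ENNReal.ofReal t < brk X η → b η = α (evoY X b t η)) :
    ∀ᵐ η, g1 α ⟨evoY X b t, evoU X b t, evoV X b t, H⟩ η =
      (1 - (open Classical in if brk X η = ⊤ then 0 else b η)) * deriv X.H η := by
  filter_upwards [ae_deriv_evoV hX hb (t := t), ae_deriv_evoU hX hb ht, hcons, hX.rel',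
    hX.deriv_y] with η hV hU hc hr hy
  simp only [g1]
  rw [hV, hU]
  have hv := hX.deriv_H_nonneg η
  have hb0 := hb.nonneg η
  have hb1 := hb.le_one η
  by_cases h0 : deriv X.H η = 0
  · simp [h0]
  by_cases htop : brk X η = ⊤
  · have h1 : ¬ deriv X.U η < 0 := fun h => by
      rw [brk, if_pos h] at htop; exact ENNReal.ofReal_ne_top htop
    have h2 : clock (brk X η) t = 0 := clock_of_ge (by rw [htop]; exact le_top)
    rw [h2, mul_zero, sub_zero, if_neg, htop, if_pos rfl, if_neg (by simp)]
    have := mul_nonneg hv ht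
    linarith
  · have hneg : deriv X.U η < 0 := by
      by_contra h; exact htop (by rw [brk, if_neg h])
    set θ := (brk X η).toReal with hθ
    have hbrk : brk X η = ENNReal.ofReal θ := (ENNReal.ofReal_toReal htop).symm
    have hθ0 : 0 ≤ θ := ENNReal.toReal_nonneg
    have hUθ : deriv X.U η = -(1 / 2) * deriv X.H η * θ := by
      have h1 : θ = -(2 * deriv X.y η) / deriv X.U η := by
        rw [hθ, brk, if_pos hneg, ENNReal.toReal_ofReal]
        exact div_nonneg_of_nonpos (by linarith [hX.deriv_y_nonneg η]) hneg.le
      rw [h1, hy]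
      have hne := hneg.ne
      have h2 : -(1 / 2) * deriv X.H η * (-(2 * (1 - deriv X.H η)) / deriv X.U η) =
          (1 - deriv X.H η) * deriv X.H η / deriv X.U η := by ring
      rw [h2, ← hr, pow_two, mul_div_assoc, div_self hne, mul_one]
    rw [if_neg htop]
    by_cases hle : brk X η ≤ ENNReal.ofReal t
    · have h1 : θ ≤ t := by
        rw [hbrk] at hle; exact (ENNReal.ofReal_le_ofReal_iff ht).mp hle
      rw [if_pos hle, clock_of_le ht hle, ← hθ, hUθ, if_neg]
      have h2 : 0 ≤ deriv X.H η * ((1 - b η) * (t - θ)) :=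
        mul_nonneg hv (mul_nonneg (by linarith) (by linarith))
      nlinarith
    · have h1 := not_le.mp hle
      have h2 : t < θ := by
        rw [hbrk] at h1; exact (ENNReal.ofReal_lt_ofReal_iff_of_nonneg ht).mp h1
      rw [if_neg hle, clock_of_ge h1.le, hUθ, if_pos, hc h1]
      · ring
      · have h3 : 0 < deriv X.H η * (θ - t) :=
          mul_pos (lt_of_le_of_ne hv (Ne.symm h0)) (by linarith)
        nlinarith

end Derivatives

end HunterSaxton
end

noncomputable section


namespace HunterSaxton

/-! ## Sequences that tend to zero in `L²` -/

/-- The sequence `f` tends to zero in `L²`. -/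
structure L2Null (f : ℕ → ℝ → ℝ) : Prop where
  meas : ∀ n, AEStronglyMeasurable (f n) volume
  lim : Tendsto (fun n => eLpNorm (f n) 2 volume) atTop (𝓝 0)

namespace L2Null

variable {f g : ℕ → ℝ → ℝ}

theorem congr (hf : L2Null f) (h : ∀ n, g n =ᵐ[volume] f n) : L2Null g :=
  ⟨fun n => (hf.meas n).congr (h n).symm, hf.lim.congr fun n => (eLpNorm_congr_ae (h n)).symm⟩

theorem of_le (hg : L2Null g) (hm : ∀ n, AEStronglyMeasurable (f n) volume)
    (h : ∀ n, ∀ᵐ x, |f n x| ≤ |g n x|) : L2Null f :=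
  ⟨hm, tendsto_of_tendsto_of_tendsto_of_le_of_le tendsto_const_nhds hg.lim (fun _ => zero_le)
    fun n => eLpNorm_mono_ae (h n)⟩

theorem add (hf : L2Null f) (hg : L2Null g) : L2Null fun n x => f n x + g n x := by
  refine ⟨fun n => (hf.meas n).add (hg.meas n), ?_⟩
  have := hf.lim.add hg.lim
  rw [add_zero] at this
  exact tendsto_of_tendsto_of_tendsto_of_le_of_le tendsto_const_nhds this (fun _ => zero_le)
    fun n => eLpNorm_add_le (hf.meas n) (hg.meas n) (by norm_num)

theorem abs (hf : L2Null f) : L2Null fun n x => |f n x| :=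
  hf.of_le (fun n => (hf.meas n).norm) fun n => Eventually.of_forall fun x => by rw [abs_abs]

theorem eLpNorm_mul_left (c : ℝ) (u : ℝ → ℝ) :
    eLpNorm (fun x => c * u x) 2 volume = ENNReal.ofReal |c| * eLpNorm u 2 volume := by
  have := eLpNorm_const_smul c u 2 volume
  rw [← ofReal_norm, Real.norm_eq_abs] at this
  exact this

theorem mul_left (hf : L2Null f) {c : ℕ → ℝ} {l : ℝ} (hc : Tendsto c atTop (𝓝 l)) :
    L2Null fun n x => c n * f n x := by
  refine ⟨fun n => (hf.meas n).const_mul _, ?_⟩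
  simp_rw [eLpNorm_mul_left]
  have := ENNReal.Tendsto.mul (ENNReal.tendsto_ofReal hc.abs) (Or.inr ENNReal.zero_ne_top) hf.lim
    (Or.inr ENNReal.ofReal_ne_top)
  rwa [mul_zero] at this

theorem const_mul (hf : L2Null f) (c : ℝ) : L2Null fun n x => c * f n x :=
  hf.mul_left tendsto_const_nhds

theorem of_tendsto_mul {u : ℝ → ℝ} (hu : MemLp u 2 volume) {c : ℕ → ℝ}
    (hc : Tendsto c atTop (𝓝 0)) : L2Null fun n x => c n * u x := by
  refine ⟨fun n => hu.1.const_mul _, ?_⟩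
  simp_rw [eLpNorm_mul_left]
  have := ENNReal.Tendsto.mul_const (ENNReal.tendsto_ofReal hc.abs) (Or.inr hu.2.ne)
  rwa [abs_zero, ENNReal.ofReal_zero, zero_mul] at this

theorem of_integral_sq (hm : ∀ n, MemLp (f n) 2 volume)
    (h : Tendsto (fun n => ∫ x, f n x ^ 2) atTop (𝓝 0)) : L2Null f := by
  refine ⟨fun n => (hm n).1, ?_⟩
  have := ENNReal.tendsto_ofReal ((Real.continuous_sqrt.tendsto 0).comp h)
  rw [Real.sqrt_zero, ENNReal.ofReal_zero] at this
  exact this.congr fun n => (eLpNorm_two_eq (hm n)).symm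

theorem memLp_of_bounded {u : ℝ → ℝ} (hu : Integrable u) {M : ℝ} (hM : ∀ x, |u x| ≤ M) :
    MemLp u 2 volume := by
  refine (memLp_two_iff_integrable_sq hu.1).mpr ((hu.abs.const_mul M).mono' (hu.1.pow 2)
    (Eventually.of_forall fun x => ?_))
  rw [Real.norm_of_nonneg (sq_nonneg _), ← sq_abs, pow_two]
  exact mul_le_mul_of_nonneg_right (hM x) (abs_nonneg _)

theorem of_integral_abs (hi : ∀ n, Integrable (f n)) {M : ℝ} (hM : ∀ n x, |f n x| ≤ M)
    (h : Tendsto (fun n => ∫ x, |f n x|) atTop (𝓝 0)) : L2Null f := by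
  have hm := fun n => memLp_of_bounded (hi n) (hM n)
  refine of_integral_sq hm (squeeze_zero (fun n => integral_nonneg fun _ => sq_nonneg _)
    (fun n => ?_) (by simpa using h.const_mul M))
  rw [← integral_const_mul]
  refine integral_mono (hm n).integrable_sq ((hi n).abs.const_mul M) fun x => ?_
  simp only
  rw [← sq_abs, pow_two]
  exact mul_le_mul_of_nonneg_right (hM n x) (abs_nonneg _)

end L2Null

/-! ## Convergence of evolved data -/

/-- The fraction of the energy that is not lost to breaking at any time. -/
def remain (X : Lagr) (b : ℝ → ℝ) (η : ℝ) : ℝ := open Classical in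
  1 - if brk X η = ⊤ then 0 else b η

theorem measurable_remain (X : Lagr) {b : ℝ → ℝ} (hb : IsFrac b) : Measurable (remain X b) :=
  measurable_const.sub (Measurable.ite (measurable_brk X (measurableSet_singleton ⊤))
    measurable_const hb.meas)

theorem abs_remain_le (X : Lagr) {b : ℝ → ℝ} (hb : IsFrac b) (η : ℝ) : |remain X b η| ≤ 1 := by
  have h0 := hb.nonneg η
  have h1 := hb.le_one η
  rw [remain, abs_le]
  split_ifs <;> constructor <;> linarith

theorem min_deriv_eq (u : ℝ) : (open Classical in if u < 0 then u else 0) = min u 0 := by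
  split_ifs with h1
  · rw [min_eq_left h1.le]
  · rw [min_eq_right (not_lt.mp h1)]

theorem tendsto_eLpNorm_top {f : ℕ → ℝ → ℝ} {D : ℕ → ℝ} (hD : Tendsto D atTop (𝓝 0))
    (hf : ∀ n ξ, |f n ξ| ≤ D n) :
    Tendsto (fun n => eLpNorm (f n) ⊤ volume) atTop (𝓝 0) := by
  have h1 := ENNReal.tendsto_ofReal hD
  rw [ENNReal.ofReal_zero] at h1
  refine tendsto_of_tendsto_of_tendsto_of_le_of_le tendsto_const_nhds h1 (fun _ => zero_le)
    fun n => ?_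
  rw [eLpNorm_exponent_top]
  exact eLpNormEssSup_le_of_ae_bound (Eventually.of_forall (hf n))

/-- Converging data with fractions that are consistent up to a vanishing error. -/
structure EvoConv (α : ℝ → ℝ) (X : Lagr) (Xs : ℕ → Lagr) (G : ℝ) (d : ℕ → ℝ) (t : ℝ) (b : ℝ → ℝ)
    (bs : ℕ → ℝ → ℝ) (ε : ℕ → ℝ) : Prop where
  lip : ∃ K, LipschitzWith K α
  conv : ConvData X Xs G d
  t_nonneg : 0 ≤ t
  cons : AlmostConsistent α X b t 0
  conss : ∀ n, AlmostConsistent α (Xs n) (bs n) t (supDeriv α * ε n)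
  ε_nonneg : ∀ n, 0 ≤ ε n
  ε_lim : Tendsto (fun n => supDeriv α * ε n * G) atTop (𝓝 0)

namespace EvoConv

variable {α : ℝ → ℝ} {X : Lagr} {Xs : ℕ → Lagr} {G : ℝ} {d : ℕ → ℝ} {t : ℝ} {b : ℝ → ℝ}
  {bs : ℕ → ℝ → ℝ} {ε : ℕ → ℝ} (h : EvoConv α X Xs G d t b bs ε)
include h

theorem exists_compare : ∃ C, ∀ n, Compare X (Xs n) G b (bs n) t (supDeriv α) C (ε n) := by
  obtain ⟨C, hC⟩ := h.conv.nice.U_bdd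
  exact ⟨_, fun n => AlmostConsistent.compare h.lip h.conv.nice (h.conv.nices n) h.t_nonneg
    (h.ε_nonneg n) hC h.cons (h.conss n)⟩

theorem exists_bound_Y : ∃ D : ℕ → ℝ, Tendsto D atTop (𝓝 0) ∧ ∀ n, ∀ s ∈ Icc 0 t, ∀ ξ,
    |evoY X b s ξ - evoY (Xs n) (bs n) s ξ| ≤ D n := by
  obtain ⟨C, hC⟩ := h.exists_compare
  refine ⟨_, ?_, fun n s hs ξ => (hC n).abs_evoY_sub_le (h.conv.y_le n) (h.conv.U_le n) hs ξ⟩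
  have hE := h.conv.tendsto_energyDist
  have hB := h.conv.tendsto_brkDist h.t_nonneg
  have hd := h.conv.d_lim
  have h1 := (((hd.add (hd.const_mul t)).add (hE.const_mul (t ^ 2))).add
    (hB.const_mul (2 * t))).add (((hB.const_mul (supDeriv α * C)).add h.ε_lim).const_mul (t ^ 2))
  have h2 := (h1.const_mul 2).const_mul (Real.exp ((supDeriv α * G + 1) * t))
  simp only [mul_zero, add_zero] at h2
  refine h2.congr fun n => ?_
  ring

theorem tendsto_frac : Tendsto (fun n => ∫ η, deriv X.H η * |b η - bs n η|) atTop (𝓝 0) := by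
  obtain ⟨C, hC⟩ := h.conv.nice.U_bdd
  obtain ⟨D, hD, hD'⟩ := h.exists_bound_Y
  refine squeeze_zero (fun n => integral_nonneg fun η =>
    mul_nonneg (h.conv.nice.deriv_H_nonneg η) (abs_nonneg _)) (fun n =>
    AlmostConsistent.integral_frac_le h.lip h.conv.nice (h.conv.nices n) h.t_nonneg
    (h.ε_nonneg n) hC h.cons (h.conss n) (hD' n)) ?_
  have hB := h.conv.tendsto_brkDist h.t_nonneg
  have h1 := ((hD.const_mul (supDeriv α * G)).add (hB.const_mul (supDeriv α * (C + t * G)))).add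
    h.ε_lim
  simp only [mul_zero, add_zero] at h1
  exact h1.congr fun n => by ring

theorem integrable_frac (n : ℕ) : Integrable fun η => deriv X.H η * |b η - bs n η| :=
  h.conv.nice.integrable_mul (h.cons.frac.meas.sub (h.conss n).frac.meas).abs (C := 1) fun η => by
    rw [abs_abs]; exact h.cons.frac.abs_sub_le (h.conss n).frac η

theorem tendsto_fac (k : ℕ) : Tendsto (fun n => ∫ η,
    |deriv X.H η * (t ^ k - b η * clock (brk X η) t ^ k) -
      deriv (Xs n).H η * (t ^ k - bs n η * clock (brk (Xs n) η) t ^ k)|) atTop (𝓝 0) := by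
  obtain ⟨C, hC⟩ := h.exists_compare
  have hE := h.conv.tendsto_energyDist
  have hB := h.conv.tendsto_brkDist h.t_nonneg
  have h1 := ((hE.const_mul (t ^ k)).add (hB.const_mul (k * t ^ (k - 1)))).add
    (h.tendsto_frac.const_mul (t ^ k))
  simp only [mul_zero, add_zero] at h1
  refine squeeze_zero (fun n => integral_nonneg fun _ => abs_nonneg _) (fun n =>
    ((hC n).integral_abs_fac_le h.t_nonneg le_rfl k).trans (add_le_add_right ?_ _)) h1
  rw [← integral_const_mul]
  refine integral_mono ((hC n).integrable_loss h.t_nonneg k) ((h.integrable_frac n).const_mul _)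
    fun η => ?_
  simp only
  have h2 := mul_le_mul_of_nonneg_right (pow_le_pow_left₀ (clock_nonneg (brk (Xs n) η) t)
    (clock_le h.t_nonneg) k) (abs_nonneg (b η - bs n η))
  have := mul_le_mul_of_nonneg_left h2 (h.conv.nice.deriv_H_nonneg η)
  linarith

theorem exists_bound_U : ∃ D : ℕ → ℝ, Tendsto D atTop (𝓝 0) ∧ ∀ n ξ,
    |evoU X b t ξ - evoU (Xs n) (bs n) t ξ| ≤ D n := by
  have h1 := h.conv.d_lim.add ((h.tendsto_fac 1).const_mul (1 / 4))
  simp only [mul_zero, add_zero, pow_one] at h1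
  refine ⟨_, h1, fun n ξ => ?_⟩
  have i1 := h.cons.frac.integrable_fac h.conv.nice h.t_nonneg 1
  have i2 := (h.conss n).frac.integrable_fac (h.conv.nices n) h.t_nonneg 1
  simp only [pow_one] at i1 i2
  have h2 := abs_kern_sub_kern_le i1 i2 ξ
  have h3 := h.conv.U_le n ξ
  simp only [evoU]
  rw [show ∀ a b c d : ℝ, a + 1 / 2 * b - (c + 1 / 2 * d) = (a - c) + 1 / 2 * (b - d) by
    intros; ring]
  refine (abs_add_le _ _).trans ?_
  rw [abs_mul, abs_of_pos (by norm_num : (0:ℝ) < 1 / 2)]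
  linarith

theorem null_H : L2Null fun n η => deriv X.H η - deriv (Xs n).H η := by
  refine L2Null.of_integral_abs (M := 1) (fun n =>
    h.conv.nice.integrable_deriv_H.sub (h.conv.nices n).integrable_deriv_H) (fun n η => ?_)
    h.conv.tendsto_energyDist
  rw [abs_le]
  constructor <;> linarith [h.conv.nice.deriv_H_nonneg η, h.conv.nice.deriv_H_le η,
    (h.conv.nices n).deriv_H_nonneg η, (h.conv.nices n).deriv_H_le η]

theorem null_U0 : L2Null fun n η => deriv X.U η - deriv (Xs n).U η :=
  L2Null.of_integral_sq (fun n => (h.conv.memLp_U h.conv.nice).sub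
    (h.conv.memLp_U (h.conv.nices n))) h.conv.tendsto_sq_U

theorem abs_density_le {Y : Lagr} {c : ℝ → ℝ} (hY : IsNice Y G) (hc : IsFrac c) (k : ℕ) (η : ℝ) :
    |deriv Y.H η * (t ^ k - c η * clock (brk Y η) t ^ k)| ≤ t ^ k := by
  rw [abs_mul, abs_of_nonneg (hY.deriv_H_nonneg η)]
  have := mul_le_mul (hY.deriv_H_le η) (hc.abs_fac_le Y h.t_nonneg k η) (abs_nonneg _) zero_le_one
  linarith

theorem null_fac (k : ℕ) : L2Null fun n η =>
    deriv X.H η * (t ^ k - b η * clock (brk X η) t ^ k) -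
      deriv (Xs n).H η * (t ^ k - bs n η * clock (brk (Xs n) η) t ^ k) := by
  refine L2Null.of_integral_abs (M := t ^ k + t ^ k) (fun n =>
    (h.cons.frac.integrable_fac h.conv.nice h.t_nonneg k).sub
      ((h.conss n).frac.integrable_fac (h.conv.nices n) h.t_nonneg k)) (fun n η => ?_)
    (h.tendsto_fac k)
  exact (abs_sub _ _).trans (add_le_add (h.abs_density_le h.conv.nice h.cons.frac k η)
    (h.abs_density_le (h.conv.nices n) (h.conss n).frac k η))

theorem null_deriv_Y : L2Null fun n η => deriv (evoY X b t) η - deriv (evoY (Xs n) (bs n) t) η := by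
  refine ((((h.null_H.const_mul (-1)).add (h.null_U0.const_mul t))).add
    ((h.null_fac 2).const_mul (1 / 4))).congr fun n => ?_
  filter_upwards [ae_deriv_evoY h.conv.nice h.cons.frac h.t_nonneg,
    ae_deriv_evoY (h.conv.nices n) (h.conss n).frac h.t_nonneg] with η h1 h2
  rw [h1, h2]; ring

theorem null_deriv_U : L2Null fun n η => deriv (evoU X b t) η - deriv (evoU (Xs n) (bs n) t) η := by
  refine (h.null_U0.add ((h.null_fac 1).const_mul (1 / 2))).congr fun n => ?_
  filter_upwards [ae_deriv_evoU h.conv.nice h.cons.frac h.t_nonneg,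
    ae_deriv_evoU (h.conv.nices n) (h.conss n).frac h.t_nonneg] with η h1 h2
  rw [h1, h2]; ring

theorem memLp_deriv_U : MemLp (deriv (evoU X b t)) 2 volume := by
  have h1 := (h.conv.memLp_U h.conv.nice).add ((L2Null.memLp_of_bounded
    (h.cons.frac.integrable_fac h.conv.nice h.t_nonneg 1)
    (h.abs_density_le h.conv.nice h.cons.frac 1)).const_mul (1 / 2))
  refine (memLp_congr_ae ?_).mpr h1
  filter_upwards [ae_deriv_evoU h.conv.nice h.cons.frac h.t_nonneg] with η h1
  rw [h1]; simp

theorem exists_bound_evoU : ∃ C, ∀ ξ, |evoU X b t ξ| ≤ C := by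
  obtain ⟨C, hC⟩ := h.conv.nice.U_bdd
  refine ⟨C + 1 / 2 * (1 / 2 * (G * t)), fun ξ => ?_⟩
  have hm := h.cons.frac.meas_fac X t 1
  have hb := h.cons.frac.abs_fac_le X h.t_nonneg 1
  simp only [pow_one] at hm hb
  have h1 := kern_abs_mul_le h.conv.nice hm hb ξ
  rw [evoU]
  refine (abs_add_le _ _).trans (add_le_add (hC ξ) ?_)
  rw [abs_mul, abs_of_pos (by norm_num : (0:ℝ) < 1 / 2)]
  linarith

/-- Products of the velocity with converging functions converge. -/
theorem null_mul {f : ℝ → ℝ} {fs : ℕ → ℝ → ℝ} (hf : MemLp f 2 volume)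
    (hfs : L2Null fun n η => f η - fs n η) :
    L2Null fun n η => evoU X b t η * f η - evoU (Xs n) (bs n) t η * fs n η := by
  obtain ⟨C, hC⟩ := h.exists_bound_evoU
  obtain ⟨D, hD, hD'⟩ := h.exists_bound_U
  have hcont : ∀ {Y : Lagr} {c : ℝ → ℝ}, IsNice Y G → IsFrac c → Measurable (evoU Y c t) := by
    intro Y c hY hc
    have hi := hc.integrable_fac hY h.t_nonneg 1
    simp only [pow_one] at hi
    have hk : Continuous (kern fun η => deriv Y.H η * (t - c η * clock (brk Y η) t)) := by
      have : kern (fun η => deriv Y.H η * (t - c η * clock (brk Y η) t)) = fun x =>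
          kern (fun η => deriv Y.H η * (t - c η * clock (brk Y η) t)) 0 +
          ∫ η in (0:ℝ)..x, deriv Y.H η * (t - c η * clock (brk Y η) t) := by
        funext x; rw [← kern_sub_kern hi]; ring
      rw [this]
      exact continuous_const.add (intervalIntegral.continuous_primitive
        (fun a b => hi.intervalIntegrable) 0)
    exact (hY.lip_U.continuous.add (continuous_const.mul hk)).measurable
  have hfm : ∀ n, AEStronglyMeasurable (fs n) volume := fun n => by
    refine (hf.1.sub (hfs.meas n)).congr (Eventually.of_forall fun x => ?_)
    simp
  have hnull := (hfs.abs.mul_left (hD.const_add C)).add (L2Null.of_tendsto_mul hf.abs hD)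
  refine hnull.of_le (fun n => ((hcont h.conv.nice h.cons.frac).aestronglyMeasurable.mul hf.1).sub
    ((hcont (h.conv.nices n) (h.conss n).frac).aestronglyMeasurable.mul (hfm n)))
    fun n => Eventually.of_forall fun η => ?_
  have e : evoU X b t η * f η - evoU (Xs n) (bs n) t η * fs n η =
      evoU (Xs n) (bs n) t η * (f η - fs n η) +
        (evoU X b t η - evoU (Xs n) (bs n) t η) * f η := by ring
  have h1 := hD' n η
  have h2 : |evoU (Xs n) (bs n) t η| ≤ C + D n := by
    have h3 := abs_sub_abs_le_abs_sub (evoU (Xs n) (bs n) t η) (evoU X b t η)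
    rw [abs_sub_comm] at h3
    linarith [hC η]
  refine le_trans ?_ (le_abs_self _)
  rw [e]
  refine (abs_add_le _ _).trans ?_
  rw [abs_mul, abs_mul]
  exact add_le_add (mul_le_mul_of_nonneg_right h2 (abs_nonneg _))
    (mul_le_mul_of_nonneg_right h1 (abs_nonneg _))

theorem null_min : L2Null fun n η => min (deriv (evoU X b t) η) 0 -
    min (deriv (evoU (Xs n) (bs n) t) η) 0 :=
  h.null_deriv_U.of_le (fun n => (((measurable_deriv _).min measurable_const).sub
    ((measurable_deriv _).min measurable_const)).aestronglyMeasurable)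
    fun n => Eventually.of_forall fun η => abs_min_sub_min_le_max _ _ _ _ |>.trans (by simp)

theorem memLp_min : MemLp (fun η => min (deriv (evoU X b t) η) 0) 2 volume :=
  h.memLp_deriv_U.of_le ((measurable_deriv _).min measurable_const).aestronglyMeasurable
    (Eventually.of_forall fun η => by
      rw [Real.norm_eq_abs, Real.norm_eq_abs]
      rcases le_total (deriv (evoU X b t) η) 0 with h1 | h1
      · rw [min_eq_left h1]
      · rw [min_eq_right h1, abs_zero]; exact abs_nonneg _)

theorem integrable_remain {Y : Lagr} {c : ℝ → ℝ} (hY : IsNice Y G) (hc : IsFrac c) :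
    Integrable fun η => remain Y c η * deriv Y.H η := by
  refine (hY.integrable_mul (measurable_remain Y hc) (C := 1) (abs_remain_le Y hc)).congr
    (Eventually.of_forall fun η => mul_comm _ _)

theorem null_remain : L2Null fun n η =>
    remain X b η * deriv X.H η - remain (Xs n) (bs n) η * deriv (Xs n).H η := by
  refine L2Null.of_integral_abs (M := 2) (fun n =>
    (h.integrable_remain h.conv.nice h.cons.frac).sub
      (h.integrable_remain (h.conv.nices n) (h.conss n).frac)) (fun n η => ?_) ?_
  · have key : ∀ {Y : Lagr} {c : ℝ → ℝ}, IsNice Y G → IsFrac c →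
        |remain Y c η * deriv Y.H η| ≤ 1 := fun {Y c} hY hc => by
      rw [abs_mul, abs_of_nonneg (hY.deriv_H_nonneg η)]
      exact mul_le_one₀ (abs_remain_le Y hc η) (hY.deriv_H_nonneg η) (hY.deriv_H_le η)
    have h1 := key h.conv.nice h.cons.frac
    have h2 := key (h.conv.nices n) (h.conss n).frac
    refine (abs_sub _ _).trans ?_
    linarith
  · have hlim := (h.conv.tendsto_energyDist.add h.tendsto_frac).add h.conv.tendsto_mismatch
    simp only [add_zero] at hlim
    refine squeeze_zero (fun n => integral_nonneg fun _ => abs_nonneg _) (fun n => ?_) hlim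
    have i1 : Integrable fun η => |deriv X.H η - deriv (Xs n).H η| :=
      (h.conv.nice.integrable_deriv_H.sub (h.conv.nices n).integrable_deriv_H).abs
    have i2 := h.integrable_frac n
    have i3 : Integrable fun η => deriv X.H η *
        (open Classical in if (brk (Xs n) η = ⊤ ↔ brk X η = ⊤) then (0:ℝ) else 1) :=
      h.conv.nice.integrable_mul (Measurable.ite (measurableSet_brk_iff X _)
        measurable_const measurable_const) (C := 1) fun η => by split_ifs <;> simp
    have i4 : Integrable fun η => |deriv X.H η - deriv (Xs n).H η| +
        deriv X.H η * |b η - bs n η| := i1.add i2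
    rw [energyDist, mismatch, ← integral_add i1 i2, ← integral_add i4 i3]
    refine integral_mono_of_nonneg (Eventually.of_forall fun _ => abs_nonneg _)
      (i4.add i3) (Eventually.of_forall fun η => ?_)
    have hv := h.conv.nice.deriv_H_nonneg η
    have e : remain X b η * deriv X.H η - remain (Xs n) (bs n) η * deriv (Xs n).H η =
        remain (Xs n) (bs n) η * (deriv X.H η - deriv (Xs n).H η) +
          deriv X.H η * (remain X b η - remain (Xs n) (bs n) η) := by ring
    have h1 : |remain X b η - remain (Xs n) (bs n) η| ≤ |b η - bs n η| +
        (open Classical in if (brk (Xs n) η = ⊤ ↔ brk X η = ⊤) then (0:ℝ) else 1) := by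
      have a0 := h.cons.frac.nonneg η
      have a1 := h.cons.frac.le_one η
      have c0 := (h.conss n).frac.nonneg η
      have c1 := (h.conss n).frac.le_one η
      have d := abs_nonneg (b η - bs n η)
      simp only [remain]
      by_cases e1 : brk X η = ⊤ <;> by_cases e2 : brk (Xs n) η = ⊤ <;> simp only [e1, e2] <;>
        simp only [iff_true, iff_false, if_true, if_false, not_true]
      · simp
      · rw [abs_le]; constructor <;> linarith
      · rw [abs_le]; constructor <;> linarith
      · rw [show 1 - b η - (1 - bs n η) = -(b η - bs n η) by ring, abs_neg, add_zero]
    simp only [e]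
    refine (abs_add_le _ _).trans ?_
    rw [abs_mul, abs_mul, abs_of_nonneg hv, add_assoc, ← mul_add]
    refine add_le_add ?_ (mul_le_mul_of_nonneg_left h1 hv)
    exact mul_le_of_le_one_left (abs_nonneg _) (abs_remain_le _ (h.conss n).frac η)

theorem null_g1 : L2Null fun n η => g1 α ⟨evoY X b t, evoU X b t, evoV X b t, X.H⟩ η -
    g1 α ⟨evoY (Xs n) (bs n) t, evoU (Xs n) (bs n) t, evoV (Xs n) (bs n) t, (Xs n).H⟩ η := by
  refine h.null_remain.congr fun n => ?_
  filter_upwards [ae_g1_eq h.conv.nice h.cons.frac h.t_nonneg (H := X.H)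
      (Eventually.of_forall h.cons.later),
    ae_g1_eq (h.conv.nices n) (h.conss n).frac h.t_nonneg (H := (Xs n).H)
      (Eventually.of_forall (h.conss n).later)] with η h1 h2
  rw [h1, h2, remain, remain]

/-- The evolved data converge with respect to the metric `d`. -/
theorem tendsto_lagrDist : Tendsto (fun n =>
    lagrDist α ⟨evoY X b t, evoU X b t, evoV X b t, X.H⟩
      ⟨evoY (Xs n) (bs n) t, evoU (Xs n) (bs n) t, evoV (Xs n) (bs n) t, (Xs n).H⟩)
    atTop (𝓝 0) := by
  obtain ⟨DY, hDY, hDY'⟩ := h.exists_bound_Y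
  obtain ⟨DU, hDU, hDU'⟩ := h.exists_bound_U
  have t1 := tendsto_eLpNorm_top hDY fun n ξ => hDY' n t ⟨h.t_nonneg, le_rfl⟩ ξ
  have t2 := tendsto_eLpNorm_top hDU hDU'
  have t3 : Tendsto (fun n => eLpNorm (fun ξ => deriv X.H ξ - deriv (Xs n).H ξ) 1 volume)
      atTop (𝓝 0) := by
    have h1 := ENNReal.tendsto_ofReal h.conv.tendsto_energyDist
    rw [ENNReal.ofReal_zero] at h1
    refine h1.congr fun n => ?_
    have hi : Integrable fun ξ => deriv X.H ξ - deriv (Xs n).H ξ :=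
      h.conv.nice.integrable_deriv_H.sub (h.conv.nices n).integrable_deriv_H
    rw [eLpNorm_one_eq_lintegral_enorm, energyDist, ← ofReal_integral_norm_eq_lintegral_enorm hi]
    rfl
  have t4 := ENNReal.Tendsto.const_mul (a := ENNReal.ofReal (supDeriv α))
    (h.null_mul (h.conv.memLp_H h.conv.nice) h.null_H).lim (Or.inr ENNReal.ofReal_ne_top)
  rw [mul_zero] at t4
  have t7 : L2Null fun n η => g1 α ⟨evoY X b t, evoU X b t, evoV X b t, X.H⟩ η +
      deriv (evoY X b t) η -
      g1 α ⟨evoY (Xs n) (bs n) t, evoU (Xs n) (bs n) t, evoV (Xs n) (bs n) t, (Xs n).H⟩ η -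
      deriv (evoY (Xs n) (bs n) t) η :=
    (h.null_g1.add h.null_deriv_Y).congr fun n => Eventually.of_forall fun η => by ring
  have t9 : L2Null fun n η => g2 α ⟨evoY X b t, evoU X b t, evoV X b t, X.H⟩ η -
      g2 α ⟨evoY (Xs n) (bs n) t, evoU (Xs n) (bs n) t, evoV (Xs n) (bs n) t, (Xs n).H⟩ η := by
    refine (h.null_min.const_mul (supDeriv α * G)).congr fun n => Eventually.of_forall fun η => ?_
    simp only [g2, limTop_eq h.conv.nice.H_top, limTop_eq (h.conv.nices n).H_top, ← min_deriv_eq]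
    split_ifs <;> ring
  have t10 : L2Null fun n η => g3 α ⟨evoY X b t, evoU X b t, evoV X b t, X.H⟩ η -
      g3 α ⟨evoY (Xs n) (bs n) t, evoU (Xs n) (bs n) t, evoV (Xs n) (bs n) t, (Xs n).H⟩ η := by
    refine ((h.null_mul h.memLp_min h.null_min).const_mul (supDeriv α)).congr fun n =>
      Eventually.of_forall fun η => ?_
    simp only [g3, ← min_deriv_eq]
    split_ifs <;> ring
  have key := (((((((((t1.add t2).add t3).add t4).add h.null_deriv_Y.lim).add
    h.null_deriv_U.lim).add t7.lim).add h.null_H.lim).add t9.lim).add t10.lim)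
  simp only [add_zero] at key
  exact key

end EvoConv

end HunterSaxton
end

noncomputable section


namespace HunterSaxton

theorem MemD0.cellData {Z : Euler} (hZ : MemD0 Z) {h : ℝ} (hh : 0 < h) {σ : ℤ → ℝ}
    (hσ : ∀ j, σ j = 1 ∨ σ j = -1) :
    CellData (lagrNodes h (proj h σ Z).ν) (mapL (proj h σ Z)) (Z.μ univ).toReal h
      (cellSlopeY h σ Z) (cellSlopeU h σ Z) := by
  obtain ⟨g, hg⟩ := hZ.exists_energySlope
  have hgood := hZ.proj_isGood hh hσ
  have := hgood.fin
  exact ⟨lagrNodes_isNodes (proj h σ Z).μ hh, hZ.proj_isNice hh hσ, hh,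
    proj_y_cellAffine hg hσ hh hgood, proj_U_cellAffine hg hσ hh hgood,
    proj_cell_large hg hσ hh hgood⟩

/-- The error of the fractions vanishes under the restriction on the time step. -/
theorem tendsto_stepError {K G c : ℝ} (hK : 0 ≤ K) (hG : 0 ≤ G) {hs Δ : ℕ → ℝ}
    (hlim : Tendsto hs atTop (𝓝 0)) (hΔ : ∀ n, 0 ≤ Δ n) (hle : ∀ n, K * G * Δ n ^ 2 ≤ 8 * hs n) :
    Tendsto (fun n => K * (1 / 8 * (G * Δ n ^ 2) + c * Δ n) * G) atTop (𝓝 0) := by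
  have hKG := mul_nonneg hK hG
  have h1 : Tendsto (fun n => K * G * Δ n ^ 2) atTop (𝓝 0) :=
    squeeze_zero (fun n => mul_nonneg hKG (sq_nonneg _)) hle (by simpa using hlim.const_mul 8)
  have h2 : Tendsto (fun n => K * G * Δ n) atTop (𝓝 0) := by
    have h3 := ((Real.continuous_sqrt.tendsto 0).comp h1).const_mul (Real.sqrt (K * G))
    rw [Real.sqrt_zero, mul_zero] at h3
    refine h3.congr fun n => ?_
    simp only [Function.comp]
    rw [Real.sqrt_mul hKG, Real.sqrt_sq (hΔ n), ← mul_assoc, Real.mul_self_sqrt hKG]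
  have h4 := (h1.const_mul (1 / 8 * G)).add (h2.const_mul c)
  simp only [mul_zero, add_zero] at h4
  exact h4.congr fun n => by ring

/-- Convergence of the numerical solutions along a sequence of mesh sizes. -/
theorem MemD0.tendsto_lagrDist_numSolOp {Z : Euler} (hZ : MemD0 Z) {α : ℝ → ℝ}
    (hα : ∀ x, α x ∈ Ico (0:ℝ) 1) (hL : ∃ K, LipschitzWith K α) {T t : ℝ} (ht : t ∈ Icc 0 T)
    {hs : ℕ → ℝ} (hpos : ∀ n, 0 < hs n) (hlim : Tendsto hs atTop (𝓝 0)) {σ : ℕ → ℤ → ℝ}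
    (hσ : ∀ n j, σ n j = 1 ∨ σ n j = -1) {Δ : ℕ → ℝ} (hΔ : ∀ n, 0 ≤ Δ n)
    (hle : ∀ n, supDeriv α * (Z.μ univ).toReal * Δ n ^ 2 ≤ 8 * hs n) {M : ℕ → ℕ → ℕ}
    (hM : ∀ n, IsIterationCount
      (breakTimes (lagrNodes (hs n) (proj (hs n) (σ n) Z).ν) (mapL (proj (hs n) (σ n) Z)))
      (extracted (breakTimes (lagrNodes (hs n) (proj (hs n) (σ n) Z).ν)
        (mapL (proj (hs n) (σ n) Z))) T (Δ n)) (M n)) :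
    Tendsto (fun n => lagrDist α (solOp α t (mapL Z))
      (numSolOp (lagrNodes (hs n) (proj (hs n) (σ n) Z).ν) α T (Δ n) (M n) t
        (mapL (proj (hs n) (σ n) Z)))) atTop (𝓝 0) := by
  have hc : Continuous α := hL.choose_spec.continuous
  have hconv := hZ.convData hpos hlim hσ
  set Xs := fun n => mapL (proj (hs n) (σ n) Z) with hXs
  set G := (Z.μ univ).toReal
  obtain ⟨-, -, b, hb, hsol⟩ := solOp_spec hα hL hconv.nice
  obtain ⟨C, hC⟩ := hconv.nice.U_bdd
  obtain ⟨D, hD⟩ := hconv.d_lim.bddAbove_range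
  have hCs : ∀ n ξ, |(Xs n).U ξ| ≤ C + D := fun n ξ => by
    have h1 := hconv.U_le n ξ
    have h2 := hD ⟨n, rfl⟩
    have h3 := abs_sub_abs_le_abs_sub ((Xs n).U ξ) ((mapL Z).U ξ)
    rw [abs_sub_comm] at h3
    simp only at h2
    linarith [hC ξ]
  choose c hcf hnum herr using fun n => (hZ.cellData (hpos n) (hσ n)).numSolOp_spec hα hL (hΔ n)
    (hCs n) (hM n) ht
  have hG : 0 ≤ G := ENNReal.toReal_nonneg
  have hCD : 0 ≤ C + D := (abs_nonneg _).trans (hCs 0 0)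
  have hT : 0 ≤ T := ht.1.trans ht.2
  set ε : ℕ → ℝ := fun n => 1 / 8 * (G * Δ n ^ 2) + (C + D + T * G) * Δ n with hε
  have hε0 : ∀ n, 0 ≤ ε n := fun n => by have := hΔ n; positivity
  obtain ⟨a1, a2, a3, a4⟩ := almostConsistent_truncFrac hα hc hconv.nice hb.1 ht.1 le_rfl
    (Eventually.of_forall fun η _ => by rw [← hb.2 η, sub_self, abs_zero])
  have hsn := fun n => almostConsistent_truncFrac hα hc (hconv.nices n) (hcf n) ht.1
    (mul_nonneg (supDeriv_nonneg α) (hε0 n)) (herr n)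
  have key : EvoConv α (mapL Z) Xs G _ t (truncFrac α (mapL Z) b t)
      (fun n => truncFrac α (Xs n) (c n) t) ε :=
    ⟨hL, hconv, ht.1, a1, fun n => (hsn n).1, hε0,
      tendsto_stepError (supDeriv_nonneg α) hG hlim hΔ hle⟩
  refine key.tendsto_lagrDist.congr fun n => ?_
  obtain ⟨-, b2, b3, b4⟩ := hsn n
  rw [hsol t ht.1, hnum n, a2, a3, a4, b2, b3, b4]

end HunterSaxton
end

theorem theorem4p8
    (α : ℝ → ℝ) (hα : ∀ x, α x ∈ Set.Ico (0 : ℝ) 1) (hLip : ∃ K : ℝ≥0, LipschitzWith K α)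
    (T : ℝ) (hT : 0 ≤ T)
    (Z : HunterSaxton.Euler) (hZ : HunterSaxton.MemD0 Z)
    (σ : ℝ → ℤ → ℝ) (hσ : ∀ h > 0, ∀ j, σ h j = 1 ∨ σ h j = -1)
    (Δt : ℝ → ℝ)
    (hΔt : ∀ h > 0, 0 < Δt h ∧
      HunterSaxton.supDeriv α * (Z.ν Set.univ).toReal * Δt h ^ 2 ≤ 8 * h)
    (X : HunterSaxton.Lagr) (hX : X = HunterSaxton.mapL Z)
    (XΔ : ℝ → HunterSaxton.Lagr)
    (hXΔ : ∀ h > 0, XΔ h = HunterSaxton.mapL (HunterSaxton.proj h (σ h) Z))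
    (ξ : ℝ → ℤ → ℝ)
    (hξ : ∀ h > 0, ξ h = HunterSaxton.lagrNodes h (HunterSaxton.proj h (σ h) Z).ν)
    (M : ℝ → ℕ → ℕ)
    (hM : ∀ h > 0, HunterSaxton.IsIterationCount (HunterSaxton.breakTimes (ξ h) (XΔ h))
      (HunterSaxton.extracted (HunterSaxton.breakTimes (ξ h) (XΔ h)) T (Δt h)) (M h)) :
    HunterSaxton.IsAlphaSolution α X (fun s => HunterSaxton.solOp α s X) ∧
    (∀ Y : ℝ → HunterSaxton.Lagr, HunterSaxton.IsAlphaSolution α X Y →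
      ∀ s, 0 ≤ s → Y s = HunterSaxton.solOp α s X) ∧
    ∀ t ∈ Set.Icc (0 : ℝ) T,
      Tendsto (fun h => HunterSaxton.lagrDist α (HunterSaxton.solOp α t X)
        (HunterSaxton.numSolOp (ξ h) α T (Δt h) (M h) t (XΔ h))) (𝓝[>] 0) (𝓝 0) := by
  subst hX
  have hG : Z.ν = Z.μ := hZ.2.symm
  obtain ⟨h1, h2, -⟩ := HunterSaxton.solOp_spec hα hLip hZ.isGood.isNice
  refine ⟨h1, h2, fun t ht => tendsto_of_seq_tendsto fun hs hhs => ?_⟩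
  obtain ⟨hs0, hspos⟩ := tendsto_nhdsWithin_iff.mp hhs
  obtain ⟨N, hN⟩ := eventually_atTop.mp hspos
  have hpos : ∀ n, 0 < hs (n + N) := fun n => hN _ (Nat.le_add_left N n)
  refine (tendsto_add_atTop_iff_nat N).mp ?_
  have key := hZ.tendsto_lagrDist_numSolOp hα hLip ht hpos
    ((tendsto_add_atTop_iff_nat N).mpr hs0) (fun n => hσ _ (hpos n))
    (fun n => (hΔt _ (hpos n)).1.le) (fun n => hG ▸ (hΔt _ (hpos n)).2)
    (M := fun n => M (hs (n + N))) (fun n => by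
      rw [← hXΔ _ (hpos n), ← hξ _ (hpos n)]; exact hM _ (hpos n))
  refine key.congr fun n => ?_
  simp only [Function.comp]
  rw [hXΔ _ (hpos n), hξ _ (hpos n)]
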